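/- **Setting.** An *odd form ring* $(R,\Delta)$ is an associative, not necessarily unital ring $R$ with involution $a\mapsto\bar a$, a group $(\Delta,\dotplus)$ with a right action $(u,a)\mapsto u\cdot a$ of the multiplicative semigroup of $R$ by endomorphisms, and maps $\phi\colon R\to\Delta$, $\pi,\rho\colon\Delta\to R$ such that $\phi,\pi$ are homomorphisms, $\phi(\bar aba)=\phi(b)\cdot a$, $\pi(u\cdot a)=\pi(u)a$, $[u,v]=\phi(-\overline{\pi(u)}\pi(v))$, $\rho(u\dotplus v)=\rho(u)-\overline{\pi(u)}\pi(v)+\rho(v)$, $\overline{\rho(u)}+\overline{\pi(u)}\pi(u)+\rho(u)=0$, $\rho(u\cdot a)=\bar a\rho(u)a$, $\pi(\phi(a))=0$, $\rho(\phi(a))=a-\bar a$, $\phi(a+\bar a)=\phi(\bar aa)=\dot0$, $u\cdot(a+b)=u\cdot a\dotplus\phi(\bar b\rho(u)a)\dotplus u\cdot b$. An action of $(R,\Delta)$ on $(S,\Theta)$ consists of products $R\times S\to S$, $S\times R\to S$, $\Theta\times R\to\Theta$, $\Delta\times S\to\Theta$ making $(S\rtimes R,\Theta\rtimes\Delta)$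 an odd form ring. A *crossed module* $\delta\colon(S,\Theta)\to(R,\Delta)$ is an equivariant homomorphism, for a given action, with $ab=\delta(a)b=a\delta(b)$ and $u\cdot a=\delta(u)\cdot a=u\cdot\delta(a)$ for $a,b\in S$, $u\in\Theta$. The unitary group is $U(R,\Delta)=\{g\in\Delta\mid\pi(g)=\overline{\rho(g)},\ \pi(g)\overline{\pi(g)}=\overline{\pi(g)}\pi(g)\}$ with $gh=g\cdot\pi(h)\dotplus h\dotplus g$; it acts on $(S,\Theta)$ by ${}^ga=(\pi(g)+1)\,a\,\overline{(\pi(g)+1)}$ and ${}^gu=(g\cdot\pi(u)\dotplus u)\cdot\overline{(\pi(g)+1)}$. Fix a crossed module $\delta\colon(S,\Theta)\to(R,\Delta)$ and a *strong orthogonal hyperbolic family* $H$ of rank $\ell$ in $(R,\Delta)$, i.e. elements $e_i\in R$, $q_i\in\Delta$ ($1\le|i|\le\ell$) such that the $e_i$ are pairwise orthogonal idempotents, $\bar e_i=e_{-i}$, $\pi(q_i)=e_i$, $\rho(q_i)=0$, $q_i=q_i\cdot e_i$, and $e_i\in Re_jR$ for all $i,j$. Put $S_{ij}=e_iSe_j$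 and $\Theta^0_j=\{u\in\Theta\cdot e_j\mid e_k\pi(u)=0\ \forall k\}$. The Steinberg group $\mathrm{StU}(S,\Theta;\Phi)$ has generators $X_{ij}(a)$ ($i\ne\pm j$, $a\in S_{ij}$), $X_j(u)$ ($u\in\Theta^0_j$) and relations $$X_{ij}(a)=X_{-j,-i}(-\bar a),\quad X_{ij}(a)X_{ij}(b)=X_{ij}(a+b),\quad X_j(u)X_j(v)=X_j(u\dotplus v),$$ $$[X_{ij}(a),X_{kl}(b)]=1\ (j\ne k\ne-i\ne-l\ne j),\quad [X_{ij}(a),X_l(u)]=1\ (i\ne l\ne-j),$$ $$[X_{-i,j}(a),X_{ji}(b)]=X_i(\phi(ab)),\quad [X_i(u),X_i(v)]=X_i(\phi(-\overline{\pi(u)}\pi(v))),$$ $$[X_i(u),X_j(v)]=X_{-i,j}(-\overline{\pi(u)}\pi(v))\ (i\ne\pm j),\quad [X_{ij}(a),X_{jk}(b)]=X_{ik}(ab)\ (i\ne\pm k),$$ $$[X_i(u),X_{ij}(a)]=X_{-i,j}(\rho(u)a)\,X_j(\dotminus u\cdot(-a)).$$ Here $[x,y]=xyx^{-1}y^{-1}$.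 The case $(S,\Theta)=(R,\Delta)$ is allowed. Let $\mathrm{st}\colon\mathrm{StU}(S,\Theta;\Phi)\to U(S,\Theta)$ be the homomorphism $X_{ij}(a)\mapsto q_i\cdot a\dotminus q_{-j}\cdot\bar a\dotminus\phi(a)$, $X_j(u)\mapsto u\dotminus\phi(\rho(u)+\pi(u))\dotplus q_{-j}\cdot(\rho(u)-\overline{\pi(u)})$. Let $\Phi=\{\pm\mathrm e_i\pm\mathrm e_j\ (i\neq j),\ \pm\mathrm e_i,\ \pm2\mathrm e_i\}\subset\mathbb R^\ell$ be the root system of type $\mathsf{BC}_\ell$, $\mathrm e_{-i}=-\mathrm e_i$; the roots $\pm\mathrm e_i$ are *ultrashort*, the roots $\pm\mathrm e_i\pm\mathrm e_j$ with $i\ne j$ are *short*. The root subgroup $X_\alpha(S,\Theta)$ consists of all $X_{ij}(a)$ if $\alpha=\mathrm e_j-\mathrm e_i$ ($i\neq\pm j$), all $X_j(u)$ if $\alpha=\mathrm e_j$, all $X_j(\phi(a))$, $a\in S_{-j,j}$, if $\alpha=2\mathrm e_j$. A set $\Sigma\subseteq\Phi$ is *saturated* if it is closed under those sums that are roots and contains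 $\frac12\alpha$ whenever $\alpha\in\Sigma$, $\frac12\alpha\in\Phi$; it is *special* if it is closed under such sums and $\Sigma\cap-\Sigma=\varnothing$; a saturated root subsystem is a saturated $\Psi$ with $\Psi=-\Psi$. $\mathrm{StU}(S,\Theta;\Sigma)$ is the subgroup generated by $X_\alpha(S,\Theta)$, $\alpha\in\Sigma$. For a saturated root subsystem $\Psi$ write $\mathrm e_i\sim_\Psi\mathrm e_j$ if $\mathrm e_i-\mathrm e_j\in\Psi\cup\{0\}$ and $\mathrm e_j\notin\Psi$. The family $H/\Psi$ is formed by the sums of $e_i$ and of $q_i$ over the classes of this partial equivalence relation; its root system is the image $\Phi/\Psi$ of $\Phi\setminus\Psi$ in $\mathbb R^\ell/\mathbb R\Psi$, with projection $\pi_\Psi\colon\Phi\setminus\Psi\to\Phi/\Psi$. The groups constructed by $H/\Psi$ are denoted with $\Phi/\Psi$ in place of $\Phi$. The canonical homomorphism $F_\Psi\colon\mathrm{StU}(S,\Theta;\Phi/\Psi)\to\mathrm{StU}(S,\Theta;\Phi)$ is the one that maps each $X_\beta(S,\Theta)$ to $\mathrm{StU}(S,\Theta;\pi_\Psi^{-1}\{\beta,2\beta\})$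 and satisfies $\mathrm{st}\circ F_\Psi=\mathrm{st}$. We write $\Phi/\alpha$, $F_\alpha$ if $\Psi$ is the smallest saturated set $\langle\alpha,-\alpha\rangle$ containing $\pm\alpha$. For $\Psi\ni\alpha$ the family $H/\Psi$ is also obtained from $H/\alpha$ by summing over classes, and $F_{\Psi/\alpha}$ denotes the corresponding homomorphism from the group for $\Phi/\Psi$ to the group for $\Phi/\alpha$. Let $\overline{\mathrm{StU}}(R,\Delta;S,\Theta;\Phi)$ be the universal group with a *conjugacy calculus* with respect to $H$, i.e. the group generated by symbols ${}^g\{h\}_\Sigma$ for saturated special $\Sigma\subseteq\Phi$, $g\in\mathrm{StU}(R,\Delta;\Sigma)$, $h\in\mathrm{StU}(S,\Theta;\Phi)$ with the defining relations * (Hom) ${}^g\{h_1h_2\}_\Sigma={}^g\{h_1\}_\Sigma\,{}^g\{h_2\}_\Sigma$; * (Sub) ${}^g\{h\}_{\Sigma'}={}^g\{h\}_\Sigma$ if $\Sigma'\subseteq\Sigma$; * (Chev) ${}^{gx}\{y\}_\Sigma={}^g\{[x,y]\,y\}_\Sigma$ for $x\in X_\alpha(R,\Delta)$, $y\in X_\beta(S,\Theta)$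 with $\alpha\in\Sigma$ and $\alpha,\beta$ not antiparallel, where $[x,y]\in\mathrm{StU}(S,\Theta;\Phi)$ is given by the commutator formulas above (with the products of the action); * (XMod) ${}^{\delta(x)g}\{h\}_\Sigma={}^1\{x\}_\Sigma\;{}^g\{h\}_\Sigma\;({}^1\{x\}_\Sigma)^{-1}$ for $x\in X_\alpha(S,\Theta)$, $\alpha\in\Sigma$; * (Conj) ${}^{g_1}\{x\}_{\Sigma'}\;{}^{F_\Psi(g_2)}\{F_\Psi(h)\}_{\pi_\Psi^{-1}(\Sigma)}\;({}^{g_1}\{x\}_{\Sigma'})^{-1}={}^{F_\Psi({}^{\delta(f)}g_2)}\{F_\Psi({}^fh)\}_{\pi_\Psi^{-1}(\Sigma)}$ for a saturated root subsystem $\Psi\subseteq\Phi$, a saturated special $\Sigma\subseteq\Phi/\Psi$, a saturated special $\Sigma'\subseteq\Psi$, $\alpha\in\Psi$, $x\in X_\alpha(S,\Theta)$, $g_1\in\mathrm{StU}(R,\Delta;\Sigma')$, $g_2\in\mathrm{StU}(R,\Delta;\Sigma)$, $h\in\mathrm{StU}(S,\Theta;\Phi/\Psi)$, where $f={}^{\mathrm{st}(g_1)}\mathrm{st}(x)\in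 U(S,\Theta)$ and $f$, $\delta(f)$ act on the Steinberg groups for $\Phi/\Psi$ by acting on the arguments of the root elements. The homomorphisms $F$ of Steinberg groups induce homomorphisms $F$ of the universal groups, ${}^g\{h\}_\Sigma\mapsto{}^{F(g)}\{F(h)\}_{\Sigma'}$, where $\Sigma'$ is the preimage of $\Sigma$. **Proposition.** 1. The homomorphism $F_\alpha\colon\overline{\mathrm{StU}}(R,\Delta;S,\Theta;\Phi/\alpha)\to\overline{\mathrm{StU}}(R,\Delta;S,\Theta;\Phi)$ exists and is surjective if $\alpha$ is a short root and $\ell\ge3$, or if $\alpha$ is an ultrashort root and $\ell\ge2$. 2. The homomorphism $F_{\Psi/\alpha}\colon\overline{\mathrm{StU}}(R,\Delta;S,\Theta;\Phi/\Psi)\to\overline{\mathrm{StU}}(R,\Delta;S,\Theta;\Phi/\alpha)$ exists and is surjective if $\alpha\in\Psi\subseteq\Phi$, $\Psi$ is a root subsystem of type $\mathsf A_2$, and $\ell\ge3$. -/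

import Mathlib

namespace OddUnitary

noncomputable section

/-! ### Odd form rings, actions, crossed modules -/

/-- An odd form ring `(R, Δ)`: `R` is a non-unital associative ring with involution `star`, the
group `Δ` (written additively, not assumed commutative) carries a right action `act u a = u · a` of
the multiplicative semigroup of `R` by group endomorphisms, and there are maps `phi`, `pi`, `rho`. -/
class OddFormRing (R Δ : Type*) [NonUnitalRing R] [StarRing R] [AddGroup Δ] where
  act : Δ → R → Δ
  phi : R → Δ
  pi : Δ → R
  rho : Δ → R
  add_act : ∀ (u v : Δ) (a : R), act (u + v) a = act u a + act v a
  act_mul : ∀ (u : Δ) (a b : R), act u (a * b) = act (act u a) b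
  phi_add : ∀ a b : R, phi (a + b) = phi a + phi b
  phi_conj : ∀ a b : R, phi (star b * a * b) = act (phi a) b
  pi_add : ∀ u v : Δ, pi (u + v) = pi u + pi v
  pi_act : ∀ (u : Δ) (a : R), pi (act u a) = pi u * a
  add_comm_phi : ∀ u v : Δ, u + v + -u + -v = phi (-(star (pi u) * pi v))
  rho_add : ∀ u v : Δ, rho (u + v) = rho u - star (pi u) * pi v + rho v
  rho_symm : ∀ u : Δ, star (rho u) + star (pi u) * pi u + rho u = 0
  rho_act : ∀ (u : Δ) (a : R), rho (act u a) = star a * rho u * a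
  pi_phi : ∀ a : R, pi (phi a) = 0
  rho_phi : ∀ a : R, rho (phi a) = a - star a
  phi_add_star : ∀ a : R, phi (a + star a) = 0
  phi_star_mul_self : ∀ a : R, phi (star a * a) = 0
  act_add : ∀ (u : Δ) (a b : R), act u (a + b) = act u a + phi (star b * rho u * a) + act u b

open OddFormRing
open scoped commutatorElement

/-- Underlying set of a semidirect product; `⟨l, r⟩` stands for the sum of `l` and `r`. -/
@[ext] structure Semi (A B : Type*) where
  l : A
  r : B

/-- The four operations `R × S → S`, `S × R → S`, `Θ × R → Θ`, `Δ × S → Θ`. -/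
structure ActionData (R Δ S Θ : Type*) where
  lmul : R → S → S
  rmul : S → R → S
  actR : Θ → R → Θ
  actS : Δ → S → Θ

/-- The operations of an odd form ring acting on itself. -/
def selfAction (R Δ : Type*) [NonUnitalRing R] [StarRing R] [AddGroup Δ] [OddFormRing R Δ] :
    ActionData R Δ R Δ where
  lmul a b := a * b
  rmul a b := a * b
  actR u a := act u a
  actS u a := act u a

section Steinberg

variable {R Δ S Θ : Type*} [NonUnitalRing R] [StarRing R] [AddGroup Δ] [OddFormRing R Δ]
  [NonUnitalRing S] [StarRing S] [AddGroup Θ] [OddFormRing S Θ]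

/-- The operations define an action of `(R, Δ)` on `(S, Θ)`: the semidirect product
`(S ⋊ R, Θ ⋊ Δ)`, whose operations are forced by the odd form ring axioms (for instance
`δ + θ = φ(-star (π δ) π θ) + θ + δ` in `Θ ⋊ Δ`), is an odd form ring. -/
def ActionData.IsAction (A : ActionData R Δ S Θ) : Prop :=
  ∃ (_ : NonUnitalRing (Semi S R)) (_ : StarRing (Semi S R)) (_ : AddGroup (Semi Θ Δ))
    (_ : OddFormRing (Semi S R) (Semi Θ Δ)),
    (∀ x y : Semi S R, x + y = ⟨x.l + y.l, x.r + y.r⟩) ∧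
    (∀ x y : Semi S R, x * y = ⟨x.l * y.l + A.rmul x.l y.r + A.lmul x.r y.l, x.r * y.r⟩) ∧
    (∀ x : Semi S R, star x = ⟨star x.l, star x.r⟩) ∧
    (∀ u v : Semi Θ Δ, u + v =
      ⟨u.l + phi (-(A.lmul (star (pi u.r)) (pi v.l))) + v.l, u.r + v.r⟩) ∧
    (∀ (u : Semi Θ Δ) (x : Semi S R), act u x =
      ⟨act u.l x.l + phi (A.lmul (star x.r) (rho u.l * x.l)) + A.actR u.l x.r
        + A.actS u.r x.l + phi (A.lmul (star x.r * rho u.r) x.l), act u.r x.r⟩) ∧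
    (∀ x : Semi S R, (phi x : Semi Θ Δ) = ⟨phi x.l, phi x.r⟩) ∧
    (∀ u : Semi Θ Δ, (pi u : Semi S R) = ⟨pi u.l, pi u.r⟩) ∧
    (∀ u : Semi Θ Δ, (rho u : Semi S R) =
      ⟨rho u.l - A.rmul (star (pi u.l)) (pi u.r), rho u.r⟩)

/-- A crossed module `(S, Θ) → (R, Δ)` of odd form rings: an action of `(R, Δ)` on `(S, Θ)` and an
equivariant homomorphism `(dS, dΘ)` of odd form rings satisfying the Peiffer identities. -/
structure CrossedModule (R Δ S Θ : Type*)
    [NonUnitalRing R] [StarRing R] [AddGroup Δ] [OddFormRing R Δ]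
    [NonUnitalRing S] [StarRing S] [AddGroup Θ] [OddFormRing S Θ] where
  action : ActionData R Δ S Θ
  isAction : action.IsAction
  dS : S →⋆ₙ+* R
  dΘ : Θ →+ Δ
  map_act : ∀ (u : Θ) (a : S), dΘ (act u a) = act (dΘ u) (dS a)
  map_phi : ∀ a : S, dΘ (phi a) = phi (dS a)
  map_pi : ∀ u : Θ, dS (pi u) = pi (dΘ u)
  map_rho : ∀ u : Θ, dS (rho u) = rho (dΘ u)
  map_lmul : ∀ (p : R) (a : S), dS (action.lmul p a) = p * dS a
  map_rmul : ∀ (a : S) (p : R), dS (action.rmul a p) = dS a * p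
  map_actR : ∀ (u : Θ) (p : R), dΘ (action.actR u p) = act (dΘ u) p
  map_actS : ∀ (s : Δ) (a : S), dΘ (action.actS s a) = act s (dS a)
  peiffer_left : ∀ a b : S, a * b = action.lmul (dS a) b
  peiffer_right : ∀ a b : S, a * b = action.rmul a (dS b)
  peiffer_actS : ∀ (u : Θ) (a : S), act u a = action.actS (dΘ u) a
  peiffer_actR : ∀ (u : Θ) (a : S), act u a = action.actR u (dS a)

/-! ### Hyperbolic families

Families are indexed by a finite set `I` with an involution `i ↦ -i` without fixed points; in rank
`ℓ` one may take `I = {±1, …, ±ℓ}`. The pair with index `i` is `(e (-i), e i, q (-i), q i)`. -/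

/-- The data of a family of hyperbolic pairs. -/
structure Family (R Δ I : Type*) where
  e : I → R
  q : I → Δ

/-- The family is a strong orthogonal hyperbolic family. -/
structure Family.IsStrong {I : Type*} [InvolutiveNeg I] (H : Family R Δ I) : Prop where
  star_e : ∀ i, star (H.e i) = H.e (-i)
  idem : ∀ i, H.e i * H.e i = H.e i
  orth : ∀ i j, i ≠ j → H.e i * H.e j = 0
  pi_q : ∀ i, pi (H.q i) = H.e i
  rho_q : ∀ i, (rho (H.q i) : R) = 0
  act_q : ∀ i, H.q i = act (H.q i) (H.e i)
  full : ∀ i j, H.e i ∈ AddSubgroup.closure {z : R | ∃ x y : R, z = x * H.e j * y}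

/-- `S_{ij} = e_i S e_j`. -/
def Sij {I : Type*} (A : ActionData R Δ S Θ) (H : Family R Δ I) (i j : I) : Set S :=
  {a | ∃ b, a = A.rmul (A.lmul (H.e i) b) (H.e j)}

/-- `Θ⁰_j = {u ∈ Θ · e_j | e_k π(u) = 0 for all k}`. -/
def Theta0 {I : Type*} (A : ActionData R Δ S Θ) (H : Family R Δ I) (j : I) : Set Θ :=
  {u | (∃ v, u = A.actR v (H.e j)) ∧ ∀ k, A.lmul (H.e k) (pi u) = 0}

/-! ### Unrelativized Steinberg groups -/

section

variable {I : Type*} [InvolutiveNeg I]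

/-- Generators `X_{ij}(a)` and `X_j(u)` of the Steinberg group. -/
inductive Gen (A : ActionData R Δ S Θ) (H : Family R Δ I) : Type _
  | short (i j : I) (a : S) (h : i ≠ j ∧ i ≠ -j ∧ a ∈ Sij A H i j) : Gen A H
  | ultrashort (j : I) (u : Θ) (h : u ∈ Theta0 A H j) : Gen A H

open scoped Classical in
/-- The letter `X_{ij}(a)`; it is `1` unless `i ≠ ±j` and `a ∈ S_{ij}`. -/
def wX (A : ActionData R Δ S Θ) (H : Family R Δ I) (i j : I) (a : S) : FreeGroup (Gen A H) :=
  if h : i ≠ j ∧ i ≠ -j ∧ a ∈ Sij A H i j then FreeGroup.of (Gen.short i j a h) else 1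

open scoped Classical in
/-- The letter `X_j(u)`; it is `1` unless `u ∈ Θ⁰_j`. -/
def wY (A : ActionData R Δ S Θ) (H : Family R Δ I) (j : I) (u : Θ) : FreeGroup (Gen A H) :=
  if h : u ∈ Theta0 A H j then FreeGroup.of (Gen.ultrashort j u h) else 1

/-- The Steinberg relations. -/
inductive StRel (A : ActionData R Δ S Θ) (H : Family R Δ I) :
    FreeGroup (Gen A H) → FreeGroup (Gen A H) → Prop
  | sym (i j : I) (a : S) : i ≠ j → i ≠ -j → a ∈ Sij A H i j →
      StRel A H (wX A H i j a) (wX A H (-j) (-i) (-star a))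
  | addX (i j : I) (a b : S) : i ≠ j → i ≠ -j → a ∈ Sij A H i j → b ∈ Sij A H i j →
      StRel A H (wX A H i j a * wX A H i j b) (wX A H i j (a + b))
  | addY (j : I) (u v : Θ) : u ∈ Theta0 A H j → v ∈ Theta0 A H j →
      StRel A H (wY A H j u * wY A H j v) (wY A H j (u + v))
  | commXX (i j k l : I) (a b : S) : i ≠ j → i ≠ -j → k ≠ l → k ≠ -l →
      a ∈ Sij A H i j → b ∈ Sij A H k l → j ≠ k → k ≠ -i → -i ≠ -l → -l ≠ j →
      StRel A H ⁅wX A H i j a, wX A H k l b⁆ 1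
  | commXY (i j l : I) (a : S) (u : Θ) : i ≠ j → i ≠ -j →
      a ∈ Sij A H i j → u ∈ Theta0 A H l → i ≠ l → l ≠ -j →
      StRel A H ⁅wX A H i j a, wY A H l u⁆ 1
  | commLong (i j : I) (a b : S) : i ≠ j → i ≠ -j →
      a ∈ Sij A H (-i) j → b ∈ Sij A H j i →
      StRel A H ⁅wX A H (-i) j a, wX A H j i b⁆ (wY A H i (phi (a * b)))
  | commYsame (i : I) (u v : Θ) : u ∈ Theta0 A H i → v ∈ Theta0 A H i →
      StRel A H ⁅wY A H i u, wY A H i v⁆ (wY A H i (phi (-(star (pi u : S) * pi v))))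
  | commYY (i j : I) (u v : Θ) : i ≠ j → i ≠ -j → u ∈ Theta0 A H i → v ∈ Theta0 A H j →
      StRel A H ⁅wY A H i u, wY A H j v⁆ (wX A H (-i) j (-(star (pi u) * pi v)))
  | commShort (i j k : I) (a b : S) : i ≠ j → i ≠ -j → j ≠ k → j ≠ -k → i ≠ k → i ≠ -k →
      a ∈ Sij A H i j → b ∈ Sij A H j k →
      StRel A H ⁅wX A H i j a, wX A H j k b⁆ (wX A H i k (a * b))
  | commYX (i j : I) (u : Θ) (a : S) : i ≠ j → i ≠ -j →
      u ∈ Theta0 A H i → a ∈ Sij A H i j →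
      StRel A H ⁅wY A H i u, wX A H i j a⁆
        (wX A H (-i) j (rho u * a) * wY A H j (-(act u (-a))))

/-- The Steinberg group of `(S, Θ)` with respect to the family `H`. -/
abbrev StU (A : ActionData R Δ S Θ) (H : Family R Δ I) : Type _ :=
  PresentedGroup {r : FreeGroup (Gen A H) | ∃ x y, StRel A H x y ∧ r = x * y⁻¹}

/-- The element `X_{ij}(a)` of the Steinberg group. -/
def X (A : ActionData R Δ S Θ) (H : Family R Δ I) (i j : I) (a : S) : StU A H :=
  PresentedGroup.mk _ (wX A H i j a)

/-- The element `X_j(u)` of the Steinberg group. -/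
def Y (A : ActionData R Δ S Θ) (H : Family R Δ I) (j : I) (u : Θ) : StU A H :=
  PresentedGroup.mk _ (wY A H j u)

/-! ### The map to the unitary group, diagonal automorphisms -/

/-- The operation `g h = g · π(h) + h + g` of the unitary group. -/
def umul (g h : Θ) : Θ := act g (pi h : S) + h + g

/-- `T_{ij}(a) = q_i · a - q_{-j} · star a - φ(a)`. -/
def TX (A : ActionData R Δ S Θ) (H : Family R Δ I) (i j : I) (a : S) : Θ :=
  A.actS (H.q i) a + -(A.actS (H.q (-j)) (star a)) + -(phi a)

/-- `T_j(u) = u - φ(ρ(u) + π(u)) + q_{-j} · (ρ(u) - star π(u))`. -/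
def TY (A : ActionData R Δ S Θ) (H : Family R Δ I) (j : I) (u : Θ) : Θ :=
  u + -(phi (rho u + pi u : S)) + A.actS (H.q (-j)) (rho u - star (pi u))

/-- `StVal A H x t` means that `t` is the image of `x` under the canonical homomorphism from the
Steinberg group to the unitary group of `(S, Θ)`, `X_{ij}(a) ↦ T_{ij}(a)`, `X_j(u) ↦ T_j(u)`. Every
element of the Steinberg group is a product of root elements, so inverses need no clause. -/
inductive StVal (A : ActionData R Δ S Θ) (H : Family R Δ I) : StU A H → Θ → Prop
  | one : StVal A H 1 0
  | mulX (i j : I) (a : S) (x : StU A H) (t : Θ) : i ≠ j → i ≠ -j → a ∈ Sij A H i j →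
      StVal A H x t → StVal A H (X A H i j a * x) (umul (S := S) (TX A H i j a) t)
  | mulY (j : I) (u : Θ) (x : StU A H) (t : Θ) : u ∈ Theta0 A H j →
      StVal A H x t → StVal A H (Y A H j u * x) (umul (S := S) (TY A H j u) t)

/-- The action of `g` from the unitary group of `(R, Δ)` on `S`: conjugation by `π(g) + 1`. -/
def conjS (A : ActionData R Δ S Θ) (g : Δ) (a : S) : S :=
  a + A.lmul (pi g) a + A.rmul a (star (pi g)) + A.rmul (A.lmul (pi g) a) (star (pi g))

/-- The action of `g` from the unitary group of `(R, Δ)` on `Θ`, `u ↦ v · (star π(g) + 1)` with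
`v = g · π(u) + u`, the last product being expanded by the rule for `v · (a + b)`. -/
def conjΘ (A : ActionData R Δ S Θ) (g : Δ) (u : Θ) : Θ :=
  A.actR (A.actS g (pi u : S) + u) (star (pi g))
    + phi (A.rmul (rho (A.actS g (pi u : S) + u)) (star (pi g)))
    + (A.actS g (pi u : S) + u)

/-- The graph of the automorphism of the Steinberg group given by an element `g` of the diagonal
group, `X_{ij}(a) ↦ X_{ij}(ᵍa)`, `X_j(u) ↦ X_j(ᵍu)`. -/
def diagGraph (A : ActionData R Δ S Θ) (H : Family R Δ I) (g : Δ) :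
    Subgroup (StU A H × StU A H) :=
  Subgroup.closure
    ({p | ∃ i j a, i ≠ j ∧ i ≠ -j ∧ a ∈ Sij A H i j ∧
        p = (X A H i j a, X A H i j (conjS A g a))} ∪
     {p | ∃ j, ∃ u ∈ Theta0 A H j, p = (Y A H j u, Y A H j (conjΘ A g u))})

end

/-! ### Roots -/

section

variable {I J : Type*} [InvolutiveNeg I] [InvolutiveNeg J]

open scoped Classical in
/-- The vector `e_i`; the lattice spanned by all `e_i` is realized by odd functions on `I`, so
that `e_{-i} = -e_i`. -/
def vec (i : I) : I → ℤ := Pi.single i 1 - Pi.single (-i) 1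

variable (I) in
/-- The root system of type `BC`: the roots `e_i` and `e_i + e_j` for `j ≠ -i` (including
`2 e_i = e_i + e_i`). -/
def roots : Set (I → ℤ) := {α | ∃ i, α = vec i} ∪ {α | ∃ i j, j ≠ -i ∧ α = vec i + vec j}

/-- Roots of length `1`. -/
def IsUltrashort (α : I → ℤ) : Prop := ∃ i, α = vec i

/-- Roots of length `√2`. -/
def IsShort (α : I → ℤ) : Prop := ∃ i j, j ≠ i ∧ j ≠ -i ∧ α = vec i + vec j

/-- Saturated (closed) sets of roots. -/
structure IsSaturated (P : Set (I → ℤ)) : Prop where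
  subset : P ⊆ roots I
  closed : ∀ α ∈ P, ∀ β ∈ P, α + β ∈ roots I → α + β ∈ P
  half : ∀ α ∈ P, ∀ β ∈ roots I, α = β + β → β ∈ P

/-- Saturated special sets of roots. -/
structure IsSatSpecial (P : Set (I → ℤ)) : Prop extends IsSaturated P where
  special : ∀ α ∈ P, -α ∉ P

/-- Saturated root subsystems. -/
structure IsSubsystem (P : Set (I → ℤ)) : Prop extends IsSaturated P where
  neg : ∀ α ∈ P, -α ∈ P

/-- The smallest saturated set of roots containing `P`. -/
def satHull (P : Set (I → ℤ)) : Set (I → ℤ) := {γ | ∀ Q, IsSaturated Q → P ⊆ Q → γ ∈ Q}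

/-- The standard inner product (up to a scalar factor). -/
def form (α β : I → ℤ) : ℤ := ∑ᶠ k, α k * β k

/-- Root subsystems of type `A₂`: there are simple roots `β`, `γ` of the same length at the angle
`2π/3`. -/
def IsTypeA2 (P : Set (I → ℤ)) : Prop :=
  P ⊆ roots I ∧ ∃ β γ, 0 < form β β ∧ form γ γ = form β β ∧ 2 * form β γ = -form β β ∧
    P = {β, γ, β + γ, -β, -γ, -(β + γ)}

/-- The partial equivalence relation `e_i ∼_Ψ e_j` on ultrashort roots. -/
def perOf (P : Set (I → ℤ)) (i j : I) : Prop :=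
  (vec i - vec j ∈ P ∨ vec i - vec j = 0) ∧ vec j ∉ P

/-- `c : I → Option J` labels the equivalence classes of `∼_Ψ` by the elements of `J`, opposite
classes having opposite labels; `c i = none` means that `i` lies in no class. So `J` is the index
set of `H / Ψ` and `roots J` is the root system `Φ / Ψ`. -/
structure IsQuotient (P : Set (I → ℤ)) (c : I → Option J) : Prop where
  neg : ∀ i, c (-i) = (c i).map (fun E => -E)
  surj : ∀ E, ∃ i, c i = some E
  rel : ∀ i j, perOf P i j ↔ ∃ E, c i = some E ∧ c j = some E

/-- The class with label `E`. -/
def fiber [Finite I] (c : I → Option J) (E : J) : Finset I :=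
  (Set.toFinite {i | c i = some E}).toFinset

/-- The linear map `ℝ Φ → ℝ Φ / ℝ Ψ`, sending `e_i` to `e_E` if `c i = some E` and to `0` if
`c i = none`. -/
def proj [Finite I] (c : I → Option J) (v : I → ℤ) : J → ℤ := fun E => ∑ i ∈ fiber c E, v i

/-- The preimage in `Φ` of a set of roots from `Φ / Ψ`. -/
def pre [Finite I] (c : I → Option J) (P : Set (J → ℤ)) : Set (I → ℤ) :=
  {α | α ∈ roots I ∧ proj c α ∈ P}

/-- The family `H / Ψ` formed by the sums of hyperbolic pairs over all classes (the elements `q i`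
with `i` from one class commute for a hyperbolic family, so the order of summation is immaterial).
-/
def Family.push [Finite I] (H : Family R Δ I) (c : I → Option J) : Family R Δ J where
  e E := ∑ i ∈ fiber c E, H.e i
  q E := ((fiber c E).toList.map H.q).sum

/-- The root subgroup `X_α(S, Θ)` of the Steinberg group. -/
def rootSet (A : ActionData R Δ S Θ) (H : Family R Δ I) (α : I → ℤ) : Set (StU A H) :=
  {x | ∃ i j a, i ≠ j ∧ i ≠ -j ∧ a ∈ Sij A H i j ∧ α = vec j - vec i ∧ x = X A H i j a} ∪
  {x | ∃ j, ∃ u ∈ Theta0 A H j, α = vec j ∧ x = Y A H j u} ∪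
  {x | ∃ j, ∃ a ∈ Sij A H (-j) j, α = vec j + vec j ∧ x = Y A H j (phi a)}

/-- The subgroup `StU(S, Θ; Σ)` generated by the root subgroups with roots from `P = Σ`. -/
def stSub (A : ActionData R Δ S Θ) (H : Family R Δ I) (P : Set (I → ℤ)) : Subgroup (StU A H) :=
  Subgroup.closure (⋃ α ∈ P, rootSet A H α)

/-- The graph of the canonical homomorphism `F` from the Steinberg group of a quotient family `H'`
to the Steinberg group of `H`: it maps every root subgroup `X_β` to `StU(π⁻¹{β, 2β})` and commutes
with the maps to the unitary group. -/
def elimGraph [Finite I] (A : ActionData R Δ S Θ) (H : Family R Δ I) (H' : Family R Δ J)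
    (c : I → Option J) : Subgroup (StU A H' × StU A H) :=
  Subgroup.closure {p | ∃ β ∈ roots J, p.1 ∈ rootSet A H' β ∧
    p.2 ∈ stSub A H (pre c {β, β + β}) ∧ ∃ t, StVal A H' p.1 t ∧ StVal A H p.2 t}

end

/-! ### Conjugacy calculus and the universal group -/

section

variable {I : Type} [InvolutiveNeg I]

/-- `ChevRel M H α x y w`: for a root element `x = X_α(μ)` over `(R, Δ)` and a root element
`y = X_β(ν)` over `(S, Θ)`, where `α` and `β` are not antiparallel, `w` is the product
`∏ X_{iα+jβ}(f_{αβij}(μ, ν))` over `i ≥ 0`, `j > 0`, i.e. `[x, y] y` with `[x, y]` given by the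
Chevalley commutator formula. All pairs of roots are covered because of
`X_{ij}(a) = X_{-j,-i}(-star a)`. -/
inductive ChevRel (M : CrossedModule R Δ S Θ) (H : Family R Δ I) :
    (I → ℤ) → StU (selfAction R Δ) H → StU M.action H → StU M.action H → Prop
  | commXX (i j k l : I) (p : R) (b : S) : i ≠ j → i ≠ -j → k ≠ l → k ≠ -l →
      p ∈ Sij (selfAction R Δ) H i j → b ∈ Sij M.action H k l →
      j ≠ k → k ≠ -i → -i ≠ -l → -l ≠ j →
      ChevRel M H (vec j - vec i) (X (selfAction R Δ) H i j p) (X M.action H k l b)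
        (X M.action H k l b)
  | commXY (i j l : I) (p : R) (u : Θ) : i ≠ j → i ≠ -j →
      p ∈ Sij (selfAction R Δ) H i j → u ∈ Theta0 M.action H l → i ≠ l → l ≠ -j →
      ChevRel M H (vec j - vec i) (X (selfAction R Δ) H i j p) (Y M.action H l u)
        (Y M.action H l u)
  | commYX (i j l : I) (s : Δ) (a : S) : i ≠ j → i ≠ -j →
      s ∈ Theta0 (selfAction R Δ) H l → a ∈ Sij M.action H i j → i ≠ l → l ≠ -j →
      ChevRel M H (vec l) (Y (selfAction R Δ) H l s) (X M.action H i j a)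
        (X M.action H i j a)
  | long (i j : I) (p : R) (b : S) : i ≠ j → i ≠ -j →
      p ∈ Sij (selfAction R Δ) H (-i) j → b ∈ Sij M.action H j i →
      ChevRel M H (vec j - vec (-i)) (X (selfAction R Δ) H (-i) j p) (X M.action H j i b)
        (Y M.action H i (phi (M.action.lmul p b)) * X M.action H j i b)
  | same (i : I) (s : Δ) (u : Θ) :
      s ∈ Theta0 (selfAction R Δ) H i → u ∈ Theta0 M.action H i →
      ChevRel M H (vec i) (Y (selfAction R Δ) H i s) (Y M.action H i u)
        (Y M.action H i (phi (-(M.action.lmul (star (pi s)) (pi u)))) * Y M.action H i u)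
  | ultrashort (i j : I) (s : Δ) (u : Θ) : i ≠ j → i ≠ -j →
      s ∈ Theta0 (selfAction R Δ) H i → u ∈ Theta0 M.action H j →
      ChevRel M H (vec i) (Y (selfAction R Δ) H i s) (Y M.action H j u)
        (X M.action H (-i) j (-(M.action.lmul (star (pi s)) (pi u))) * Y M.action H j u)
  | short (i j k : I) (p : R) (b : S) : i ≠ j → i ≠ -j → j ≠ k → j ≠ -k → i ≠ k → i ≠ -k →
      p ∈ Sij (selfAction R Δ) H i j → b ∈ Sij M.action H j k →
      ChevRel M H (vec j - vec i) (X (selfAction R Δ) H i j p) (X M.action H j k b)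
        (X M.action H i k (M.action.lmul p b) * X M.action H j k b)
  | mixedYX (i j : I) (s : Δ) (a : S) : i ≠ j → i ≠ -j →
      s ∈ Theta0 (selfAction R Δ) H i → a ∈ Sij M.action H i j →
      ChevRel M H (vec i) (Y (selfAction R Δ) H i s) (X M.action H i j a)
        (X M.action H (-i) j (M.action.lmul (rho s) a) * Y M.action H j (-(M.action.actS s (-a)))
          * X M.action H i j a)
  | mixedXY (i j : I) (p : R) (u : Θ) : i ≠ j → i ≠ -j →
      p ∈ Sij (selfAction R Δ) H i j → u ∈ Theta0 M.action H i →
      ChevRel M H (vec j - vec i) (X (selfAction R Δ) H i j p) (Y M.action H i u)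
        (Y M.action H j (M.action.actR u (-p)) * X M.action H (-i) j (-(M.action.rmul (rho u) p))
          * Y M.action H i u)

/-- The formal symbols `ᵍ{h}_Σ` of a conjugacy calculus, for a saturated special set `P = Σ`,
`g ∈ StU(R, Δ; Σ)`, and `h ∈ StU(S, Θ; Φ)`. -/
structure CalcSymbol (M : CrossedModule R Δ S Θ) (H : Family R Δ I) where
  P : Set (I → ℤ)
  special : IsSatSpecial P
  g : StU (selfAction R Δ) H
  g_mem : g ∈ stSub (selfAction R Δ) H P
  h : StU M.action H

/-- The symbol `ᵍ{h}_Σ` as an element of the free group. -/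
def br (M : CrossedModule R Δ S Θ) (H : Family R Δ I) (P : Set (I → ℤ)) (hP : IsSatSpecial P)
    (g : StU (selfAction R Δ) H) (hg : g ∈ stSub (selfAction R Δ) H P) (h : StU M.action H) :
    FreeGroup (CalcSymbol M H) :=
  FreeGroup.of ⟨P, hP, g, hg, h⟩

/-- The axioms of a conjugacy calculus with respect to `H`, as equalities of words in the symbols
`ᵍ{h}_Σ`: (Hom), (Sub), (Chev), (XMod) for the two kinds of root elements, and (Conj). -/
inductive CalcRel [Finite I] (M : CrossedModule R Δ S Θ) (H : Family R Δ I) :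
    FreeGroup (CalcSymbol M H) → FreeGroup (CalcSymbol M H) → Prop
  | hom (P : Set (I → ℤ)) (hP : IsSatSpecial P) (g : StU (selfAction R Δ) H)
      (hg : g ∈ stSub (selfAction R Δ) H P) (h₁ h₂ : StU M.action H) :
      CalcRel M H (br M H P hP g hg (h₁ * h₂)) (br M H P hP g hg h₁ * br M H P hP g hg h₂)
  | sub (P P' : Set (I → ℤ)) (hP : IsSatSpecial P) (hP' : IsSatSpecial P') (_ : P' ⊆ P)
      (g : StU (selfAction R Δ) H) (hg : g ∈ stSub (selfAction R Δ) H P)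
      (hg' : g ∈ stSub (selfAction R Δ) H P') (h : StU M.action H) :
      CalcRel M H (br M H P' hP' g hg' h) (br M H P hP g hg h)
  | chev (P : Set (I → ℤ)) (hP : IsSatSpecial P) (g x : StU (selfAction R Δ) H)
      (hg : g ∈ stSub (selfAction R Δ) H P) (hgx : g * x ∈ stSub (selfAction R Δ) H P)
      (α : I → ℤ) (_ : α ∈ P) (y w : StU M.action H) (_ : ChevRel M H α x y w) :
      CalcRel M H (br M H P hP (g * x) hgx y) (br M H P hP g hg w)
  | xmodX (P : Set (I → ℤ)) (hP : IsSatSpecial P) (g : StU (selfAction R Δ) H)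
      (hg : g ∈ stSub (selfAction R Δ) H P) (h1 : 1 ∈ stSub (selfAction R Δ) H P)
      (i j : I) (a : S) (_ : i ≠ j) (_ : i ≠ -j) (_ : a ∈ Sij M.action H i j)
      (_ : vec j - vec i ∈ P)
      (hxg : X (selfAction R Δ) H i j (M.dS a) * g ∈ stSub (selfAction R Δ) H P)
      (h : StU M.action H) :
      CalcRel M H (br M H P hP (X (selfAction R Δ) H i j (M.dS a) * g) hxg h)
        (br M H P hP 1 h1 (X M.action H i j a) * br M H P hP g hg h *
          (br M H P hP 1 h1 (X M.action H i j a))⁻¹)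
  | xmodY (P : Set (I → ℤ)) (hP : IsSatSpecial P) (g : StU (selfAction R Δ) H)
      (hg : g ∈ stSub (selfAction R Δ) H P) (h1 : 1 ∈ stSub (selfAction R Δ) H P)
      (j : I) (u : Θ) (_ : u ∈ Theta0 M.action H j) (_ : vec j ∈ P)
      (hxg : Y (selfAction R Δ) H j (M.dΘ u) * g ∈ stSub (selfAction R Δ) H P)
      (h : StU M.action H) :
      CalcRel M H (br M H P hP (Y (selfAction R Δ) H j (M.dΘ u) * g) hxg h)
        (br M H P hP 1 h1 (Y M.action H j u) * br M H P hP g hg h *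
          (br M H P hP 1 h1 (Y M.action H j u))⁻¹)
  /-- Here `J`, `c` describe `Φ / Ψ` for a saturated root subsystem `Ψ`; the set `P'` is special
  and contained in `Ψ`, `x` is a root element with the root `α ∈ Ψ`, `t` and `s` are the images of
  `g₁` and `x` in the unitary groups, so that `f = conjΘ M.action t s`; the elements `g₂'`, `h'` are
  the results of the action of `f` on `g₂` and `h`; finally, `k`, `k'`, `m`, `m'` are the images of
  `g₂`, `g₂'`, `h`, `h'` under the canonical homomorphisms `F_Ψ`. -/
  | conj {J : Type} [InvolutiveNeg J] (Ψ : Set (I → ℤ)) (_ : IsSubsystem Ψ)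
      (c : I → Option J) (_ : IsQuotient Ψ c)
      (P' : Set (I → ℤ)) (hP' : IsSatSpecial P') (_ : P' ⊆ Ψ)
      (g₁ : StU (selfAction R Δ) H) (hg₁ : g₁ ∈ stSub (selfAction R Δ) H P')
      (α : I → ℤ) (_ : α ∈ Ψ) (x : StU M.action H) (_ : x ∈ rootSet M.action H α)
      (t : Δ) (_ : StVal (selfAction R Δ) H g₁ t) (s : Θ) (_ : StVal M.action H x s)
      (P : Set (J → ℤ)) (_ : IsSatSpecial P) (hP : IsSatSpecial (pre c P))
      (g₂ g₂' : StU (selfAction R Δ) (H.push c))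
      (_ : g₂ ∈ stSub (selfAction R Δ) (H.push c) P)
      (_ : (g₂, g₂') ∈ diagGraph (selfAction R Δ) (H.push c) (M.dΘ (conjΘ M.action t s)))
      (h h' : StU M.action (H.push c))
      (_ : (h, h') ∈ diagGraph M.action (H.push c) (M.dΘ (conjΘ M.action t s)))
      (k k' : StU (selfAction R Δ) H)
      (_ : (g₂, k) ∈ elimGraph (selfAction R Δ) H (H.push c) c)
      (_ : (g₂', k') ∈ elimGraph (selfAction R Δ) H (H.push c) c)
      (hk : k ∈ stSub (selfAction R Δ) H (pre c P)) (hk' : k' ∈ stSub (selfAction R Δ) H (pre c P))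
      (m m' : StU M.action H)
      (_ : (h, m) ∈ elimGraph M.action H (H.push c) c)
      (_ : (h', m') ∈ elimGraph M.action H (H.push c) c) :
      CalcRel M H
        (br M H P' hP' g₁ hg₁ x * br M H (pre c P) hP k hk m * (br M H P' hP' g₁ hg₁ x)⁻¹)
        (br M H (pre c P) hP k' hk' m')

/-- The universal group with a conjugacy calculus with respect to `H`. -/
abbrev StUbar [Finite I] (M : CrossedModule R Δ S Θ) (H : Family R Δ I) : Type _ :=
  PresentedGroup {r : FreeGroup (CalcSymbol M H) | ∃ x y, CalcRel M H x y ∧ r = x * y⁻¹}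

/-- The element `ᵍ{h}_Σ` of the universal group. -/
def bracket [Finite I] (M : CrossedModule R Δ S Θ) (H : Family R Δ I) (P : Set (I → ℤ))
    (hP : IsSatSpecial P) (g : StU (selfAction R Δ) H) (hg : g ∈ stSub (selfAction R Δ) H P)
    (h : StU M.action H) : StUbar M H :=
  PresentedGroup.mk _ (br M H P hP g hg h)

/-- `F` is the canonical homomorphism between the universal groups of a quotient family `H'` and of
`H`: there are canonical homomorphisms `FR`, `FS` between the Steinberg groups of `(R, Δ)` and of
`(S, Θ)`, and `F` maps `ᵍ{h}_Σ` to `ᵏ{FS h}_{Σ'}` with `k = FR g`, where `Σ'` is the preimage of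
`Σ`. -/
def IsElim {J : Type} [InvolutiveNeg J] [Finite I] [Finite J] (M : CrossedModule R Δ S Θ)
    (H : Family R Δ I) (H' : Family R Δ J) (c : I → Option J) (F : StUbar M H' →* StUbar M H) :
    Prop :=
  ∃ (FR : StU (selfAction R Δ) H' →* StU (selfAction R Δ) H)
    (FS : StU M.action H' →* StU M.action H),
    (∀ x, (x, FR x) ∈ elimGraph (selfAction R Δ) H H' c) ∧
    (∀ x, (x, FS x) ∈ elimGraph M.action H H' c) ∧
    ∀ (P : Set (J → ℤ)) (hP : IsSatSpecial P) (g : StU (selfAction R Δ) H')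
      (hg : g ∈ stSub (selfAction R Δ) H' P) (h : StU M.action H'),
      ∃ (hP' : IsSatSpecial (pre c P)) (hg' : FR g ∈ stSub (selfAction R Δ) H (pre c P)),
        F (bracket M H' P hP g hg h) = bracket M H (pre c P) hP' (FR g) hg' (FS h)

end

end Steinberg

end

end OddUnitary

open OddUnitary

/-!
The action of a crossed module embeds `(S, Θ)` and `(R, Δ)` into their semidirect product, one odd
form ring in which the action becomes multiplication (`CrossedModule.exists_fullAmbient`). Hence a
Steinberg group maps to the unitary group of the semidirect product (`Ambient.st`). On the subgroup
generated by the root subgroups from an open half-space this map is injective: elements of the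
column of an index of maximal weight have a normal form that can be read off from their action on
`e_t`, and the other factors fix `e_t` (`st_injOn`). Therefore an identity between products of root
elements from one half-space can be checked in the unitary group. This gives the existence and the
uniqueness of the canonical homomorphism `elimHom` from the Steinberg group of a quotient family
(`elimGen_rel`, `eq_elimHom_of_mem_elimGraph`).

The image of one root element under `elimHom` is a product of several root elements, so the defining
relations of the universal group, which concern single root elements, have to be extended to
arbitrary elements of the subgroups generated by root subgroups. This is `exists_brk_conj` for the
Chevalley relation, where the conjugate `ˣy` is a product of root elements with roots from a cone,
`brk_delta` for the crossed module relation, and `brk_conj_diag` for the conjugation relation. In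
the last one a quotient of a quotient is again a quotient (`push_push`, `isQuotient_preSub`). As a
result the canonical homomorphism `elimBar` of universal groups exists for any labelling of classes.

For surjectivity, a saturated special set lies in a system of positive roots. In an element `ᵍ{y}`
for a root element `y`, the factors of `g` with roots not antiparallel to the root of `y` can be
eliminated by the Chevalley relation, starting from the root of minimal height
(`brk_mem_of_anti`). Let all roots of `g` be antiparallel to the root `β` of `y`. If `β` does not
vanish in the quotient, then neither do the roots of `g`, and `ᵍ{y}` comes from the quotient
(`brk_mem_range`). Otherwise it suffices to express `y` by root elements with roots that do not
vanish in the quotient and by conjugates `w = ᶻv` of such elements, because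
`ᵍ{w} = ᵍᶻ{v} = ᵘ{ᵍv}` with `u = ᵍz`, and adding roots that vanish in the quotient to a root that does
not gives roots of the last kind (`brk_mem_range_of_chev`, `elimBar_surjective`).

Such expressions exist by the fullness condition `e_i ∈ R e_j R`. If some index `k` lies outside the
class of `i` and `j`, then `X_{ij}(a)` is a product of commutators `[X_{ik}(p), X_{kj}(b)]`
(`X_mem_offSub_of_third`); if `i` lies outside all classes and `k` inside, then `X_i(u)` is
obtained from commutators with `X_k(v)` and `X_{ki}(b)` (`Y_mem_offSub_of_other`). These cases cover
`Φ / α`. For a subsystem `Ψ` of type `A₂` containing `α` all the indices of `Φ / α` in question may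
lie in one class for `Ψ / α`. But two opposite classes for `α` consist of two indices each, so their
idempotents are sums of products `ρ(φ(p)) q`, and `X_{ij}(ρ(φ(p)) b)` is obtained from
`[X_{-i}(φ(p)), X_{-i,j}(b)]` (`X_mem_offSub_of_rho_phi`).
-/

set_option linter.unusedSectionVars false

namespace OddUnitary

noncomputable section

open OddFormRing
open scoped commutatorElement

/-! ### Calculus in odd form rings and the unitary group -/

section Calculus

variable {B Γ : Type*} [NonUnitalRing B] [StarRing B] [AddGroup Γ] [OddFormRing B Γ]

theorem phi_zero : (phi (0 : B) : Γ) = 0 := by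
  have h := phi_add (Δ := Γ) (0 : B) 0
  rw [add_zero] at h
  exact left_eq_add.mp h

theorem pi_zero : (pi (0 : Γ) : B) = 0 := by
  have h := pi_add (R := B) (0 : Γ) 0
  rw [add_zero] at h
  exact left_eq_add.mp h

theorem pi_neg (u : Γ) : (pi (-u) : B) = -pi u := by
  rw [eq_neg_iff_add_eq_zero, ← pi_add, neg_add_cancel, pi_zero]

theorem phi_neg (a : B) : (phi (-a) : Γ) = -phi a := by
  rw [eq_neg_iff_add_eq_zero, ← phi_add, neg_add_cancel, phi_zero]

theorem rho_zero : (rho (0 : Γ) : B) = 0 := by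
  have h := rho_add (R := B) (0 : Γ) 0
  simpa [pi_zero] using h

theorem zero_act (a : B) : act (0 : Γ) a = 0 := by
  have h := add_act (R := B) (0 : Γ) 0 a
  rw [add_zero] at h
  exact left_eq_add.mp h

theorem act_zero (u : Γ) : act u (0 : B) = 0 := by
  have h := act_add u (0 : B) 0
  simpa [phi_zero] using h

theorem neg_act (u : Γ) (a : B) : act (-u) a = -act u a := by
  rw [eq_neg_iff_add_eq_zero, ← add_act, neg_add_cancel, zero_act]

/-- The elements `φ(a)` are central. -/
theorem phi_comm (a : B) (u : Γ) : u + phi a = phi a + u := by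
  have h := add_comm_phi (R := B) u (phi a : Γ)
  rw [pi_phi, mul_zero, neg_zero, phi_zero] at h
  rw [add_neg_eq_zero, add_neg_eq_iff_eq_add] at h
  exact h

theorem phi_left_comm (a : B) (u v : Γ) : u + (phi a + v) = phi a + (u + v) := by
  rw [← add_assoc, phi_comm, add_assoc]

theorem phi_phi_add (a b : B) (v : Γ) : phi a + (phi b + v) = phi (a + b) + v := by
  rw [← add_assoc, phi_add]

/-- Commuting two elements of the group costs a central summand. -/
theorem add_swap (u v : Γ) : u + v = phi (-(star (pi u) * pi v) : B) + (v + u) := by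
  rw [← add_comm_phi]; simp [add_assoc]

theorem add_swap_left (u v w : Γ) :
    u + (v + w) = phi (-(star (pi u) * pi v) : B) + (v + (u + w)) := by
  rw [← add_assoc, add_swap u v (B := B)]; simp [add_assoc]

theorem add_comm_of_mul_eq_zero {u v : Γ} (h : star (pi u) * pi v = (0 : B)) : u + v = v + u := by
  rw [add_swap (B := B) u v, h, neg_zero, phi_zero, zero_add]

theorem phi_star (a : B) : (phi (star a) : Γ) = phi (-a) := by
  rw [phi_neg, eq_neg_iff_add_eq_zero, ← phi_add, add_comm, phi_add_star]

theorem phi_neg_star (a : B) : (phi (-star a) : Γ) = phi a := by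
  rw [phi_neg, phi_star, ← phi_neg, neg_neg]

theorem phi_congr {a b : B} (c : B) (h : a - b = c + star c) : (phi a : Γ) = phi b := by
  have : a = b + (c + star c) := by rw [← h]; abel
  rw [this, phi_add, phi_add_star, add_zero]

theorem phi_act (a b : B) : act (phi a : Γ) b = phi (star b * a * b) := (phi_conj a b).symm

theorem rho_neg (u : Γ) : (rho (-u) : B) = star (rho u) := by
  have h := rho_add (R := B) u (-u)
  rw [add_neg_cancel, rho_zero, pi_neg] at h
  have h2 := rho_symm (R := B) u
  have : (rho (-u) : B) = star (rho u) + (rho u + star (pi u) * pi u + rho (-u))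
      - (star (rho u) + star (pi u) * pi u + rho u) + star (pi u) * pi u - star (pi u) * pi u := by
    abel
  rw [this, h2]
  have h3 : rho u + star (pi u) * pi u + rho (-u) = (0 : B) := by
    rw [h]; simp
  rw [h3]; simp

theorem act_neg (u : Γ) (a : B) : act u (-a) = phi (star a * rho u * a) + -act u a := by
  have h := act_add u a (-a)
  rw [add_neg_cancel, act_zero, star_neg, neg_mul, neg_mul, phi_neg] at h
  have h2 : act u (-a) = -(-phi (star a * rho u * a)) + -act u a := by
    rw [← neg_add_rev, eq_neg_iff_add_eq_zero]
    have h3 : act u a + -phi (star a * rho u * a) = -act u (-a) := by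
      rw [eq_neg_iff_add_eq_zero]; exact h.symm
    rw [h3]; simp
  simpa using h2

theorem act_neg_of_rho {u : Γ} (h : rho u = (0 : B)) (a : B) : act u (-a) = -act u a := by
  rw [act_neg, h]; simp [phi_zero]

theorem act_add_of_rho {u : Γ} (h : rho u = (0 : B)) (a b : B) :
    act u (a + b) = act u a + act u b := by
  rw [act_add, h]; simp [phi_zero]

theorem neg_phi (a : B) : (-phi a : Γ) = phi (-a) := (phi_neg a).symm

theorem star_rho (u : Γ) : star (rho u) = -(star (pi u) * pi u) - (rho u : B) := by
  have h := rho_symm (R := B) u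
  rw [eq_sub_iff_add_eq, eq_neg_iff_add_eq_zero, ← h]; abel

theorem act_phi_left (u v : Γ) (a b : B) : act u a + (phi b + v) = phi b + (act u a + v) :=
  phi_left_comm ..

theorem neg_act_phi_left (u v : Γ) (a b : B) :
    -act u a + (phi b + v) = phi b + (-act u a + v) :=
  phi_left_comm ..

theorem umul_assoc {f g h : Γ} (hf : pi f = star (rho f : B)) :
    umul (S := B) (umul (S := B) f g) h = umul (S := B) f (umul (S := B) g h) := by
  have e : (rho f : B) = star (pi f) := by rw [hf, star_star]
  simp only [umul, pi_add, pi_act, add_act, ← act_mul, act_add, add_assoc, e,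
    act_phi_left, phi_phi_add]
  rw [add_swap_left (act g (pi h)) (act f (pi h)) (B := B)]
  rw [add_swap_left h (act f (pi g)) (B := B), act_phi_left, act_phi_left, act_phi_left,
    add_swap_left (act g (pi h)) (act f (pi g)) (B := B)]
  simp only [act_phi_left, phi_phi_add]
  congr 1
  apply phi_congr (-(star (pi h) * star (pi f) * pi g * pi h + star (pi g) * star (pi f) * pi g * pi h
    + star (pi g) * star (pi f) * pi h))
  simp only [pi_act, star_mul, star_add, star_neg, star_star]
  noncomm_ring

/-- `u · (1 + a)`. -/
def actOne (u : Γ) (a : B) : Γ := act u a + phi (rho u * a) + u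

theorem pi_actOne (u : Γ) (a : B) : pi (actOne u a) = pi u * a + pi u := by
  simp [actOne, pi_add, pi_act, pi_phi]

theorem rho_actOne (u : Γ) (a : B) :
    rho (actOne u a) = star a * rho u * a + rho u * a + star a * rho u + rho u := by
  simp only [actOne, rho_add, rho_act, rho_phi, pi_add, pi_act, pi_phi, star_mul,
    star_rho u, mul_zero, add_zero, sub_zero]
  noncomm_ring

theorem actOne_add (u v : Γ) (a : B) : actOne (u + v) a = actOne u a + actOne v a := by
  simp only [actOne, rho_add, add_act, add_assoc, act_phi_left, phi_phi_add, phi_left_comm _ u]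
  rw [add_swap_left (B := B) u (act v a), act_phi_left, phi_phi_add]
  simp only [pi_act]
  congr 2
  noncomm_ring

theorem actOne_mul (u : Γ) (a b : B) : actOne (actOne u a) b = actOne u (a * b + (b + a)) := by
  conv_lhs => rw [actOne, rho_actOne]
  simp only [actOne, add_act, act_add, ← act_mul, phi_act, add_assoc, act_phi_left, phi_phi_add]
  congr 2
  rw [star_add]
  noncomm_ring

theorem actOne_act (u : Γ) (a b : B) : act (actOne u a) b = act u (a * b + b) := by
  simp only [actOne, add_act, act_add, ← act_mul, phi_act, mul_assoc]

theorem act_actOne (u : Γ) (a b : B) : actOne (act u a) b = act u (a * b + a) := by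
  simp only [actOne, act_add, ← act_mul, rho_act, mul_assoc]

/-- Conjugation by an element of the unitary group on the ring part of an odd form ring,
`a ↦ (π(f) + 1) a (star π(f) + 1)`. -/
def conjB (f : Γ) (a : B) : B :=
  a + pi f * a + a * star (pi f) + pi f * a * star (pi f)

/-- Conjugation by an element of the unitary group on the group part of an odd form ring,
`u ↦ (f · π(u) + u) · (star π(f) + 1)`. -/
def conjG (f u : Γ) : Γ := actOne (act f (pi u : B) + u) (star (pi f) : B)

/-- The defining conditions of the unitary group. -/
def IsUnitary (B : Type*) {Γ : Type*} [NonUnitalRing B] [StarRing B] [AddGroup Γ]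
    [OddFormRing B Γ] (f : Γ) : Prop :=
  pi f = star (rho f : B) ∧ pi f * star (pi f) = star (pi f) * (pi f : B)

variable {f : Γ}

theorem IsUnitary.rho_eq (hf : IsUnitary B f) :  (rho f : B) = star (pi f) := by rw [hf.1, star_star]

theorem IsUnitary.star_mul_pi (hf : IsUnitary B f) :  star (pi f) * pi f = -(pi f) - star (pi f : B) := by
  have h := rho_symm (R := B) f
  rw [hf.rho_eq, star_star] at h
  rw [eq_sub_iff_add_eq, eq_neg_iff_add_eq_zero, ← h]; abel

theorem IsUnitary.mul_star_pi (hf : IsUnitary B f) :  pi f * star (pi f) = -(pi f) - star (pi f : B) := by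
  rw [hf.2, hf.star_mul_pi]

theorem conjG_add (hf : IsUnitary B f) (u v : Γ) : conjG (B := B) f (u + v) = conjG (B := B) f u + conjG (B := B) f v := by
  rw [conjG, conjG, conjG, ← actOne_add]
  congr 1
  simp only [pi_add, act_add, add_assoc, act_phi_left]
  rw [add_swap_left (B := B) u (act f (pi v)), act_phi_left]
  congr 1
  rw [hf.rho_eq, ← phi_neg_star, pi_act]
  congr 1
  simp [mul_assoc]

theorem conjG_phi (a : B) : conjG (B := B) f (phi a) = phi (conjB f a) := by
  simp only [conjG, pi_phi, act_zero, zero_add, actOne, phi_act, rho_phi, ← phi_add, star_star]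
  apply phi_congr (-(star a * star (pi f)))
  simp [conjB]
  noncomm_ring

theorem rho_aux (hf : IsUnitary B f) (u : Γ) : (rho (act f (pi u : B) + u) : B) = rho u := by
  simp [rho_add, rho_act, hf.rho_eq, pi_act, mul_assoc]

theorem pi_conjG (u : Γ) : (pi (conjG (B := B) f u) : B) = conjB f (pi u) := by
  simp only [conjG, pi_actOne, pi_add, pi_act, conjB]
  noncomm_ring

theorem rho_conjG (hf : IsUnitary B f) (u : Γ) : (rho (conjG (B := B) f u) : B) = conjB f (rho u) := by
  simp only [conjG, rho_actOne, rho_aux hf, conjB, star_star]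
  noncomm_ring

theorem conjB_mul (hf : IsUnitary B f) (a b : B) : conjB f (a * b) = conjB f a * conjB f b := by
  have h := hf.star_mul_pi
  have : conjB f a * conjB f b = conjB f (a * b) + (a + pi f * a) * (star (pi f) * pi f + pi f + star (pi f)) * (b + b * star (pi f)) := by
    simp only [conjB]; noncomm_ring
  rw [this, h, show -pi f - star (pi f) + pi f + star (pi f) = (0 : B) by abel]; simp

theorem conjB_star (a : B) : conjB f (star a) = star (conjB f a) := by
  simp [conjB, mul_assoc]; abel

theorem conjB_add (a b : B) : conjB f (a + b) = conjB f a + conjB f b := by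
  simp only [conjB]; noncomm_ring

theorem conjG_act (hf : IsUnitary B f) (u : Γ) (a : B) : conjG (B := B) f (act u a) = act (conjG (B := B) f u) (conjB f a) := by
  have e : act f (pi (act u a) : B) + act u a = act (act f (pi u : B) + u) a := by
    rw [add_act, pi_act, act_mul]
  rw [conjG, conjG, e, act_actOne, actOne_act]
  congr 1
  have h := hf.star_mul_pi
  have : star (pi f) * conjB f a + conjB f a = a * star (pi f) + a + (star (pi f) * pi f + pi f + star (pi f)) * (a + a * star (pi f)) := by
    simp only [conjB]; noncomm_ring
  rw [this, h, show -pi f - star (pi f) + pi f + star (pi f) = (0 : B) by abel]; simp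

theorem conjB_umul (f g : Γ) (a : B) : conjB (umul (S := B) f g) a = conjB f (conjB g a) := by
  simp only [conjB, umul, pi_add, pi_act, star_add, star_mul]
  noncomm_ring

theorem conjG_umul (hf : IsUnitary B f) (g u : Γ) : conjG (B := B) (umul (S := B) f g) u = conjG (B := B) f (conjG (B := B) g u) := by
  set v : Γ := act g (pi u : B) + u with hv
  have hV : act f (pi v : B) + v = act (umul (S := B) f g) (pi u : B) + u := by
    simp only [hv, umul, pi_add, pi_act, add_act, act_add, ← act_mul, add_assoc, act_phi_left]
    rw [add_swap_left (B := B) (act f (pi u)) (act g (pi u))]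
    simp only [act_phi_left, phi_phi_add]
    conv_rhs => rw [← zero_add (act f _ + _), ← phi_zero (B := B)]
    congr 2
    rw [hf.rho_eq, pi_act, pi_act, star_mul]
    noncomm_ring
  have e : conjG (B := B) g u = actOne v (star (pi g) : B) := rfl
  conv_rhs => rw [conjG, e, pi_actOne, ← act_actOne, ← actOne_add, actOne_mul, hV]
  rw [conjG]
  congr 1
  simp only [umul, pi_add, pi_act, star_add, star_mul]
  abel

theorem pi_umul (g h : Γ) : (pi (umul (S := B) g h) : B) = pi g * pi h + pi h + pi g := by
  simp [umul, pi_add, pi_act]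

theorem IsUnitary.mul_star_add (hf : IsUnitary B f) :
    pi f * star (pi f) + pi f + star (pi f) = (0 : B) := by
  rw [hf.mul_star_pi]; abel

theorem IsUnitary.star_mul_add (hf : IsUnitary B f) :
    star (pi f) * pi f + pi f + star (pi f) = (0 : B) := by
  rw [hf.star_mul_pi]; abel

theorem IsUnitary.umul {g h : Γ} (hg : IsUnitary B g) (hh : IsUnitary B h) :
    IsUnitary B (umul (S := B) g h) := by
  have h1 := hg.star_mul_add
  have h2 := hg.mul_star_add
  have h3 := hh.star_mul_add
  have h4 := hh.mul_star_add
  refine ⟨?_, ?_⟩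
  · have e : (rho (OddUnitary.umul (S := B) g h) : B) = star (pi h) * star (pi g) + star (pi h)
        + star (pi g) - star (pi h) * (star (pi g) * pi g + pi g + star (pi g)) := by
      simp only [OddUnitary.umul, pi_add, pi_act, rho_add, rho_act, hg.rho_eq, hh.rho_eq, star_add,
        star_mul]
      noncomm_ring
    rw [e, h1, pi_umul]
    simp
  · have e1 : pi (OddUnitary.umul (S := B) g h) * star (pi (OddUnitary.umul (S := B) g h))
        = pi g * (pi h * star (pi h) + pi h + star (pi h)) * star (pi g)
          + pi g * (pi h * star (pi h) + pi h + star (pi h))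
          + (pi h * star (pi h) + pi h + star (pi h)) * star (pi g)
          + (pi h * star (pi h) + pi h + star (pi h))
          + (pi g * star (pi g) + pi g + star (pi g))
          - (pi g * pi h + star (pi h) * star (pi g) + pi h + star (pi h) + pi g + star (pi g) : B) := by
      simp only [pi_umul, star_add, star_mul]
      noncomm_ring
    have e2 : star (pi (OddUnitary.umul (S := B) g h)) * pi (OddUnitary.umul (S := B) g h)
        = star (pi h) * (star (pi g) * pi g + pi g + star (pi g)) * pi h
          + star (pi h) * (star (pi g) * pi g + pi g + star (pi g))
          + (star (pi g) * pi g + pi g + star (pi g)) * pi h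
          + (star (pi h) * pi h + pi h + star (pi h))
          + (star (pi g) * pi g + pi g + star (pi g))
          - (pi g * pi h + star (pi h) * star (pi g) + pi h + star (pi h) + pi g + star (pi g) : B) := by
      simp only [pi_umul, star_add, star_mul]
      noncomm_ring
    rw [e1, e2, h1, h2, h3, h4]
    simp

/-- The inverse of `g` in the unitary group. -/
def uinv (B : Type*) {Γ : Type*} [NonUnitalRing B] [StarRing B] [AddGroup Γ]
    [OddFormRing B Γ] (g : Γ) : Γ := -act g (star (pi g) : B) + -g

theorem pi_uinv {g : Γ} (hg : IsUnitary B g) : (pi (uinv B g) : B) = star (pi g) := by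
  simp only [uinv, pi_add, pi_neg, pi_act, hg.mul_star_pi]
  abel

theorem IsUnitary.uinv {g : Γ} (hg : IsUnitary B g) : IsUnitary B (uinv B g) := by
  refine ⟨?_, ?_⟩
  · have e : (rho (OddUnitary.uinv B g) : B) = pi g + pi g * (pi g * star (pi g))
        - pi g * (star (pi g) * pi g) := by
      simp only [OddUnitary.uinv, rho_add, rho_neg, rho_act, hg.rho_eq, pi_neg, pi_act, star_neg,
        star_mul, star_star]
      noncomm_ring
    rw [e, hg.2, pi_uinv hg]
    simp
  · rw [pi_uinv hg, star_star, hg.2]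

variable (B Γ) in
/-- The unitary group `U(B, Γ)`. -/
@[ext] structure UGrp where
  val : Γ
  prop : IsUnitary B val

theorem umul_zero (g : Γ) : umul (S := B) g 0 = g := by
  simp [umul, pi_zero, act_zero]

theorem isUnitary_zero : IsUnitary B (0 : Γ) := by
  simp [IsUnitary, pi_zero, rho_zero]

instance : Mul (UGrp B Γ) := ⟨fun g h => ⟨umul (S := B) g.1 h.1, g.2.umul h.2⟩⟩

instance : Inv (UGrp B Γ) := ⟨fun g => ⟨uinv B g.1, g.2.uinv⟩⟩

instance : One (UGrp B Γ) := ⟨⟨0, isUnitary_zero⟩⟩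

theorem umul_uinv {g : Γ} (hg : IsUnitary B g) : umul (S := B) g (uinv B g) = 0 := by
  rw [umul, pi_uinv hg, uinv]
  simp

instance : Group (UGrp B Γ) :=
  Group.ofRightAxioms (fun f _ _ => UGrp.ext (umul_assoc f.2.1))
    (fun g => UGrp.ext (umul_zero g.1)) (fun g => UGrp.ext (umul_uinv g.2))

theorem UGrp.val_mul (g h : UGrp B Γ) : (g * h).1 = OddUnitary.umul (S := B) g.1 h.1 := rfl

theorem UGrp.val_one : (1 : UGrp B Γ).1 = 0 := rfl

theorem UGrp.val_inv (g : UGrp B Γ) : (g⁻¹).1 = OddUnitary.uinv B g.1 := rfl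

end Calculus

/-! ### Transvections -/

section Hyp

variable {B Γ : Type*} [NonUnitalRing B] [StarRing B] [AddGroup Γ] [OddFormRing B Γ]
variable {I : Type*} [InvolutiveNeg I]

/-- An orthogonal hyperbolic family, without the fullness condition of a strong one. -/
structure Family.IsHyp (N : Family B Γ I) : Prop where
  star_e : ∀ i, star (N.e i) = N.e (-i)
  idem : ∀ i, N.e i * N.e i = N.e i
  orth : ∀ i j, i ≠ j → N.e i * N.e j = 0
  pi_q : ∀ i, pi (N.q i) = N.e i
  rho_q : ∀ i, (rho (N.q i) : B) = 0
  act_q : ∀ i, N.q i = act (N.q i) (N.e i)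
  neg_ne : ∀ i : I, -i ≠ i

/-- The vectors for which the transvection `T_j(u)` makes sense: `u ∈ Γ · e_j` with `π(u)`
orthogonal to the hyperbolic pair with index `j`. -/
structure IsIso (N : Family B Γ I) (j : I) (u : Γ) : Prop where
  act : act u (N.e j) = u
  e_pi : N.e j * pi u = 0
  e_neg_pi : N.e (-j) * pi u = 0

/-- The transvection `T_j(u)`. -/
def tY (N : Family B Γ I) (j : I) (u : Γ) : Γ :=
  u + -(phi (rho u + pi u : B)) + OddFormRing.act (N.q (-j)) (rho u - star (pi u) : B)

variable {N : Family B Γ I} (hN : N.IsHyp)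

namespace IsIso

variable {j : I} {u v : Γ}

theorem pi_e (hu : IsIso N j u) : pi u * N.e j = pi u := by
  rw [← pi_act, hu.act]

theorem star_e_pi (hN : N.IsHyp) (hu : IsIso N j u) : N.e (-j) * star (pi u) = star (pi u) := by
  rw [← hN.star_e, ← star_mul, hu.pi_e]

theorem star_pi_e (hN : N.IsHyp) (hu : IsIso N j u) : star (pi u) * N.e j = 0 := by
  have h := congrArg star hu.e_neg_pi
  rwa [star_mul, hN.star_e, neg_neg, star_zero] at h

theorem star_pi_e_neg (hN : N.IsHyp) (hu : IsIso N j u) : star (pi u) * N.e (-j) = 0 := by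
  have h := congrArg star hu.e_pi
  rwa [star_mul, hN.star_e, star_zero] at h

theorem rho_e (hN : N.IsHyp) (hu : IsIso N j u) : rho u * N.e j = (rho u : B) := by
  have h := rho_act u (N.e j)
  rw [hu.act] at h
  rw [h, mul_assoc, hN.idem]

theorem e_rho (hN : N.IsHyp) (hu : IsIso N j u) : N.e (-j) * rho u = (rho u : B) := by
  have h := rho_act u (N.e j)
  rw [hu.act, hN.star_e] at h
  rw [h, ← mul_assoc, ← mul_assoc, hN.idem]

theorem mul_of {a b : B} {i : I} (ha : a * N.e i = a) (hb : N.e i * b = 0) : a * b = 0 := by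
  rw [← ha, mul_assoc, hb, mul_zero]

theorem e_rho_zero (hN : N.IsHyp) (hu : IsIso N j u) {i : I} (h : i ≠ -j) :
    N.e i * (rho u : B) = 0 := by
  rw [← hu.e_rho hN, ← mul_assoc, hN.orth _ _ h, zero_mul]

theorem e_star_zero (hN : N.IsHyp) (hu : IsIso N j u) {i : I} (h : i ≠ -j) :
    N.e i * star (pi u : B) = 0 := by
  rw [← hu.star_e_pi hN, ← mul_assoc, hN.orth _ _ h, zero_mul]

theorem pi_mul_pi (hu : IsIso N j u) (hv : IsIso N j v) : pi u * pi v = (0 : B) :=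
  mul_of hu.pi_e hv.e_pi

theorem pi_mul_rho (hN : N.IsHyp) (hu : IsIso N j u) (hv : IsIso N j v) :
    pi u * rho v = (0 : B) :=
  mul_of hu.pi_e (hv.e_rho_zero hN (hN.neg_ne j).symm)

theorem rho_mul_pi (hN : N.IsHyp) (hu : IsIso N j u) (hv : IsIso N j v) :
    rho u * pi v = (0 : B) :=
  mul_of (hu.rho_e hN) hv.e_pi

theorem rho_mul_rho (hN : N.IsHyp) (hu : IsIso N j u) (hv : IsIso N j v) :
    rho u * rho v = (0 : B) :=
  mul_of (hu.rho_e hN) (hv.e_rho_zero hN (hN.neg_ne j).symm)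

theorem rho_mul_star (hN : N.IsHyp) (hu : IsIso N j u) (hv : IsIso N j v) :
    rho u * star (pi v) = (0 : B) :=
  mul_of (hu.rho_e hN) (hv.e_star_zero hN (hN.neg_ne j).symm)

theorem star_mul_rho (hN : N.IsHyp) (hu : IsIso N j u) (hv : IsIso N j v) :
    star (pi u) * rho v = (0 : B) := by
  rw [← hv.e_rho hN, ← mul_assoc, hu.star_pi_e_neg hN, zero_mul]

theorem star_mul_star (hu : IsIso N j u) (hv : IsIso N j v) :
    star (pi u) * star (pi v) = (0 : B) := by
  rw [← star_mul, hv.pi_mul_pi hu, star_zero]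

theorem pi_mul_star_rho (hN : N.IsHyp) (hu : IsIso N j u) (hv : IsIso N j v) :
    pi u * star (rho v) = (0 : B) := by
  rw [← star_star (pi u), ← star_mul, hv.rho_mul_star hN hu, star_zero]

theorem star_rho_mul_pi (hN : N.IsHyp) (hu : IsIso N j u) (hv : IsIso N j v) :
    star (rho u) * pi v = (0 : B) := by
  rw [← star_star (pi v), ← star_mul, hv.star_mul_rho hN hu, star_zero]

theorem star_rho_mul_star (hN : N.IsHyp) (hu : IsIso N j u) (hv : IsIso N j v) :
    star (rho u) * star (pi v) = (0 : B) := by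
  rw [← star_mul, hv.pi_mul_rho hN hu, star_zero]

theorem star_mul_star_rho (hN : N.IsHyp) (hu : IsIso N j u) (hv : IsIso N j v) :
    star (pi u) * star (rho v) = (0 : B) := by
  rw [← star_mul, hv.rho_mul_pi hN hu, star_zero]

theorem star_rho_mul_rho (hN : N.IsHyp) (hu : IsIso N j u) (hv : IsIso N j v) :
    star (rho u) * rho v = (0 : B) := by
  rw [star_rho, sub_mul, neg_mul, mul_assoc, hu.pi_mul_rho hN hv, hu.rho_mul_rho hN hv]; simp

theorem rho_mul_star_rho (hN : N.IsHyp) (hu : IsIso N j u) (hv : IsIso N j v) :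
    rho u * star (rho v) = (0 : B) := by
  rw [← star_star (rho u), ← star_mul, star_rho (B := B) u, mul_sub, mul_neg, ← mul_assoc,
    hv.rho_mul_star hN hu, hv.rho_mul_rho hN hu]; simp

theorem add (hu : IsIso N j u) (hv : IsIso N j v) : IsIso N j (u + v) :=
  ⟨by rw [add_act, hu.act, hv.act], by rw [pi_add, mul_add, hu.e_pi, hv.e_pi, add_zero],
    by rw [pi_add, mul_add, hu.e_neg_pi, hv.e_neg_pi, add_zero]⟩

end IsIso

theorem pi_tY {j : I} {u : Γ} (hN : N.IsHyp) (hu : IsIso N j u) :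
    (pi (tY N j u) : B) = pi u + rho u - star (pi u) := by
  simp only [tY, pi_add, pi_neg, pi_phi, pi_act, hN.pi_q, mul_sub, hu.e_rho hN, hu.star_e_pi hN]
  abel

theorem rho_tY {j : I} {u : Γ} (hN : N.IsHyp) (hu : IsIso N j u) :
    (rho (tY N j u) : B) = star (pi u + rho u - star (pi u)) := by
  simp only [tY, rho_add, rho_neg, rho_phi, rho_act, hN.rho_q, pi_add, pi_neg, pi_phi, pi_act,
    hN.pi_q, mul_sub, hu.e_rho hN, hu.star_e_pi hN, star_sub, star_add, star_star,
    neg_zero, add_zero, hu.star_mul_rho hN hu, hu.star_mul_star hu]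
  simp only [mul_zero, zero_mul, sub_zero]
  abel

theorem isUnitary_tY {j : I} {u : Γ} (hN : N.IsHyp) (hu : IsIso N j u) : IsUnitary B (tY N j u) := by
  refine ⟨by rw [rho_tY hN hu, pi_tY hN hu, star_star], ?_⟩
  rw [pi_tY hN hu]
  simp only [star_sub, star_add, star_star, mul_sub, sub_mul, add_mul, mul_add,
    hu.star_mul_rho hN hu, hu.star_mul_star hu, hu.pi_mul_pi hu, hu.pi_mul_rho hN hu, hu.rho_mul_pi hN hu,
    hu.rho_mul_star hN hu, hu.pi_mul_star_rho hN hu, hu.star_rho_mul_pi hN hu, hu.star_rho_mul_star hN hu,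
    hu.star_mul_star_rho hN hu, hu.star_rho_mul_rho hN hu, hu.rho_mul_star_rho hN hu]
  abel

theorem act_tY_self {j : I} {u : Γ} (hN : N.IsHyp) (hu : IsIso N j u) {a : B}
    (h : N.e j * a = 0) : act (tY N j u) a = phi (-(star a * (pi u * a))) + act (N.q (-j)) (-(star (pi u) * a)) := by
  have h1 : act u a = 0 := by rw [← hu.act, ← act_mul, h, act_zero]
  have h2 : rho u * a = 0 := by rw [← hu.rho_e hN, mul_assoc, h, mul_zero]
  simp only [tY, add_act, h1, phi_act, ← act_mul, neg_phi, mul_assoc, add_mul, sub_mul, h2,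
    zero_add, zero_sub, neg_mul, mul_neg]

/-- The elements `q_{-j} · a` commute with everything orthogonal to `e_j`. -/
theorem act_q_add {j : I} (hN : N.IsHyp) {w : Γ} (h : N.e j * pi w = 0) (a : B) :
    act (N.q (-j)) a + w = w + act (N.q (-j)) a := by
  apply add_comm_of_mul_eq_zero (B := B)
  rw [pi_act, hN.pi_q, star_mul, hN.star_e, neg_neg, mul_assoc, h, mul_zero]

theorem act_q_add_left {j : I} (hN : N.IsHyp) {w : Γ} (h : N.e j * pi w = 0) (a : B) (z : Γ) :
    act (N.q (-j)) a + (w + z) = w + (act (N.q (-j)) a + z) := by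
  rw [← add_assoc, act_q_add hN h, add_assoc]

theorem act_q_add_q {j : I} (hN : N.IsHyp) (a b : B) :
    act (N.q j) a + act (N.q j) b = act (N.q j) (a + b) :=
  (act_add_of_rho (hN.rho_q j) a b).symm

theorem tY_mul {j : I} {u v : Γ} (hN : N.IsHyp) (hu : IsIso N j u) (hv : IsIso N j v) :
    umul (S := B) (tY N j u) (tY N j v) = tY N j (u + v) := by
  have h0 : N.e j * (pi v + rho v - star (pi v)) = 0 := by
    rw [mul_sub, mul_add, hv.e_pi, hv.e_rho_zero hN (hN.neg_ne j).symm,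
      hv.e_star_zero hN (hN.neg_ne j).symm]; simp
  have h1 : pi u * (pi v + rho v - star (pi v)) = (0 : B) := IsIso.mul_of hu.pi_e h0
  have h2 : star (pi u) * (pi v + rho v - star (pi v)) = (star (pi u) * pi v : B) := by
    rw [mul_sub, mul_add, hu.star_mul_rho hN hv, hu.star_mul_star hv]; simp
  have h3 : N.e (-j) * (pi (tY N j v)) = (rho v - star (pi v) : B) := by
    rw [pi_tY hN hv, mul_sub, mul_add, hv.e_neg_pi, hv.e_rho hN, hv.star_e_pi hN, zero_add]
  rw [umul, pi_tY hN hv, act_tY_self hN hu h0, h1, h2, mul_zero, neg_zero, phi_zero, zero_add]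
  simp only [tY, neg_phi, add_assoc, act_phi_left, phi_phi_add, phi_left_comm _ u,
    phi_left_comm _ v, act_q_add_left hN hu.e_pi, act_q_add_left hN hv.e_pi, act_q_add_q hN]
  rw [add_swap_left (B := B) v u]
  simp only [phi_phi_add, rho_add, pi_add, star_add]
  congr 1
  · apply phi_congr (-(star (pi v) * pi u))
    simp only [star_neg, star_mul, star_star]
    noncomm_ring
  · congr 3
    noncomm_ring

theorem IsIso.of_fix {j : I} {f v : Γ} (hv : IsIso N j v) (h3 : N.e j * pi f = 0)
    (h4 : N.e (-j) * pi f = 0) : IsIso N j (OddFormRing.act f (pi v : B) + v) where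
  act := by rw [add_act, ← act_mul, hv.pi_e, hv.act]
  e_pi := by rw [pi_add, pi_act, mul_add, ← mul_assoc, h3, hv.e_pi]; simp
  e_neg_pi := by rw [pi_add, pi_act, mul_add, ← mul_assoc, h4, hv.e_neg_pi]; simp

/-- Conjugation of a transvection `T_j(v)` by an element that centralizes the hyperbolic pair. -/
theorem umul_tY_of_fix {j : I} {f v : Γ} (hN : N.IsHyp) (hf : IsUnitary B f) (hv : IsIso N j v)
    (h2 : act f (N.e (-j)) = 0) (h3 : N.e j * pi f = 0) (h4 : N.e (-j) * pi f = 0) :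
    umul (S := B) f (tY N j v) = umul (S := B) (tY N j (act f (pi v : B) + v)) f := by
  set v' := act f (pi v : B) + v with hv'
  have hi : IsIso N j v' := hv.of_fix h3 h4
  have p' : (pi v' : B) = pi f * pi v + pi v := by rw [hv', pi_add, pi_act]
  have r' : (rho v' : B) = rho v := rho_aux hf v
  have m1 : pi v * pi f = (0 : B) := IsIso.mul_of hv.pi_e h3
  have e1 : act f (pi v + rho v - star (pi v) : B) = act f (pi v : B) := by
    have : (pi v + rho v - star (pi v) : B) = pi v + N.e (-j) * (rho v - star (pi v)) := by
      rw [mul_sub, hv.e_rho hN, hv.star_e_pi hN]; abel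
    have h5 : N.e j * (rho f : B) = 0 := by
      have h := congrArg (fun w : Γ => star (pi w : B)) h2
      simpa [pi_act, pi_zero, hN.star_e, hf.rho_eq] using h
    rw [this, act_add, act_mul, h2, zero_act, star_mul, hN.star_e, neg_neg, mul_assoc (star _), h5]
    simp [phi_zero]
  have s1 : (star (pi v') * pi f : B) = -(star (pi v) * star (pi f)) := by
    have h := hf.star_mul_add
    have : (star (pi v') * pi f + star (pi v) * star (pi f) : B)
      = star (pi v) * (star (pi f) * pi f + pi f + star (pi f)) := by
      rw [p', star_add, star_mul]; noncomm_ring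
    rw [eq_neg_iff_add_eq_zero, this, h, mul_zero]
  rw [umul, pi_tY hN hv, e1, umul, act_tY_self hN hi h3, s1, p', add_mul, mul_assoc, m1]
  have c1 : N.e j * (pi (act f (pi v : B))) = 0 := by rw [pi_act, ← mul_assoc, h3, zero_mul]
  simp only [tY, neg_phi, add_assoc, act_phi_left, phi_left_comm _ f, phi_left_comm _ v,
    act_q_add_left hN hv.e_pi, act_q_add_left hN c1, hv', neg_neg,
    mul_zero, neg_zero, phi_zero, zero_add, act_q_add hN h3, act_q_add_q hN]
  rw [add_swap_left (B := B) f (act f (pi v)), add_swap_left (B := B) f v]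
  simp only [act_phi_left, phi_phi_add]
  congr 1
  · rw [← hv', r', p']
    apply phi_congr 0
    have h := hf.star_mul_add
    have : (star (pi f) * (pi f * pi v) : B) = -(pi f * pi v) - star (pi f) * pi v := by
      rw [← mul_assoc, hf.star_mul_pi]; noncomm_ring
    simp only [pi_act, this, star_zero]
    noncomm_ring
  · congr 4
    rw [← hv', r', p', star_add, star_mul]
    abel

open scoped Classical in
/-- The transvection `T_j(u)` as an element of the unitary group. -/
def gY (N : Family B Γ I) (j : I) (u : Γ) : UGrp B Γ :=
  if h : IsUnitary B (tY N j u) then ⟨tY N j u, h⟩ else 1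

/-- The transvection `T_{ij}(a)`, written as `T_j(q_i · a)`. -/
def gX (N : Family B Γ I) (i j : I) (a : B) : UGrp B Γ := gY N j (act (N.q i) a)

/-- The element `a` lies in `e_i B e_j`. -/
def IsMat (N : Family B Γ I) (i j : I) (a : B) : Prop := N.e i * a = a ∧ a * N.e j = a

/-! ### Commutators of transvections -/

section Relations

variable {i j k l : I} {a b : B} {u v : Γ}

theorem gY_val (hN : N.IsHyp) (hu : IsIso N j u) : (gY N j u : UGrp B Γ).1 = tY N j u := by
  rw [gY, dif_pos (isUnitary_tY hN hu)]

theorem IsMat.star (hN : N.IsHyp) (ha : IsMat N i j a) : IsMat N (-j) (-i) (-star a) := by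
  constructor
  · rw [mul_neg, ← hN.star_e, ← star_mul, ha.2]
  · rw [neg_mul, ← hN.star_e, ← star_mul, ha.1]

theorem IsMat.e_mul (hN : N.IsHyp) (ha : IsMat N i j a) (h : k ≠ i) : N.e k * a = 0 := by
  rw [← ha.1, ← mul_assoc, hN.orth _ _ h, zero_mul]

theorem IsMat.mul_e (hN : N.IsHyp) (ha : IsMat N i j a) (h : j ≠ k) : a * N.e k = 0 := by
  rw [← ha.2, mul_assoc, hN.orth _ _ h, mul_zero]

theorem IsMat.mul_eq_zero (hN : N.IsHyp) (ha : IsMat N i j a) (hb : IsMat N k l b) (h : j ≠ k) :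
    a * b = 0 := IsIso.mul_of ha.2 (hb.e_mul hN h)

theorem IsMat.mul (ha : IsMat N i j a) (hb : IsMat N j k b) : IsMat N i k (a * b) :=
  ⟨by rw [← mul_assoc, ha.1], by rw [mul_assoc, hb.2]⟩

theorem IsMat.neg (ha : IsMat N i j a) : IsMat N i j (-a) :=
  ⟨by rw [mul_neg, ha.1], by rw [neg_mul, ha.2]⟩

theorem pi_q_act (hN : N.IsHyp) (ha : N.e i * a = a) : (pi (act (N.q i) a) : B) = a := by
  rw [pi_act, hN.pi_q, ha]

theorem rho_q_act (hN : N.IsHyp) : (rho (act (N.q i) a) : B) = 0 := by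
  rw [rho_act, hN.rho_q]; simp

theorem IsMat.isIso (hN : N.IsHyp) (ha : IsMat N i j a) (h1 : i ≠ j) (h2 : i ≠ -j) :
    IsIso N j (act (N.q i) a) where
  act := by rw [← act_mul, ha.2]
  e_pi := by rw [pi_q_act hN ha.1, ha.e_mul hN h1.symm]
  e_neg_pi := by rw [pi_q_act hN ha.1, ha.e_mul hN h2.symm]

theorem tX_eq (hN : N.IsHyp) (ha : IsMat N i j a) : tY N j (act (N.q i) a)
    = act (N.q i) a + -(act (N.q (-j)) (star a)) + -(phi a) := by
  rw [tY, pi_q_act hN ha.1, rho_q_act hN, zero_add, zero_sub, act_neg_of_rho (hN.rho_q _),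
    add_assoc, add_assoc, neg_phi, ← phi_comm]

theorem gX_sym (hN : N.IsHyp) (ha : IsMat N i j a) (h1 : i ≠ j) (h2 : i ≠ -j) :
    gX N i j a = gX N (-j) (-i) (-star a) := by
  have hs := ha.star hN
  have h3 : -j ≠ -i := fun h => h1 (neg_injective h.symm)
  have h4 : -j ≠ - -i := fun h => h2 (by rw [h, neg_neg])
  apply UGrp.ext
  rw [gX, gX, gY_val hN (ha.isIso hN h1 h2), gY_val hN (hs.isIso hN h3 h4), tX_eq hN ha,
    tX_eq hN hs, act_neg_of_rho (hN.rho_q _), neg_neg, star_neg, star_star,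
    act_neg_of_rho (hN.rho_q _), neg_neg, phi_neg_star]
  congr 1
  rw [add_comm_of_mul_eq_zero (B := B)]
  rw [pi_neg, pi_q_act hN ha.1, pi_act, hN.pi_q, mul_neg, ← mul_assoc]
  have : star a * N.e (-j) = 0 := by
    have h := hs.mul_e hN (k := -j) h3.symm
    rwa [neg_mul, neg_eq_zero] at h
  rw [this]; simp

theorem gY_add (hN : N.IsHyp) (hu : IsIso N j u) (hv : IsIso N j v) :
    gY N j (u + v) = gY N j u * gY N j v := by
  apply UGrp.ext
  rw [UGrp.val_mul, gY_val hN hu, gY_val hN hv, gY_val hN (hu.add hv), tY_mul hN hu hv]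

theorem gY_phi_comm (hN : N.IsHyp) (hu : IsIso N j u) (hv : IsIso N j v) :
    ⁅gY N j u, gY N j v⁆ = gY N j (phi (-(star (pi u) * pi v) : B)) := by
  have hp : IsIso N j (phi (-(star (pi u) * pi v) : B)) := by
    refine ⟨?_, by rw [pi_phi, mul_zero], by rw [pi_phi, mul_zero]⟩
    rw [phi_act, hN.star_e, mul_neg, neg_mul, ← mul_assoc, hu.star_e_pi hN, mul_assoc, hv.pi_e]
  rw [commutatorElement_def, mul_inv_eq_iff_eq_mul, mul_inv_eq_iff_eq_mul, ← gY_add hN hu hv,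
    ← gY_add hN hp hv, ← gY_add hN (hp.add hv) hu, add_swap (B := B) u v, add_assoc]

theorem gX_add (hN : N.IsHyp) (ha : IsMat N i j a) (hb : IsMat N i j b) (h1 : i ≠ j)
    (h2 : i ≠ -j) : gX N i j (a + b) = gX N i j a * gX N i j b := by
  rw [gX, act_add_of_rho (hN.rho_q i), gY_add hN (ha.isIso hN h1 h2) (hb.isIso hN h1 h2)]; rfl

theorem conj_gY (hN : N.IsHyp) (f : UGrp B Γ) (hv : IsIso N j v)
    (h2 : act f.1 (N.e (-j)) = 0) (h3 : N.e j * pi f.1 = 0) (h4 : N.e (-j) * pi f.1 = 0) :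
    f * gY N j v * f⁻¹ = gY N j (act f.1 (pi v : B) + v) := by
  rw [mul_inv_eq_iff_eq_mul]
  apply UGrp.ext
  rw [UGrp.val_mul, UGrp.val_mul, gY_val hN hv, gY_val hN (hv.of_fix h3 h4)]
  exact umul_tY_of_fix hN f.2 hv h2 h3 h4

theorem conj_gY_gY (hN : N.IsHyp) (h1 : i ≠ j) (h2 : i ≠ -j) (hu : IsIso N i u)
    (hu1 : N.e j * pi u = 0) (hu2 : N.e (-j) * pi u = 0) (hv : IsIso N j v) :
    gY N i u * gY N j v * (gY N i u)⁻¹ = gY N j (act (tY N i u) (pi v : B) + v) := by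
  have h3 : -j ≠ -i := fun h => h1 (neg_injective h.symm)
  have h4 : j ≠ -i := fun h => h2 (by rw [h, neg_neg])
  rw [conj_gY hN _ hv, gY_val hN hu] <;> rw [gY_val hN hu]
  · have h5 : star (pi u) * N.e (-j) = 0 := by rw [← hN.star_e, ← star_mul, hu1, star_zero]
    rw [act_tY_self hN hu (hN.orth _ _ h2), hN.star_e, neg_neg, ← mul_assoc, hu1, h5]
    simp [phi_zero, act_zero]
  · rw [pi_tY hN hu, mul_sub, mul_add, hu1, hu.e_rho_zero hN h4, hu.e_star_zero hN h4]; simp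
  · rw [pi_tY hN hu, mul_sub, mul_add, hu2, hu.e_rho_zero hN h3, hu.e_star_zero hN h3]; simp

theorem IsIso.neg (hu : IsIso N j u) : IsIso N j (-u) :=
  ⟨by rw [neg_act, hu.act], by rw [pi_neg, mul_neg, hu.e_pi, neg_zero],
    by rw [pi_neg, mul_neg, hu.e_neg_pi, neg_zero]⟩

theorem IsIso.phi (hN : N.IsHyp) (ha : IsMat N (-j) j a) : IsIso N j (phi a : Γ) :=
  ⟨by rw [phi_act, hN.star_e, ha.1, ha.2], by rw [pi_phi, mul_zero], by rw [pi_phi, mul_zero]⟩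

/-- `[T_i(u), T_j(v)] = T_{-i,j}(-star π(u) π(v))`. -/
theorem comm_gY_gY (hN : N.IsHyp) (h1 : i ≠ j) (h2 : i ≠ -j) (hu : IsIso N i u)
    (hu1 : N.e j * pi u = 0) (hu2 : N.e (-j) * pi u = 0) (hv : IsIso N j v)
    (hv1 : N.e i * pi v = 0) :
    ⁅gY N i u, gY N j v⁆ = gX N (-i) j (-(star (pi u) * pi v)) := by
  have hm : IsMat N (-i) j (-(star (pi u) * pi v)) :=
    ⟨by rw [mul_neg, ← mul_assoc, hu.star_e_pi hN], by rw [neg_mul, mul_assoc, hv.pi_e]⟩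
  have h4 : -i ≠ j := fun h => h2 (by rw [← h, neg_neg])
  have h5 : -i ≠ -j := fun h => h1 (neg_injective h)
  rw [commutatorElement_def, conj_gY_gY hN h1 h2 hu hu1 hu2 hv, mul_inv_eq_iff_eq_mul, gX,
    ← gY_add hN (hm.isIso hN h4 h5) hv]
  congr 2
  have h6 : pi u * pi v = (0 : B) := IsIso.mul_of hu.pi_e hv1
  rw [act_tY_self hN hu hv1, h6]
  simp [phi_zero]

theorem isIso_act (ha : IsMat N i j a) (hu1 : N.e j * pi u = 0) (hu2 : N.e (-j) * pi u = 0) :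
    IsIso N j (act u a) :=
  ⟨by rw [← act_mul, ha.2], by rw [pi_act, ← mul_assoc, hu1, zero_mul],
    by rw [pi_act, ← mul_assoc, hu2, zero_mul]⟩

/-- `[T_i(u), T_{ij}(a)] = T_{-i,j}(ρ(u) a) T_j(-u · (-a))`. -/
theorem comm_gY_gX (hN : N.IsHyp) (h1 : i ≠ j) (h2 : i ≠ -j) (hu : IsIso N i u)
    (hu1 : N.e j * pi u = 0) (hu2 : N.e (-j) * pi u = 0) (ha : IsMat N i j a) :
    ⁅gY N i u, gX N i j a⁆ = gX N (-i) j (rho u * a) * gY N j (-(act u (-a))) := by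
  have h4 : -i ≠ j := fun h => h2 (by rw [← h, neg_neg])
  have h5 : -i ≠ -j := fun h => h1 (neg_injective h)
  have hm : IsMat N (-i) j (rho u * a) :=
    ⟨by rw [← mul_assoc, hu.e_rho hN], by rw [mul_assoc, ha.2]⟩
  have hi := (isIso_act ha.neg hu1 hu2).neg
  have hq := ha.isIso hN h1 h2
  rw [commutatorElement_def, gX, conj_gY_gY hN h1 h2 hu hu1 hu2 hq, mul_inv_eq_iff_eq_mul, gX,
    ← gY_add hN (hm.isIso hN h4 h5) hi, ← gY_add hN ((hm.isIso hN h4 h5).add hi) hq, pi_q_act hN ha.1]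
  congr 2
  have e1 : star a * (pi u * a) = 0 := by
    have h := hu.e_neg_pi
    have hs : star a * N.e (-i) = star a := by rw [← hN.star_e, ← star_mul, ha.1]
    rw [← mul_assoc, IsIso.mul_of hs h, zero_mul]
  have e2 : star (pi u) * a = 0 := by
    rw [← ha.1, ← mul_assoc, hu.star_pi_e hN, zero_mul]
  have e3 : N.e i * pi (act u a) = 0 := by rw [pi_act, ← mul_assoc, hu.e_pi, zero_mul]
  have e4 : star (-(star a * rho u * a)) = -(star a * star (rho u) * a) := by
    simp [mul_assoc]
  have e5 : act (tY N i u) a = act u a + (phi (-(star a * (rho u * a))) + act (N.q (-i)) (rho u * a)) := by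
    simp only [tY, add_act, neg_phi, phi_act, ← act_mul, add_assoc, sub_mul, add_mul, e2, sub_zero,
      mul_assoc, neg_mul, mul_neg, mul_add, e1, add_zero]
  rw [e5, act_neg, neg_add_rev, neg_neg, neg_phi, ← add_assoc (act (N.q (-i)) _),
    act_q_add hN e3, add_assoc, phi_comm, mul_assoc]

theorem commX_short (hN : N.IsHyp) (h1 : i ≠ j) (h2 : i ≠ -j) (h3 : j ≠ k) (h4 : j ≠ -k)
    (h5 : i ≠ k) (h6 : i ≠ -k) (ha : IsMat N i j a) (hb : IsMat N j k b) :
    ⁅gX N i j a, gX N j k b⁆ = gX N i k (a * b) := by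
  have hi := ha.isIso hN h1 h2
  have hz : IsIso N k (0 : Γ) := ⟨zero_act _, by rw [pi_zero, mul_zero], by rw [pi_zero, mul_zero]⟩
  have e1 := comm_gY_gX hN h3 h4 hi (by rw [pi_q_act hN ha.1, ha.e_mul hN h5.symm])
    (by rw [pi_q_act hN ha.1, ha.e_mul hN h6.symm]) hb
  rw [gX, e1, rho_q_act hN, zero_mul, gX, gX, act_zero, ← act_mul, mul_neg,
    act_neg_of_rho (hN.rho_q i), neg_neg]
  have : gY N k (0 : Γ) = 1 := by
    have h := gY_add hN hz hz
    rw [add_zero] at h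
    exact (left_eq_mul.mp h)
  rw [this, one_mul]

theorem gY_zero (hN : N.IsHyp) : gY N k (0 : Γ) = 1 := by
  have hz : IsIso N k (0 : Γ) := ⟨zero_act _, by rw [pi_zero, mul_zero], by rw [pi_zero, mul_zero]⟩
  have h := gY_add hN hz hz
  rw [add_zero] at h
  exact (left_eq_mul.mp h)

theorem commX_long (hN : N.IsHyp) (h1 : i ≠ j) (h2 : i ≠ -j) (ha : IsMat N (-i) j a)
    (hb : IsMat N j i b) : ⁅gX N (-i) j a, gX N j i b⁆ = gY N i (phi (a * b)) := by
  have h3 : -i ≠ j := fun h => h2 (by rw [← h, neg_neg])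
  have h4 : -i ≠ -j := fun h => h1 (neg_injective h)
  have hs := ha.star hN
  rw [neg_neg] at hs
  have h5 : -j ≠ i := fun h => h2 h.symm
  have h7 : j ≠ -i := h3.symm
  rw [gX_sym hN ha h3 h4, neg_neg, gX, gX,
    gY_phi_comm hN (hs.isIso hN h5 h4.symm) (hb.isIso hN h1.symm h7),
    pi_q_act hN hs.1, pi_q_act hN hb.1]
  simp

/-- Transvections with disjoint, orthogonal vectors commute. -/
theorem commX_Y (hN : N.IsHyp) (h1 : i ≠ j) (h2 : i ≠ -j) (ha : IsMat N i j a)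
    (hu : IsIso N l u) (h3 : i ≠ l) (h4 : l ≠ -j) (hu0 : N.e (-i) * pi u = 0)
    (hu1 : N.e j * pi u = 0) :
    ⁅gX N i j a, gY N l u⁆ = 1 := by
  have hi := ha.isIso hN h1 h2
  have hz : star a * pi u = 0 := by
    have hs : star a * N.e (-i) = star a := by rw [← hN.star_e, ← star_mul, ha.1]
    exact IsIso.mul_of hs hu0
  by_cases hl : l = j
  · subst hl
    rw [gX, gY_phi_comm hN hi hu, pi_q_act hN ha.1, hz, neg_zero, phi_zero, gY_zero hN]
  by_cases hl2 : l = -i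
  · subst hl2
    have hs := ha.star hN
    have h5 : -j ≠ -i := Ne.symm h4
    have h6 : -j ≠ - -i := by rw [neg_neg]; exact fun h => h2 h.symm
    have hj : star (-star a) * pi u = 0 := by
      rw [star_neg, star_star, neg_mul, ← ha.2, mul_assoc, hu1]; simp
    rw [gX_sym hN ha h1 h2, gX, gY_phi_comm hN (hs.isIso hN h5 h6) hu, pi_q_act hN hs.1, hj,
      neg_zero, phi_zero, gY_zero hN]
  · have h5 : j ≠ -l := fun h => h4 (by rw [h, neg_neg])
    rw [gX, comm_gY_gY hN (Ne.symm hl) h5 hi (by rw [pi_q_act hN ha.1, ha.e_mul hN h3.symm])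
      (by rw [pi_q_act hN ha.1, ha.e_mul hN (fun h => hl2 (by rw [← h, neg_neg]))]) hu hu1,
      pi_q_act hN ha.1, hz, neg_zero, gX, act_zero, gY_zero hN]

theorem commX_X (hN : N.IsHyp) (h1 : i ≠ j) (h2 : i ≠ -j) (h3 : k ≠ l) (h4 : k ≠ -l)
    (ha : IsMat N i j a) (hb : IsMat N k l b) (h5 : j ≠ k) (h6 : k ≠ -i) (h7 : -i ≠ -l)
    (h8 : -l ≠ j) : ⁅gX N i j a, gX N k l b⁆ = 1 := by
  have hp : pi (act (N.q k) b) = b := pi_q_act hN hb.1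
  have hjl : l ≠ -j := fun h => h8 (by rw [h, neg_neg])
  have hil : i ≠ l := fun h => h7 (by rw [h])
  have hi := ha.isIso hN h1 h2
  have hz : star a * b = 0 := by
    have hs : star a * N.e (-i) = star a := by rw [← hN.star_e, ← star_mul, ha.1]
    exact IsIso.mul_of hs (hb.e_mul hN h6.symm)
  by_cases hl : l = j
  · subst hl
    rw [gX, gX, gY_phi_comm hN hi (hb.isIso hN h3 h4), pi_q_act hN ha.1, hp, hz,
      neg_zero, phi_zero, gY_zero hN]
  by_cases hk : k = -j
  · subst hk
    have hs := hb.star hN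
    rw [neg_neg] at hs
    have hz' : star a * -star b = 0 := by
      have h9 : star a * N.e (-i) = star a := by rw [← hN.star_e, ← star_mul, ha.1]
      exact IsIso.mul_of h9 (hs.e_mul hN h7)
    rw [gX_sym hN hb h3 h4, neg_neg, gX, gX, gY_phi_comm hN hi (hs.isIso hN h8 (fun h => hl (neg_injective h))),
      pi_q_act hN ha.1, pi_q_act hN hs.1, hz', neg_zero, phi_zero, gY_zero hN]
  by_cases hi2 : i = -l
  · subst hi2
    have hs := ha.star hN
    rw [neg_neg] at hs
    have hz' : star (-star a) * b = 0 := by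
      rw [star_neg, star_star, neg_mul, ha.mul_eq_zero hN hb h5, neg_zero]
    rw [gX_sym hN ha h1 h2, neg_neg, gX, gX,
      gY_phi_comm hN (hs.isIso hN hjl.symm (fun h => hl (neg_injective h).symm)) (hb.isIso hN h3 h4),
      pi_q_act hN hs.1, hp, hz', neg_zero, phi_zero, gY_zero hN]
  · rw [gX, gX, comm_gY_gY hN (Ne.symm hl) (Ne.symm h8) hi
      (by rw [pi_q_act hN ha.1, ha.e_mul hN hil.symm])
      (by rw [pi_q_act hN ha.1, ha.e_mul hN (Ne.symm hi2)]) (hb.isIso hN h3 h4)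
      (by rw [hp, hb.e_mul hN h5]), pi_q_act hN ha.1, hp, hz, neg_zero, gX, act_zero, gY_zero hN]

end Relations

end Hyp

/-! ### Ambient odd form rings -/

section Amb

variable {R Δ S Θ : Type*} [NonUnitalRing R] [StarRing R] [AddGroup Δ] [OddFormRing R Δ]
  [NonUnitalRing S] [StarRing S] [AddGroup Θ] [OddFormRing S Θ]

/-- An embedding of both sides of an action of `(R, Δ)` on `(S, Θ)` into one odd form ring
`(B, Γ)`, such that the action becomes multiplication. -/
structure Ambient (A : ActionData R Δ S Θ) (B Γ : Type*) [NonUnitalRing B] [StarRing B]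
    [AddGroup Γ] [OddFormRing B Γ] where
  r : R →⋆ₙ+* B
  d : Δ →+ Γ
  s : S →⋆ₙ+* B
  t : Θ →+ Γ
  s_inj : Function.Injective s
  t_inj : Function.Injective t
  d_act : ∀ (u : Δ) (a : R), d (act u a) = act (d u) (r a)
  d_pi : ∀ u : Δ, r (pi u) = pi (d u)
  d_rho : ∀ u : Δ, r (rho u) = rho (d u)
  t_act : ∀ (u : Θ) (a : S), t (act u a) = act (t u) (s a)
  t_phi : ∀ a : S, t (phi a) = phi (s a)
  t_pi : ∀ u : Θ, s (pi u) = pi (t u)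
  t_rho : ∀ u : Θ, s (rho u) = rho (t u)
  s_lmul : ∀ (p : R) (a : S), s (A.lmul p a) = r p * s a
  s_rmul : ∀ (a : S) (p : R), s (A.rmul a p) = s a * r p
  t_actR : ∀ (u : Θ) (p : R), t (A.actR u p) = act (t u) (r p)
  t_actS : ∀ (u : Δ) (a : S), t (A.actS u a) = act (d u) (s a)

variable {B Γ : Type*} [NonUnitalRing B] [StarRing B] [AddGroup Γ] [OddFormRing B Γ]
variable {A : ActionData R Δ S Θ} (E : Ambient A B Γ)
variable {I : Type*} [InvolutiveNeg I] {H : Family R Δ I}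

namespace Ambient

/-- The image of a hyperbolic family in the ambient odd form ring. -/
def fam (H : Family R Δ I) : Family B Γ I where
  e i := E.r (H.e i)
  q i := E.d (H.q i)

theorem fam_isHyp (hH : H.IsHyp) : (E.fam H).IsHyp where
  star_e i := by simp only [fam]; rw [← map_star, hH.star_e]
  idem i := by simp only [fam]; rw [← map_mul, hH.idem]
  orth i j h := by simp only [fam]; rw [← map_mul, hH.orth _ _ h, map_zero]
  pi_q i := by simp only [fam]; rw [← E.d_pi, hH.pi_q]
  rho_q i := by simp only [fam]; rw [← E.d_rho, hH.rho_q, map_zero]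
  act_q i := by simp only [fam]; rw [← E.d_act, ← hH.act_q]
  neg_ne := hH.neg_ne

theorem mem_Sij (hH : H.IsHyp) {i j : I} {a : S} :
    a ∈ Sij A H i j ↔ IsMat (E.fam H) i j (E.s a) := by
  have hN := E.fam_isHyp hH
  constructor
  · rintro ⟨b, rfl⟩
    rw [E.s_rmul, E.s_lmul]
    exact ⟨by rw [← mul_assoc, ← mul_assoc]; exact congrArg₂ (· * ·) (congrArg₂ (· * ·) (hN.idem i) rfl) rfl, by
      rw [mul_assoc]; exact congrArg₂ (· * ·) rfl (hN.idem j)⟩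
  · intro h
    refine ⟨a, E.s_inj ?_⟩
    rw [E.s_rmul, E.s_lmul]
    exact (by rw [h.1, h.2] : E.s a = (E.fam H).e i * E.s a * (E.fam H).e j)

theorem mem_Theta0 (hH : H.IsHyp) {j : I} {u : Θ} :
    u ∈ Theta0 A H j ↔ act (E.t u) ((E.fam H).e j) = E.t u ∧
      ∀ k, (E.fam H).e k * pi (E.t u) = 0 := by
  have hN := E.fam_isHyp hH
  constructor
  · rintro ⟨⟨v, rfl⟩, h⟩
    refine ⟨?_, fun k => ?_⟩
    · rw [E.t_actR, ← act_mul]; exact congrArg _ (hN.idem j)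
    · have := congrArg E.s (h k)
      rwa [E.s_lmul, map_zero, E.t_pi] at this
  · rintro ⟨h1, h2⟩
    refine ⟨⟨u, E.t_inj ?_⟩, fun k => E.s_inj ?_⟩
    · rw [E.t_actR]; exact h1.symm
    · rw [E.s_lmul, map_zero, E.t_pi]; exact h2 k

theorem isIso (hH : H.IsHyp) {j : I} {u : Θ} (hu : u ∈ Theta0 A H j) :
    IsIso (E.fam H) j (E.t u) :=
  let h := (E.mem_Theta0 hH).1 hu
  ⟨h.1, h.2 _, h.2 _⟩

theorem isMat (hH : H.IsHyp) {i j : I} {a : S} (ha : a ∈ Sij A H i j) :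
    IsMat (E.fam H) i j (E.s a) := (E.mem_Sij hH).1 ha

theorem e_pi (hH : H.IsHyp) {j : I} {u : Θ} (hu : u ∈ Theta0 A H j) (k : I) :
    (E.fam H).e k * pi (E.t u) = 0 := ((E.mem_Theta0 hH).1 hu).2 k

section Closure

variable {i j k : I} {a b : S} {u v : Θ}
variable (hH : H.IsHyp)
include E hH

theorem Sij_add (ha : a ∈ Sij A H i j) (hb : b ∈ Sij A H i j) : a + b ∈ Sij A H i j := by
  rw [E.mem_Sij hH] at *
  rw [map_add]
  exact ⟨by rw [mul_add, ha.1, hb.1], by rw [add_mul, ha.2, hb.2]⟩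

theorem Sij_zero : (0 : S) ∈ Sij A H i j := by
  rw [E.mem_Sij hH, map_zero]
  exact ⟨mul_zero _, zero_mul _⟩

theorem Sij_neg (ha : a ∈ Sij A H i j) : -a ∈ Sij A H i j := by
  rw [E.mem_Sij hH] at *
  rw [map_neg]; exact ha.neg

theorem Sij_star (ha : a ∈ Sij A H i j) : -star a ∈ Sij A H (-j) (-i) := by
  rw [E.mem_Sij hH] at *
  rw [map_neg, map_star]; exact ha.star (E.fam_isHyp hH)

theorem Sij_mul (ha : a ∈ Sij A H i j) (hb : b ∈ Sij A H j k) : a * b ∈ Sij A H i k := by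
  rw [E.mem_Sij hH] at *
  rw [map_mul]; exact ha.mul hb

theorem Sij_pi (hu : u ∈ Theta0 A H i) (hv : v ∈ Theta0 A H j) :
    -(star (pi u) * pi v) ∈ Sij A H (-i) j := by
  have h1 := E.isIso hH hu
  have h2 := E.isIso hH hv
  rw [E.mem_Sij hH, map_neg, map_mul, map_star, E.t_pi, E.t_pi]
  refine IsMat.neg ⟨?_, ?_⟩
  · rw [← mul_assoc, h1.star_e_pi (E.fam_isHyp hH)]
  · rw [mul_assoc, h2.pi_e]

theorem Sij_rho (hu : u ∈ Theta0 A H i) (ha : a ∈ Sij A H i j) :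
    rho u * a ∈ Sij A H (-i) j := by
  have h1 := E.isIso hH hu
  have h2 := E.isMat hH ha
  rw [E.mem_Sij hH, map_mul, E.t_rho]
  exact ⟨by rw [← mul_assoc, h1.e_rho (E.fam_isHyp hH)], by rw [mul_assoc, h2.2]⟩

theorem Theta0_add (hu : u ∈ Theta0 A H i) (hv : v ∈ Theta0 A H i) : u + v ∈ Theta0 A H i := by
  rw [E.mem_Theta0 hH] at *
  rw [map_add]
  exact ⟨by rw [add_act, hu.1, hv.1], fun k => by rw [pi_add, mul_add, hu.2, hv.2, add_zero]⟩

theorem Theta0_zero : (0 : Θ) ∈ Theta0 A H i := by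
  rw [E.mem_Theta0 hH, map_zero]
  exact ⟨zero_act _, fun k => by rw [pi_zero, mul_zero]⟩

theorem Theta0_neg (hu : u ∈ Theta0 A H i) : -u ∈ Theta0 A H i := by
  rw [E.mem_Theta0 hH] at *
  rw [map_neg]
  exact ⟨by rw [neg_act, hu.1], fun k => by rw [pi_neg, mul_neg, hu.2, neg_zero]⟩

theorem Theta0_phi (ha : a ∈ Sij A H (-i) i) : (phi a : Θ) ∈ Theta0 A H i := by
  have h := IsIso.phi (Γ := Γ) (E.fam_isHyp hH) (E.isMat hH ha)
  rw [E.mem_Theta0 hH, E.t_phi]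
  exact ⟨h.act, fun k => by rw [pi_phi, mul_zero]⟩

theorem Theta0_act (hu : u ∈ Theta0 A H i) (ha : a ∈ Sij A H i j) : act u a ∈ Theta0 A H j := by
  have h2 := E.isMat hH ha
  rw [E.mem_Theta0 hH] at *
  rw [E.t_act]
  exact ⟨by rw [← act_mul, h2.2], fun k => by rw [pi_act, ← mul_assoc, hu.2, zero_mul]⟩

end Closure

end Ambient

/-! ### Steinberg groups -/

section Steinberg

variable {i j k l : I} {a b : S} {u v : Θ}

theorem StRel.mk_eq {x y : FreeGroup (Gen A H)} (h : StRel A H x y) :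
    (PresentedGroup.mk _ x : StU A H) = PresentedGroup.mk _ y := by
  apply PresentedGroup.mk_eq_mk_of_mul_inv_mem
  exact ⟨x, y, h, rfl⟩

/-- The homomorphism from the Steinberg group given by the images of the generators. -/
def StU.lift {G : Type*} [Group G] (f : Gen A H → G)
    (hf : ∀ x y, StRel A H x y → FreeGroup.lift f x = FreeGroup.lift f y) : StU A H →* G :=
  PresentedGroup.toGroup (f := f) (by
    rintro _ ⟨x, y, h, rfl⟩
    rw [map_mul, map_inv, hf x y h, mul_inv_cancel])

theorem StU.lift_mk {G : Type*} [Group G] (f : Gen A H → G)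
    (hf : ∀ x y, StRel A H x y → FreeGroup.lift f x = FreeGroup.lift f y)
    (w : FreeGroup (Gen A H)) : StU.lift f hf (PresentedGroup.mk _ w) = FreeGroup.lift f w := rfl

theorem lift_wX {G : Type*} [Group G] (f : Gen A H → G) (h1 : i ≠ j) (h2 : i ≠ -j)
    (ha : a ∈ Sij A H i j) : FreeGroup.lift f (wX A H i j a) = f (.short i j a ⟨h1, h2, ha⟩) := by
  rw [wX, dif_pos ⟨h1, h2, ha⟩, FreeGroup.lift_apply_of]

theorem lift_wY {G : Type*} [Group G] (f : Gen A H → G)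
    (hu : u ∈ Theta0 A H j) : FreeGroup.lift f (wY A H j u) = f (.ultrashort j u hu) := by
  rw [wY, dif_pos hu, FreeGroup.lift_apply_of]

theorem X_sym (h1 : i ≠ j) (h2 : i ≠ -j) (ha : a ∈ Sij A H i j) :
    X A H i j a = X A H (-j) (-i) (-star a) := (StRel.sym i j a h1 h2 ha).mk_eq

theorem X_add (h1 : i ≠ j) (h2 : i ≠ -j) (ha : a ∈ Sij A H i j) (hb : b ∈ Sij A H i j) :
    X A H i j (a + b) = X A H i j a * X A H i j b :=
  ((StRel.addX i j a b h1 h2 ha hb).mk_eq).symm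

theorem Y_add (hu : u ∈ Theta0 A H j) (hv : v ∈ Theta0 A H j) :
    Y A H j (u + v) = Y A H j u * Y A H j v :=
  ((StRel.addY j u v hu hv).mk_eq).symm

include E

theorem X_zero (hH : H.IsHyp) (h1 : i ≠ j) (h2 : i ≠ -j) : X A H i j 0 = 1 := by
  have h0 : (0 : S) ∈ Sij A H i j := E.Sij_zero hH
  have h := X_add h1 h2 h0 h0
  rw [add_zero] at h
  exact left_eq_mul.mp h

theorem Y_zero (hH : H.IsHyp) : Y A H j 0 = 1 := by
  have h0 : (0 : Θ) ∈ Theta0 A H j := E.Theta0_zero hH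
  have h := Y_add h0 h0
  rw [add_zero] at h
  exact left_eq_mul.mp h

theorem X_neg (hH : H.IsHyp) (h1 : i ≠ j) (h2 : i ≠ -j) (ha : a ∈ Sij A H i j) :
    X A H i j (-a) = (X A H i j a)⁻¹ := by
  rw [eq_inv_iff_mul_eq_one, ← X_add h1 h2 (E.Sij_neg hH ha) ha, neg_add_cancel,
    X_zero E hH h1 h2]

theorem Y_neg (hH : H.IsHyp) (hu : u ∈ Theta0 A H j) : Y A H j (-u) = (Y A H j u)⁻¹ := by
  rw [eq_inv_iff_mul_eq_one, ← Y_add (E.Theta0_neg hH hu) hu, neg_add_cancel, Y_zero E hH]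

omit E

theorem mk_short (h) : (PresentedGroup.mk _ (FreeGroup.of (Gen.short i j a h)) : StU A H) =
    X A H i j a := by
  rw [X, wX, dif_pos h]

theorem mk_ultrashort (h) : (PresentedGroup.mk _ (FreeGroup.of (Gen.ultrashort j u h)) : StU A H) =
    Y A H j u := by
  rw [Y, wY, dif_pos h]

include E in
/-- Elements of the Steinberg group are products of root elements. -/
theorem StU.induction (hH : H.IsHyp) {P : StU A H → Prop} (x : StU A H) (one : P 1)
    (mulX : ∀ i j a x, i ≠ j → i ≠ -j → a ∈ Sij A H i j → P x → P (X A H i j a * x))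
    (mulY : ∀ j u x, u ∈ Theta0 A H j → P x → P (Y A H j u * x)) : P x := by
  obtain ⟨w, rfl⟩ := PresentedGroup.mk_surjective _ x
  suffices h : ∀ y, P y → P (PresentedGroup.mk _ w * y) by
    simpa using h 1 one
  induction w using FreeGroup.induction_on with
  | C1 => intro y hy; simpa using hy
  | of g =>
    intro y hy
    cases g with
    | short i j a h => rw [mk_short]; exact mulX i j a y h.1 h.2.1 h.2.2 hy
    | ultrashort j u h => rw [mk_ultrashort]; exact mulY j u y h hy
  | inv_of g =>
    intro y hy
    cases g with
    | short i j a h =>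
      rw [map_inv, mk_short, ← X_neg E hH h.1 h.2.1 h.2.2]
      exact mulX i j _ y h.1 h.2.1 (E.Sij_neg hH h.2.2) hy
    | ultrashort j u h =>
      rw [map_inv, mk_ultrashort, ← Y_neg E hH h]
      exact mulY j _ y (E.Theta0_neg hH h) hy
  | mul x y hx hy =>
    intro z hz
    rw [map_mul, mul_assoc]
    exact hx _ (hy z hz)

end Steinberg
end Amb

/-! ### The homomorphism to the unitary group -/

section St

variable {R Δ S Θ : Type*} [NonUnitalRing R] [StarRing R] [AddGroup Δ] [OddFormRing R Δ]
  [NonUnitalRing S] [StarRing S] [AddGroup Θ] [OddFormRing S Θ]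
variable {B Γ : Type*} [NonUnitalRing B] [StarRing B] [AddGroup Γ] [OddFormRing B Γ]
variable {A : ActionData R Δ S Θ} (E : Ambient A B Γ)
variable {I : Type*} [InvolutiveNeg I] {H : Family R Δ I}
variable {i j k l : I} {a b : S} {u v : Θ}

/-- The images of the generators under the canonical map to the unitary group. -/
def stGen (E : Ambient A B Γ) : Gen A H → UGrp B Γ
  | .short i j a _ => gX (E.fam H) i j (E.s a)
  | .ultrashort j u _ => gY (E.fam H) j (E.t u)

theorem stGen_rel (hH : H.IsHyp) (x y : FreeGroup (Gen A H)) (h : StRel A H x y) :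
    FreeGroup.lift (stGen E) x = FreeGroup.lift (stGen E) y := by
  have hN := E.fam_isHyp hH
  have mm := fun {i j : I} {a : S} (ha : a ∈ Sij A H i j) => E.isMat hH ha
  have mi := fun {j : I} {u : Θ} (ha : u ∈ Theta0 A H j) => E.isIso hH ha
  have mp := fun {j : I} {u : Θ} (ha : u ∈ Theta0 A H j) => E.e_pi hH ha
  have nn : ∀ {i j : I}, i ≠ j → -i ≠ -j := fun h h' => h (neg_injective h')
  have nl : ∀ {i j : I}, i ≠ -j → -i ≠ j := fun h h' => h (by rw [← h', neg_neg])
  have nr : ∀ {i j : I}, i ≠ -j → j ≠ -i := fun h h' => h (by rw [h', neg_neg])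
  cases h with
  | sym i j a h1 h2 ha =>
    rw [lift_wX _ h1 h2 ha, lift_wX _ (nn h1.symm) (nn (nr h2)) (E.Sij_star hH ha)]
    simp only [stGen, map_neg, map_star]
    exact gX_sym hN (mm ha) h1 h2
  | addX i j a b h1 h2 ha hb =>
    rw [map_mul, lift_wX _ h1 h2 ha, lift_wX _ h1 h2 hb, lift_wX _ h1 h2 (E.Sij_add hH ha hb)]
    simp only [stGen, map_add]
    exact (gX_add hN (mm ha) (mm hb) h1 h2).symm
  | addY j u v hu hv =>
    rw [map_mul, lift_wY _ hu, lift_wY _ hv, lift_wY _ (E.Theta0_add hH hu hv)]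
    simp only [stGen, map_add]
    exact (gY_add hN (mi hu) (mi hv)).symm
  | commXX i j k l a b h1 h2 h3 h4 ha hb h5 h6 h7 h8 =>
    rw [map_commutatorElement, lift_wX _ h1 h2 ha, lift_wX _ h3 h4 hb, map_one]
    exact commX_X hN h1 h2 h3 h4 (mm ha) (mm hb) h5 h6 h7 h8
  | commXY i j l a u h1 h2 ha hu h3 h4 =>
    rw [map_commutatorElement, lift_wX _ h1 h2 ha, lift_wY _ hu, map_one]
    exact commX_Y hN h1 h2 (mm ha) (mi hu) h3 h4 (mp hu _) (mp hu _)
  | commLong i j a b h1 h2 ha hb =>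
    rw [map_commutatorElement, lift_wX _ (nl h2) (nn h1) ha, lift_wX _ h1.symm (nr h2) hb,
      lift_wY _ (E.Theta0_phi hH (E.Sij_mul hH ha hb))]
    simp only [stGen, E.t_phi, map_mul]
    exact commX_long hN h1 h2 (mm ha) (mm hb)
  | commYsame i u v hu hv =>
    rw [map_commutatorElement, lift_wY _ hu, lift_wY _ hv,
      lift_wY _ (E.Theta0_phi hH (E.Sij_pi hH hu hv))]
    simp only [stGen, E.t_phi, map_neg, map_mul, map_star, E.t_pi]
    exact gY_phi_comm hN (mi hu) (mi hv)
  | commYY i j u v h1 h2 hu hv =>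
    rw [map_commutatorElement, lift_wY _ hu, lift_wY _ hv,
      lift_wX _ (nl h2) (nn h1) (E.Sij_pi hH hu hv)]
    simp only [stGen, map_neg, map_mul, map_star, E.t_pi]
    exact comm_gY_gY hN h1 h2 (mi hu) (mp hu _) (mp hu _) (mi hv) (mp hv _)
  | commShort i j k a b h1 h2 h3 h4 h5 h6 ha hb =>
    rw [map_commutatorElement, lift_wX _ h1 h2 ha, lift_wX _ h3 h4 hb,
      lift_wX _ h5 h6 (E.Sij_mul hH ha hb)]
    simp only [stGen, map_mul]
    exact commX_short hN h1 h2 h3 h4 h5 h6 (mm ha) (mm hb)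
  | commYX i j u a h1 h2 hu ha =>
    rw [map_commutatorElement, lift_wX _ h1 h2 ha, lift_wY _ hu, map_mul,
      lift_wX _ (nl h2) (nn h1) (E.Sij_rho hH hu ha),
      lift_wY _ (E.Theta0_neg hH (E.Theta0_act hH hu (E.Sij_neg hH ha)))]
    simp only [stGen, map_mul, map_neg, E.t_rho, E.t_act]
    exact comm_gY_gX hN h1 h2 (mi hu) (mp hu _) (mp hu _) (mm ha)

namespace Ambient

variable (hH : H.IsHyp)

/-- The canonical homomorphism from the Steinberg group to the unitary group of the ambient odd
form ring. -/
def st : StU A H →* UGrp B Γ := StU.lift (stGen E) (stGen_rel E hH)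

theorem st_X (h1 : i ≠ j) (h2 : i ≠ -j) (ha : a ∈ Sij A H i j) :
    E.st hH (X A H i j a) = gX (E.fam H) i j (E.s a) := by
  rw [X, st, StU.lift_mk, lift_wX _ h1 h2 ha]; rfl

theorem st_Y (hu : u ∈ Theta0 A H j) :
    E.st hH (Y A H j u) = gY (E.fam H) j (E.t u) := by
  rw [Y, st, StU.lift_mk, lift_wY _ hu]; rfl

theorem t_umul (u v : Θ) : E.t (umul (S := S) u v) = umul (S := B) (E.t u) (E.t v) := by
  simp only [umul, map_add, E.t_act, E.t_pi]

theorem t_TY : E.t (TY A H j u) = tY (E.fam H) j (E.t u) := by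
  simp only [TY, tY, map_add, map_neg, E.t_phi, E.t_actS, map_sub, E.t_rho, E.t_pi, map_star, fam]

include hH in
theorem t_TX (ha : a ∈ Sij A H i j) :
    E.t (TX A H i j a) = tY (E.fam H) j (act ((E.fam H).q i) (E.s a)) := by
  rw [tX_eq (E.fam_isHyp hH) (E.isMat hH ha)]
  simp only [TX, map_add, map_neg, E.t_phi, E.t_actS, map_star, fam]

theorem st_of_stVal {x : StU A H} {t : Θ} (h : StVal A H x t) : (E.st hH x).val = E.t t := by
  induction h with
  | one => rw [map_one, map_zero]; rfl
  | mulX i j a x t h1 h2 ha _ ih =>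
    rw [map_mul, UGrp.val_mul, ih, st_X E hH h1 h2 ha, t_umul, E.t_TX hH ha, gX,
      gY_val (E.fam_isHyp hH) ((E.isMat hH ha).isIso (E.fam_isHyp hH) h1 h2)]
  | mulY j u x t hu _ ih =>
    rw [map_mul, UGrp.val_mul, ih, st_Y E hH hu, t_umul, E.t_TY,
      gY_val (E.fam_isHyp hH) (E.isIso hH hu)]

include E hH in
theorem exists_stVal (x : StU A H) : ∃ t, StVal A H x t := by
  induction x using StU.induction E hH with
  | one => exact ⟨_, .one⟩
  | mulX i j a x h1 h2 ha ih => exact ih.elim fun t ht => ⟨_, .mulX i j a x t h1 h2 ha ht⟩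
  | mulY j u x hu ih => exact ih.elim fun t ht => ⟨_, .mulY j u x t hu ht⟩

theorem stVal_iff {x : StU A H} {t : Θ} : StVal A H x t ↔ (E.st hH x).val = E.t t := by
  refine ⟨E.st_of_stVal hH, fun h => ?_⟩
  obtain ⟨t', ht'⟩ := E.exists_stVal hH x
  rw [E.st_of_stVal hH ht'] at h
  rwa [← E.t_inj h]

end Ambient

/-! ### Roots and weights -/

section Roots

theorem vec_neg (i : I) : vec (-i) = -vec i := by
  simp [vec]

theorem vec_mem_roots (i : I) : vec i ∈ roots I := Or.inl ⟨i, rfl⟩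

theorem add_mem_roots {i j : I} (h : j ≠ -i) : vec i + vec j ∈ roots I := Or.inr ⟨i, j, h, rfl⟩

theorem neg_mem_roots {α : I → ℤ} (h : α ∈ roots I) : -α ∈ roots I := by
  rcases h with ⟨i, rfl⟩ | ⟨i, j, hij, rfl⟩
  · rw [← vec_neg]; exact vec_mem_roots _
  · rw [neg_add, ← vec_neg, ← vec_neg]
    exact add_mem_roots fun h => hij (neg_injective h)

theorem sub_mem_roots {i j : I} (h : i ≠ j) : vec j - vec i ∈ roots I := by
  rw [sub_eq_add_neg, ← vec_neg]
  exact add_mem_roots (fun h' => h (neg_injective h'))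

variable [Finite I]

/-- The linear functional on the root lattice with weights `ω`. -/
def ht (ω v : I → ℤ) : ℤ := ∑ᶠ i, ω i * v i

theorem ht_add (ω v w : I → ℤ) : ht ω (v + w) = ht ω v + ht ω w := by
  simp only [ht, Pi.add_apply, mul_add]
  exact finsum_add_distrib (Set.toFinite _) (Set.toFinite _)

theorem ht_neg (ω v : I → ℤ) : ht ω (-v) = -ht ω v := by
  simp only [ht, Pi.neg_apply, mul_neg]
  exact finsum_neg_distrib _

theorem ht_zero (ω : I → ℤ) : ht ω 0 = 0 := by
  simp [ht]

theorem ht_sub (ω v w : I → ℤ) : ht ω (v - w) = ht ω v - ht ω w := by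
  rw [sub_eq_add_neg, ht_add, ht_neg, sub_eq_add_neg]

theorem ht_single [DecidableEq I] (ω : I → ℤ) (i : I) : ht ω (Pi.single i 1) = ω i := by
  rw [ht, finsum_eq_single _ i]
  · simp
  · intro x hx; simp [hx]

/-- Odd weights: `ω_{-i} = -ω_i`. -/
def IsOdd (ω : I → ℤ) : Prop := ∀ i, ω (-i) = -ω i

theorem ht_vec {ω : I → ℤ} (hω : IsOdd ω) (i : I) : ht ω (vec i) = 2 * ω i := by
  classical
  rw [vec, ht_sub]
  have h1 := ht_single ω i
  have h2 := ht_single ω (-i)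
  rw [hω] at h2
  rw [h1, h2]; ring

/-- The roots on which the functional with weights `ω` is positive. -/
def posRoots (ω : I → ℤ) : Set (I → ℤ) := {α | α ∈ roots I ∧ 0 < ht ω α}

end Roots

section PosSub

variable [Finite I] {ω : I → ℤ}

theorem X_mem_stSub {P : Set (I → ℤ)} (h1 : i ≠ j) (h2 : i ≠ -j) (ha : a ∈ Sij A H i j)
    (h : vec j - vec i ∈ P) : X A H i j a ∈ stSub A H P :=
  Subgroup.subset_closure (Set.mem_biUnion h (Or.inl (Or.inl ⟨i, j, a, h1, h2, ha, rfl, rfl⟩)))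

theorem Y_mem_stSub {P : Set (I → ℤ)} (hu : u ∈ Theta0 A H j)
    (h : vec j ∈ P) : Y A H j u ∈ stSub A H P :=
  Subgroup.subset_closure (Set.mem_biUnion h (Or.inl (Or.inr ⟨j, u, hu, rfl, rfl⟩)))

theorem Yphi_mem_stSub {P : Set (I → ℤ)} (ha : a ∈ Sij A H (-j) j)
    (h : vec j + vec j ∈ P) : Y A H j (phi a) ∈ stSub A H P :=
  Subgroup.subset_closure (Set.mem_biUnion h (Or.inr ⟨j, a, ha, rfl, rfl⟩))

theorem stSub_mono {P Q : Set (I → ℤ)} (h : P ⊆ Q) : stSub A H P ≤ stSub A H Q :=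
  Subgroup.closure_mono (Set.biUnion_subset_biUnion_left h)

theorem stSub_le {P : Set (I → ℤ)} {K : Subgroup (StU A H)}
    (hX : ∀ i j a, i ≠ j → i ≠ -j → a ∈ Sij A H i j → vec j - vec i ∈ P → X A H i j a ∈ K)
    (hY : ∀ j u, u ∈ Theta0 A H j → vec j ∈ P → Y A H j u ∈ K)
    (hZ : ∀ j a, a ∈ Sij A H (-j) j → vec j + vec j ∈ P → Y A H j (phi a) ∈ K) :
    stSub A H P ≤ K := by
  refine (Subgroup.closure_le _).2 (Set.iUnion₂_subset ?_)
  rintro α hα x ((⟨i, j, a, h1, h2, ha, rfl, rfl⟩ | ⟨j, u, hu, rfl, rfl⟩) | ⟨j, a, ha, rfl, rfl⟩)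
  · exact hX i j a h1 h2 ha hα
  · exact hY j u hu hα
  · exact hZ j a ha hα

/-- The subgroup generated by the root elements with indices in `s` and positive weight. -/
def tri (A : ActionData R Δ S Θ) (H : Family R Δ I) (ω : I → ℤ) (s : Finset I) :
    Subgroup (StU A H) :=
  Subgroup.closure
    ({x | ∃ i j a, i ≠ j ∧ i ≠ -j ∧ a ∈ Sij A H i j ∧ i ∈ s ∧ j ∈ s ∧ ω i < ω j ∧ x = X A H i j a} ∪
     {x | ∃ j u, u ∈ Theta0 A H j ∧ j ∈ s ∧ 0 < ω j ∧ x = Y A H j u})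

/-- The subgroup generated by the column with index `t`, i.e. by the root elements `X_{it}(a)` and
`X_t(u)`: the unipotent radical of the stabilizer of `e_t`. -/
def col (A : ActionData R Δ S Θ) (H : Family R Δ I) (t : I) : Subgroup (StU A H) :=
  Subgroup.closure
    ({x | ∃ i a, i ≠ t ∧ i ≠ -t ∧ a ∈ Sij A H i t ∧ x = X A H i t a} ∪
     {x | ∃ u, u ∈ Theta0 A H t ∧ x = Y A H t u})

end PosSub

/-! ### Conjugation of root elements -/

section Conj

theorem conj_of_comm {G : Type*} [Group G] {x y z : G} (h : ⁅x, y⁆ = z) :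
    x * y * x⁻¹ = z * y := by
  rw [← h, commutatorElement_def]; group

theorem conj_XX (h1 : i ≠ j) (h2 : i ≠ -j) (h3 : k ≠ l) (h4 : k ≠ -l)
    (ha : a ∈ Sij A H i j) (hb : b ∈ Sij A H k l) (h5 : j ≠ k) (h6 : k ≠ -i) (h7 : i ≠ l)
    (h8 : l ≠ -j) : X A H i j a * X A H k l b * (X A H i j a)⁻¹ = X A H k l b := by
  have h := (StRel.commXX i j k l a b h1 h2 h3 h4 ha hb h5 h6 (fun h => h7 (neg_injective h))
    (fun h => h8 (by rw [← h, neg_neg]))).mk_eq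
  rw [map_commutatorElement, map_one] at h
  have := conj_of_comm h
  rwa [one_mul] at this

theorem conj_XY (h1 : i ≠ j) (h2 : i ≠ -j) (ha : a ∈ Sij A H i j) (hu : u ∈ Theta0 A H l)
    (h3 : i ≠ l) (h4 : l ≠ -j) : X A H i j a * Y A H l u * (X A H i j a)⁻¹ = Y A H l u := by
  have h := (StRel.commXY i j l a u h1 h2 ha hu h3 h4).mk_eq
  rw [map_commutatorElement, map_one] at h
  have := conj_of_comm h
  rwa [one_mul] at this

theorem conj_YX (h1 : i ≠ j) (h2 : i ≠ -j) (ha : a ∈ Sij A H i j) (hu : u ∈ Theta0 A H l)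
    (h3 : i ≠ l) (h4 : l ≠ -j) : Y A H l u * X A H i j a * (Y A H l u)⁻¹ = X A H i j a := by
  have h := conj_XY h1 h2 ha hu h3 h4
  rw [mul_inv_eq_iff_eq_mul] at h ⊢
  exact h.symm

theorem conj_long (h1 : i ≠ j) (h2 : i ≠ -j) (ha : a ∈ Sij A H (-i) j) (hb : b ∈ Sij A H j i) :
    X A H (-i) j a * X A H j i b * (X A H (-i) j a)⁻¹ = Y A H i (phi (a * b)) * X A H j i b := by
  have h := (StRel.commLong i j a b h1 h2 ha hb).mk_eq
  rw [map_commutatorElement] at h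
  exact conj_of_comm h

theorem conj_YY (h1 : i ≠ j) (h2 : i ≠ -j) (hu : u ∈ Theta0 A H i) (hv : v ∈ Theta0 A H j) :
    Y A H i u * Y A H j v * (Y A H i u)⁻¹ =
      X A H (-i) j (-(star (pi u) * pi v)) * Y A H j v := by
  have h := (StRel.commYY i j u v h1 h2 hu hv).mk_eq
  rw [map_commutatorElement] at h
  exact conj_of_comm h

theorem conj_short (h1 : i ≠ j) (h2 : i ≠ -j) (h3 : j ≠ k) (h4 : j ≠ -k) (h5 : i ≠ k)
    (h6 : i ≠ -k) (ha : a ∈ Sij A H i j) (hb : b ∈ Sij A H j k) :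
    X A H i j a * X A H j k b * (X A H i j a)⁻¹ = X A H i k (a * b) * X A H j k b := by
  have h := (StRel.commShort i j k a b h1 h2 h3 h4 h5 h6 ha hb).mk_eq
  rw [map_commutatorElement] at h
  exact conj_of_comm h

theorem conj_mixedYX (h1 : i ≠ j) (h2 : i ≠ -j) (hu : u ∈ Theta0 A H i) (ha : a ∈ Sij A H i j) :
    Y A H i u * X A H i j a * (Y A H i u)⁻¹ =
      X A H (-i) j (rho u * a) * Y A H j (-(act u (-a))) * X A H i j a := by
  have h := (StRel.commYX i j u a h1 h2 hu ha).mk_eq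
  rw [map_commutatorElement, map_mul] at h
  exact conj_of_comm h

end Conj

/-! ### Faithfulness on positive subgroups -/

section Faithful

theorem ne_neg {i j : I} (h : i ≠ -j) : -i ≠ j := fun h' => h (by rw [← h', neg_neg])

theorem ne_neg' {i j : I} (h : i ≠ -j) : j ≠ -i := fun h' => h (by rw [h', neg_neg])

theorem neg_ne_neg' {i j : I} (h : i ≠ j) : -i ≠ -j := fun h' => h (neg_injective h')

variable (hH : H.IsHyp)

theorem X_mem_col {t : I} (h1 : i ≠ t) (h2 : i ≠ -t) (ha : a ∈ Sij A H i t) :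
    X A H i t a ∈ col A H t := Subgroup.subset_closure (Or.inl ⟨i, a, h1, h2, ha, rfl⟩)

theorem Y_mem_col {t : I} (hu : u ∈ Theta0 A H t) :
    Y A H t u ∈ col A H t := Subgroup.subset_closure (Or.inr ⟨u, hu, rfl⟩)

include E hH in
theorem X_conj_col {t : I} (h1 : i ≠ j) (h2 : i ≠ -j) (ha : a ∈ Sij A H i j) (hi : i ≠ t)
    (hi' : i ≠ -t) (hj : j ≠ t) (hj' : j ≠ -t) {n : StU A H} (hn : n ∈ col A H t) :
    X A H i j a * n * (X A H i j a)⁻¹ ∈ col A H t := by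
  induction hn using Subgroup.closure_induction with
  | mem x hx =>
    rcases hx with ⟨k, b, hk, hk', hb, rfl⟩ | ⟨u, hu, rfl⟩
    · by_cases e1 : j = k
      · subst e1
        rw [conj_short h1 h2 hj hj' hi hi' ha hb]
        exact mul_mem (X_mem_col hi hi' (E.Sij_mul hH ha hb)) (X_mem_col hj hj' hb)
      by_cases e2 : k = -i
      · subst e2
        have hs := E.Sij_star hH ha
        rw [X_sym h1 h2 ha, conj_short (neg_ne_neg' h1.symm) (neg_ne_neg' (ne_neg' h2)) hk hk'
          (ne_neg hj') (neg_ne_neg' hj) hs hb]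
        exact mul_mem (X_mem_col (ne_neg hj') (neg_ne_neg' hj) (E.Sij_mul hH hs hb))
          (X_mem_col hk hk' hb)
      · rw [conj_XX h1 h2 hk hk' ha hb e1 e2 hi (ne_neg' hj')]
        exact X_mem_col hk hk' hb
    · rw [conj_XY h1 h2 ha hu hi (ne_neg' hj')]
      exact Y_mem_col hu
  | one => simp
  | mul x y _ _ hx hy =>
    have := mul_mem hx hy
    simpa [mul_assoc] using this
  | inv x _ hx =>
    have := inv_mem hx
    simpa [mul_assoc] using this

include E hH in
theorem Y_conj_col {t : I} (hu : u ∈ Theta0 A H i) (hi : i ≠ t)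
    (hi' : i ≠ -t) {n : StU A H} (hn : n ∈ col A H t) :
    Y A H i u * n * (Y A H i u)⁻¹ ∈ col A H t := by
  induction hn using Subgroup.closure_induction with
  | mem x hx =>
    rcases hx with ⟨k, b, hk, hk', hb, rfl⟩ | ⟨v, hv, rfl⟩
    · by_cases e1 : i = k
      · subst e1
        rw [conj_mixedYX hi hi' hu hb]
        exact mul_mem (mul_mem (X_mem_col (ne_neg hi') (neg_ne_neg' hi) (E.Sij_rho hH hu hb))
          (Y_mem_col (E.Theta0_neg hH (E.Theta0_act hH hu (E.Sij_neg hH hb))))) (X_mem_col hk hk' hb)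
      · rw [conj_YX hk hk' hb hu (Ne.symm e1) hi']
        exact X_mem_col hk hk' hb
    · rw [conj_YY hi hi' hu hv]
      exact mul_mem (X_mem_col (ne_neg hi') (neg_ne_neg' hi) (E.Sij_pi hH hu hv)) (Y_mem_col hv)
  | one => simp
  | mul x y _ _ hx hy =>
    have := mul_mem hx hy
    simpa [mul_assoc] using this
  | inv x _ hx =>
    have := inv_mem hx
    simpa [mul_assoc] using this

end Faithful

end St

/-! ### Columns and their normal forms -/

section Inj

variable {R Δ S Θ : Type*} [NonUnitalRing R] [StarRing R] [AddGroup Δ] [OddFormRing R Δ]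
  [NonUnitalRing S] [StarRing S] [AddGroup Θ] [OddFormRing S Θ]
variable {B Γ : Type*} [NonUnitalRing B] [StarRing B] [AddGroup Γ] [OddFormRing B Γ]
variable {A : ActionData R Δ S Θ} (E : Ambient A B Γ)
variable {I : Type*} [InvolutiveNeg I] {H : Family R Δ I}
variable {i j k l t : I} {a b : S} {u v : Θ}
variable (hH : H.IsHyp)

/-- The product of root elements `X_{it}(a_i)` over a list of indices `i`. -/
def colProd (A : ActionData R Δ S Θ) (H : Family R Δ I) (t : I) (L : List I) (a : I → S) :
    StU A H := (L.map fun i => X A H i t (a i)).prod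

theorem colProd_congr {L : List I} {a a' : I → S} (h : ∀ i ∈ L, a i = a' i) :
    colProd A H t L a = colProd A H t L a' := by
  rw [colProd, colProd]
  congr 1
  exact List.map_congr_left fun i hi => by rw [h i hi]

include E hH in
/-- Moving a root element into a product over the column costs a central element `X_t(w)`. -/
theorem X_mul_colProd (h1 : i ≠ t) (h2 : i ≠ -t) (hb : b ∈ Sij A H i t) (L : List I)
    (hL : L.Nodup) (hLt : ∀ j ∈ L, j ≠ t ∧ j ≠ -t) (hi : i ∈ L) (a : I → S)
    (ha : ∀ j ∈ L, a j ∈ Sij A H j t) :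
    ∃ w ∈ Theta0 A H t, ∃ a' : I → S, (∀ j ∈ L, a' j ∈ Sij A H j t) ∧
      X A H i t b * colProd A H t L a = Y A H t w * colProd A H t L a' := by
  classical
  induction L with
  | nil => simp at hi
  | cons j L ih =>
    rw [List.nodup_cons] at hL
    have haj := ha j List.mem_cons_self
    have hj := hLt j List.mem_cons_self
    by_cases hij : i = j
    · subst hij
      refine ⟨0, E.Theta0_zero hH, Function.update a i (b + a i), fun k hk => ?_, ?_⟩
      · by_cases hki : k = i
        · subst hki
          rw [Function.update_self]; exact E.Sij_add hH hb haj
        · rw [Function.update_of_ne hki]; exact ha k hk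
      · rw [Y_zero E hH, one_mul, colProd, colProd, List.map_cons, List.prod_cons, ← mul_assoc,
          ← X_add h1 h2 hb haj, List.map_cons, List.prod_cons, Function.update_self]
        congr 1
        refine (colProd_congr fun k hk => ?_)
        rw [Function.update_of_ne]
        rintro rfl
        exact hL.1 hk
    · obtain ⟨w, hw, a', ha', e⟩ := ih hL.2 (fun k hk => hLt k (List.mem_cons_of_mem _ hk))
        (by simpa [hij] using hi) (fun k hk => ha k (List.mem_cons_of_mem _ hk))
      have hswap : ∃ w' ∈ Theta0 A H t, X A H i t b * X A H j t (a j) =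
          Y A H t w' * X A H j t (a j) * X A H i t b := by
        by_cases hji : j = -i
        · subst hji
          have hs := E.Sij_star hH hb
          refine ⟨_, E.Theta0_phi hH (E.Sij_mul hH hs haj), ?_⟩
          rw [← mul_inv_eq_iff_eq_mul, X_sym h1 h2 hb]
          exact conj_long hj.1.symm (ne_neg' hj.2) hs haj
        · refine ⟨0, E.Theta0_zero hH, ?_⟩
          rw [Y_zero E hH, one_mul, ← mul_inv_eq_iff_eq_mul]
          exact conj_XX h1 h2 hj.1 hj.2 hb haj hj.1.symm hji h1 (fun h => hH.neg_ne t h.symm)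
      obtain ⟨w', hw', e'⟩ := hswap
      refine ⟨w' + w, E.Theta0_add hH hw' hw, Function.update a' j (a j), fun k hk => ?_, ?_⟩
      · by_cases hkj : k = j
        · subst hkj
          rw [Function.update_self]; exact haj
        · rw [Function.update_of_ne hkj]
          exact ha' k (by simpa [hkj] using hk)
      · have hc : colProd A H t L (Function.update a' j (a j)) = colProd A H t L a' :=
          colProd_congr fun k hk => by
            rw [Function.update_of_ne]
            rintro rfl
            exact hL.1 hk
        have hxy := conj_XY hj.1 hj.2 haj hw hj.1 (fun h => hH.neg_ne t h.symm)
        rw [mul_inv_eq_iff_eq_mul] at hxy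
        have e1 : colProd A H t (j :: L) a = X A H j t (a j) * colProd A H t L a := by
          rw [colProd, colProd, List.map_cons, List.prod_cons]
        have e2 : colProd A H t (j :: L) (Function.update a' j (a j)) =
            X A H j t (a j) * colProd A H t L a' := by
          rw [colProd, List.map_cons, List.prod_cons, Function.update_self, ← hc, colProd]
        rw [e1, e2, ← mul_assoc, e', mul_assoc, e, ← mul_assoc, mul_assoc _ _ (Y A H t w), hxy,
          Y_add hw' hw]
        simp only [mul_assoc]

include E hH in
/-- Elements of the column have the form `X_t(w) ∏ X_{it}(a_i)`. -/
theorem col_normal_form (L : List I)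
    (hL : L.Nodup) (hLt : ∀ j, j ∈ L ↔ j ≠ t ∧ j ≠ -t) {n : StU A H} (hn : n ∈ col A H t) :
    ∃ w ∈ Theta0 A H t, ∃ a : I → S, (∀ j ∈ L, a j ∈ Sij A H j t) ∧
      n = Y A H t w * colProd A H t L a := by
  have hX : ∀ i b, i ≠ t → i ≠ -t → b ∈ Sij A H i t → ∀ n : StU A H,
      (∃ w ∈ Theta0 A H t, ∃ a : I → S, (∀ j ∈ L, a j ∈ Sij A H j t) ∧
        n = Y A H t w * colProd A H t L a) →
      (∃ w ∈ Theta0 A H t, ∃ a : I → S, (∀ j ∈ L, a j ∈ Sij A H j t) ∧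
        X A H i t b * n = Y A H t w * colProd A H t L a) := by
    rintro i b h1 h2 hb _ ⟨w, hw, a, ha, rfl⟩
    obtain ⟨w', hw', a', ha', e⟩ := X_mul_colProd E hH h1 h2 hb L hL (fun j hj => (hLt j).1 hj)
      ((hLt i).2 ⟨h1, h2⟩) a ha
    have hxy := conj_XY h1 h2 hb hw h1 (fun h => hH.neg_ne t h.symm)
    rw [mul_inv_eq_iff_eq_mul] at hxy
    refine ⟨w + w', E.Theta0_add hH hw hw', a', ha', ?_⟩
    rw [← mul_assoc, hxy, mul_assoc, e, Y_add hw hw', mul_assoc]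
  have hY : ∀ u, u ∈ Theta0 A H t → ∀ n : StU A H,
      (∃ w ∈ Theta0 A H t, ∃ a : I → S, (∀ j ∈ L, a j ∈ Sij A H j t) ∧
        n = Y A H t w * colProd A H t L a) →
      (∃ w ∈ Theta0 A H t, ∃ a : I → S, (∀ j ∈ L, a j ∈ Sij A H j t) ∧
        Y A H t u * n = Y A H t w * colProd A H t L a) := by
    rintro u hu _ ⟨w, hw, a, ha, rfl⟩
    exact ⟨u + w, E.Theta0_add hH hu hw, a, ha, by rw [Y_add hu hw, mul_assoc]⟩
  induction hn using Subgroup.closure_induction_left with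
  | one =>
    refine ⟨0, E.Theta0_zero hH, fun _ => 0, fun _ _ => E.Sij_zero hH, ?_⟩
    rw [Y_zero E hH, one_mul, colProd, List.prod_eq_one]
    intro x hx
    obtain ⟨j, hj, rfl⟩ := List.mem_map.1 hx
    exact X_zero E hH ((hLt j).1 hj).1 ((hLt j).1 hj).2
  | mul_left x hx y _ ih =>
    rcases hx with ⟨k, b, hk, hk', hb, rfl⟩ | ⟨u, hu, rfl⟩
    · exact hX k b hk hk' hb y ih
    · exact hY u hu y ih
  | inv_mul_cancel x hx y _ ih =>
    rcases hx with ⟨k, b, hk, hk', hb, rfl⟩ | ⟨u, hu, rfl⟩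
    · rw [← X_neg E hH hk hk' hb]
      exact hX k _ hk hk' (E.Sij_neg hH hb) y ih
    · rw [← Y_neg E hH hu]
      exact hY _ (E.Theta0_neg hH hu) y ih

/-- The vector `Σ q_i · a_i` with `T_t(Σ q_i · a_i) = ∏ T_{it}(a_i)`. -/
def colVec (E : Ambient A B Γ) (H : Family R Δ I) (L : List I) (a : I → S) : Γ :=
  (L.map fun i => act ((E.fam H).q i) (E.s (a i))).sum

theorem st_colProd (L : List I)
    (hLt : ∀ j ∈ L, j ≠ t ∧ j ≠ -t) (a : I → S)
    (ha : ∀ j ∈ L, a j ∈ Sij A H j t) :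
    IsIso (E.fam H) t (colVec E H L a) ∧
      E.st hH (colProd A H t L a) = gY (E.fam H) t (colVec E H L a) := by
  have hN := E.fam_isHyp hH
  induction L with
  | nil =>
    refine ⟨⟨zero_act _, ?_, ?_⟩, ?_⟩
    · simp [colVec, pi_zero]
    · simp [colVec, pi_zero]
    · simp [colVec, colProd, gY_zero hN]
  | cons j L ih =>
    obtain ⟨i1, i2⟩ := ih (fun k hk => hLt k (List.mem_cons_of_mem _ hk))
      (fun k hk => ha k (List.mem_cons_of_mem _ hk))
    have haj := ha j List.mem_cons_self
    have hj := hLt j List.mem_cons_self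
    have hi := (E.isMat hH haj).isIso hN hj.1 hj.2
    have e1 : colProd A H t (j :: L) a = X A H j t (a j) * colProd A H t L a := by
      rw [colProd, colProd, List.map_cons, List.prod_cons]
    have e2 : colVec E H (j :: L) a = act ((E.fam H).q j) (E.s (a j)) + colVec E H L a := by
      rw [colVec, colVec, List.map_cons, List.sum_cons]
    rw [e1, e2]
    refine ⟨hi.add i1, ?_⟩
    rw [map_mul, i2, gY_add hN hi i1, E.st_X hH hj.1 hj.2 haj, gX]

include hH in
theorem pi_colVec (L : List I) (hL : L.Nodup) (a : I → S)
    (ha : ∀ j ∈ L, a j ∈ Sij A H j t) :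
    (i ∈ L → (E.fam H).e i * pi (colVec E H L a) = E.s (a i)) ∧
      (i ∉ L → (E.fam H).e i * pi (colVec E H L a) = 0) := by
  have hN := E.fam_isHyp hH
  induction L with
  | nil => simp [colVec, pi_zero]
  | cons j L ih =>
    rw [List.nodup_cons] at hL
    have ih' := ih hL.2 (fun k hk => ha k (List.mem_cons_of_mem _ hk))
    have hm := E.isMat hH (ha j List.mem_cons_self)
    have e2 : colVec E H (j :: L) a = act ((E.fam H).q j) (E.s (a j)) + colVec E H L a := by
      rw [colVec, colVec, List.map_cons, List.sum_cons]
    rw [e2, pi_add, pi_q_act hN hm.1, mul_add, List.mem_cons]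
    by_cases hij : i = j
    · subst hij
      rw [hm.1, ih'.2 hL.1]; simp
    · rw [hm.e_mul hN hij, zero_add]; simpa [hij] using ih'

/-- The transvections `T_t(z)` are determined by their action on `e_t`. -/
theorem eq_zero_of_act_tY {N : Family B Γ I} (hN : N.IsHyp) {z : Γ} (hz : IsIso N t z)
    (h : act (tY N t z) (N.e t) = 0) : z = 0 := by
  have e1 : act (tY N t z) (N.e t) = z + (phi (-(rho z) : B) + act (N.q (-t)) (rho z : B)) := by
    simp only [tY, add_act, hz.act, neg_phi, phi_act, ← act_mul, sub_mul, hz.rho_e hN,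
      hz.star_pi_e hN, sub_zero, mul_neg, neg_mul, mul_add, hN.star_e, hz.e_rho hN, hz.e_neg_pi,
      add_zero, add_assoc]
  rw [e1] at h
  have e2 := congrArg (fun w : Γ => N.e (-t) * (pi w : B)) h
  simp only [pi_add, pi_phi, pi_act, hN.pi_q, mul_add, hz.e_neg_pi, hz.e_rho hN, pi_zero, mul_zero,
    zero_add] at e2
  rw [e2, neg_zero, phi_zero, act_zero, zero_add, add_zero] at h
  exact h

include E hH in
/-- The canonical map to the unitary group is faithful on a column; even the action of the image on
`e_t` determines the element, since it recovers all parameters of the normal form. -/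
theorem eq_one_of_col [Finite I] {n : StU A H} (hn : n ∈ col A H t)
    (h : act (E.st hH n).val ((E.fam H).e t) = 0) : n = 1 := by
  classical
  have hN := E.fam_isHyp hH
  let _ := Fintype.ofFinite I
  set L : List I := (Finset.univ.filter fun j => j ≠ t ∧ j ≠ -t).toList with hLdef
  have hL : L.Nodup := Finset.nodup_toList _
  have hLt : ∀ j, j ∈ L ↔ j ≠ t ∧ j ≠ -t := by intro j; simp [hLdef]
  obtain ⟨w, hw, a, ha, rfl⟩ := col_normal_form E hH L hL hLt hn
  obtain ⟨i1, i2⟩ := st_colProd E hH L (fun j hj => (hLt j).1 hj) a ha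
  have hwi := E.isIso hH hw
  rw [map_mul, i2, E.st_Y hH hw, ← gY_add hN hwi i1, gY_val hN (hwi.add i1)] at h
  have hz := eq_zero_of_act_tY hN (hwi.add i1) h
  have ha0 : ∀ j ∈ L, a j = 0 := by
    intro j hj
    have := congrArg (fun w : Γ => (E.fam H).e j * (pi w : B)) hz
    simp only [pi_add, mul_add, E.e_pi hH hw, zero_add, pi_zero, mul_zero] at this
    exact E.s_inj (by rw [← (pi_colVec E hH L hL a ha).1 hj, this, map_zero])
  have hc : colProd A H t L a = 1 := by
    rw [colProd, List.prod_eq_one]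
    intro x hx
    obtain ⟨j, hj, rfl⟩ := List.mem_map.1 hx
    rw [ha0 j hj]
    exact X_zero E hH ((hLt j).1 hj).1 ((hLt j).1 hj).2
  have hv : colVec E H L a = 0 := by
    rw [colVec]
    apply List.sum_eq_zero
    intro x hx
    obtain ⟨j, hj, rfl⟩ := List.mem_map.1 hx
    rw [ha0 j hj, map_zero, act_zero]
  rw [hv, add_zero] at hz
  have : w = 0 := E.t_inj (by rw [hz, map_zero])
  rw [hc, this, Y_zero E hH, one_mul]

/-- The elements of the unitary group that fix `e_t`. -/
def fixSub (N : Family B Γ I) (t : I) : Subgroup (UGrp B Γ) where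
  carrier := {f | act f.val (N.e t) = 0}
  one_mem' := zero_act _
  mul_mem' {f g} hf hg := by
    simp only [Set.mem_ofPred_eq] at *
    have hp : pi g.val * N.e t = (0 : B) := by rw [← pi_act, hg, pi_zero]
    rw [UGrp.val_mul, umul, add_act, add_act, ← act_mul, hp, act_zero, hf, hg, add_zero, add_zero]
  inv_mem' {f} hf := by
    simp only [Set.mem_ofPred_eq] at *
    have hp : pi f.val * N.e t = (0 : B) := by rw [← pi_act, hf, pi_zero]
    have h : act (f⁻¹ * f).val (N.e t) = 0 := by rw [inv_mul_cancel]; exact zero_act _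
    rwa [UGrp.val_mul, umul, add_act, add_act, ← act_mul, hp, act_zero, hf, zero_add, zero_add] at h

theorem gY_mem_fixSub {N : Family B Γ I} (hN : N.IsHyp) {w : Γ} (hw : IsIso N j w) (hj : j ≠ t)
    (hz : N.e (-t) * pi w = 0) : gY N j w ∈ fixSub N t := by
  show act (gY N j w).val (N.e t) = 0
  have e1 : pi w * N.e t = 0 := IsIso.mul_of hw.pi_e (hN.orth _ _ hj)
  have e2 : star (pi w) * N.e t = 0 := by
    rw [← neg_neg t, ← hN.star_e, ← star_mul, hz, star_zero]
  rw [gY_val hN hw, act_tY_self hN hw (hN.orth _ _ hj), e1, e2]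
  simp [phi_zero, act_zero]

theorem act_umul_fix {N : Family B Γ I} {f g : UGrp B Γ} (hg : g ∈ fixSub N t) :
    act (f * g).val (N.e t) = act f.val (N.e t) := by
  have hg : act g.val (N.e t) = 0 := hg
  have hp : pi g.val * N.e t = (0 : B) := by rw [← pi_act, hg, pi_zero]
  rw [UGrp.val_mul, umul, add_act, add_act, ← act_mul, hp, act_zero, hg, zero_add, zero_add]

variable [Finite I] {ω : I → ℤ}

include E hH in
/-- If `t` has the maximal weight among the indices in `s`, then every root element of positive
weight either lies in the column of `t` or does not involve `±t`, and in the second case it normalizes the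
column. -/
theorem tri_decomp [DecidableEq I] (hω : IsOdd ω) (s : Finset I) (hs : ∀ i ∈ s, -i ∈ s) (hts : t ∈ s)
    (hmax : ∀ i ∈ s, ω i ≤ ω t) {g : StU A H} (hg : g ∈ tri A H ω s) :
    ∃ n ∈ col A H t, ∃ k ∈ tri A H ω ((s.erase t).erase (-t)), g = n * k := by
  have hX : ∀ i j a, i ≠ j → i ≠ -j → a ∈ Sij A H i j → i ∈ s → j ∈ s → ω i < ω j → ∀ g : StU A H,
      (∃ n ∈ col A H t, ∃ k ∈ tri A H ω ((s.erase t).erase (-t)), g = n * k) →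
      (∃ n ∈ col A H t, ∃ k ∈ tri A H ω ((s.erase t).erase (-t)), X A H i j a * g = n * k) := by
    rintro i j a h1 h2 ha hi hj h3 _ ⟨n, hn, k, hk, rfl⟩
    by_cases e1 : j = t
    · subst e1
      exact ⟨_, mul_mem (X_mem_col h1 h2 ha) hn, k, hk, (mul_assoc _ _ _).symm⟩
    by_cases e2 : i = -t
    · subst e2
      rw [X_sym h1 h2 ha]
      have := E.Sij_star hH ha
      rw [neg_neg] at this ⊢
      exact ⟨_, mul_mem (X_mem_col (fun h => h1 (by rw [← h, neg_neg])) (neg_ne_neg' e1) this) hn, k, hk,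
        (mul_assoc _ _ _).symm⟩
    have e3 : i ≠ t := by
      rintro rfl; exact absurd (hmax j hj) (not_le.2 h3)
    have e4 : j ≠ -t := by
      rintro rfl
      have := hmax _ (hs i hi)
      rw [hω] at this h3
      omega
    refine ⟨_, X_conj_col E hH h1 h2 ha e3 e2 e1 e4 hn, X A H i j a * k, mul_mem ?_ hk, by group⟩
    exact Subgroup.subset_closure (Or.inl ⟨i, j, a, h1, h2, ha, by simp [*], by simp [*], h3, rfl⟩)
  have hY : ∀ j u, u ∈ Theta0 A H j → j ∈ s → 0 < ω j → ∀ g : StU A H,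
      (∃ n ∈ col A H t, ∃ k ∈ tri A H ω ((s.erase t).erase (-t)), g = n * k) →
      (∃ n ∈ col A H t, ∃ k ∈ tri A H ω ((s.erase t).erase (-t)), Y A H j u * g = n * k) := by
    rintro j u hu hj h3 _ ⟨n, hn, k, hk, rfl⟩
    by_cases e1 : j = t
    · subst e1
      exact ⟨_, mul_mem (Y_mem_col hu) hn, k, hk, (mul_assoc _ _ _).symm⟩
    have e4 : j ≠ -t := by
      rintro rfl
      have := hmax _ hj
      rw [hω] at this h3
      omega
    refine ⟨_, Y_conj_col E hH hu e1 e4 hn, Y A H j u * k, mul_mem ?_ hk, by group⟩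
    exact Subgroup.subset_closure (Or.inr ⟨j, u, hu, by simp [*], h3, rfl⟩)
  induction hg using Subgroup.closure_induction_left with
  | one => exact ⟨1, one_mem _, 1, one_mem _, by simp⟩
  | mul_left x hx y _ ih =>
    rcases hx with ⟨i, j, a, h1, h2, ha, hi, hj, h3, rfl⟩ | ⟨j, u, hu, hj, h3, rfl⟩
    · exact hX i j a h1 h2 ha hi hj h3 y ih
    · exact hY j u hu hj h3 y ih
  | inv_mul_cancel x hx y _ ih =>
    rcases hx with ⟨i, j, a, h1, h2, ha, hi, hj, h3, rfl⟩ | ⟨j, u, hu, hj, h3, rfl⟩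
    · rw [← X_neg E hH h1 h2 ha]
      exact hX i j _ h1 h2 (E.Sij_neg hH ha) hi hj h3 y ih
    · rw [← Y_neg E hH hu]
      exact hY j _ (E.Theta0_neg hH hu) hj h3 y ih

theorem st_tri_mem_fixSub [DecidableEq I] (s : Finset I) {k : StU A H}
    (hk : k ∈ tri A H ω ((s.erase t).erase (-t))) : E.st hH k ∈ fixSub (E.fam H) t := by
  have hN := E.fam_isHyp hH
  suffices h : tri A H ω ((s.erase t).erase (-t)) ≤ (fixSub (E.fam H) t).comap (E.st hH) from h hk
  refine (Subgroup.closure_le _).2 ?_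
  rintro x (⟨i, j, a, h1, h2, ha, hi, hj, h3, rfl⟩ | ⟨j, u, hu, hj, h3, rfl⟩)
  · simp only [Finset.mem_erase] at hi hj
    show E.st hH (X A H i j a) ∈ fixSub (E.fam H) t
    rw [E.st_X hH h1 h2 ha, gX]
    refine gY_mem_fixSub hN ((E.isMat hH ha).isIso hN h1 h2) hj.2.1 ?_
    rw [pi_q_act hN (E.isMat hH ha).1, (E.isMat hH ha).e_mul hN (Ne.symm hi.1)]
  · simp only [Finset.mem_erase] at hj
    show E.st hH (Y A H j u) ∈ fixSub (E.fam H) t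
    rw [E.st_Y hH hu]
    exact gY_mem_fixSub hN (E.isIso hH hu) hj.2.1 (E.e_pi hH hu _)

/-- Peeling off the columns of indices of maximal weight one after another: the factor without the
indices `±t` fixes `e_t`, so the factor from the column of `t` acts trivially on `e_t`. -/
theorem eq_one_of_tri [DecidableEq I] (hω : IsOdd ω) (s : Finset I) (hs : ∀ i ∈ s, -i ∈ s) {g : StU A H}
    (hg : g ∈ tri A H ω s) (h : E.st hH g = 1) : g = 1 := by
  induction s using Finset.strongInduction generalizing g with
  | H s ih =>
    rcases s.eq_empty_or_nonempty with rfl | hne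
    · have : tri A H ω ∅ ≤ ⊥ := by
        refine (Subgroup.closure_le _).2 ?_
        rintro x (⟨i, j, a, h1, h2, ha, hi, hj, h3, rfl⟩ | ⟨j, u, hu, hj, h3, rfl⟩)
        · simp at hi
        · simp at hj
      exact this hg
    · obtain ⟨t, hts, hmax⟩ := s.exists_max_image ω hne
      obtain ⟨n, hn, k, hk, rfl⟩ := tri_decomp E hH hω s hs hts hmax hg
      have hf := st_tri_mem_fixSub E hH s hk
      have h1 : n = 1 := by
        apply eq_one_of_col E hH hn
        rw [← act_umul_fix hf, ← map_mul, h]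
        exact zero_act _
      subst h1
      rw [one_mul] at h ⊢
      refine ih _ ?_ (fun i hi => ?_) hk h
      · exact (Finset.erase_subset _ _).trans_ssubset (Finset.erase_ssubset hts)
      · simp only [Finset.mem_erase] at hi ⊢
        exact ⟨neg_ne_neg' hi.2.1, ne_neg (hi.1), hs i hi.2.2⟩

include E hH in
theorem stSub_posRoots_le [Fintype I] (hω : IsOdd ω) :
    stSub A H (posRoots ω) ≤ tri A H ω Finset.univ := by
  refine stSub_le (fun i j a h1 h2 ha h => ?_) (fun j u hu h => ?_) (fun j a ha h => ?_)
  · refine Subgroup.subset_closure (Or.inl ⟨i, j, a, h1, h2, ha, by simp, by simp, ?_, rfl⟩)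
    have := h.2
    rw [ht_sub, ht_vec hω, ht_vec hω] at this
    omega
  · refine Subgroup.subset_closure (Or.inr ⟨j, u, hu, by simp, ?_, rfl⟩)
    have := h.2
    rw [ht_vec hω] at this
    omega
  · refine Subgroup.subset_closure (Or.inr ⟨j, _, E.Theta0_phi hH ha, by simp, ?_, rfl⟩)
    have := h.2
    rw [ht_add, ht_vec hω] at this
    omega

/-- The canonical map to the unitary group is faithful on the subgroup generated by the root
subgroups on the positive side of a linear functional. -/
theorem st_injOn (hω : IsOdd ω) {x y : StU A H} (hx : x ∈ stSub A H (posRoots ω))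
    (hy : y ∈ stSub A H (posRoots ω)) (h : E.st hH x = E.st hH y) : x = y := by
  classical
  let _ := Fintype.ofFinite I
  rw [← mul_inv_eq_one]
  refine eq_one_of_tri E hH hω Finset.univ (by simp)
    (stSub_posRoots_le E hH hω (mul_mem hx (inv_mem hy))) ?_
  rw [map_mul, map_inv, h, mul_inv_cancel]

end Inj

/-! ### Labels of classes -/

section Labels

variable {I J : Type*} [InvolutiveNeg I] [InvolutiveNeg J]

/-- The properties of the labelling `c` of the classes of a quotient that do not refer to the root
subsystem. -/
structure IsLabel (c : I → Option J) : Prop where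
  neg : ∀ i, c (-i) = (c i).map (fun E => -E)
  surj : ∀ E, ∃ i, c i = some E
  neg_ne : ∀ E : J, -E ≠ E

/-- The image of a basis vector under the projection of root lattices. -/
def vecOpt : Option J → J → ℤ
  | none => 0
  | some E => vec E

/-- Weights on the index set of a quotient, as weights on the original index set; they vanish
outside the classes. -/
def pull (c : I → Option J) (ω : J → ℤ) (i : I) : ℤ := (c i).elim 0 ω

variable {c : I → Option J}

theorem IsLabel.neg_some (hc : IsLabel c) {i : I} {F : J} (h : c i = some F) : c (-i) = some (-F) := by
  rw [hc.neg, h]; rfl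

theorem IsLabel.neg_none (hc : IsLabel c) {i : I} (h : c i = none) : c (-i) = none := by
  rw [hc.neg, h]; rfl

theorem IsLabel.isOdd_pull (hc : IsLabel c) {ω : J → ℤ} (hω : IsOdd ω) : IsOdd (pull c ω) := by
  intro i
  rcases h : c i with _ | F
  · simp [pull, hc.neg_none h, h]
  · simp [pull, hc.neg_some h, h, hω F]

variable [Finite I]

theorem mem_fiber {i : I} {F : J} : i ∈ fiber c F ↔ c i = some F := by
  simp [fiber]

theorem proj_add (v w : I → ℤ) : proj c (v + w) = proj c v + proj c w := by
  ext F; simp [proj, Finset.sum_add_distrib]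

theorem proj_neg (v : I → ℤ) : proj c (-v) = -proj c v := by
  ext F; simp [proj]

theorem proj_sub (v w : I → ℤ) : proj c (v - w) = proj c v - proj c w := by
  ext F; simp [proj]

theorem proj_vec (hc : IsLabel c) (i : I) : proj c (vec i) = vecOpt (c i) := by
  classical
  ext F
  have key : ∀ k : I, ∑ j ∈ fiber c F, (Pi.single k 1 : I → ℤ) j = if c k = some F then 1 else 0 := by
    intro k
    have : ∀ j : I, (Pi.single k 1 : I → ℤ) j = if j = k then 1 else 0 := by
      intro j; simp [Pi.single_apply]
    simp only [this, Finset.sum_ite_eq', mem_fiber]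
  have h1 := key i
  have h2 := key (-i)
  simp only [proj, vec, Pi.sub_apply, Finset.sum_sub_distrib]
  refine (congrArg₂ (· - ·) h1 h2).trans ?_
  rcases h : c i with _ | G
  · simp [hc.neg_none h, vecOpt]
  · simp only [hc.neg_some h, vecOpt, vec, Option.some.injEq, Pi.sub_apply, Pi.single_apply, eq_comm]

theorem ht_vecOpt [Finite J] {ω : J → ℤ} (hω : IsOdd ω) (hc : IsLabel c) (i : I) :
    ht ω (vecOpt (c i)) = ht (pull c ω) (vec i) := by
  rw [ht_vec (hc.isOdd_pull hω)]
  rcases h : c i with _ | G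
  · simp [vecOpt, ht_zero, pull, h]
  · simp [vecOpt, ht_vec hω, pull, h]

theorem ht_proj [Finite J] {ω : J → ℤ} (hω : IsOdd ω) (hc : IsLabel c) {α : I → ℤ} (hα : α ∈ roots I) :
    ht (pull c ω) α = ht ω (proj c α) := by
  rcases hα with ⟨i, rfl⟩ | ⟨i, j, _, rfl⟩
  · rw [proj_vec hc, ht_vecOpt hω hc]
  · rw [proj_add, ht_add, ht_add, proj_vec hc, proj_vec hc, ht_vecOpt hω hc, ht_vecOpt hω hc]

theorem pre_subset_posRoots [Finite J] {ω : J → ℤ} (hω : IsOdd ω) (hc : IsLabel c) {P : Set (J → ℤ)}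
    (hP : ∀ β ∈ P, 0 < ht ω β) : pre c P ⊆ posRoots (pull c ω) := fun α hα =>
  ⟨hα.1, by rw [ht_proj hω hc hα.1]; exact hP _ hα.2⟩

end Labels

/-! ### Quotient families -/

section Push

variable {B Γ : Type*} [NonUnitalRing B] [StarRing B] [AddGroup Γ] [OddFormRing B Γ]
variable {I J : Type*} [InvolutiveNeg I] [InvolutiveNeg J] [Finite I]
variable {c : I → Option J} {N : Family B Γ I} {i j : I} {F G : J}

theorem e_push_mul (hN : N.IsHyp) (h : c i = some F) : (N.push c).e F * N.e i = N.e i := by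
  simp only [Family.push, Finset.sum_mul]
  rw [Finset.sum_eq_single i, hN.idem]
  · intro j _ hj; exact hN.orth _ _ hj
  · intro h'; exact absurd (mem_fiber.2 h) h'

theorem mul_e_push (hN : N.IsHyp) (h : c i = some F) : N.e i * (N.push c).e F = N.e i := by
  simp only [Family.push, Finset.mul_sum]
  rw [Finset.sum_eq_single i, hN.idem]
  · intro j _ hj; exact hN.orth _ _ hj.symm
  · intro h'; exact absurd (mem_fiber.2 h) h'

theorem e_push_mul_zero (hN : N.IsHyp) (h : c i ≠ some F) : (N.push c).e F * N.e i = 0 := by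
  simp only [Family.push, Finset.sum_mul]
  refine Finset.sum_eq_zero fun j hj => hN.orth _ _ ?_
  rintro rfl
  exact h (mem_fiber.1 hj)

theorem mul_e_push_zero (hN : N.IsHyp) (h : c i ≠ some F) : N.e i * (N.push c).e F = 0 := by
  simp only [Family.push, Finset.mul_sum]
  refine Finset.sum_eq_zero fun j hj => hN.orth _ _ ?_
  rintro rfl
  exact h (mem_fiber.1 hj)

theorem sum_q (hN : N.IsHyp) (hc : IsLabel c) (L : List I) (hL : ∀ i ∈ L, c i = some F) :
    (pi ((L.map N.q).sum) : B) = (L.map N.e).sum ∧ (rho ((L.map N.q).sum) : B) = 0 := by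
  induction L with
  | nil => simp [pi_zero, rho_zero]
  | cons i L ih =>
    obtain ⟨h1, h2⟩ := ih fun k hk => hL k (List.mem_cons_of_mem _ hk)
    have hi := hL i List.mem_cons_self
    simp only [List.map_cons, List.sum_cons, pi_add, rho_add, hN.pi_q, hN.rho_q, h1, h2, true_and,
      zero_sub, add_zero, neg_eq_zero]
    have hz : ∀ M : List I, (∀ k ∈ M, c k = some F) → N.e (-i) * (M.map N.e).sum = 0 := by
      intro M hM
      induction M with
      | nil => simp
      | cons k M ihM =>
        rw [List.map_cons, List.sum_cons, mul_add, ihM fun k hk => hM k (List.mem_cons_of_mem _ hk),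
          add_zero]
        refine hN.orth _ _ ?_
        rintro rfl
        have h3 := hM _ List.mem_cons_self
        rw [hc.neg_some hi, Option.some.injEq] at h3
        exact hc.neg_ne F h3
    rw [hN.star_e]
    exact hz L fun k hk => hL k (List.mem_cons_of_mem _ hk)

theorem push_isHyp (hN : N.IsHyp) (hc : IsLabel c) : (N.push c).IsHyp := by
  have hL : ∀ F : J, ∀ i ∈ (fiber c F).toList, c i = some F := fun F i hi =>
    mem_fiber.1 (Finset.mem_toList.1 hi)
  have hsum : ∀ F : J, ((fiber c F).toList.map N.e).sum = (N.push c).e F := fun F => by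
    rw [Finset.sum_map_toList]; rfl
  refine ⟨fun F => ?_, fun F => ?_, fun F G h => ?_, fun F => ?_, fun F => ?_, fun F => ?_, hc.neg_ne⟩
  · simp only [Family.push, star_sum, hN.star_e]
    refine Finset.sum_nbij' (fun i => -i) (fun i => -i) ?_ ?_ ?_ ?_ ?_
    · intro i hi; exact mem_fiber.2 (hc.neg_some (mem_fiber.1 hi))
    · intro i hi
      have := hc.neg_some (mem_fiber.1 hi)
      rw [neg_neg] at this
      exact mem_fiber.2 this
    · simp
    · simp
    · simp
  · have : (N.push c).e F = ∑ i ∈ fiber c F, N.e i := rfl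
    conv_lhs => rw [this, Finset.sum_mul]
    rw [this]
    exact Finset.sum_congr rfl fun i hi => mul_e_push hN (mem_fiber.1 hi)
  · have : (N.push c).e F = ∑ i ∈ fiber c F, N.e i := rfl
    rw [this, Finset.sum_mul]
    refine Finset.sum_eq_zero fun i hi => mul_e_push_zero hN ?_
    rw [mem_fiber.1 hi]; simpa using h
  · rw [← hsum]; exact (sum_q hN hc _ (hL F)).1
  · exact (sum_q hN hc _ (hL F)).2
  · have : ∀ L : List I, (∀ i ∈ L, c i = some F) →
        (L.map N.q).sum = act ((L.map N.q).sum) ((N.push c).e F) := by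
      intro L hL
      induction L with
      | nil => simp [zero_act]
      | cons i L ih =>
        rw [List.map_cons, List.sum_cons, add_act,
          ← ih fun k hk => hL k (List.mem_cons_of_mem _ hk)]
        have h1 : act (N.q i) ((N.push c).e F) = N.q i := by
          conv_lhs => rw [hN.act_q i, ← act_mul, mul_e_push hN (hL i List.mem_cons_self)]
          exact (hN.act_q i).symm
        rw [h1]
    exact this _ (hL F)

/-- The element `q_E` of a quotient family restricts to `q_i` for every `i` in the class. -/
theorem q_push_act (hN : N.IsHyp) (h : c i = some F) : act ((N.push c).q F) (N.e i) = N.q i := by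
  classical
  have key : ∀ L : List I, L.Nodup → act ((L.map N.q).sum) (N.e i) = if i ∈ L then N.q i else 0 := by
    intro L hL
    induction L with
    | nil => simp [zero_act]
    | cons j L ih =>
      rw [List.nodup_cons] at hL
      rw [List.map_cons, List.sum_cons, add_act, ih hL.2, hN.act_q j, ← act_mul]
      by_cases hij : j = i
      · subst hij
        rw [if_neg hL.1, hN.idem, ← hN.act_q, if_pos List.mem_cons_self, add_zero]
      · rw [hN.orth _ _ hij, act_zero]
        simp [Ne.symm hij]
  have := key _ (Finset.nodup_toList (fiber c F))
  rwa [if_pos (Finset.mem_toList.2 (mem_fiber.2 h))] at this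

theorem q_push_act_of (hN : N.IsHyp) (h : c i = some F) {a : B} (ha : N.e i * a = a) :
    act ((N.push c).q F) a = act (N.q i) a := by
  rw [← ha, act_mul, q_push_act hN h, ha]

omit [Finite I] in
theorem gY_congr {N : Family B Γ I} {N' : Family B Γ J} {u v : Γ}
    (h : tY N i u = tY N' F v) : gY N i u = gY N' F v := by
  unfold gY
  generalize tY N i u = x at h
  subst h
  rfl

/-- If the parameter `u` involves only one index `j` of a class, then the root element for the class
equals the one for `j`. -/
theorem gY_push (hN : N.IsHyp) (hc : IsLabel c) (h : c j = some F) {u : Γ} (hu : act u (N.e j) = u) :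
    gY (N.push c) F u = gY N j u := by
  refine (gY_congr ?_).symm
  have h1 : pi u * N.e j = (pi u : B) := by rw [← pi_act, hu]
  have h2 : (rho u : B) = N.e (-j) * rho u * N.e j := by rw [← hN.star_e, ← rho_act, hu]
  have h3 : N.e (-j) * (rho u - star (pi u)) = (rho u - star (pi u) : B) := by
    rw [mul_sub]
    congr 1
    · conv_lhs => rw [h2]
      rw [← mul_assoc, ← mul_assoc, hN.idem, ← h2]
    · rw [← hN.star_e, ← star_mul, h1]
  rw [tY, tY, q_push_act_of hN (hc.neg_some h) h3]

/-- A long root element for a class, whose parameter lies in `e_{-i} B e_j` for distinct `i`, `j` in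
the class, is a short root element for the original family. -/
theorem gY_push_phi (hN : N.IsHyp) (hc : IsLabel c) (hi : c i = some F) (hj : c j = some F)
    {a : B} (ha : IsMat N (-i) j a) : gY (N.push c) F (phi a) = gX N (-i) j a := by
  refine (gY_congr ?_).symm
  have hs := ha.star hN
  rw [neg_neg] at hs
  have hs' : N.e (-j) * star a = star a := by simpa using hs.1
  symm
  rw [tX_eq hN ha, tY, rho_phi, pi_phi, star_zero, add_zero, sub_zero,
    sub_eq_add_neg, act_add_of_rho (push_isHyp hN hc |>.rho_q _),
    act_neg_of_rho (push_isHyp hN hc |>.rho_q _), q_push_act_of hN (hc.neg_some hi) ha.1,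
    q_push_act_of hN (hc.neg_some hj) hs', neg_phi, ← phi_add, neg_phi, phi_comm]
  congr 1
  exact (phi_congr (star a) (by rw [star_star]; noncomm_ring))

theorem fam_push {R Δ S Θ : Type*} [NonUnitalRing R] [StarRing R] [AddGroup Δ] [OddFormRing R Δ]
    [NonUnitalRing S] [StarRing S] [AddGroup Θ] [OddFormRing S Θ] {A : ActionData R Δ S Θ}
    (E : Ambient A B Γ) (H : Family R Δ I) (c : I → Option J) :
    E.fam (H.push c) = (E.fam H).push c := by
  simp only [Ambient.fam, Family.push, Family.mk.injEq]
  refine ⟨?_, ?_⟩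
  · ext F; rw [map_sum]
  · ext F; rw [map_list_sum, List.map_map]; rfl

end Push

/-! ### Roots as weights -/

section Weights

variable {I : Type*} [InvolutiveNeg I] {i j : I}

theorem vec_apply [DecidableEq I] (i j : I) :
    vec i j = (if j = i then 1 else 0) - (if j = -i then 1 else 0) := by
  simp only [vec, Pi.sub_apply, Pi.single_apply]
  congr

theorem isOdd_vec (i : I) : IsOdd (vec i) := by
  classical
  intro j
  have h1 : (-j = i) = (j = -i) := propext neg_eq_iff_eq_neg
  have h2 : (-j = -i) = (j = i) := propext neg_inj
  simp only [vec_apply, h1, h2]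
  ring

theorem IsOdd.add {v w : I → ℤ} (hv : IsOdd v) (hw : IsOdd w) : IsOdd (v + w) := by
  intro i; simp only [Pi.add_apply, hv i, hw i]; ring

theorem IsOdd.neg {v : I → ℤ} (hv : IsOdd v) : IsOdd (-v) := by
  intro i; simp only [Pi.neg_apply, hv i]

theorem IsOdd.sub {v w : I → ℤ} (hv : IsOdd v) (hw : IsOdd w) : IsOdd (v - w) := by
  rw [sub_eq_add_neg]; exact hv.add hw.neg

theorem isOdd_of_mem_roots {α : I → ℤ} (h : α ∈ roots I) : IsOdd α := by
  rcases h with ⟨i, rfl⟩ | ⟨i, j, _, rfl⟩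
  · exact isOdd_vec i
  · exact (isOdd_vec i).add (isOdd_vec j)

theorem vec_neg_apply (i j : I) : vec i (-j) = -vec i j := isOdd_vec i j

theorem vec_comm (i j : I) : vec i j = vec j i := by
  classical
  have h2 : (j = -i) = (i = -j) := propext (by constructor <;> (rintro rfl; rw [neg_neg]))
  simp only [vec_apply, h2, eq_comm (a := i) (b := j)]

theorem vec_self (h : ∀ i : I, -i ≠ i) (i : I) : vec i i = 1 := by
  classical
  simp [vec_apply, (h i).symm]

theorem vec_nonneg (h : j ≠ -i) : 0 ≤ vec i j := by
  classical
  simp only [vec_apply, h, if_false]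
  split_ifs <;> simp

theorem vec_nonpos (h : j ≠ i) : vec i j ≤ 0 := by
  classical
  simp only [vec_apply, h, if_false]
  split_ifs <;> simp

theorem vec_eq_zero (h : j ≠ i) (h' : j ≠ -i) : vec i j = 0 :=
  le_antisymm (vec_nonpos h) (vec_nonneg h')

theorem root_ne_zero (h : ∀ i : I, -i ≠ i) {α : I → ℤ} (hα : α ∈ roots I) : α ≠ 0 := by
  rcases hα with ⟨i, rfl⟩ | ⟨i, j, hj, rfl⟩
  · intro h0
    have := congrFun h0 i
    rw [vec_self h] at this
    simp at this
  · intro h0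
    have := congrFun h0 i
    rw [Pi.add_apply, vec_self h, vec_comm] at this
    have := vec_nonneg hj
    simp at *
    omega

theorem ht_self_pos [Finite I] (h : ∀ i : I, -i ≠ i) {α : I → ℤ} (hα : α ∈ roots I) :
    0 < ht α α := by
  have := root_ne_zero h hα
  obtain ⟨i, hi⟩ := Function.ne_iff.1 this
  have := Fintype.ofFinite I
  rw [ht, finsum_eq_sum_of_fintype]
  refine Finset.sum_pos' (fun k _ => mul_self_nonneg _) ⟨i, Finset.mem_univ _, ?_⟩
  exact mul_self_pos.2 hi

end Weights

/-! ### Root elements of quotient families -/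

section Images

variable {R Δ S Θ : Type*} [NonUnitalRing R] [StarRing R] [AddGroup Δ] [OddFormRing R Δ]
  [NonUnitalRing S] [StarRing S] [AddGroup Θ] [OddFormRing S Θ]
variable {B Γ : Type*} [NonUnitalRing B] [StarRing B] [AddGroup Γ] [OddFormRing B Γ]
variable {A : ActionData R Δ S Θ} (E : Ambient A B Γ)
variable {I J : Type*} [InvolutiveNeg I] [InvolutiveNeg J] [Finite I] {H : Family R Δ I}
variable {c : I → Option J} {i j k : I} {F G : J} {P : Set (I → ℤ)} {a : S} {u v : Θ} {z w : Γ}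
variable (hH : H.IsHyp)

/-- `z` is a parameter of an ultrashort root element for the quotient family, and the transvection
with this parameter comes from the subgroup of the original Steinberg group with roots in `P`. -/
def IsImage (E : Ambient A B Γ) (hH : H.IsHyp) (c : I → Option J) (P : Set (I → ℤ)) (F : J)
    (z : Γ) : Prop :=
  IsIso ((E.fam H).push c) F z ∧
    gY ((E.fam H).push c) F z ∈ (stSub A H P).map (E.st hH)

variable {hH}

theorem IsImage.add (hc : IsLabel c) (hz : IsImage E hH c P F z) (hw : IsImage E hH c P F w) :
    IsImage E hH c P F (z + w) :=
  ⟨hz.1.add hw.1, by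
    rw [gY_add (push_isHyp (E.fam_isHyp hH) hc) hz.1 hw.1]; exact mul_mem hz.2 hw.2⟩

theorem isImage_zero (hc : IsLabel c) : IsImage E hH c P F 0 := by
  refine ⟨⟨zero_act _, ?_, ?_⟩, ?_⟩
  · rw [pi_zero, mul_zero]
  · rw [pi_zero, mul_zero]
  · rw [gY_zero (push_isHyp (E.fam_isHyp hH) hc)]; exact one_mem _

theorem act_e_push {N : Family B Γ I} (hN : N.IsHyp) (hj : c j = some F) (h : act z (N.e j) = z) :
    act z ((N.push c).e F) = z := by
  rw [← h, ← act_mul, mul_e_push hN hj]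

theorem isImage_q (hc : IsLabel c) (hj : c j = some F) (hk : c k ≠ some F) (hk' : c k ≠ some (-F))
    (hP : vec j - vec k ∈ P) (ha : a ∈ Sij A H k j) :
    IsImage E hH c P F (act ((E.fam H).q k) (E.s a)) := by
  have hN := E.fam_isHyp hH
  have hm := E.isMat hH ha
  have e : act (act ((E.fam H).q k) (E.s a)) ((E.fam H).e j) = act ((E.fam H).q k) (E.s a) := by
    rw [← act_mul, hm.2]
  have h1 : k ≠ j := by rintro rfl; exact hk hj
  have h2 : k ≠ -j := by rintro rfl; exact hk' (hc.neg_some hj)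
  refine ⟨⟨act_e_push hN hj e, ?_, ?_⟩, X A H k j a, X_mem_stSub h1 h2 ha hP, ?_⟩
  · rw [pi_q_act hN hm.1, ← hm.1, ← mul_assoc, e_push_mul_zero hN hk, zero_mul]
  · rw [pi_q_act hN hm.1, ← hm.1, ← mul_assoc, e_push_mul_zero hN hk', zero_mul]
  · rw [gY_push hN hc hj e, E.st_X hH h1 h2 ha]; rfl

theorem e_push_mul_eq_zero {N : Family B Γ I} {b : B} (h : ∀ i, c i = some F → N.e i * b = 0) :
    (N.push c).e F * b = 0 := by
  simp only [Family.push, Finset.sum_mul]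
  exact Finset.sum_eq_zero fun i hi => h i (mem_fiber.1 hi)

theorem isImage_t (hc : IsLabel c) (hj : c j = some F) (hP : vec j ∈ P) (hu : u ∈ Theta0 A H j) :
    IsImage E hH c P F (E.t u) := by
  have hN := E.fam_isHyp hH
  have e := (E.isIso hH hu).act
  refine ⟨⟨act_e_push hN hj e, ?_, ?_⟩, Y A H j u, Y_mem_stSub hu hP, ?_⟩
  · exact e_push_mul_eq_zero fun i _ => E.e_pi hH hu i
  · exact e_push_mul_eq_zero fun i _ => E.e_pi hH hu i
  · rw [gY_push hN hc hj e, E.st_Y hH hu]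

theorem isImage_phi (hc : IsLabel c) (hi : c i = some F) (hj : c j = some F)
    (hP : vec j + vec i ∈ P) (ha : a ∈ Sij A H (-i) j) :
    IsImage E hH c P F (phi (E.s a)) := by
  have hN := E.fam_isHyp hH
  have hm := E.isMat hH ha
  refine ⟨⟨?_, ?_, ?_⟩, ?_⟩
  · rw [phi_act, (push_isHyp hN hc).star_e, mul_assoc]
    conv_lhs => rw [← hm.2]
    conv_rhs => rw [← hm.1, ← hm.2]
    rw [mul_assoc, mul_e_push hN hj, hm.2]
    conv_lhs => rw [← hm.1]
    rw [← mul_assoc, e_push_mul hN (hc.neg_some hi)]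
  · rw [pi_phi, mul_zero]
  · rw [pi_phi, mul_zero]
  · by_cases hij : i = j
    · subst hij
      refine ⟨Y A H i (phi a), Yphi_mem_stSub ha hP, ?_⟩
      have hu := E.Theta0_phi hH ha
      have e := (E.isIso hH hu).act
      rw [E.st_Y hH hu, E.t_phi, gY_push hN hc hj]
      rwa [E.t_phi] at e
    · have h1 : -i ≠ j := by
        rintro rfl
        rw [hc.neg_some hi] at hj
        exact hc.neg_ne F (Option.some.inj hj)
      refine ⟨X A H (-i) j a, X_mem_stSub h1 (neg_ne_neg' hij) ha ?_, ?_⟩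
      · rw [vec_neg, sub_neg_eq_add]; exact hP
      · rw [E.st_X hH h1 (neg_ne_neg' hij) ha, gY_push_phi hN hc hi hj hm]

theorem mem_Sij_cut {b : S} : A.rmul (A.lmul (H.e i) b) (H.e j) ∈ Sij A H i j := ⟨b, rfl⟩

theorem s_cut (b : S) : E.s (A.rmul (A.lmul (H.e i) b) (H.e j)) =
    (E.fam H).e i * E.s b * (E.fam H).e j := by
  rw [E.s_rmul, E.s_lmul]; rfl

/-- A matrix with one row is the sum of its entries. -/
theorem isImage_q_row (hc : IsLabel c) (hk : c k ≠ some F) (hk' : c k ≠ some (-F))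
    (hP : ∀ j, c j = some F → vec j - vec k ∈ P) {b : S} (hb : (E.fam H).e k * E.s b = E.s b)
    (hb' : E.s b * ((E.fam H).push c).e F = E.s b) :
    IsImage E hH c P F (act ((E.fam H).q k) (E.s b)) := by
  have hN := E.fam_isHyp hH
  rw [← hb']
  have : ((E.fam H).push c).e F = ∑ j ∈ fiber c F, (E.fam H).e j := rfl
  rw [this, Finset.mul_sum]
  refine Finset.sum_induction _ (fun x => IsImage E hH c P F (act ((E.fam H).q k) x)) ?_ ?_ ?_
  · intro x y hx hy
    rw [act_add_of_rho (hN.rho_q _)]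
    exact hx.add E hc hy
  · rw [act_zero]; exact isImage_zero E hc
  · intro j hj
    rw [mem_fiber] at hj
    conv => rw [← hb, ← s_cut E b]
    exact isImage_q E hc hj hk hk' (hP j hj) mem_Sij_cut

theorem isImage_phi_sum (hc : IsLabel c)
    (hP : ∀ i j, c i = some F → c j = some F → vec j + vec i ∈ P) {b : S}
    (T : Finset I) (hT : ∀ i ∈ T, c i = some F) (hj : c j = some F) :
    IsImage E hH c P F (phi (∑ i ∈ T, (E.fam H).e (-i) * E.s b * (E.fam H).e j)) := by
  refine Finset.sum_induction _ (fun x => IsImage E hH c P F (phi x)) ?_ ?_ ?_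
  · intro x y hx hy
    rw [phi_add]; exact hx.add E hc hy
  · rw [phi_zero]; exact isImage_zero E hc
  · intro i hi
    rw [← s_cut E b]
    exact isImage_phi E hc (hT i hi) hj (hP i j (hT i hi) hj) mem_Sij_cut

/-- Short root elements of the quotient family come from the corresponding root subgroups of the
original one. -/
theorem isImage_X (hc : IsLabel c) (h1 : F ≠ G) (h2 : F ≠ -G)
    (hP : ∀ i j, c i = some F → c j = some G → vec j - vec i ∈ P) (ha : a ∈ Sij A (H.push c) F G) :
    IsImage E hH c P G (act (((E.fam H).push c).q F) (E.s a)) := by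
  have hN := E.fam_isHyp hH
  have hN' := push_isHyp hN hc
  have hm := E.isMat (push_isHyp hH hc) ha
  rw [fam_push] at hm
  rw [← hm.1]
  have : ((E.fam H).push c).e F = ∑ j ∈ fiber c F, (E.fam H).e j := rfl
  rw [this, Finset.sum_mul]
  refine Finset.sum_induction _ (fun x => IsImage E hH c P G (act (((E.fam H).push c).q F) x)) ?_ ?_ ?_
  · intro x y hx hy
    rw [act_add_of_rho (hN'.rho_q _)]
    exact hx.add E hc hy
  · rw [act_zero]; exact isImage_zero E hc
  · intro i hi
    rw [mem_fiber] at hi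
    have hs : (E.fam H).e i * E.s a = E.s (A.lmul (H.e i) a) := by rw [E.s_lmul]; rfl
    have hi1 : (E.fam H).e i * E.s (A.lmul (H.e i) a) = E.s (A.lmul (H.e i) a) := by
      rw [← hs, ← mul_assoc, hN.idem]
    rw [hs, q_push_act_of hN hi hi1]
    refine isImage_q_row E hc ?_ ?_ (fun j => hP i j hi) hi1 ?_
    · rw [hi]; simpa using h1
    · rw [hi]; simpa using h2
    · rw [← hs, mul_assoc, hm.2]

/-- Long root elements of the quotient family come from the roots `e_i + e_j` with `i`, `j` in the
class. -/
theorem isImage_Yphi (hc : IsLabel c)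
    (hP : ∀ i j, c i = some F → c j = some F → vec j + vec i ∈ P)
    (ha : a ∈ Sij A (H.push c) (-F) F) : IsImage E hH c P F (phi (E.s a)) := by
  have hN := E.fam_isHyp hH
  have hN' := push_isHyp hN hc
  have hm := E.isMat (push_isHyp hH hc) ha
  rw [fam_push] at hm
  rw [← hm.2]
  have : ((E.fam H).push c).e F = ∑ j ∈ fiber c F, (E.fam H).e j := rfl
  rw [this, Finset.mul_sum]
  refine Finset.sum_induction _ (fun x => IsImage E hH c P F (phi x)) ?_ ?_ ?_
  · intro x y hx hy
    rw [phi_add]; exact hx.add E hc hy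
  · rw [phi_zero]; exact isImage_zero E hc
  · intro j hj
    have := isImage_phi_sum E (hH := hH) (b := a) hc hP (fiber c F) (fun i => mem_fiber.1) (mem_fiber.1 hj)
    rw [← Finset.sum_mul, ← Finset.sum_mul] at this
    have e : ∑ i ∈ fiber c F, (E.fam H).e (-i) = ((E.fam H).push c).e (-F) := by
      rw [← hN'.star_e]
      simp only [Family.push, star_sum, hN.star_e]
    rwa [e, hm.1] at this

/-- Ultrashort root elements of the quotient family with parameters orthogonal to all `e_k`: the
parameter is the sum of its restrictions to the members of the class up to elements `φ(a)`. -/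
theorem isImage_Y_of_isotropic (hc : IsLabel c)
    (hP1 : ∀ j, c j = some F → vec j ∈ P)
    (hP : ∀ i j, c i = some F → c j = some F → vec j + vec i ∈ P)
    (hu : act (E.t u) (((E.fam H).push c).e F) = E.t u)
    (hu' : ∀ k, (E.fam H).e k * pi (E.t u) = 0) : IsImage E hH c P F (E.t u) := by
  classical
  have hN := E.fam_isHyp hH
  have key : ∀ T : Finset I, (∀ i ∈ T, c i = some F) →
      IsImage E hH c P F (act (E.t u) (∑ j ∈ T, (E.fam H).e j)) := by
    intro T
    induction T using Finset.induction_on with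
    | empty => intro _; rw [Finset.sum_empty, act_zero]; exact isImage_zero E hc
    | insert j T hj ih =>
      intro hT
      have hT' : ∀ i ∈ T, c i = some F := fun i hi => hT i (Finset.mem_insert_of_mem hi)
      have hj' := hT j (Finset.mem_insert_self _ _)
      rw [Finset.sum_insert hj, act_add]
      refine (IsImage.add E hc ?_ ?_).add E hc (ih hT')
      · have : act (E.t u) ((E.fam H).e j) = E.t (A.actR u (H.e j)) := by rw [E.t_actR]; rfl
        rw [this]
        refine isImage_t E hc hj' (hP1 j hj') ((E.mem_Theta0 hH).2 ⟨?_, fun k => ?_⟩)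
        · rw [← this, ← act_mul, hN.idem]
        · rw [← this, pi_act, ← mul_assoc, hu', zero_mul]
      · have := isImage_phi_sum E (hH := hH) (b := rho u) hc hP T hT' hj'
        rw [← Finset.sum_mul, ← Finset.sum_mul] at this
        simpa only [star_sum, hN.star_e, E.t_rho] using this
  have := key (fiber c F) fun i => mem_fiber.1
  exact hu ▸ this

/-- Ultrashort root elements of the quotient family. The indices `k` outside all classes contribute
the root elements with roots `e_j - e_k`; after subtracting these, the parameter becomes orthogonal
to all `e_k`. -/
theorem isImage_Y (hc : IsLabel c)
    (hP0 : ∀ j k, c j = some F → c k = none → vec j - vec k ∈ P)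
    (hP1 : ∀ j, c j = some F → vec j ∈ P)
    (hP : ∀ i j, c i = some F → c j = some F → vec j + vec i ∈ P)
    (hu : u ∈ Theta0 A (H.push c) F) : IsImage E hH c P F (E.t u) := by
  classical
  have hN := E.fam_isHyp hH
  have h := (E.mem_Theta0 (push_isHyp hH hc)).1 hu
  rw [fam_push] at h
  have key : ∀ T : Finset I, (∀ k ∈ T, c k = none) → ∀ v : Θ,
      act (E.t v) (((E.fam H).push c).e F) = E.t v →
      (∀ k ∉ T, (E.fam H).e k * pi (E.t v) = 0) → IsImage E hH c P F (E.t v) := by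
    intro T
    induction T using Finset.induction_on with
    | empty =>
      intro _ v hv hv'
      exact isImage_Y_of_isotropic E hc hP1 hP hv fun k => hv' k (Finset.notMem_empty _)
    | insert k T hk ih =>
      intro hT v hv hv'
      have hk' := hT k (Finset.mem_insert_self _ _)
      have e1 : E.t (A.actS (H.q k) (A.lmul (H.e k) (pi v))) =
          act ((E.fam H).q k) ((E.fam H).e k * pi (E.t v)) := by
        rw [E.t_actS, E.s_lmul, E.t_pi]; rfl
      have hkk : (E.fam H).e k * ((E.fam H).e k * pi (E.t v)) = (E.fam H).e k * pi (E.t v) := by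
        rw [← mul_assoc, hN.idem]
      have hkF : (E.fam H).e k * pi (E.t v) * (Family.push (E.fam H) c).e F =
          (E.fam H).e k * pi (E.t v) := by
        rw [mul_assoc, ← pi_act, hv]
      have h1 : IsImage E hH c P F (act ((E.fam H).q k) ((E.fam H).e k * pi (E.t v))) := by
        have e2 : E.s (A.lmul (H.e k) (pi v)) = (E.fam H).e k * pi (E.t v) := by
          rw [E.s_lmul, E.t_pi]; rfl
        rw [← e2]
        refine isImage_q_row E hc (by simp [hk']) (by simp [hk']) (fun j hj => hP0 j k hj hk') ?_ ?_
        · rw [e2, hkk]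
        · rw [e2, hkF]
      have h2 : IsImage E hH c P F (E.t (v + -(A.actS (H.q k) (A.lmul (H.e k) (pi v))))) := by
        refine ih (fun i hi => hT i (Finset.mem_insert_of_mem hi)) _ ?_ ?_
        · rw [map_add, map_neg, e1, add_act, neg_act, hv, ← act_mul, hkF]
        · intro m hm
          rw [map_add, map_neg, e1, pi_add, pi_neg, pi_q_act hN hkk, mul_add, mul_neg, ← mul_assoc]
          by_cases hmk : m = k
          · subst hmk
            rw [hN.idem, add_neg_cancel]
          · rw [hN.orth _ _ hmk, zero_mul, neg_zero, add_zero]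
            exact hv' m (by simp [hmk, hm])
      have := h2.add E hc h1
      rwa [← e1, ← map_add, neg_add_cancel_right] at this
  refine key (Set.toFinite {k | c k = none}).toFinset (fun k => by simp) u h.1 fun k hk => ?_
  rcases hk' : c k with _ | G
  · simp [hk'] at hk
  · rw [← mul_e_push hN hk', mul_assoc, h.2 G, mul_zero]

end Images

/-! ### Canonical homomorphisms between Steinberg groups -/

section Elim

variable {R Δ S Θ : Type*} [NonUnitalRing R] [StarRing R] [AddGroup Δ] [OddFormRing R Δ]
  [NonUnitalRing S] [StarRing S] [AddGroup Θ] [OddFormRing S Θ]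
variable {B Γ : Type*} [NonUnitalRing B] [StarRing B] [AddGroup Γ] [OddFormRing B Γ]
variable {A : ActionData R Δ S Θ} (E : Ambient A B Γ)
variable {I J : Type*} [InvolutiveNeg I] [InvolutiveNeg J] [Finite I] {H : Family R Δ I}
variable {c : I → Option J} {i j k : I} {F G K L : J} {P : Set (I → ℤ)} {Q : Set (J → ℤ)}
  {a : S} {u v : Θ}
variable (hH : H.IsHyp)

theorem Sij_roots (hc : IsLabel c) (h1 : F ≠ G) (hi : c i = some F) (hj : c j = some G) :
    vec j - vec i ∈ roots I ∧ proj c (vec j - vec i) = vec G - vec F := by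
  refine ⟨sub_mem_roots ?_, ?_⟩
  · rintro rfl; rw [hi] at hj; exact h1 (Option.some.inj hj)
  · rw [proj_sub, proj_vec hc, proj_vec hc, hi, hj]; rfl

theorem roots_add_of_label (hc : IsLabel c) (hi : c i = some F) (hj : c j = some F) :
    vec j + vec i ∈ roots I ∧ proj c (vec j + vec i) = vec F + vec F := by
  refine ⟨add_mem_roots ?_, ?_⟩
  · rintro rfl; rw [hc.neg_some hj] at hi; exact hc.neg_ne F (Option.some.inj hi)
  · rw [proj_add, proj_vec hc, proj_vec hc, hi, hj]; rfl

theorem exists_image_X (hc : IsLabel c) (h1 : F ≠ G) (h2 : F ≠ -G) (ha : a ∈ Sij A (H.push c) F G)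
    (hQ : vec G - vec F ∈ Q) :
    ∃ y ∈ stSub A H (pre c Q), E.st hH y = E.st (push_isHyp hH hc) (X A (H.push c) F G a) := by
  obtain ⟨_, y, hy, h⟩ := isImage_X (P := pre c Q) (hH := hH) E hc h1 h2 (fun i j hi hj =>
    ⟨(Sij_roots hc h1 hi hj).1, by rw [(Sij_roots hc h1 hi hj).2]; exact hQ⟩) ha
  refine ⟨y, hy, h.trans ?_⟩
  rw [E.st_X _ h1 h2 ha, fam_push]; rfl

theorem exists_image_Y (hc : IsLabel c) (hu : u ∈ Theta0 A (H.push c) F)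
    (hQ : vec F ∈ Q) (hQ' : vec F + vec F ∈ Q) :
    ∃ y ∈ stSub A H (pre c Q), E.st hH y = E.st (push_isHyp hH hc) (Y A (H.push c) F u) := by
  have h0 : ∀ j k, c j = some F → c k = none → vec j - vec k ∈ pre c Q := fun j k hj hk => by
    refine ⟨sub_mem_roots ?_, ?_⟩
    · rintro rfl; rw [hj] at hk; simp at hk
    · rw [proj_sub, proj_vec hc, proj_vec hc, hj, hk]
      simpa [vecOpt] using hQ
  have h1 : ∀ j, c j = some F → vec j ∈ pre c Q := fun j hj =>
    ⟨vec_mem_roots j, by rw [proj_vec hc, hj]; exact hQ⟩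
  have h2 : ∀ i j, c i = some F → c j = some F → vec j + vec i ∈ pre c Q := fun i j hi hj =>
    ⟨(roots_add_of_label hc hi hj).1, by rw [(roots_add_of_label hc hi hj).2]; exact hQ'⟩
  obtain ⟨_, y, hy, h⟩ := isImage_Y (hH := hH) E hc h0 h1 h2 hu
  refine ⟨y, hy, h.trans ?_⟩
  rw [E.st_Y _ hu, fam_push]

theorem exists_image_Yphi (hc : IsLabel c) (ha : a ∈ Sij A (H.push c) (-F) F)
    (hQ' : vec F + vec F ∈ Q) :
    ∃ y ∈ stSub A H (pre c Q), E.st hH y = E.st (push_isHyp hH hc) (Y A (H.push c) F (phi a)) := by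
  obtain ⟨_, y, hy, h⟩ := isImage_Yphi (P := pre c Q) (hH := hH) E hc
    (fun i j hi hj => ⟨(roots_add_of_label hc hi hj).1, by
      rw [(roots_add_of_label hc hi hj).2]; exact hQ'⟩) ha
  refine ⟨y, hy, h.trans ?_⟩
  rw [E.st_Y _ (E.Theta0_phi (push_isHyp hH hc) ha), fam_push, E.t_phi]

/-- The images of the generators under the canonical homomorphism between Steinberg groups: chosen
elements of `StU(S, Θ; π⁻¹{β, 2β})` with the same image in the unitary group. -/
def elimGen (hc : IsLabel c) : Gen A (H.push c) → StU A H
  | .short F G _ h => Classical.choose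
      (exists_image_X (Q := {vec G - vec F}) E hH hc h.1 h.2.1 h.2.2 rfl)
  | .ultrashort F _ h => Classical.choose
      (exists_image_Y (Q := {vec F, vec F + vec F}) E hH hc h (Or.inl rfl) (Or.inr rfl))

theorem st_elimGen (hc : IsLabel c) (x : FreeGroup (Gen A (H.push c))) :
    E.st hH (FreeGroup.lift (elimGen E hH hc) x) =
      E.st (push_isHyp hH hc) (PresentedGroup.mk _ x) := by
  have : (E.st hH).comp (FreeGroup.lift (elimGen E hH hc)) =
      (E.st (push_isHyp hH hc)).comp (PresentedGroup.mk _) := by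
    refine FreeGroup.ext_hom _ _ fun g => ?_
    cases g with
    | short F G a h =>
      simp only [MonoidHom.comp_apply, FreeGroup.lift_apply_of, mk_short, elimGen]
      exact (Classical.choose_spec (exists_image_X (Q := {vec G - vec F}) E hH hc h.1 h.2.1 h.2.2 rfl)).2
    | ultrashort F u h =>
      simp only [MonoidHom.comp_apply, FreeGroup.lift_apply_of, mk_ultrashort, elimGen]
      exact (Classical.choose_spec (exists_image_Y (Q := {vec F, vec F + vec F}) E hH hc h
        (Or.inl rfl) (Or.inr rfl))).2
  exact DFunLike.congr_fun this x

variable [Finite J] {ω : J → ℤ}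

theorem elimGen_X_mem (hc : IsLabel c) (h1 : F ≠ G) (h2 : F ≠ -G) (ha : a ∈ Sij A (H.push c) F G)
    (hω : IsOdd ω) (h : 0 < ω G - ω F) :
    FreeGroup.lift (elimGen E hH hc) (wX A (H.push c) F G a) ∈ stSub A H (posRoots (pull c ω)) := by
  rw [lift_wX _ h1 h2 ha]
  refine stSub_mono (pre_subset_posRoots hω hc ?_) (Classical.choose_spec
    (exists_image_X (Q := {vec G - vec F}) E hH hc h1 h2 ha rfl)).1
  rintro _ rfl
  rw [ht_sub, ht_vec hω, ht_vec hω]; omega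

theorem elimGen_Y_mem (hc : IsLabel c) (hu : u ∈ Theta0 A (H.push c) F)
    (hω : IsOdd ω) (h : 0 < ω F) :
    FreeGroup.lift (elimGen E hH hc) (wY A (H.push c) F u) ∈ stSub A H (posRoots (pull c ω)) := by
  rw [lift_wY _ hu]
  refine stSub_mono (pre_subset_posRoots hω hc ?_) (Classical.choose_spec
    (exists_image_Y (Q := {vec F, vec F + vec F}) E hH hc hu (Or.inl rfl) (Or.inr rfl))).1
  rintro _ (rfl | rfl)
  · rw [ht_vec hω]; omega
  · rw [ht_add, ht_vec hω]; omega

theorem comm_mem {G : Type*} [Group G] {K : Subgroup G} {x y : G} (hx : x ∈ K) (hy : y ∈ K) :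
    ⁅x, y⁆ ∈ K := by
  rw [commutatorElement_def]
  exact mul_mem (mul_mem (mul_mem hx hy) (inv_mem hx)) (inv_mem hy)

/-- Both sides of a Steinberg relation for the quotient family have the same image in the unitary
group, and they involve only roots from an open half-space, so `st_injOn` applies. -/
theorem elimGen_rel (hc : IsLabel c) (x y : FreeGroup (Gen A (H.push c)))
    (h : StRel A (H.push c) x y) :
    FreeGroup.lift (elimGen E hH hc) x = FreeGroup.lift (elimGen E hH hc) y := by
  have hH' := push_isHyp hH hc
  have hst : E.st hH (FreeGroup.lift (elimGen E hH hc) x) =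
      E.st hH (FreeGroup.lift (elimGen E hH hc) y) := by
    rw [st_elimGen, st_elimGen, h.mk_eq]
  -- it remains to find a weight that is positive on the roots involved
  suffices ∃ ω : J → ℤ, IsOdd ω ∧
      FreeGroup.lift (elimGen E hH hc) x ∈ stSub A H (posRoots (pull c ω)) ∧
      FreeGroup.lift (elimGen E hH hc) y ∈ stSub A H (posRoots (pull c ω)) by
    obtain ⟨ω, hω, hx, hy⟩ := this
    exact st_injOn E hH (hc.isOdd_pull hω) hx hy hst
  have hne := hc.neg_ne
  have hs : ∀ i : J, vec i i = 1 := fun i => vec_self hne i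
  have hodd := isOdd_vec (I := J)
  cases h with
  | sym i j a h1 h2 ha =>
    have hω := (hodd j).sub (hodd i)
    refine ⟨_, hω, elimGen_X_mem E hH hc h1 h2 ha hω ?_, elimGen_X_mem E hH hc (neg_ne_neg' h1.symm)
      (by rw [neg_neg]; exact ne_neg (ne_neg' h2)) (E.Sij_star hH' ha) hω ?_⟩
    all_goals
      have := vec_eq_zero h1 h2
      simp only [Pi.sub_apply, vec_neg_apply, hs, vec_comm i j, this]
      norm_num
  | addX i j a b h1 h2 ha hb =>
    have hω := (hodd j).sub (hodd i)
    have h0 : 0 < (vec j - vec i : J → ℤ) j - (vec j - vec i : J → ℤ) i := by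
      have := vec_eq_zero h1 h2
      simp only [Pi.sub_apply, hs, vec_comm i j, this]
      norm_num
    refine ⟨_, hω, ?_, elimGen_X_mem E hH hc h1 h2 (E.Sij_add hH' ha hb) hω h0⟩
    rw [map_mul]
    exact mul_mem (elimGen_X_mem E hH hc h1 h2 ha hω h0) (elimGen_X_mem E hH hc h1 h2 hb hω h0)
  | addY j u v hu hv =>
    have h0 : (0 : ℤ) < vec j j := by rw [hs]; norm_num
    refine ⟨_, hodd j, ?_, elimGen_Y_mem E hH hc (E.Theta0_add hH' hu hv) (hodd j) h0⟩
    rw [map_mul]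
    exact mul_mem (elimGen_Y_mem E hH hc hu (hodd j) h0) (elimGen_Y_mem E hH hc hv (hodd j) h0)
  | commXX i j k l a b h1 h2 h3 h4 ha hb h5 h6 h7 h8 =>
    have hω := ((hodd j).sub (hodd i)).add ((hodd l).sub (hodd k))
    refine ⟨_, hω, ?_, by rw [map_one]; exact one_mem _⟩
    rw [map_commutatorElement]
    refine comm_mem (elimGen_X_mem E hH hc h1 h2 ha hω ?_) (elimGen_X_mem E hH hc h3 h4 hb hω ?_)
    all_goals
      have e1 := vec_eq_zero h1 h2
      have e2 := vec_eq_zero h3 h4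
      have e3 := vec_nonneg (i := i) (j := k) h6
      have e4 := vec_nonpos (i := j) (j := k) h5.symm
      have e5 := vec_nonpos (i := i) (j := l) (fun h => h7 (by rw [h]))
      have e6 := vec_nonneg (i := j) (j := l) (fun h => h8 (by rw [h, neg_neg]))
      simp only [Pi.sub_apply, Pi.add_apply, hs, vec_comm i j, vec_comm k l, vec_comm k i,
        vec_comm k j, vec_comm l i, vec_comm l j]
      omega
  | commXY i j l a u h1 h2 ha hu h3 h4 =>
    have hω := ((hodd j).sub (hodd i)).add (hodd l)
    refine ⟨_, hω, ?_, by rw [map_one]; exact one_mem _⟩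
    rw [map_commutatorElement]
    refine comm_mem (elimGen_X_mem E hH hc h1 h2 ha hω ?_) (elimGen_Y_mem E hH hc hu hω ?_)
    all_goals
      have e1 := vec_eq_zero h1 h2
      have e3 := vec_nonneg (i := j) (j := l) h4
      have e4 := vec_nonpos (i := i) (j := l) h3.symm
      simp only [Pi.sub_apply, Pi.add_apply, hs, vec_comm i j, vec_comm l i, vec_comm l j]
      omega
  | commLong i j a b h1 h2 ha hb =>
    have e1 := vec_eq_zero h1.symm (ne_neg' h2)
    refine ⟨_, hodd i, ?_, elimGen_Y_mem E hH hc (E.Theta0_phi hH' (E.Sij_mul hH' ha hb)) (hodd i)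
      (by rw [hs]; norm_num)⟩
    rw [map_commutatorElement]
    refine comm_mem (elimGen_X_mem E hH hc (ne_neg h2) (neg_ne_neg' h1) ha (hodd i) ?_)
      (elimGen_X_mem E hH hc h1.symm (ne_neg' h2) hb (hodd i) ?_)
    all_goals
      simp only [vec_neg_apply, hs, e1]; norm_num
  | commYsame i u v hu hv =>
    have h0 : (0 : ℤ) < vec i i := by rw [hs]; norm_num
    refine ⟨_, hodd i, ?_, elimGen_Y_mem E hH hc
      (E.Theta0_phi hH' (E.Sij_pi hH' hu hv)) (hodd i) h0⟩
    rw [map_commutatorElement]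
    exact comm_mem (elimGen_Y_mem E hH hc hu (hodd i) h0) (elimGen_Y_mem E hH hc hv (hodd i) h0)
  | commYY i j u v h1 h2 hu hv =>
    have hω := (hodd i).add (hodd j)
    have e1 := vec_eq_zero h1 h2
    refine ⟨_, hω, ?_, elimGen_X_mem E hH hc (ne_neg h2) (neg_ne_neg' h1) (E.Sij_pi hH' hu hv) hω ?_⟩
    · rw [map_commutatorElement]
      refine comm_mem (elimGen_Y_mem E hH hc hu hω ?_) (elimGen_Y_mem E hH hc hv hω ?_)
      all_goals
        simp only [Pi.add_apply, hs, vec_comm i j, e1]; norm_num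
    · simp only [Pi.add_apply, vec_neg_apply, hs, vec_comm i j, e1]; norm_num
  | commShort i j k a b h1 h2 h3 h4 h5 h6 ha hb =>
    have hω := (hodd k).sub (hodd i)
    have e1 := vec_eq_zero h1 h2
    have e2 := vec_eq_zero h3 h4
    have e3 := vec_eq_zero h5 h6
    refine ⟨_, hω, ?_, elimGen_X_mem E hH hc h5 h6 (E.Sij_mul hH' ha hb) hω ?_⟩
    · rw [map_commutatorElement]
      refine comm_mem (elimGen_X_mem E hH hc h1 h2 ha hω ?_) (elimGen_X_mem E hH hc h3 h4 hb hω ?_)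
      all_goals
        simp only [Pi.sub_apply, hs, vec_comm i j, vec_comm i k, e1, e2, e3]; norm_num
    · simp only [Pi.sub_apply, hs, vec_comm i k, e3]; norm_num
  | commYX i j u a h1 h2 hu ha =>
    have hω := ((hodd i).add (hodd j)).add (hodd j)
    have e1 := vec_eq_zero h1 h2
    refine ⟨_, hω, ?_, ?_⟩
    · rw [map_commutatorElement]
      refine comm_mem (elimGen_Y_mem E hH hc hu hω ?_) (elimGen_X_mem E hH hc h1 h2 ha hω ?_)
      all_goals
        simp only [Pi.add_apply, hs, vec_comm i j, e1]; norm_num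
    · rw [map_mul]
      refine mul_mem (elimGen_X_mem E hH hc (ne_neg h2) (neg_ne_neg' h1) (E.Sij_rho hH' hu ha) hω ?_)
        (elimGen_Y_mem E hH hc (E.Theta0_neg hH' (E.Theta0_act hH' hu (E.Sij_neg hH' ha))) hω ?_)
      all_goals
        simp only [Pi.add_apply, vec_neg_apply, hs, vec_comm i j, e1]; norm_num

/-- The canonical homomorphism from the Steinberg group of a quotient family. -/
def elimHom (hc : IsLabel c) : StU A (H.push c) →* StU A H :=
  StU.lift (elimGen E hH hc) (elimGen_rel E hH hc)

theorem st_elimHom (hc : IsLabel c) (x : StU A (H.push c)) :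
    E.st hH (elimHom E hH hc x) = E.st (push_isHyp hH hc) x := by
  obtain ⟨w, rfl⟩ := PresentedGroup.mk_surjective _ x
  exact st_elimGen E hH hc w

theorem elimHom_X_mem (hc : IsLabel c) (h1 : F ≠ G) (h2 : F ≠ -G) (ha : a ∈ Sij A (H.push c) F G)
    (hQ : vec G - vec F ∈ Q) :
    elimHom E hH hc (X A (H.push c) F G a) ∈ stSub A H (pre c Q) := by
  refine stSub_mono ?_ (show _ ∈ stSub A H (pre c {vec G - vec F}) from ?_)
  · exact fun α hα => ⟨hα.1, by rw [hα.2]; exact hQ⟩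
  · rw [X, elimHom, StU.lift_mk, lift_wX _ h1 h2 ha]
    exact (Classical.choose_spec
      (exists_image_X (Q := {vec G - vec F}) E hH hc h1 h2 ha rfl)).1

theorem elimHom_Y_mem (hc : IsLabel c) (hu : u ∈ Theta0 A (H.push c) F)
    (hQ : vec F ∈ Q) (hQ' : vec F + vec F ∈ Q) :
    elimHom E hH hc (Y A (H.push c) F u) ∈ stSub A H (pre c Q) := by
  refine stSub_mono ?_ (show _ ∈ stSub A H (pre c {vec F, vec F + vec F}) from ?_)
  · rintro α ⟨hα, h | h⟩
    · exact ⟨hα, by rw [h]; exact hQ⟩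
    · exact ⟨hα, by rw [h]; exact hQ'⟩
  · rw [Y, elimHom, StU.lift_mk, lift_wY _ hu]
    exact (Classical.choose_spec
      (exists_image_Y (Q := {vec F, vec F + vec F}) E hH hc hu (Or.inl rfl) (Or.inr rfl))).1

theorem elimHom_Yphi_mem (hc : IsLabel c) (ha : a ∈ Sij A (H.push c) (-F) F)
    (hQ : vec F + vec F ∈ Q) :
    elimHom E hH hc (Y A (H.push c) F (phi a)) ∈ stSub A H (pre c Q) := by
  obtain ⟨y, hy, h⟩ := exists_image_Yphi (Q := {vec F + vec F}) E hH hc ha rfl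
  have hpos : ∀ β ∈ ({vec F, vec F + vec F} : Set (J → ℤ)), 0 < ht (vec F) β := by
    rintro _ (rfl | rfl)
    · rw [ht_vec (isOdd_vec F), vec_self hc.neg_ne]; norm_num
    · rw [ht_add, ht_vec (isOdd_vec F), vec_self hc.neg_ne]; norm_num
  have e : elimHom E hH hc (Y A (H.push c) F (phi a)) = y := by
    refine st_injOn E hH (hc.isOdd_pull (isOdd_vec F))
      (stSub_mono (pre_subset_posRoots (isOdd_vec F) hc hpos)
        (elimHom_Y_mem E hH hc (E.Theta0_phi (push_isHyp hH hc) ha) (Or.inl rfl) (Or.inr rfl)))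
      (stSub_mono (pre_subset_posRoots (isOdd_vec F) hc fun β hβ => hpos β (Or.inr hβ)) hy) ?_
    rw [st_elimHom, h]
  rw [e]
  exact stSub_mono (show pre c {vec F + vec F} ⊆ pre c Q from
    fun α hα => ⟨hα.1, by rw [hα.2]; exact hQ⟩) hy

theorem elimHom_mem (hc : IsLabel c) (hQ : ∀ F : J, vec F ∈ Q → vec F + vec F ∈ Q)
    {x : StU A (H.push c)} (hx : x ∈ stSub A (H.push c) Q) :
    elimHom E hH hc x ∈ stSub A H (pre c Q) := by
  suffices stSub A (H.push c) Q ≤ (stSub A H (pre c Q)).comap (elimHom E hH hc) from this hx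
  refine stSub_le ?_ ?_ ?_
  · intro F G a h1 h2 ha h; exact elimHom_X_mem E hH hc h1 h2 ha h
  · intro F u hu h; exact elimHom_Y_mem E hH hc hu h (hQ F h)
  · intro F a ha h; exact elimHom_Yphi_mem E hH hc ha h

theorem elimHom_rootSet (hc : IsLabel c) {β : J → ℤ} {x : StU A (H.push c)}
    (hx : x ∈ rootSet A (H.push c) β) : elimHom E hH hc x ∈ stSub A H (pre c {β, β + β}) := by
  rcases hx with (⟨F, G, a, h1, h2, ha, rfl, rfl⟩ | ⟨F, u, hu, rfl, rfl⟩) | ⟨F, a, ha, rfl, rfl⟩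
  · exact elimHom_X_mem E hH hc h1 h2 ha (Or.inl rfl)
  · exact elimHom_Y_mem E hH hc hu (Or.inl rfl) (Or.inr rfl)
  · exact elimHom_Yphi_mem E hH hc ha (Or.inl rfl)

theorem mem_elimGraph_elimHom (hc : IsLabel c) (x : StU A (H.push c)) :
    (x, elimHom E hH hc x) ∈ elimGraph A H (H.push c) c := by
  have hgen : ∀ β ∈ roots J, ∀ y ∈ rootSet A (H.push c) β,
      (y, elimHom E hH hc y) ∈ elimGraph A H (H.push c) c := by
    intro β hβ y hy
    refine Subgroup.subset_closure ⟨β, hβ, hy, elimHom_rootSet E hH hc hy, ?_⟩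
    obtain ⟨t, ht⟩ := E.exists_stVal (push_isHyp hH hc) y
    refine ⟨t, ht, ?_⟩
    rw [E.stVal_iff hH, st_elimHom]
    exact (E.stVal_iff _).1 ht
  refine StU.induction E (push_isHyp hH hc)
    (P := fun x => (x, elimHom E hH hc x) ∈ elimGraph A H (H.push c) c) x ?_ ?_ ?_
  · rw [map_one]; exact one_mem _
  · intro F G a x h1 h2 ha hx
    rw [map_mul]
    exact mul_mem (hgen _ (sub_mem_roots h1) (X A _ F G a)
      (Or.inl (Or.inl ⟨F, G, a, h1, h2, ha, rfl, rfl⟩))) hx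
  · intro F u x hu hx
    rw [map_mul]
    exact mul_mem (hgen _ (vec_mem_roots F) (Y A _ F u)
      (Or.inl (Or.inr ⟨F, u, hu, rfl, rfl⟩))) hx

/-- The canonical homomorphism is determined by its characterization. -/
theorem eq_elimHom_of_mem_elimGraph (hc : IsLabel c) {p : StU A (H.push c) × StU A H}
    (hp : p ∈ elimGraph A H (H.push c) c) : p.2 = elimHom E hH hc p.1 := by
  suffices elimGraph A H (H.push c) c ≤
      ((elimHom E hH hc).comp (MonoidHom.fst _ _)).eqLocus (MonoidHom.snd _ _) from (this hp).symm
  refine (Subgroup.closure_le _).2 ?_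
  rintro ⟨x, y⟩ ⟨β, hβ, hx, hy, t, ht1, ht2⟩
  have hω := isOdd_of_mem_roots hβ
  have hpos : ∀ γ ∈ ({β, β + β} : Set (J → ℤ)), 0 < ht β γ := by
    have := ht_self_pos hc.neg_ne hβ
    rintro _ (rfl | rfl)
    · exact this
    · rw [ht_add]; omega
  refine st_injOn E hH (hc.isOdd_pull hω)
    (stSub_mono (pre_subset_posRoots hω hc hpos) (elimHom_rootSet E hH hc hx))
    (stSub_mono (pre_subset_posRoots hω hc hpos) hy) ?_
  change E.st hH (elimHom E hH hc x) = _
  rw [st_elimHom]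
  refine UGrp.ext ?_
  rw [(E.stVal_iff _).1 ht1]
  exact ((E.stVal_iff hH).1 ht2).symm

end Elim

/-! ### Semidirect products -/

section Semidirect

variable {R Δ S Θ : Type*} [NonUnitalRing R] [StarRing R] [AddGroup Δ] [OddFormRing R Δ]
  [NonUnitalRing S] [StarRing S] [AddGroup Θ] [OddFormRing S Θ]

/-- An ambient odd form ring into which `(R, Δ)` embeds as an odd form ring as well. -/
structure FullAmbient (A : ActionData R Δ S Θ) (B Γ : Type*) [NonUnitalRing B] [StarRing B]
    [AddGroup Γ] [OddFormRing B Γ] extends Ambient A B Γ where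
  r_inj : Function.Injective r
  d_inj : Function.Injective d
  d_phi : ∀ a : R, d (phi a) = phi (r a)

variable {A : ActionData R Δ S Θ} {B Γ : Type*} [NonUnitalRing B] [StarRing B] [AddGroup Γ]
  [OddFormRing B Γ]

/-- The embedding of `(R, Δ)`, considered as acting on itself. -/
def FullAmbient.self (E : FullAmbient A B Γ) : FullAmbient (selfAction R Δ) B Γ where
  r := E.r
  d := E.d
  s := E.r
  t := E.d
  s_inj := E.r_inj
  t_inj := E.d_inj
  d_act := E.d_act
  d_pi := E.d_pi
  d_rho := E.d_rho
  t_act := E.d_act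
  t_phi := E.d_phi
  t_pi := E.d_pi
  t_rho := E.d_rho
  s_lmul _ _ := map_mul _ _ _
  s_rmul _ _ := map_mul _ _ _
  t_actR := E.d_act
  t_actS := E.d_act
  r_inj := E.r_inj
  d_inj := E.d_inj
  d_phi := E.d_phi

/-- The semidirect product of a crossed module is an ambient odd form ring. The action is required
to make it an odd form ring; this determines its values at zero only up to constants, which vanish
by `ρ(0) = 0` and by the Peiffer identities. -/
theorem CrossedModule.exists_fullAmbient (M : CrossedModule R Δ S Θ) :
    ∃ (_ : NonUnitalRing (Semi S R)) (_ : StarRing (Semi S R)) (_ : AddGroup (Semi Θ Δ))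
      (_ : OddFormRing (Semi S R) (Semi Θ Δ)),
      Nonempty (FullAmbient M.action (Semi S R) (Semi Θ Δ)) := by
  obtain ⟨i1, i2, i3, i4, hadd, hmul, hstar, hgadd, hact, hphi, hpi, hrho⟩ := M.isAction
  refine ⟨i1, i2, i3, i4, ?_⟩
  have z1 : (0 : Semi S R) = ⟨0, 0⟩ := by
    have h := hadd ⟨0, 0⟩ ⟨0, 0⟩
    simp only [add_zero] at h
    exact (left_eq_add.1 h.symm).symm
  have z2 : (0 : Semi Θ Δ) = ⟨0, 0⟩ := by
    rw [← phi_zero (B := Semi S R), hphi, z1]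
    simp only [phi_zero]
  have zz : M.action.rmul 0 0 = 0 := by
    have h := hrho 0
    rw [rho_zero, z1, z2] at h
    have := congrArg Semi.l h
    simpa [pi_zero, rho_zero] using this
  have m1 : ∀ a q, M.action.rmul a 0 + M.action.lmul 0 0 = 0 ∧
      M.action.rmul 0 q + M.action.lmul 0 0 = 0 := by
    intro a q
    constructor
    · have h := hmul ⟨a, 0⟩ 0
      rw [mul_zero, z1] at h
      simpa using (congrArg Semi.l h).symm
    · have h := hmul 0 ⟨0, q⟩
      rw [zero_mul, z1] at h
      simpa using (congrArg Semi.l h).symm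
  have m0 : M.action.lmul 0 0 = 0 := by simpa [zz] using (m1 0 0).1
  have r1 : ∀ a, M.action.rmul a 0 = 0 := fun a => by simpa [m0] using (m1 a 0).1
  have r2 : ∀ q, M.action.rmul 0 q = 0 := fun a => by simpa [m0] using (m1 0 a).2
  have l1 : ∀ a, M.action.lmul 0 a = 0 := by
    intro a
    have h := hmul 0 ⟨a, 0⟩
    rw [zero_mul, z1] at h
    simpa [zz] using (congrArg Semi.l h).symm
  have l2 : ∀ p, M.action.lmul p 0 = 0 := by
    intro p
    have h := hmul ⟨0, p⟩ 0
    rw [mul_zero, z1] at h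
    simpa [zz] using (congrArg Semi.l h).symm
  have k0 : M.action.actS 0 0 = 0 := by
    have h := M.peiffer_actS 0 0
    rw [map_zero, act_zero] at h
    exact h.symm
  have a1 : ∀ p, M.action.actR 0 p = 0 := by
    intro p
    have h := hact 0 ⟨0, p⟩
    rw [zero_act, z2] at h
    simpa [rho_zero, l1, l2, phi_zero, zero_act, act_zero, k0] using (congrArg Semi.l h).symm
  have a2 : ∀ u, M.action.actS u 0 = 0 := by
    intro u
    have h := hact ⟨0, u⟩ 0
    rw [act_zero, z1, z2] at h
    simpa [rho_zero, l1, l2, phi_zero, zero_act, act_zero, k0, a1] using (congrArg Semi.l h).symm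
  have a3 : ∀ u, M.action.actR u 0 = 0 := by
    intro u
    have h := hact ⟨u, 0⟩ 0
    rw [act_zero, z1, z2] at h
    simpa [rho_zero, l1, l2, phi_zero, zero_act, act_zero, k0, a1] using (congrArg Semi.l h).symm
  have a4 : ∀ a, M.action.actS 0 a = 0 := by
    intro a
    have h := hact 0 ⟨a, 0⟩
    rw [zero_act, z2] at h
    simpa [rho_zero, l1, l2, phi_zero, zero_act, act_zero, k0, a1] using (congrArg Semi.l h).symm
  exact ⟨{
    r := { toFun := fun p => ⟨0, p⟩
           map_zero' := z1.symm
           map_add' := fun x y => by rw [hadd]; simp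
           map_mul' := fun x y => by rw [hmul]; simp [r2, l2]
           map_star' := fun x => by rw [hstar]; simp }
    s := { toFun := fun p => ⟨p, 0⟩
           map_zero' := z1.symm
           map_add' := fun x y => by rw [hadd]; simp
           map_mul' := fun x y => by rw [hmul]; simp [r1, l1]
           map_star' := fun x => by rw [hstar]; simp }
    d := { toFun := fun u => ⟨0, u⟩
           map_zero' := z2.symm
           map_add' := fun x y => by rw [hgadd]; simp [pi_zero, l2, phi_zero] }
    t := { toFun := fun u => ⟨u, 0⟩
           map_zero' := z2.symm
           map_add' := fun x y => by rw [hgadd]; simp [pi_zero, l1, phi_zero] }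
    s_inj := fun x y h => congrArg Semi.l h
    t_inj := fun x y h => congrArg Semi.l h
    r_inj := fun x y h => congrArg Semi.r h
    d_inj := fun x y h => congrArg Semi.r h
    d_act := fun u a => show (⟨0, act u a⟩ : Semi Θ Δ) = act ⟨0, u⟩ (⟨0, a⟩ : Semi S R) by
      rw [hact]; simp [act_zero, rho_zero, a1, a2, l2, phi_zero]
    d_pi := fun u => show (⟨0, pi u⟩ : Semi S R) = pi (⟨0, u⟩ : Semi Θ Δ) by
      rw [hpi]; simp [pi_zero]
    d_rho := fun u => show (⟨0, rho u⟩ : Semi S R) = rho (⟨0, u⟩ : Semi Θ Δ) by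
      rw [hrho]; simp [pi_zero, rho_zero, r2]
    d_phi := fun a => show (⟨0, phi a⟩ : Semi Θ Δ) = phi (⟨0, a⟩ : Semi S R) by
      rw [hphi]; simp [phi_zero]
    t_act := fun u a => show (⟨act u a, 0⟩ : Semi Θ Δ) = act ⟨u, 0⟩ (⟨a, 0⟩ : Semi S R) by
      rw [hact]; simp [act_zero, rho_zero, a3, a4, l1, phi_zero]
    t_pi := fun u => show (⟨pi u, 0⟩ : Semi S R) = pi (⟨u, 0⟩ : Semi Θ Δ) by
      rw [hpi]; simp [pi_zero]
    t_rho := fun u => show (⟨rho u, 0⟩ : Semi S R) = rho (⟨u, 0⟩ : Semi Θ Δ) by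
      rw [hrho]; simp [pi_zero, rho_zero, r1]
    t_phi := fun a => show (⟨phi a, 0⟩ : Semi Θ Δ) = phi (⟨a, 0⟩ : Semi S R) by
      rw [hphi]; simp [phi_zero]
    s_lmul := fun p a => show (⟨M.action.lmul p a, 0⟩ : Semi S R) = ⟨0, p⟩ * ⟨a, 0⟩ by
      rw [hmul]; simp [zz]
    s_rmul := fun a p => show (⟨M.action.rmul a p, 0⟩ : Semi S R) = ⟨a, 0⟩ * ⟨0, p⟩ by
      rw [hmul]; simp [m0]
    t_actR := fun u p =>
      show (⟨M.action.actR u p, 0⟩ : Semi Θ Δ) = act ⟨u, 0⟩ (⟨0, p⟩ : Semi S R) by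
      rw [hact]; simp [zero_act, act_zero, rho_zero, k0, l2, phi_zero]
    t_actS := fun u a =>
      show (⟨M.action.actS u a, 0⟩ : Semi Θ Δ) = act ⟨0, u⟩ (⟨a, 0⟩ : Semi S R) by
      rw [hact]; simp [zero_act, act_zero, rho_zero, a1, l1, phi_zero] }⟩

end Semidirect

/-! ### Commutator formulas for an action -/

section Chevalley

variable {R Δ S Θ : Type*} [NonUnitalRing R] [StarRing R] [AddGroup Δ] [OddFormRing R Δ]
  [NonUnitalRing S] [StarRing S] [AddGroup Θ] [OddFormRing S Θ]
variable {I : Type*} [InvolutiveNeg I]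

/-- The Chevalley commutator formulas as in `ChevRel`, for an arbitrary action and with the root of
the second argument recorded. -/
inductive Chev (A : ActionData R Δ S Θ) (H : Family R Δ I) :
    (I → ℤ) → (I → ℤ) → StU (selfAction R Δ) H → StU A H → StU A H → Prop
  | commXX (i j k l : I) (p : R) (b : S) (h1 : i ≠ j) (h2 : i ≠ -j) (h3 : k ≠ l) (h4 : k ≠ -l)
      (hp : p ∈ Sij (selfAction R Δ) H i j) (hb : b ∈ Sij A H k l)
      (h5 : j ≠ k) (h6 : k ≠ -i) (h7 : -i ≠ -l) (h8 : -l ≠ j) :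
      Chev A H (vec j - vec i) (vec l - vec k) (X (selfAction R Δ) H i j p) (X A H k l b)
        (X A H k l b)
  | commXY (i j l : I) (p : R) (u : Θ) (h1 : i ≠ j) (h2 : i ≠ -j)
      (hp : p ∈ Sij (selfAction R Δ) H i j) (hu : u ∈ Theta0 A H l) (h3 : i ≠ l) (h4 : l ≠ -j) :
      Chev A H (vec j - vec i) (vec l) (X (selfAction R Δ) H i j p) (Y A H l u) (Y A H l u)
  | commYX (i j l : I) (s : Δ) (a : S) (h1 : i ≠ j) (h2 : i ≠ -j)
      (hs : s ∈ Theta0 (selfAction R Δ) H l) (ha : a ∈ Sij A H i j) (h3 : i ≠ l) (h4 : l ≠ -j) :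
      Chev A H (vec l) (vec j - vec i) (Y (selfAction R Δ) H l s) (X A H i j a) (X A H i j a)
  | long (i j : I) (p : R) (b : S) (h1 : i ≠ j) (h2 : i ≠ -j)
      (hp : p ∈ Sij (selfAction R Δ) H (-i) j) (hb : b ∈ Sij A H j i) :
      Chev A H (vec j - vec (-i)) (vec i - vec j) (X (selfAction R Δ) H (-i) j p) (X A H j i b)
        (Y A H i (phi (A.lmul p b)) * X A H j i b)
  | same (i : I) (s : Δ) (u : Θ)
      (hs : s ∈ Theta0 (selfAction R Δ) H i) (hu : u ∈ Theta0 A H i) :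
      Chev A H (vec i) (vec i) (Y (selfAction R Δ) H i s) (Y A H i u)
        (Y A H i (phi (-(A.lmul (star (pi s)) (pi u)))) * Y A H i u)
  | ultrashort (i j : I) (s : Δ) (u : Θ) (h1 : i ≠ j) (h2 : i ≠ -j)
      (hs : s ∈ Theta0 (selfAction R Δ) H i) (hu : u ∈ Theta0 A H j) :
      Chev A H (vec i) (vec j) (Y (selfAction R Δ) H i s) (Y A H j u)
        (X A H (-i) j (-(A.lmul (star (pi s)) (pi u))) * Y A H j u)
  | short (i j k : I) (p : R) (b : S) (h1 : i ≠ j) (h2 : i ≠ -j) (h3 : j ≠ k) (h4 : j ≠ -k)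
      (h5 : i ≠ k) (h6 : i ≠ -k)
      (hp : p ∈ Sij (selfAction R Δ) H i j) (hb : b ∈ Sij A H j k) :
      Chev A H (vec j - vec i) (vec k - vec j) (X (selfAction R Δ) H i j p) (X A H j k b)
        (X A H i k (A.lmul p b) * X A H j k b)
  | mixedYX (i j : I) (s : Δ) (a : S) (h1 : i ≠ j) (h2 : i ≠ -j)
      (hs : s ∈ Theta0 (selfAction R Δ) H i) (ha : a ∈ Sij A H i j) :
      Chev A H (vec i) (vec j - vec i) (Y (selfAction R Δ) H i s) (X A H i j a)
        (X A H (-i) j (A.lmul (rho s) a) * Y A H j (-(A.actS s (-a))) * X A H i j a)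
  | mixedXY (i j : I) (p : R) (u : Θ) (h1 : i ≠ j) (h2 : i ≠ -j)
      (hp : p ∈ Sij (selfAction R Δ) H i j) (hu : u ∈ Theta0 A H i) :
      Chev A H (vec j - vec i) (vec i) (X (selfAction R Δ) H i j p) (Y A H i u)
        (Y A H j (A.actR u (-p)) * X A H (-i) j (-(A.rmul (rho u) p)) * Y A H i u)

variable {A : ActionData R Δ S Θ} {H : Family R Δ I} {α β : I → ℤ}
  {x : StU (selfAction R Δ) H} {y w : StU A H}

theorem Chev.left_mem (h : Chev A H α β x y w) : x ∈ rootSet (selfAction R Δ) H α := by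
  cases h
  case commXX i j k l p b h1 h2 h3 h4 hp hb h5 h6 h7 h8 =>
    exact Or.inl (Or.inl ⟨_, _, _, h1, h2, hp, rfl, rfl⟩)
  case commXY i j l p u h1 h2 hp hu h3 h4 => exact Or.inl (Or.inl ⟨_, _, _, h1, h2, hp, rfl, rfl⟩)
  case commYX i j l s a h1 h2 hs ha h3 h4 => exact Or.inl (Or.inr ⟨_, _, hs, rfl, rfl⟩)
  case long i j p b h1 h2 hp hb =>
    exact Or.inl (Or.inl ⟨_, _, _, ne_neg h2, neg_ne_neg' h1, hp, rfl, rfl⟩)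
  case same i s u hs hu => exact Or.inl (Or.inr ⟨_, _, hs, rfl, rfl⟩)
  case ultrashort i j s u h1 h2 hs hu => exact Or.inl (Or.inr ⟨_, _, hs, rfl, rfl⟩)
  case short i j k p b h1 h2 h3 h4 h5 h6 hp hb =>
    exact Or.inl (Or.inl ⟨_, _, _, h1, h2, hp, rfl, rfl⟩)
  case mixedYX i j s a h1 h2 hs ha => exact Or.inl (Or.inr ⟨_, _, hs, rfl, rfl⟩)
  case mixedXY i j p u h1 h2 hp hu => exact Or.inl (Or.inl ⟨_, _, _, h1, h2, hp, rfl, rfl⟩)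

theorem Chev.right_mem (h : Chev A H α β x y w) : y ∈ rootSet A H β := by
  cases h
  case commXX i j k l p b h1 h2 h3 h4 hp hb h5 h6 h7 h8 =>
    exact Or.inl (Or.inl ⟨_, _, _, h3, h4, hb, rfl, rfl⟩)
  case commXY i j l p u h1 h2 hp hu h3 h4 => exact Or.inl (Or.inr ⟨_, _, hu, rfl, rfl⟩)
  case commYX i j l s a h1 h2 hs ha h3 h4 => exact Or.inl (Or.inl ⟨_, _, _, h1, h2, ha, rfl, rfl⟩)
  case long i j p b h1 h2 hp hb =>
    exact Or.inl (Or.inl ⟨_, _, _, h1.symm, ne_neg' h2, hb, rfl, rfl⟩)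
  case same i s u hs hu => exact Or.inl (Or.inr ⟨_, _, hu, rfl, rfl⟩)
  case ultrashort i j s u h1 h2 hs hu => exact Or.inl (Or.inr ⟨_, _, hu, rfl, rfl⟩)
  case short i j k p b h1 h2 h3 h4 h5 h6 hp hb =>
    exact Or.inl (Or.inl ⟨_, _, _, h3, h4, hb, rfl, rfl⟩)
  case mixedYX i j s a h1 h2 hs ha => exact Or.inl (Or.inl ⟨_, _, _, h1, h2, ha, rfl, rfl⟩)
  case mixedXY i j p u h1 h2 hp hu => exact Or.inl (Or.inr ⟨_, _, hu, rfl, rfl⟩)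

/-- The arguments of a Chevalley commutator formula lie in a common half-space. -/
theorem Chev.exists_weight [Finite I] (hne : ∀ i : I, -i ≠ i) (h : Chev A H α β x y w) :
    ∃ ω : I → ℤ, IsOdd ω ∧ 0 < ht ω α ∧ 0 < ht ω β := by
  have hs : ∀ i : I, vec i i = 1 := fun i => vec_self hne i
  have hodd := isOdd_vec (I := I)
  cases h
  case commXX i j k l p b h1 h2 h3 h4 hp hb h5 h6 h7 h8 =>
    have hω := ((hodd j).sub (hodd i)).add ((hodd l).sub (hodd k))
    refine ⟨_, hω, ?_, ?_⟩
    all_goals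
      have e1 := vec_eq_zero h1 h2
      have e2 := vec_eq_zero h3 h4
      have e3 := vec_nonneg (i := i) (j := k) h6
      have e4 := vec_nonpos (i := j) (j := k) h5.symm
      have e5 := vec_nonpos (i := i) (j := l) (fun h => h7 (by rw [h]))
      have e6 := vec_nonneg (i := j) (j := l) (fun h => h8 (by rw [h, neg_neg]))
      simp only [ht_sub, ht_vec hω, Pi.sub_apply, Pi.add_apply, hs, vec_comm i j, vec_comm k l,
        vec_comm k i, vec_comm k j, vec_comm l i, vec_comm l j]
      omega
  case commXY i j l p u h1 h2 hp hu h3 h4 =>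
    have hω := ((hodd j).sub (hodd i)).add (hodd l)
    refine ⟨_, hω, ?_, ?_⟩
    all_goals
      have e1 := vec_eq_zero h1 h2
      have e3 := vec_nonneg (i := j) (j := l) h4
      have e4 := vec_nonpos (i := i) (j := l) h3.symm
      simp only [ht_sub, ht_vec hω, Pi.sub_apply, Pi.add_apply, hs, vec_comm i j, vec_comm l i,
        vec_comm l j]
      omega
  case commYX i j l p u h1 h2 hp hu h3 h4 =>
    have hω := ((hodd j).sub (hodd i)).add (hodd l)
    refine ⟨_, hω, ?_, ?_⟩
    all_goals
      have e1 := vec_eq_zero h1 h2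
      have e3 := vec_nonneg (i := j) (j := l) h4
      have e4 := vec_nonpos (i := i) (j := l) h3.symm
      simp only [ht_sub, ht_vec hω, Pi.sub_apply, Pi.add_apply, hs, vec_comm i j, vec_comm l i,
        vec_comm l j]
      omega
  case long i j p b h1 h2 hp hb =>
    have e1 := vec_eq_zero h1.symm (ne_neg' h2)
    refine ⟨_, hodd i, ?_, ?_⟩
    all_goals simp only [ht_sub, vec_neg, ht_neg, ht_vec (hodd i), hs, e1]; norm_num
  case same i s u hs' hu =>
    refine ⟨_, hodd i, ?_, ?_⟩
    all_goals simp only [ht_vec (hodd i), hs]; norm_num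
  case ultrashort i j s u h1 h2 hs' hu =>
    have hω := (hodd i).add (hodd j)
    have e1 := vec_eq_zero h1 h2
    refine ⟨_, hω, ?_, ?_⟩
    all_goals simp only [ht_vec hω, Pi.add_apply, hs, vec_comm i j, e1]; norm_num
  case short i j k p b h1 h2 h3 h4 h5 h6 hp hb =>
    have hω := (hodd k).sub (hodd i)
    have e1 := vec_eq_zero h1 h2
    have e2 := vec_eq_zero h3 h4
    have e3 := vec_eq_zero h5 h6
    refine ⟨_, hω, ?_, ?_⟩
    all_goals
      simp only [ht_sub, ht_vec hω, Pi.sub_apply, hs, vec_comm i j, vec_comm i k, e1, e2, e3]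
      norm_num
  case mixedYX i j s a h1 h2 hs' ha =>
    have hω := ((hodd i).add (hodd j)).add (hodd j)
    have e1 := vec_eq_zero h1 h2
    refine ⟨_, hω, ?_, ?_⟩
    all_goals simp only [ht_sub, ht_vec hω, Pi.add_apply, hs, vec_comm i j, e1]; norm_num
  case mixedXY i j p u h1 h2 hp hu =>
    have hω := ((hodd i).add (hodd j)).add (hodd j)
    have e1 := vec_eq_zero h1 h2
    refine ⟨_, hω, ?_, ?_⟩
    all_goals simp only [ht_sub, ht_vec hω, Pi.add_apply, hs, vec_comm i j, e1]; norm_num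

variable {B Γ : Type*} [NonUnitalRing B] [StarRing B] [AddGroup Γ] [OddFormRing B Γ]

section

variable (E : FullAmbient A B Γ) (hH : H.IsHyp) {i j k : I} {p : R} {a b : S} {s : Δ} {u : Θ}
include E hH

theorem lmul_mem (hp : p ∈ Sij (selfAction R Δ) H i j) (hb : b ∈ Sij A H j k) :
    A.lmul p b ∈ Sij A H i k := by
  have h1 := E.self.isMat hH hp
  have h2 := E.isMat hH hb
  rw [E.mem_Sij hH, E.s_lmul]
  exact h1.mul h2

theorem lmul_pi_mem (hs : s ∈ Theta0 (selfAction R Δ) H i) (hu : u ∈ Theta0 A H j) :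
    -(A.lmul (star (pi s)) (pi u)) ∈ Sij A H (-i) j := by
  have h1 := E.self.isIso hH hs
  have h2 := E.isIso hH hu
  rw [E.mem_Sij hH, map_neg, E.s_lmul, map_star, E.d_pi, E.t_pi]
  refine IsMat.neg ⟨?_, ?_⟩
  · rw [← mul_assoc]; congr 1; exact h1.star_e_pi (E.fam_isHyp hH)
  · rw [mul_assoc, h2.pi_e]

theorem lmul_rho_mem (hs : s ∈ Theta0 (selfAction R Δ) H i) (ha : a ∈ Sij A H i j) :
    A.lmul (rho s) a ∈ Sij A H (-i) j := by
  have h1 := E.self.isIso hH hs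
  have h2 := E.isMat hH ha
  rw [E.mem_Sij hH, E.s_lmul, E.d_rho]
  exact ⟨by rw [← mul_assoc]; congr 1; exact h1.e_rho (E.fam_isHyp hH), by rw [mul_assoc, h2.2]⟩

theorem rmul_rho_mem (hu : u ∈ Theta0 A H i) (hp : p ∈ Sij (selfAction R Δ) H i j) :
    -(A.rmul (rho u) p) ∈ Sij A H (-i) j := by
  have h1 := E.isIso hH hu
  have h2 := E.self.isMat hH hp
  rw [E.mem_Sij hH, map_neg, E.s_rmul, E.t_rho]
  refine IsMat.neg ⟨?_, ?_⟩
  · rw [← mul_assoc]; congr 1; exact h1.e_rho (E.fam_isHyp hH)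
  · rw [mul_assoc]; congr 1; exact h2.2

theorem actS_mem (hs : s ∈ Theta0 (selfAction R Δ) H i) (ha : a ∈ Sij A H i j) :
    -(A.actS s (-a)) ∈ Theta0 A H j := by
  refine E.Theta0_neg hH ?_
  have h1 := (E.self.mem_Theta0 hH).1 hs
  have h2 := (E.isMat hH ha).neg
  rw [E.mem_Theta0 hH, E.t_actS, map_neg]
  refine ⟨by rw [← act_mul, h2.2], fun k => ?_⟩
  rw [pi_act, ← mul_assoc]
  have := h1.2 k
  exact (congrArg (· * _) this).trans (zero_mul _)

theorem actR_mem (hu : u ∈ Theta0 A H i) (hp : p ∈ Sij (selfAction R Δ) H i j) :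
    A.actR u (-p) ∈ Theta0 A H j := by
  have h1 := (E.mem_Theta0 hH).1 hu
  have h2 := (E.self.isMat hH hp).neg
  rw [E.mem_Theta0 hH, E.t_actR, map_neg]
  refine ⟨?_, fun k => ?_⟩
  · rw [← act_mul]; exact congrArg _ h2.2
  · rw [pi_act, ← mul_assoc, h1.2, zero_mul]

end

/-- The set of roots `iα + jβ` with `i ≥ 0` and `j > 0`. -/
def cone (α β : I → ℤ) : Set (I → ℤ) :=
  {γ | γ ∈ roots I ∧ ∃ m n : ℕ, 0 < n ∧ γ = m • α + n • β}

/-- The right hand side of a commutator formula consists of root elements with roots in the cone. -/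
theorem Chev.mem_cone [Finite I] (E : FullAmbient A B Γ) (hH : H.IsHyp) (h : Chev A H α β x y w) :
    w ∈ stSub A H (cone α β) := by
  have hne := hH.neg_ne
  have hself : ∀ {α β : I → ℤ}, β ∈ roots I → β ∈ cone α β := fun h => ⟨h, 0, 1, by simp⟩
  have hy : y ∈ stSub A H (cone α β) := by
    cases h
    case commXX i j k l p b h1 h2 h3 h4 hp hb h5 h6 h7 h8 =>
      exact X_mem_stSub h3 h4 hb (hself (sub_mem_roots h3))
    case commXY i j l p u h1 h2 hp hu h3 h4 => exact Y_mem_stSub hu (hself (vec_mem_roots _))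
    case commYX i j l s a h1 h2 hs ha h3 h4 =>
      exact X_mem_stSub h1 h2 ha (hself (sub_mem_roots h1))
    case long i j p b h1 h2 hp hb =>
      exact X_mem_stSub h1.symm (ne_neg' h2) hb (hself (sub_mem_roots h1.symm))
    case same i s u hs hu => exact Y_mem_stSub hu (hself (vec_mem_roots _))
    case ultrashort i j s u h1 h2 hs hu => exact Y_mem_stSub hu (hself (vec_mem_roots _))
    case short i j k p b h1 h2 h3 h4 h5 h6 hp hb =>
      exact X_mem_stSub h3 h4 hb (hself (sub_mem_roots h3))
    case mixedYX i j s a h1 h2 hs ha => exact X_mem_stSub h1 h2 ha (hself (sub_mem_roots h1))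
    case mixedXY i j p u h1 h2 hp hu => exact Y_mem_stSub hu (hself (vec_mem_roots _))
  cases h
  case commXX i j k l p b h1 h2 h3 h4 hp hb h5 h6 h7 h8 => exact hy
  case commXY i j l p u h1 h2 hp hu h3 h4 => exact hy
  case commYX i j l s a h1 h2 hs ha h3 h4 => exact hy
  case long i j p b h1 h2 hp hb =>
    refine mul_mem (Yphi_mem_stSub (lmul_mem E hH hp hb) ⟨add_mem_roots (hne i).symm, 1, 1, ?_⟩) hy
    rw [vec_neg]; simp; abel
  case same i s u hs hu =>
    refine mul_mem (Yphi_mem_stSub (lmul_pi_mem E hH hs hu) ⟨add_mem_roots (hne i).symm, 1, 1, ?_⟩) hy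
    simp
  case ultrashort i j s u h1 h2 hs hu =>
    refine mul_mem (X_mem_stSub (ne_neg h2) (neg_ne_neg' h1) (lmul_pi_mem E hH hs hu)
      ⟨sub_mem_roots (ne_neg h2), 1, 1, ?_⟩) hy
    rw [vec_neg]; simp; abel
  case short i j k p b h1 h2 h3 h4 h5 h6 hp hb =>
    refine mul_mem (X_mem_stSub h5 h6 (lmul_mem E hH hp hb) ⟨sub_mem_roots h5, 1, 1, ?_⟩) hy
    simp
  case mixedYX i j s a h1 h2 hs ha =>
    refine mul_mem (mul_mem (X_mem_stSub (ne_neg h2) (neg_ne_neg' h1) (lmul_rho_mem E hH hs ha)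
      ⟨sub_mem_roots (ne_neg h2), 2, 1, ?_⟩) (Y_mem_stSub (actS_mem E hH hs ha)
      ⟨vec_mem_roots _, 1, 1, ?_⟩)) hy
    · simp only [one_smul, zero_lt_one, true_and, two_smul, vec_neg]; abel
    · simp
  case mixedXY i j p u h1 h2 hp hu =>
    refine mul_mem (mul_mem (Y_mem_stSub (actR_mem E hH hu hp) ⟨vec_mem_roots _, 1, 1, ?_⟩)
      (X_mem_stSub (ne_neg h2) (neg_ne_neg' h1) (rmul_rho_mem E hH hu hp)
      ⟨sub_mem_roots (ne_neg h2), 1, 2, ?_⟩)) hy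
    · simp
    · simp only [one_smul, zero_lt_two, true_and, two_smul, vec_neg]; abel

/-- The commutator formulas hold in the unitary group of the ambient odd form ring. -/
theorem Chev.st_eq (E : FullAmbient A B Γ) (hH : H.IsHyp) (h : Chev A H α β x y w) :
    E.st hH w = E.self.st hH x * E.st hH y * (E.self.st hH x)⁻¹ := by
  have hN := E.fam_isHyp hH
  symm
  cases h
  case commXX i j k l p b h1 h2 h3 h4 hp hb h5 h6 h7 h8 =>
    rw [E.self.st_X hH h1 h2 hp, E.st_X hH h3 h4 hb]
    refine (conj_of_comm (commX_X hN h1 h2 h3 h4 (E.self.isMat hH hp) (E.isMat hH hb) h5 h6 h7 h8)).trans ?_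
    rw [one_mul]
  case commXY i j l p u h1 h2 hp hu h3 h4 =>
    rw [E.self.st_X hH h1 h2 hp, E.st_Y hH hu]
    refine (conj_of_comm (commX_Y hN h1 h2 (E.self.isMat hH hp) (E.isIso hH hu) h3 h4
      (E.e_pi hH hu _) (E.e_pi hH hu _))).trans ?_
    rw [one_mul]
  case commYX i j l s a h1 h2 hs ha h3 h4 =>
    rw [E.self.st_Y hH hs, E.st_X hH h1 h2 ha]
    have := commX_Y hN h1 h2 (E.isMat hH ha) (E.self.isIso hH hs) h3 h4
      (E.self.e_pi hH hs _) (E.self.e_pi hH hs _)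
    refine (conj_of_comm (z := 1) ?_).trans (one_mul _)
    rw [← commutatorElement_inv, inv_eq_one]
    exact this
  case long i j p b h1 h2 hp hb =>
    have hpb := lmul_mem E hH hp hb
    rw [E.self.st_X hH (ne_neg h2) (neg_ne_neg' h1) hp, E.st_X hH h1.symm (ne_neg' h2) hb, map_mul,
      E.st_X hH h1.symm (ne_neg' h2) hb, E.st_Y hH (E.Theta0_phi hH hpb), E.t_phi, E.s_lmul]
    exact conj_of_comm (commX_long hN h1 h2 (E.self.isMat hH hp) (E.isMat hH hb))
  case same i s u hs hu =>
    have hpb := lmul_pi_mem E hH hs hu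
    rw [E.self.st_Y hH hs, map_mul, E.st_Y hH hu, E.st_Y hH (E.Theta0_phi hH hpb), E.t_phi, map_neg,
      E.s_lmul, map_star, E.d_pi, E.t_pi]
    exact conj_of_comm (gY_phi_comm hN (E.self.isIso hH hs) (E.isIso hH hu))
  case ultrashort i j s u h1 h2 hs hu =>
    have hpb := lmul_pi_mem E hH hs hu
    rw [E.self.st_Y hH hs, map_mul, E.st_Y hH hu, E.st_X hH (ne_neg h2) (neg_ne_neg' h1) hpb,
      map_neg, E.s_lmul, map_star, E.d_pi, E.t_pi]
    exact conj_of_comm (comm_gY_gY hN h1 h2 (E.self.isIso hH hs) (E.self.e_pi hH hs _)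
      (E.self.e_pi hH hs _) (E.isIso hH hu) (E.e_pi hH hu _))
  case short i j k p b h1 h2 h3 h4 h5 h6 hp hb =>
    have hpb := lmul_mem E hH hp hb
    rw [E.self.st_X hH h1 h2 hp, map_mul, E.st_X hH h3 h4 hb, E.st_X hH h5 h6 hpb, E.s_lmul]
    exact conj_of_comm (commX_short hN h1 h2 h3 h4 h5 h6 (E.self.isMat hH hp) (E.isMat hH hb))
  case mixedYX i j s a h1 h2 hs ha =>
    rw [E.self.st_Y hH hs, map_mul, map_mul, E.st_X hH h1 h2 ha,
      E.st_X hH (ne_neg h2) (neg_ne_neg' h1) (lmul_rho_mem E hH hs ha),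
      E.st_Y hH (actS_mem E hH hs ha), map_neg, E.t_actS, map_neg, E.s_lmul, E.d_rho]
    exact conj_of_comm (comm_gY_gX hN h1 h2 (E.self.isIso hH hs) (E.self.e_pi hH hs _)
      (E.self.e_pi hH hs _) (E.isMat hH ha))
  case mixedXY i j p u h1 h2 hp hu =>
    have hX := rmul_rho_mem E hH hu hp
    have hY := actR_mem E hH hu hp
    have h := comm_gY_gX hN h1 h2 (E.isIso hH hu) (E.e_pi hH hu _)
      (E.e_pi hH hu _) (E.self.isMat hH hp)
    rw [E.self.st_X hH h1 h2 hp, map_mul, map_mul, E.st_Y hH hu]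
    refine conj_of_comm ?_
    rw [← commutatorElement_inv]
    refine (congrArg (·⁻¹) h).trans ?_
    rw [mul_inv_rev]
    congr 1
    · have e : A.actR u (-p) = -(-(A.actR u (-p))) := (neg_neg _).symm
      rw [e, Y_neg E.toAmbient hH (E.Theta0_neg hH hY), map_inv, E.st_Y hH (E.Theta0_neg hH hY), map_neg,
        E.t_actR, map_neg]
      rfl
    · have hX' : A.rmul (rho u) p ∈ Sij A H (-i) j := by
        have := E.Sij_neg hH hX
        rwa [neg_neg] at this
      rw [X_neg E.toAmbient hH (ne_neg h2) (neg_ne_neg' h1) hX', map_inv,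
        E.st_X hH (ne_neg h2) (neg_ne_neg' h1) hX', E.s_rmul, E.t_rho]
      rfl

end Chevalley

/-! ### Commutator formulas for pairs of roots -/

section Coverage

variable {R Δ S Θ : Type*} [NonUnitalRing R] [StarRing R] [AddGroup Δ] [OddFormRing R Δ]
  [NonUnitalRing S] [StarRing S] [AddGroup Θ] [OddFormRing S Θ]
variable {I : Type*} [InvolutiveNeg I]
variable {A : ActionData R Δ S Θ} {H : Family R Δ I} {α β : I → ℤ}
variable {i j k l : I} {p : R} {a b : S} {s : Δ} {u : Θ}
variable {B Γ : Type*} [NonUnitalRing B] [StarRing B] [AddGroup Γ] [OddFormRing B Γ]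

theorem eq_neg_swap (h : i = -j) : j = -i := by rw [h, neg_neg]

theorem vec_sub_neg_neg (i j : I) : vec (-i) - vec (-j) = vec j - vec i := by
  have h : ∀ i : I, vec (-i) = -vec i := fun i => by
    simp only [vec, neg_neg, neg_sub]
  rw [h, h]; abel

theorem Chev.exists_XX_core (h1 : i ≠ j) (h2 : i ≠ -j) (h3 : j ≠ l) (h4 : j ≠ -l)
    (hp : p ∈ Sij (selfAction R Δ) H i j) (hb : b ∈ Sij A H j l) (h5 : i ≠ l) :
    ∃ w, Chev A H (vec j - vec i) (vec l - vec j) (X (selfAction R Δ) H i j p) (X A H j l b) w := by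
  by_cases h6 : i = -l
  · subst h6
    exact ⟨_, Chev.long l j p b h3.symm (ne_neg' h4) hp hb⟩
  · exact ⟨_, Chev.short i j l p b h1 h2 h3 h4 h5 h6 hp hb⟩

/-- Two short root elements satisfy one of the commutator formulas unless their roots are
opposite. -/
theorem Chev.exists_XX (E : FullAmbient A B Γ) (hH : H.IsHyp) (h1 : i ≠ j) (h2 : i ≠ -j)
    (h3 : k ≠ l) (h4 : k ≠ -l)
    (hp : p ∈ Sij (selfAction R Δ) H i j) (hb : b ∈ Sij A H k l)
    (h : vec j - vec i + (vec l - vec k) ≠ 0) :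
    ∃ w, Chev A H (vec j - vec i) (vec l - vec k) (X (selfAction R Δ) H i j p) (X A H k l b) w := by
  have h1' : -j ≠ -i := neg_ne_neg' h1.symm
  have h2' : -j ≠ -(-i) := by rw [neg_neg]; exact ne_neg (ne_neg' h2)
  have h3' : -l ≠ -k := neg_ne_neg' h3.symm
  have h4' : -l ≠ -(-k) := by rw [neg_neg]; exact ne_neg (ne_neg' h4)
  by_cases c1 : j = k
  · subst c1
    refine Chev.exists_XX_core h1 h2 h3 h4 hp hb ?_
    rintro rfl
    exact h (by abel)
  by_cases c2 : k = -i
  · subst c2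
    rw [X_sym h1 h2 hp, ← vec_sub_neg_neg i j]
    refine Chev.exists_XX_core h1' h2' h3 h4 (E.self.Sij_star hH hp) hb ?_
    rintro rfl
    rw [vec_sub_neg_neg] at h
    exact h (by abel)
  by_cases c3 : -l = j
  · subst c3
    rw [X_sym h3 h4 hb, ← vec_sub_neg_neg k l]
    exact Chev.exists_XX_core h1 h2 h3' h4' hp (E.Sij_star hH hb)
      (fun h => c2 (eq_neg_swap h))
  by_cases c4 : i = l
  · subst c4
    rw [X_sym h1 h2 hp, ← vec_sub_neg_neg i j, X_sym h3 h4 hb, ← vec_sub_neg_neg k i]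
    exact Chev.exists_XX_core h1' h2' h3' h4' (E.self.Sij_star hH hp) (E.Sij_star hH hb)
      (neg_ne_neg' c1)
  · exact ⟨_, Chev.commXX i j k l p b h1 h2 h3 h4 hp hb c1 c2 (neg_ne_neg' c4) c3⟩

theorem Chev.exists_XY (E : FullAmbient A B Γ) (hH : H.IsHyp) (h1 : i ≠ j) (h2 : i ≠ -j)
    (hp : p ∈ Sij (selfAction R Δ) H i j) (hu : u ∈ Theta0 A H l) :
    ∃ w, Chev A H (vec j - vec i) (vec l) (X (selfAction R Δ) H i j p) (Y A H l u) w := by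
  by_cases c1 : i = l
  · subst c1
    exact ⟨_, Chev.mixedXY i j p u h1 h2 hp hu⟩
  by_cases c2 : l = -j
  · subst c2
    rw [X_sym h1 h2 hp, ← vec_sub_neg_neg i j]
    exact ⟨_, Chev.mixedXY (-j) (-i) _ u (neg_ne_neg' h1.symm)
      (by rw [neg_neg]; exact ne_neg (ne_neg' h2)) (E.self.Sij_star hH hp) hu⟩
  · exact ⟨_, Chev.commXY i j l p u h1 h2 hp hu c1 c2⟩

theorem Chev.exists_YX (E : FullAmbient A B Γ) (hH : H.IsHyp) (h1 : i ≠ j) (h2 : i ≠ -j)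
    (hs : s ∈ Theta0 (selfAction R Δ) H l) (ha : a ∈ Sij A H i j) :
    ∃ w, Chev A H (vec l) (vec j - vec i) (Y (selfAction R Δ) H l s) (X A H i j a) w := by
  by_cases c1 : i = l
  · subst c1
    exact ⟨_, Chev.mixedYX i j s a h1 h2 hs ha⟩
  by_cases c2 : l = -j
  · subst c2
    rw [X_sym h1 h2 ha, ← vec_sub_neg_neg i j]
    exact ⟨_, Chev.mixedYX (-j) (-i) s _ (neg_ne_neg' h1.symm)
      (by rw [neg_neg]; exact ne_neg (ne_neg' h2)) hs (E.Sij_star hH ha)⟩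
  · exact ⟨_, Chev.commYX i j l s a h1 h2 hs ha c1 c2⟩

theorem Chev.exists_YY (hs : s ∈ Theta0 (selfAction R Δ) H i) (hu : u ∈ Theta0 A H j)
    (h : vec i + vec j ≠ 0) :
    ∃ w, Chev A H (vec i) (vec j) (Y (selfAction R Δ) H i s) (Y A H j u) w := by
  by_cases c1 : i = j
  · subst c1
    exact ⟨_, Chev.same i s u hs hu⟩
  by_cases c2 : i = -j
  · subst c2
    refine absurd ?_ h
    simp only [vec, neg_neg]; abel
  · exact ⟨_, Chev.ultrashort i j s u c1 c2 hs hu⟩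

/-- The root elements `X_{ij}(a)` and `X_j(u)` with their roots. In contrast to `rootSet`, the
element `X_j(φ(a))` is not considered as an element with the long root `2 e_j`. -/
def redRootSet (A : ActionData R Δ S Θ) (H : Family R Δ I) (α : I → ℤ) : Set (StU A H) :=
  {x | ∃ i j a, i ≠ j ∧ i ≠ -j ∧ a ∈ Sij A H i j ∧ α = vec j - vec i ∧ x = X A H i j a} ∪
  {x | ∃ j, ∃ u ∈ Theta0 A H j, α = vec j ∧ x = Y A H j u}

theorem redRootSet_subset : redRootSet A H α ⊆ rootSet A H α := fun _ hx => Or.inl hx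

/-- Two root elements satisfy one of the commutator formulas unless their roots are opposite. -/
theorem Chev.exists (E : FullAmbient A B Γ) (hH : H.IsHyp) {x : StU (selfAction R Δ) H}
    {y : StU A H} (hx : x ∈ redRootSet (selfAction R Δ) H α) (hy : y ∈ redRootSet A H β)
    (h : α + β ≠ 0) : ∃ w, Chev A H α β x y w := by
  rcases hx with ⟨i, j, p, h1, h2, hp, rfl, rfl⟩ | ⟨i, s, hs, rfl, rfl⟩ <;>
  rcases hy with ⟨k, l, b, h3, h4, hb, rfl, rfl⟩ | ⟨l, u, hu, rfl, rfl⟩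
  · exact Chev.exists_XX E hH h1 h2 h3 h4 hp hb h
  · exact Chev.exists_XY E hH h1 h2 hp hu
  · exact Chev.exists_YX E hH h3 h4 hs hb
  · exact Chev.exists_YY hs hu h

end Coverage

section ChevRel

variable {R Δ S Θ : Type*} [NonUnitalRing R] [StarRing R] [AddGroup Δ] [OddFormRing R Δ]
  [NonUnitalRing S] [StarRing S] [AddGroup Θ] [OddFormRing S Θ]
variable {I : Type} [InvolutiveNeg I] {H : Family R Δ I} {M : CrossedModule R Δ S Θ}
  {α β : I → ℤ} {x : StU (selfAction R Δ) H} {y w : StU M.action H}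

theorem Chev.chevRel (h : Chev M.action H α β x y w) : ChevRel M H α x y w := by
  cases h
  case commXX i j k l p b h1 h2 h3 h4 hp hb h5 h6 h7 h8 =>
    exact .commXX i j k l p b h1 h2 h3 h4 hp hb h5 h6 h7 h8
  case commXY i j l p u h1 h2 hp hu h3 h4 => exact .commXY i j l p u h1 h2 hp hu h3 h4
  case commYX i j l s a h1 h2 hs ha h3 h4 => exact .commYX i j l s a h1 h2 hs ha h3 h4
  case long i j p b h1 h2 hp hb => exact .long i j p b h1 h2 hp hb
  case same i s u hs hu => exact .same i s u hs hu
  case ultrashort i j s u h1 h2 hs hu => exact .ultrashort i j s u h1 h2 hs hu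
  case short i j k p b h1 h2 h3 h4 h5 h6 hp hb => exact .short i j k p b h1 h2 h3 h4 h5 h6 hp hb
  case mixedYX i j s a h1 h2 hs ha => exact .mixedYX i j s a h1 h2 hs ha
  case mixedXY i j p u h1 h2 hp hu => exact .mixedXY i j p u h1 h2 hp hu

theorem ChevRel.chev (h : ChevRel M H α x y w) : ∃ β, Chev M.action H α β x y w := by
  cases h
  case commXX i j k l p b h1 h2 h3 h4 hp hb h5 h6 h7 h8 =>
    exact ⟨_, .commXX i j k l p b h1 h2 h3 h4 hp hb h5 h6 h7 h8⟩
  case commXY i j l p u h1 h2 hp hu h3 h4 => exact ⟨_, .commXY i j l p u h1 h2 hp hu h3 h4⟩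
  case commYX i j l s a h1 h2 hs ha h3 h4 => exact ⟨_, .commYX i j l s a h1 h2 hs ha h3 h4⟩
  case long i j p b h1 h2 hp hb => exact ⟨_, .long i j p b h1 h2 hp hb⟩
  case same i s u hs hu => exact ⟨_, .same i s u hs hu⟩
  case ultrashort i j s u h1 h2 hs hu => exact ⟨_, .ultrashort i j s u h1 h2 hs hu⟩
  case short i j k p b h1 h2 h3 h4 h5 h6 hp hb =>
    exact ⟨_, .short i j k p b h1 h2 h3 h4 h5 h6 hp hb⟩
  case mixedYX i j s a h1 h2 hs ha => exact ⟨_, .mixedYX i j s a h1 h2 hs ha⟩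
  case mixedXY i j p u h1 h2 hp hu => exact ⟨_, .mixedXY i j p u h1 h2 hp hu⟩

end ChevRel

/-! ### Functoriality of Steinberg groups -/

section Functoriality

variable {R Δ S Θ S' Θ' : Type*} [NonUnitalRing R] [StarRing R] [AddGroup Δ] [OddFormRing R Δ]
  [NonUnitalRing S] [StarRing S] [AddGroup Θ] [OddFormRing S Θ]
  [NonUnitalRing S'] [StarRing S'] [AddGroup Θ'] [OddFormRing S' Θ']
variable {I : Type*} [InvolutiveNeg I]
variable {A : ActionData R Δ S Θ} {A' : ActionData R Δ S' Θ'} {H : Family R Δ I} {i j : I} {a : S}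
  {u : Θ}

/-- A homomorphism of odd form rings that maps parameters of root elements to parameters of root
elements. -/
structure ParamHom (A : ActionData R Δ S Θ) (A' : ActionData R Δ S' Θ') (H : Family R Δ I) where
  σ : S → S'
  τ : Θ → Θ'
  σ_add : ∀ a b, σ (a + b) = σ a + σ b
  σ_mul : ∀ a b, σ (a * b) = σ a * σ b
  σ_star : ∀ a, σ (star a) = star (σ a)
  τ_add : ∀ u v, τ (u + v) = τ u + τ v
  τ_phi : ∀ a, τ (phi a) = phi (σ a)
  σ_pi : ∀ u, σ (pi u) = pi (τ u)
  σ_rho : ∀ u, σ (rho u) = rho (τ u)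
  τ_act : ∀ u a, τ (act u a) = act (τ u) (σ a)
  mem_Sij : ∀ {i j a}, a ∈ Sij A H i j → σ a ∈ Sij A' H i j
  mem_Theta0 : ∀ {j u}, u ∈ Theta0 A H j → τ u ∈ Theta0 A' H j

namespace ParamHom

variable (f : ParamHom A A' H)

theorem σ_neg (a : S) : f.σ (-a) = -f.σ a := (AddMonoidHom.mk' f.σ f.σ_add).map_neg a

theorem τ_neg (u : Θ) : f.τ (-u) = -f.τ u := (AddMonoidHom.mk' f.τ f.τ_add).map_neg u

/-- Images of the generators under the induced homomorphism of Steinberg groups. -/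
def gen : Gen A H → StU A' H
  | .short i j a _ => X A' H i j (f.σ a)
  | .ultrashort j u _ => Y A' H j (f.τ u)

theorem lift_X (h1 : i ≠ j) (h2 : i ≠ -j) (ha : a ∈ Sij A H i j) :
    FreeGroup.lift f.gen (wX A H i j a) = X A' H i j (f.σ a) := lift_wX f.gen h1 h2 ha

theorem lift_Y (hu : u ∈ Theta0 A H j) :
    FreeGroup.lift f.gen (wY A H j u) = Y A' H j (f.τ u) := lift_wY f.gen hu

variable {B Γ : Type*} [NonUnitalRing B] [StarRing B] [AddGroup Γ] [OddFormRing B Γ]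
variable (E : Ambient A B Γ) (hH : H.IsHyp)

include E hH in
theorem gen_rel (x y : FreeGroup (Gen A H)) (h : StRel A H x y) :
    FreeGroup.lift f.gen x = FreeGroup.lift f.gen y := by
  cases h with
  | sym i j a h1 h2 ha =>
    rw [f.lift_X h1 h2 ha, f.lift_X (neg_ne_neg' h1.symm)
      (by rw [neg_neg]; exact ne_neg (ne_neg' h2)) (E.Sij_star hH ha), f.σ_neg, f.σ_star]
    exact X_sym h1 h2 (f.mem_Sij ha)
  | addX i j a b h1 h2 ha hb =>
    rw [map_mul, f.lift_X h1 h2 ha, f.lift_X h1 h2 hb, f.lift_X h1 h2 (E.Sij_add hH ha hb), f.σ_add]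
    exact (X_add h1 h2 (f.mem_Sij ha) (f.mem_Sij hb)).symm
  | addY j u v hu hv =>
    rw [map_mul, f.lift_Y hu, f.lift_Y hv, f.lift_Y (E.Theta0_add hH hu hv), f.τ_add]
    exact (Y_add (f.mem_Theta0 hu) (f.mem_Theta0 hv)).symm
  | commXX i j k l a b h1 h2 h3 h4 ha hb h5 h6 h7 h8 =>
    rw [map_commutatorElement, f.lift_X h1 h2 ha, f.lift_X h3 h4 hb, map_one]
    simpa [X] using
      (StRel.commXX i j k l _ _ h1 h2 h3 h4 (f.mem_Sij ha) (f.mem_Sij hb) h5 h6 h7 h8).mk_eq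
  | commXY i j l a u h1 h2 ha hu h3 h4 =>
    rw [map_commutatorElement, f.lift_X h1 h2 ha, f.lift_Y hu, map_one]
    simpa [X, Y] using
      (StRel.commXY i j l _ _ h1 h2 (f.mem_Sij ha) (f.mem_Theta0 hu) h3 h4).mk_eq
  | commLong i j a b h1 h2 ha hb =>
    rw [map_commutatorElement, f.lift_X (ne_neg h2) (neg_ne_neg' h1) ha,
      f.lift_X h1.symm (ne_neg' h2) hb, f.lift_Y (E.Theta0_phi hH (E.Sij_mul hH ha hb)), f.τ_phi,
      f.σ_mul]
    simpa [X, Y] using (StRel.commLong i j _ _ h1 h2 (f.mem_Sij ha) (f.mem_Sij hb)).mk_eq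
  | commYsame i u v hu hv =>
    rw [map_commutatorElement, f.lift_Y hu, f.lift_Y hv,
      f.lift_Y (E.Theta0_phi hH (E.Sij_pi hH hu hv)), f.τ_phi, f.σ_neg, f.σ_mul, f.σ_star, f.σ_pi,
      f.σ_pi]
    simpa [X, Y] using (StRel.commYsame i _ _ (f.mem_Theta0 hu) (f.mem_Theta0 hv)).mk_eq
  | commYY i j u v h1 h2 hu hv =>
    rw [map_commutatorElement, f.lift_Y hu, f.lift_Y hv,
      f.lift_X (ne_neg h2) (neg_ne_neg' h1) (E.Sij_pi hH hu hv), f.σ_neg, f.σ_mul, f.σ_star, f.σ_pi,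
      f.σ_pi]
    simpa [X, Y] using (StRel.commYY i j _ _ h1 h2 (f.mem_Theta0 hu) (f.mem_Theta0 hv)).mk_eq
  | commShort i j k a b h1 h2 h3 h4 h5 h6 ha hb =>
    rw [map_commutatorElement, f.lift_X h1 h2 ha, f.lift_X h3 h4 hb,
      f.lift_X h5 h6 (E.Sij_mul hH ha hb), f.σ_mul]
    simpa [X, Y] using
      (StRel.commShort i j k _ _ h1 h2 h3 h4 h5 h6 (f.mem_Sij ha) (f.mem_Sij hb)).mk_eq
  | commYX i j u a h1 h2 hu ha =>
    rw [map_commutatorElement, f.lift_Y hu, f.lift_X h1 h2 ha, map_mul,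
      f.lift_X (ne_neg h2) (neg_ne_neg' h1) (E.Sij_rho hH hu ha),
      f.lift_Y (E.Theta0_neg hH (E.Theta0_act hH hu (E.Sij_neg hH ha))), f.σ_mul, f.σ_rho,
      f.τ_neg, f.τ_act, f.σ_neg]
    simpa [X, Y] using (StRel.commYX i j _ _ h1 h2 (f.mem_Theta0 hu) (f.mem_Sij ha)).mk_eq

/-- The induced homomorphism of Steinberg groups. -/
def map (E : Ambient A B Γ) (hH : H.IsHyp) : StU A H →* StU A' H := StU.lift f.gen (f.gen_rel E hH)

theorem map_X (h1 : i ≠ j) (h2 : i ≠ -j) (ha : a ∈ Sij A H i j) :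
    f.map E hH (X A H i j a) = X A' H i j (f.σ a) := by
  rw [X, map, StU.lift_mk, f.lift_X h1 h2 ha]

theorem map_Y (hu : u ∈ Theta0 A H j) :
    f.map E hH (Y A H j u) = Y A' H j (f.τ u) := by
  rw [Y, map, StU.lift_mk, f.lift_Y hu]

theorem map_mem [Finite I] {P : Set (I → ℤ)} {x : StU A H} (hx : x ∈ stSub A H P) :
    f.map E hH x ∈ stSub A' H P := by
  suffices stSub A H P ≤ (stSub A' H P).comap (f.map E hH) from this hx
  refine stSub_le ?_ ?_ ?_
  · intro i j a h1 h2 ha h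
    rw [Subgroup.mem_comap, f.map_X E hH h1 h2 ha]
    exact X_mem_stSub h1 h2 (f.mem_Sij ha) h
  · intro j u hu h
    rw [Subgroup.mem_comap, f.map_Y E hH hu]
    exact Y_mem_stSub (f.mem_Theta0 hu) h
  · intro j a ha h
    rw [Subgroup.mem_comap, f.map_Y E hH (E.Theta0_phi hH ha), f.τ_phi]
    exact Yphi_mem_stSub (f.mem_Sij ha) h

end ParamHom

end Functoriality

/-! ### The diagonal group -/

section Diagonal

variable {R Δ S Θ : Type*} [NonUnitalRing R] [StarRing R] [AddGroup Δ] [OddFormRing R Δ]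
  [NonUnitalRing S] [StarRing S] [AddGroup Θ] [OddFormRing S Θ]
variable {B Γ : Type*} [NonUnitalRing B] [StarRing B] [AddGroup Γ] [OddFormRing B Γ]
variable {A : ActionData R Δ S Θ} (E : Ambient A B Γ)
variable {I : Type*} [InvolutiveNeg I] {H : Family R Δ I} {i j : I} {g g' g'' : Δ}

theorem Ambient.s_conjS (g : Δ) (a : S) : E.s (conjS A g a) = conjB (E.d g) (E.s a) := by
  simp only [conjS, conjB, map_add, E.s_lmul, E.s_rmul, map_star, E.d_pi]

theorem Ambient.t_conjΘ (g : Δ) (u : Θ) : E.t (conjΘ A g u) = conjG (B := B) (E.d g) (E.t u) := by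
  simp only [conjΘ, conjG, actOne, map_add, E.t_actR, E.t_actS, E.t_phi, E.s_rmul, map_star, E.d_pi,
    E.t_rho, E.t_pi]

/-- Elements of the diagonal group: unitary elements that commute with the idempotents of the
family. -/
structure IsDiag (E : Ambient A B Γ) (H : Family R Δ I) (g : Δ) : Prop where
  unitary : IsUnitary B (E.d g)
  comm : ∀ i, pi (E.d g) * (E.fam H).e i = (E.fam H).e i * pi (E.d g)

variable {E}

theorem IsDiag.conj_e (h : IsDiag E H g) (i : I) :
    conjB (E.d g) ((E.fam H).e i) = (E.fam H).e i := by
  have h1 := h.unitary.mul_star_add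
  rw [conjB, h.comm i, mul_assoc, add_assoc, add_assoc, ← mul_add, ← mul_add]
  have : pi (E.d g) + (star (pi (E.d g)) + pi (E.d g) * star (pi (E.d g))) = (0 : B) := by
    rw [← h1]; abel
  rw [this, mul_zero, add_zero]

/-- The homomorphism of odd form rings given by an element of the diagonal group. -/
def diagParam (hH : H.IsHyp) (h : IsDiag E H g) : ParamHom A A H where
  σ := conjS A g
  τ := conjΘ A g
  σ_add a b := E.s_inj (by simp only [map_add, E.s_conjS, conjB_add])
  σ_mul a b := E.s_inj (by simp only [map_mul, E.s_conjS, conjB_mul h.unitary])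
  σ_star a := E.s_inj (by simp only [map_star, E.s_conjS, conjB_star])
  τ_add a b := E.t_inj (by simp only [map_add, E.t_conjΘ, conjG_add h.unitary])
  τ_phi a := E.t_inj (by simp only [E.t_phi, E.t_conjΘ, E.s_conjS, conjG_phi])
  σ_pi u := E.s_inj (by simp only [E.t_pi, E.t_conjΘ, E.s_conjS, pi_conjG])
  σ_rho u := E.s_inj (by simp only [E.t_rho, E.t_conjΘ, E.s_conjS, rho_conjG h.unitary])
  τ_act u a := E.t_inj (by simp only [E.t_act, E.t_conjΘ, E.s_conjS, conjG_act h.unitary])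
  mem_Sij ha := by
    rw [E.mem_Sij hH] at ha ⊢
    rw [E.s_conjS]
    exact ⟨by rw [← h.conj_e _, ← conjB_mul h.unitary, ha.1],
      by rw [← h.conj_e _, ← conjB_mul h.unitary, ha.2]⟩
  mem_Theta0 hu := by
    rw [E.mem_Theta0 hH] at hu ⊢
    rw [E.t_conjΘ]
    refine ⟨by rw [← h.conj_e _, ← conjG_act h.unitary, hu.1], fun k => ?_⟩
    rw [pi_conjG, ← h.conj_e k, ← conjB_mul h.unitary, hu.2]
    simp [conjB]

/-- The automorphism of the Steinberg group given by an element of the diagonal group. -/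
def diagHom (hH : H.IsHyp) (h : IsDiag E H g) : StU A H →* StU A H :=
  (diagParam hH h).map E hH

theorem mem_diagGraph (hH : H.IsHyp) (h : IsDiag E H g) (x : StU A H) :
    (x, diagHom hH h x) ∈ diagGraph A H g := by
  refine StU.induction E hH (P := fun x => (x, diagHom hH h x) ∈ diagGraph A H g) x ?_ ?_ ?_
  · rw [map_one]; exact one_mem _
  · intro i j a x h1 h2 ha hx
    rw [map_mul]
    refine mul_mem (a := (X A H i j a, diagHom hH h (X A H i j a))) (Subgroup.subset_closure ?_) hx
    rw [diagHom, ParamHom.map_X _ _ _ h1 h2 ha]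
    exact Or.inl ⟨i, j, a, h1, h2, ha, rfl⟩
  · intro j u x hu hx
    rw [map_mul]
    refine mul_mem (a := (Y A H j u, diagHom hH h (Y A H j u))) (Subgroup.subset_closure ?_) hx
    rw [diagHom, ParamHom.map_Y _ _ _ hu]
    exact Or.inr ⟨j, u, hu, rfl⟩

theorem eq_diagHom_of_mem_diagGraph (hH : H.IsHyp) (h : IsDiag E H g) {p : StU A H × StU A H}
    (hp : p ∈ diagGraph A H g) : p.2 = diagHom hH h p.1 := by
  suffices diagGraph A H g ≤
      ((diagHom (E := E) hH h).comp (MonoidHom.fst _ _)).eqLocus (MonoidHom.snd _ _) from (this hp).symm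
  refine (Subgroup.closure_le _).2 ?_
  rintro _ (⟨i, j, a, h1, h2, ha, rfl⟩ | ⟨j, u, hu, rfl⟩)
  · exact (diagParam hH h).map_X E hH h1 h2 ha
  · exact (diagParam hH h).map_Y E hH hu

theorem diagHom_diagHom (hH : H.IsHyp) (h : IsDiag E H g) (h' : IsDiag E H g')
    (h'' : IsDiag E H g'') (e : E.d g'' = umul (S := B) (E.d g) (E.d g')) (x : StU A H) :
    diagHom hH h (diagHom hH h' x) = diagHom hH h'' x := by
  have e1 : ∀ a, conjS A g (conjS A g' a) = conjS A g'' a := fun a => E.s_inj (by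
    rw [E.s_conjS, E.s_conjS, E.s_conjS, e, conjB_umul])
  have e2 : ∀ a, conjΘ A g (conjΘ A g' a) = conjΘ A g'' a := fun a => E.t_inj (by
    rw [E.t_conjΘ, E.t_conjΘ, E.t_conjΘ, e, conjG_umul h.unitary])
  refine StU.induction E hH (P := fun x => diagHom hH h (diagHom hH h' x) = diagHom hH h'' x)
    x ?_ ?_ ?_
  · simp only [map_one]
  · intro i j a x h1 h2 ha hx
    simp only [map_mul, hx]
    congr 1
    simp only [diagHom]
    rw [ParamHom.map_X _ _ _ h1 h2 ha, ParamHom.map_X _ _ _ h1 h2 ha,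
      ParamHom.map_X _ _ _ h1 h2 ((diagParam hH h').mem_Sij ha)]
    exact congrArg _ (e1 a)
  · intro j u x hu hx
    simp only [map_mul, hx]
    congr 1
    simp only [diagHom]
    rw [ParamHom.map_Y _ _ _ hu, ParamHom.map_Y _ _ _ hu,
      ParamHom.map_Y _ _ _ ((diagParam hH h').mem_Theta0 hu)]
    exact congrArg _ (e2 u)

theorem diagHom_of_eq_zero (hH : H.IsHyp) (h : IsDiag E H g) (e : E.d g = 0) (x : StU A H) :
    diagHom hH h x = x := by
  have e1 : ∀ a, conjS A g a = a := fun a => E.s_inj (by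
    rw [E.s_conjS, e]; simp [conjB, pi_zero])
  have e2 : ∀ a, conjΘ A g a = a := fun a => E.t_inj (by
    rw [E.t_conjΘ, e]; simp [conjG, actOne, pi_zero, zero_act, act_zero, phi_zero])
  refine StU.induction E hH (P := fun x => diagHom hH h x = x) x ?_ ?_ ?_
  · simp only [map_one]
  · intro i j a x h1 h2 ha hx
    rw [map_mul, hx]
    congr 1
    rw [diagHom, ParamHom.map_X _ _ _ h1 h2 ha]
    exact congrArg _ (e1 a)
  · intro j u x hu hx
    rw [map_mul, hx]
    congr 1
    rw [diagHom, ParamHom.map_Y _ _ _ hu]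
    exact congrArg _ (e2 u)

/-- The action of a unitary element on the unitary group is conjugation. -/
theorem UGrp.val_conj (f g : UGrp B Γ) : (f * g * f⁻¹).val = conjG (B := B) f.val g.val := by
  have hf := f.2
  have hg := g.2
  suffices h : umul (S := B) (conjG (B := B) f.val g.val) f.val = umul (S := B) f.val g.val by
    have hc : IsUnitary B (conjG (B := B) f.val g.val) := by
      refine ⟨?_, ?_⟩
      · rw [pi_conjG, rho_conjG hf, ← conjB_star, ← hg.1]
      · rw [pi_conjG, ← conjB_star, ← conjB_mul hf, ← conjB_mul hf, hg.2]
    have : (⟨_, hc⟩ : UGrp B Γ) * f = f * g := UGrp.ext h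
    rw [← this, mul_inv_cancel_right]
  set v := act f.val (pi g.val : B) + g.val with hv
  have h1 : conjG (B := B) f.val g.val = actOne v (star (pi f.val) : B) := rfl
  have h2 : (pi v : B) = pi f.val * pi g.val + pi g.val := by rw [hv, pi_add, pi_act]
  have h3 : (rho v : B) = star (pi g.val) := by rw [hv, rho_aux hf, hg.rho_eq]
  have h4 : star (pi f.val) * pi f.val + star (pi f.val) = -(pi f.val : B) := by
    rw [hf.star_mul_pi]; abel
  have h5 : star (pi f.val) * pi f.val + pi f.val = -star (pi f.val : B) := by
    rw [hf.star_mul_pi]; abel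
  have h6 : (pi (actOne v (star (pi f.val) : B)) : B) =
      pi f.val * pi g.val * star (pi f.val) + pi g.val * star (pi f.val) +
        (pi f.val * pi g.val + pi g.val) := by
    rw [pi_actOne, h2, add_mul]
  have h7 : star (pi f.val) * (pi f.val * pi g.val * star (pi f.val) + pi g.val * star (pi f.val) +
        (pi f.val * pi g.val + pi g.val)) =
      -(pi f.val * pi g.val * star (pi f.val) + pi f.val * pi g.val : B) := by
    have : star (pi f.val) * (pi f.val * pi g.val * star (pi f.val) + pi g.val * star (pi f.val) +
        (pi f.val * pi g.val + pi g.val)) =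
      (star (pi f.val) * pi f.val + star (pi f.val)) * (pi g.val * star (pi f.val) + pi g.val : B) := by
      noncomm_ring
    rw [this, h4]; noncomm_ring
  have h8 : umul (S := B) f.val g.val = v + f.val := rfl
  rw [h8, h1, umul, actOne_act, h5, act_neg, add_assoc, add_swap (B := B) f.val, h6, h7, star_star,
    h3, actOne, h3]
  simp only [add_assoc, act_phi_left, neg_act_phi_left, phi_phi_add, neg_add_cancel_left]
  refine add_eq_right.2 ?_
  rw [← phi_add_star (pi f.val * pi g.val * star (pi f.val) + pi f.val * pi g.val : B)]
  congr 1
  simp only [star_add, star_mul, star_star, neg_neg, mul_assoc]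
  abel

end Diagonal

/-! ### Quotients of quotients -/

section Composition

variable {I J K : Type*} [InvolutiveNeg I] [InvolutiveNeg J] [InvolutiveNeg K] [Finite I] [Finite J]
variable {c : I → Option J} {d : J → Option K} {i j : I} {F G : J}

theorem IsLabel.bind (hc : IsLabel c) (hd : IsLabel d) : IsLabel (fun i => (c i).bind d) where
  neg i := by
    rcases h : c i with _ | F
    · simp [hc.neg_none h]
    · simp [hc.neg_some h, hd.neg]
  surj E := by
    obtain ⟨F, hF⟩ := hd.surj E
    obtain ⟨i, hi⟩ := hc.surj F
    exact ⟨i, by simp [hi, hF]⟩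
  neg_ne := hd.neg_ne

theorem mem_fiber_bind {E : K} :
    i ∈ fiber (fun i => (c i).bind d) E ↔ ∃ F ∈ fiber d E, i ∈ fiber c F := by
  simp only [mem_fiber, Option.bind_eq_some_iff]
  constructor
  · rintro ⟨F, h1, h2⟩; exact ⟨F, h2, h1⟩
  · rintro ⟨F, h1, h2⟩; exact ⟨F, h2, h1⟩

theorem sum_fiber_bind {V : Type*} [AddCommMonoid V] (f : I → V) (E : K) :
    ∑ F ∈ fiber d E, ∑ i ∈ fiber c F, f i = ∑ i ∈ fiber (fun i => (c i).bind d) E, f i := by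
  classical
  rw [← Finset.sum_biUnion]
  · refine Finset.sum_congr ?_ fun _ _ => rfl
    ext i
    rw [Finset.mem_biUnion, mem_fiber_bind]
  · intro F _ G _ h
    refine Finset.disjoint_left.2 fun i hi hi' => h ?_
    rw [mem_fiber] at hi hi'
    exact Option.some.inj (hi.symm.trans hi')

theorem proj_proj (v : I → ℤ) : proj d (proj c v) = proj (fun i => (c i).bind d) v := by
  ext E
  exact sum_fiber_bind v E

/-- Summing hyperbolic pairs over classes in two steps. The order of summation does not matter for
the elements `q_i` from one class, since `star π(q_i) π(q_j) = e_{-i} e_j = 0`. -/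
theorem push_push {R Δ : Type*} [NonUnitalRing R] [StarRing R] [AddGroup Δ] [OddFormRing R Δ]
    {H : Family R Δ I} (hH : H.IsHyp) (hc : IsLabel c) (hd : IsLabel d) :
    (H.push c).push d = H.push (fun i => (c i).bind d) := by
  have key : ∀ L : List J, (L.map fun F => ((fiber c F).toList.map H.q).sum).sum =
      ((L.flatMap fun F => (fiber c F).toList).map H.q).sum := by
    intro L
    induction L with
    | nil => rfl
    | cons F L ih => rw [List.map_cons, List.sum_cons, ih, List.flatMap_cons, List.map_append, List.sum_append]
  have e1 : ((H.push c).push d).e = (H.push (fun i => (c i).bind d)).e :=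
    funext fun E => sum_fiber_bind H.e E
  have e2 : ((H.push c).push d).q = (H.push (fun i => (c i).bind d)).q := by
    funext E
    refine (key (fiber d E).toList).trans ?_
    have hmem : ∀ i, i ∈ (fiber d E).toList.flatMap (fun F => (fiber c F).toList) ↔
        i ∈ fiber (fun i => (c i).bind d) E := by
      intro i
      rw [mem_fiber_bind]
      simp only [List.mem_flatMap, Finset.mem_toList]
    have hperm : ((fiber d E).toList.flatMap fun F => (fiber c F).toList).Perm
        (fiber (fun i => (c i).bind d) E).toList := by
      refine (List.perm_ext_iff_of_nodup ?_ (Finset.nodup_toList _)).2 fun i => ?_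
      · refine List.nodup_flatMap.2 ⟨fun F _ => Finset.nodup_toList _, ?_⟩
        refine (Finset.nodup_toList _).imp fun {F G} h => ?_
        refine List.disjoint_left.2 fun i hi hi' => h ?_
        rw [Finset.mem_toList, mem_fiber] at hi hi'
        exact Option.some.inj (hi.symm.trans hi')
      · rw [hmem, Finset.mem_toList]
    refine (hperm.map H.q).sum_eq' ?_
    rw [List.pairwise_map]
    have hcd := hc.bind hd
    have hpair : ∀ i ∈ (fiber d E).toList.flatMap (fun F => (fiber c F).toList),
        ∀ j ∈ (fiber d E).toList.flatMap (fun F => (fiber c F).toList),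
          AddCommute (H.q i) (H.q j) := by
      intro i hi j hj
      rw [hmem, mem_fiber] at hi hj
      refine add_comm_of_mul_eq_zero (B := R) ?_
      rw [hH.pi_q, hH.pi_q, hH.star_e]
      refine hH.orth _ _ ?_
      rintro rfl
      have h3 := hcd.neg_some hi
      exact hcd.neg_ne E (Option.some.inj (h3.symm.trans hj))
    exact List.pairwise_of_forall_mem_list hpair
  generalize (H.push c).push d = N at *
  cases N
  simp only at e1 e2
  rw [e1, e2]

end Composition

/-! ### Preimages of sets of roots -/

section Preimages

variable {I J : Type*} [InvolutiveNeg I] [InvolutiveNeg J] [Finite I]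
variable {c : I → Option J} {i j : I} {F G : J} {P : Set (J → ℤ)}

theorem vec_ne_zero (h : ∀ i : J, -i ≠ i) (F : J) : vec F ≠ 0 :=
  root_ne_zero h (vec_mem_roots F)

theorem vec_injective (h : ∀ i : J, -i ≠ i) (e : vec F = vec G) : F = G := by
  by_contra hFG
  have h1 := vec_self h F
  rw [e] at h1
  have := vec_nonpos (i := G) (j := F) hFG
  omega

theorem vecOpt_add_mem (o o' : Option J) :
    vecOpt o + vecOpt o' ∈ roots J ∨ vecOpt o + vecOpt o' = 0 := by
  rcases o with _ | F <;> rcases o' with _ | G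
  · right; simp [vecOpt]
  · left; simpa [vecOpt] using vec_mem_roots G
  · left; simpa [vecOpt] using vec_mem_roots F
  · by_cases h : G = -F
    · right
      simp only [vecOpt, h, vec, neg_neg]; abel
    · left; exact add_mem_roots h

theorem proj_mem_roots (hc : IsLabel c) {α : I → ℤ} (hα : α ∈ roots I) :
    proj c α ∈ roots J ∨ proj c α = 0 := by
  rcases hα with ⟨i, rfl⟩ | ⟨i, j, _, rfl⟩
  · rw [proj_vec hc]
    rcases c i with _ | F
    · exact Or.inr rfl
    · exact Or.inl (vec_mem_roots F)
  · rw [proj_add, proj_vec hc, proj_vec hc]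
    exact vecOpt_add_mem _ _

omit [InvolutiveNeg I] [Finite I] in
theorem double_eq_zero {v : I → ℤ} (h : v + v = 0) : v = 0 := by
  ext i
  have := congrFun h i
  simp at this ⊢
  omega

omit [Finite I] in
theorem zero_notMem (hne : ∀ i : I, -i ≠ i) {Q : Set (I → ℤ)} (h : IsSaturated Q) : (0 : I → ℤ) ∉ Q :=
  fun h0 => root_ne_zero hne (h.subset h0) rfl

omit [Finite I] in
theorem IsSaturated.double_mem {Q : Set (I → ℤ)} (hQ : IsSaturated Q) (hne : ∀ i : I, -i ≠ i)
    (i : I) (h : vec i ∈ Q) : vec i + vec i ∈ Q :=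
  hQ.closed _ h _ h (add_mem_roots (hne i).symm)

theorem isSatSpecial_pre (hc : IsLabel c) (hP : IsSatSpecial P) : IsSatSpecial (pre c P) where
  subset _ hα := hα.1
  closed α hα β hβ h := by
    refine ⟨h, ?_⟩
    rcases proj_mem_roots hc h with h' | h'
    · rw [proj_add] at h' ⊢
      exact hP.closed _ hα.2 _ hβ.2 h'
    · rw [proj_add] at h'
      have := hP.special _ hα.2
      rw [neg_eq_of_add_eq_zero_right h'] at this
      exact absurd hβ.2 this
  half α hα β hβ h := by
    refine ⟨hβ, ?_⟩
    have h2 := hα.2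
    rw [h, proj_add] at h2
    rcases proj_mem_roots hc hβ with h' | h'
    · exact hP.half _ h2 _ h' rfl
    · rw [h', add_zero] at h2
      exact absurd h2 (zero_notMem hc.neg_ne hP.toIsSaturated)
  special α hα hα' := hP.special _ hα.2 (by rw [← proj_neg]; exact hα'.2)

/-- The preimage of a root subsystem, together with the kernel of the projection. -/
def preSub (c : I → Option J) (Q : Set (J → ℤ)) : Set (I → ℤ) :=
  {γ | γ ∈ roots I ∧ (proj c γ ∈ Q ∨ proj c γ = 0)}

theorem isSubsystem_preSub (hc : IsLabel c) (hP : IsSubsystem P) :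
    IsSubsystem (preSub c P) where
  subset _ hα := hα.1
  closed α hα β hβ h := by
    refine ⟨h, ?_⟩
    rcases proj_mem_roots hc h with h' | h'
    · left
      rw [proj_add] at h' ⊢
      rcases hα.2 with h1 | h1 <;> rcases hβ.2 with h2 | h2
      · exact hP.closed _ h1 _ h2 h'
      · rwa [h2, add_zero]
      · rwa [h1, zero_add]
      · rw [h1, h2, add_zero] at h'
        exact absurd rfl (root_ne_zero hc.neg_ne h')
    · exact Or.inr h'
  half α hα β hβ h := by
    refine ⟨hβ, ?_⟩
    have h2 := hα.2
    rw [h, proj_add] at h2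
    rcases proj_mem_roots hc hβ with h' | h'
    · rcases h2 with h2 | h2
      · exact Or.inl (hP.half _ h2 _ h' rfl)
      · exact Or.inr (double_eq_zero h2)
    · exact Or.inr h'
  neg α hα := by
    refine ⟨neg_mem_roots hα.1, ?_⟩
    rw [proj_neg]
    rcases hα.2 with h | h
    · exact Or.inl (hP.neg _ h)
    · right; rw [h, neg_zero]

theorem pre_subset_preSub {Q : Set (J → ℤ)} (h : P ⊆ Q) : pre c P ⊆ preSub c Q :=
  fun _ hα => ⟨hα.1, Or.inl (h hα.2)⟩

variable {K : Type*} [InvolutiveNeg K] {d : J → Option K}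

theorem IsQuotient.isLabel_of_double {Q : Set (I → ℤ)} (hne : ∀ i : I, -i ≠ i)
    (hQ : ∀ i, vec i + vec i ∈ Q → vec i ∈ Q) (h : IsQuotient Q c) : IsLabel c where
  neg := h.neg
  surj := h.surj
  neg_ne F e := by
    obtain ⟨i, hi⟩ := h.surj F
    have h1 : perOf Q i i := (h.rel i i).2 ⟨F, hi, hi⟩
    have h2 : perOf Q i (-i) := (h.rel i (-i)).2 ⟨F, hi, by rw [h.neg, hi, Option.map_some, e]⟩
    have h3 : vec i - vec (-i) = vec i + vec i := by rw [vec_neg, sub_neg_eq_add]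
    rcases h2.1 with h4 | h4 <;> rw [h3] at h4
    · exact h1.2 (hQ i h4)
    · exact absurd (double_eq_zero h4) (vec_ne_zero hne i)

theorem IsQuotient.isLabel {Q : Set (I → ℤ)} (hQ : IsSubsystem Q) (hne : ∀ i : I, -i ≠ i)
    (h : IsQuotient Q c) : IsLabel c :=
  h.isLabel_of_double hne fun i hi => hQ.half _ hi _ (vec_mem_roots i) rfl

/-- A quotient of a quotient of a family is a quotient of the family. -/
theorem isQuotient_preSub [Finite J] (hc : IsLabel c) (hP : IsSubsystem P)
    (hd : IsQuotient P d) : IsQuotient (preSub c P) (fun i => (c i).bind d) where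
  neg := (hc.bind (hd.isLabel hP hc.neg_ne)).neg
  surj := (hc.bind (hd.isLabel hP hc.neg_ne)).surj
  rel i j := by
    have hF : ∀ F, vec F ∉ P ↔ ∃ E, d F = some E := by
      intro F
      constructor
      · intro h
        obtain ⟨E, h1, _⟩ := (hd.rel F F).1 ⟨Or.inr (sub_self _), h⟩
        exact ⟨E, h1⟩
      · rintro ⟨E, h⟩
        exact ((hd.rel F F).2 ⟨E, h, h⟩).2
    constructor
    · rintro ⟨h1, h2⟩
      rcases hj : c j with _ | F
      · exact absurd ⟨vec_mem_roots j, Or.inr (by rw [proj_vec hc, hj]; rfl)⟩ h2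
      have hFP : vec F ∉ P := fun h => h2 ⟨vec_mem_roots j, Or.inl (by rw [proj_vec hc, hj]; exact h)⟩
      have h3 : proj c (vec i - vec j) ∈ P ∨ proj c (vec i - vec j) = 0 := by
        rcases h1 with h1 | h1
        · exact h1.2
        · right; rw [h1]; ext; simp [proj]
      rw [proj_sub, proj_vec hc, proj_vec hc, hj] at h3
      rcases hi : c i with _ | G
      · rw [hi] at h3
        simp only [vecOpt, zero_sub, neg_eq_zero] at h3
        rcases h3 with h3 | h3
        · exact absurd (by simpa using hP.neg _ h3) hFP
        · exact absurd h3 (vec_ne_zero hc.neg_ne F)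
      · rw [hi] at h3
        simpa using (hd.rel G F).1 ⟨h3, hFP⟩
    · rintro ⟨E, hi, hj⟩
      obtain ⟨G, hG, hG'⟩ := Option.bind_eq_some_iff.1 hi
      obtain ⟨F, hF1, hF'⟩ := Option.bind_eq_some_iff.1 hj
      obtain ⟨h1, h2⟩ := (hd.rel G F).2 ⟨E, hG', hF'⟩
      constructor
      · by_cases hij : i = j
        · right; rw [hij, sub_self]
        · left
          refine ⟨sub_mem_roots (Ne.symm hij), ?_⟩
          rw [proj_sub, proj_vec hc, proj_vec hc, hG, hF1]
          exact h1
      · rintro ⟨_, h⟩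
        rw [proj_vec hc, hF1] at h
        rcases h with h | h
        · exact h2 h
        · exact vec_ne_zero hc.neg_ne F h

variable {R Δ S Θ : Type*} [NonUnitalRing R] [StarRing R] [AddGroup Δ] [OddFormRing R Δ]
  [NonUnitalRing S] [StarRing S] [AddGroup Θ] [OddFormRing S Θ]
variable {B Γ : Type*} [NonUnitalRing B] [StarRing B] [AddGroup Γ] [OddFormRing B Γ]
variable {A : ActionData R Δ S Θ} (E : Ambient A B Γ) {H : Family R Δ I}

theorem pre_pre_subset [Finite J] {Q : Set (K → ℤ)} :
    pre c (pre d Q) ⊆ pre (fun i => (c i).bind d) Q :=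
  fun _ hα => ⟨hα.1, by rw [← proj_proj]; exact hα.2.2⟩

/-- The composite of canonical homomorphisms satisfies the characterization of the canonical
homomorphism for the composite labelling. -/
theorem mem_elimGraph_comp [Finite J] [Finite K] (hH : H.IsHyp) (hc : IsLabel c) (hd : IsLabel d)
    (x : StU A ((H.push c).push d)) :
    (x, elimHom E hH hc (elimHom E (push_isHyp hH hc) hd x)) ∈
      elimGraph A H ((H.push c).push d) (fun i => (c i).bind d) := by
  set f := fun x => elimHom E hH hc (elimHom E (push_isHyp hH hc) hd x) with hf
  have hH' := push_isHyp (push_isHyp hH hc) hd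
  have hgen : ∀ β ∈ roots K, ∀ y ∈ rootSet A ((H.push c).push d) β,
      (y, f y) ∈ elimGraph A H ((H.push c).push d) (fun i => (c i).bind d) := by
    intro β hβ y hy
    refine Subgroup.subset_closure ⟨β, hβ, hy, ?_, ?_⟩
    · refine stSub_mono pre_pre_subset (elimHom_mem E hH hc ?_ (elimHom_rootSet E _ hd hy))
      rintro F ⟨_, h⟩
      refine ⟨add_mem_roots (hc.neg_ne F).symm, ?_⟩
      rw [proj_add]
      rw [proj_vec hd] at h ⊢
      rcases h with h | h
      · right; rw [h]; rfl
      · exfalso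
        have h : vecOpt (d F) = β + β := h
        rcases hF : d F with _ | G
        · rw [hF] at h
          exact root_ne_zero hd.neg_ne hβ (double_eq_zero h.symm)
        · have := congrFun h G
          simp only [hF, vecOpt, vec_self hd.neg_ne, Pi.add_apply] at this
          omega
    · obtain ⟨t, ht⟩ := E.exists_stVal hH' y
      refine ⟨t, ht, ?_⟩
      rw [E.stVal_iff hH]
      simp only [hf]
      rw [st_elimHom, st_elimHom]
      exact (E.stVal_iff _).1 ht
  refine StU.induction E hH'
    (P := fun x => (x, f x) ∈ elimGraph A H ((H.push c).push d) (fun i => (c i).bind d)) x ?_ ?_ ?_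
  · simp only [hf, map_one]; exact one_mem _
  · intro F G a x h1 h2 ha hx
    have e : f (X A _ F G a * x) = f (X A _ F G a) * f x := by simp only [hf, map_mul]
    rw [e]
    exact mul_mem (hgen _ (sub_mem_roots h1) (X A _ F G a)
      (Or.inl (Or.inl ⟨F, G, a, h1, h2, ha, rfl, rfl⟩))) hx
  · intro F u x hu hx
    have e : f (Y A _ F u * x) = f (Y A _ F u) * f x := by simp only [hf, map_mul]
    rw [e]
    exact mul_mem (hgen _ (vec_mem_roots F) (Y A _ F u)
      (Or.inl (Or.inr ⟨F, u, hu, rfl, rfl⟩))) hx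

end Preimages

/-! ### Unitary elements commuting with idempotents -/

section Commuting

variable {B Γ : Type*} [NonUnitalRing B] [StarRing B] [AddGroup Γ] [OddFormRing B Γ]
variable {I K : Type*} [InvolutiveNeg I] [InvolutiveNeg K] [Finite I] {c : I → Option K}
  {N : Family B Γ I} {i j : I} {a : B} {u : Γ}

/-- The unitary elements that commute with the idempotents of a family. -/
def commSub (N : Family B Γ K) : Subgroup (UGrp B Γ) where
  carrier := {f | ∀ F, pi f.val * N.e F = N.e F * pi f.val ∧
    star (pi f.val) * N.e F = N.e F * star (pi f.val : B)}
  one_mem' F := by simp [UGrp.val_one, pi_zero]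
  mul_mem' {f g} hf hg F := by
    simp only [UGrp.val_mul, pi_umul, star_add, star_mul, add_mul, mul_add]
    refine ⟨?_, ?_⟩
    · rw [mul_assoc, (hg F).1, ← mul_assoc, (hf F).1, mul_assoc]
    · rw [mul_assoc, (hf F).2, ← mul_assoc, (hg F).2, mul_assoc]
  inv_mem' {f} hf F := by
    rw [UGrp.val_inv, pi_uinv f.2, star_star]
    exact (hf F).symm

theorem IsMat.comm_push (hN : N.IsHyp) (ha : IsMat N i j a) (h : c i = c j) (F : K) :
    a * (N.push c).e F = (N.push c).e F * a := by
  by_cases hF : c i = some F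
  · rw [← ha.2, mul_assoc, mul_e_push hN (h ▸ hF), ha.2, ← ha.1, ← mul_assoc, e_push_mul hN hF]
  · rw [← ha.2, mul_assoc, mul_e_push_zero hN (h ▸ hF), mul_zero, ha.2, ← ha.1, ← mul_assoc,
      e_push_mul_zero hN hF, zero_mul]

theorem mem_commSub_of_comm {f : UGrp B Γ} (hN : (N.push c).IsHyp)
    (h : ∀ F, pi f.val * (N.push c).e F = (N.push c).e F * pi f.val) : f ∈ commSub (N.push c) := by
  refine fun F => ⟨h F, ?_⟩
  have := congrArg star (h (-F))
  simp only [star_mul, hN.star_e, neg_neg] at this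
  exact this.symm

theorem gX_mem_commSub (hN : N.IsHyp) (hc : IsLabel c) (h1 : i ≠ j) (h2 : i ≠ -j)
    (ha : IsMat N i j a) (h : c i = c j) : gX N i j a ∈ commSub (N.push c) := by
  have hz := ha.isIso hN h1 h2
  refine mem_commSub_of_comm (push_isHyp hN hc) fun F => ?_
  rw [gX, gY_val hN hz, pi_tY hN hz, pi_q_act hN ha.1, rho_q_act hN, add_zero, sub_eq_add_neg,
    add_mul, mul_add, ha.comm_push hN h, (ha.star hN).comm_push hN]
  rw [hc.neg, hc.neg, h]

theorem gY_mem_commSub (hN : N.IsHyp) (hc : IsLabel c) (hu : IsIso N j u)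
    (hu' : ∀ k, N.e k * pi u = 0) (h : c j = none) : gY N j u ∈ commSub (N.push c) := by
  have hN' := push_isHyp hN hc
  have h1 : ∀ F, pi u * (N.push c).e F = 0 := fun F => by
    rw [← hu.pi_e, mul_assoc, mul_e_push_zero hN (by simp [h]), mul_zero]
  have h2 : ∀ F, (N.push c).e F * pi u = 0 := fun F => e_push_mul_eq_zero fun i _ => hu' i
  have h3 : IsMat N (-j) j (rho u) := ⟨hu.e_rho hN, hu.rho_e hN⟩
  refine mem_commSub_of_comm hN' fun F => ?_
  have h4 : star (pi u) * (N.push c).e F = 0 := by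
    have := congrArg star (h2 (-F))
    rwa [star_mul, hN'.star_e, neg_neg, star_zero] at this
  have h5 : (N.push c).e F * star (pi u) = 0 := by
    have := congrArg star (h1 (-F))
    rwa [star_mul, hN'.star_e, neg_neg, star_zero] at this
  rw [gY_val hN hu, pi_tY hN hu, sub_mul, mul_sub, add_mul, mul_add, h1, h2, h4, h5,
    h3.comm_push hN (by rw [hc.neg, h]; rfl)]

end Commuting

section Kernel

variable {I J : Type*} [InvolutiveNeg I] [InvolutiveNeg J] [Finite I]
variable {c : I → Option J} {Q : Set (I → ℤ)}

/-- The projection kills the roots of the subsystem. -/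
theorem IsQuotient.proj_eq_zero (hQ : IsSubsystem Q) (hc : IsLabel c) (h : IsQuotient Q c)
    {α : I → ℤ} (hα : α ∈ Q) : proj c α = 0 := by
  have hnone : ∀ i, vec i ∈ Q → c i = none := by
    intro i hi
    by_contra h'
    obtain ⟨E, hE⟩ := Option.ne_none_iff_exists'.1 h'
    exact ((h.rel i i).2 ⟨E, hE, hE⟩).2 hi
  rcases hQ.subset hα with ⟨i, rfl⟩ | ⟨i, j, hij, rfl⟩
  · rw [proj_vec hc, hnone i hα]; rfl
  · rw [proj_add, proj_vec hc, proj_vec hc]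
    by_cases hj : vec (-j) ∈ Q
    · have hj' : vec j ∈ Q := by
        have := hQ.neg _ hj
        rwa [vec_neg, neg_neg] at this
      have hi : vec i ∈ Q := by
        have e : vec i = (vec i + vec j) + vec (-j) := by rw [vec_neg]; abel
        rw [e]
        exact hQ.closed _ hα _ hj (e ▸ vec_mem_roots i)
      rw [hnone i hi, hnone j hj']; simp [vecOpt]
    · obtain ⟨E, h1, h2⟩ := (h.rel i (-j)).1 ⟨Or.inl (by rw [vec_neg, sub_neg_eq_add]; exact hα), hj⟩
      have h3 := hc.neg_some h2
      rw [neg_neg] at h3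
      rw [h1, h3, vecOpt, vecOpt, vec_neg, add_neg_cancel]

theorem vecOpt_injective (hne : ∀ i : J, -i ≠ i) {o o' : Option J} (h : vecOpt o = vecOpt o') :
    o = o' := by
  rcases o with _ | F <;> rcases o' with _ | G
  · rfl
  · exact absurd h.symm (vec_ne_zero hne G)
  · exact absurd h (vec_ne_zero hne F)
  · rw [vec_injective hne h]

end Kernel

/-! ### Subgroups generated by root subgroups -/

section Induction

variable {R Δ S Θ : Type*} [NonUnitalRing R] [StarRing R] [AddGroup Δ] [OddFormRing R Δ]
  [NonUnitalRing S] [StarRing S] [AddGroup Θ] [OddFormRing S Θ]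
variable {B Γ : Type*} [NonUnitalRing B] [StarRing B] [AddGroup Γ] [OddFormRing B Γ]
variable {A : ActionData R Δ S Θ} (E : Ambient A B Γ)
variable {I : Type*} [InvolutiveNeg I] {H : Family R Δ I} (hH : H.IsHyp) {P : Set (I → ℤ)}

include E hH in
theorem inv_mem_rootSet {α : I → ℤ} {x : StU A H} (hx : x ∈ rootSet A H α) :
    x⁻¹ ∈ rootSet A H α := by
  rcases hx with (⟨i, j, a, h1, h2, ha, rfl, rfl⟩ | ⟨j, u, hu, rfl, rfl⟩) | ⟨j, a, ha, rfl, rfl⟩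
  · exact Or.inl (Or.inl ⟨i, j, -a, h1, h2, E.Sij_neg hH ha, rfl, (X_neg E hH h1 h2 ha).symm⟩)
  · exact Or.inl (Or.inr ⟨j, -u, E.Theta0_neg hH hu, rfl, (Y_neg E hH hu).symm⟩)
  · refine Or.inr ⟨j, -a, E.Sij_neg hH ha, rfl, ?_⟩
    rw [phi_neg, Y_neg E hH (E.Theta0_phi hH ha)]

theorem mem_stSub {α : I → ℤ} {x : StU A H} (hx : x ∈ rootSet A H α) (h : α ∈ P) :
    x ∈ stSub A H P := Subgroup.subset_closure (Set.mem_biUnion h hx)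

include E hH in
theorem stSub_induction {p : StU A H → Prop} (one : p 1)
    (mul : ∀ α ∈ P, ∀ x ∈ rootSet A H α, ∀ y ∈ stSub A H P, p y → p (x * y)) {x : StU A H}
    (hx : x ∈ stSub A H P) : p x := by
  refine Subgroup.closure_induction_left (p := fun x _ => p x) one ?_ ?_ hx
  · intro x hx y hy h
    obtain ⟨α, hα, hx⟩ := Set.mem_iUnion₂.1 hx
    exact mul α hα x hx y hy h
  · intro x hx y hy h
    obtain ⟨α, hα, hx⟩ := Set.mem_iUnion₂.1 hx
    exact mul α hα _ (inv_mem_rootSet E hH hx) y hy h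

variable [Finite I] {J : Type*} [InvolutiveNeg J] {c : I → Option J}

include E hH in
/-- The root elements whose roots vanish in the quotient are block diagonal with respect to the
classes. -/
theorem st_mem_commSub (hc : IsLabel c) (hP : ∀ α ∈ P, proj c α = 0) {x : StU A H}
    (hx : x ∈ stSub A H P) : E.st hH x ∈ commSub ((E.fam H).push c) := by
  have hN := E.fam_isHyp hH
  suffices stSub A H P ≤ (commSub ((E.fam H).push c)).comap (E.st hH) from this hx
  refine stSub_le ?_ ?_ ?_
  · intro i j a h1 h2 ha h
    rw [Subgroup.mem_comap, E.st_X hH h1 h2 ha]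
    refine gX_mem_commSub hN hc h1 h2 (E.isMat hH ha) (vecOpt_injective hc.neg_ne ?_)
    have := hP _ h
    rw [proj_sub, proj_vec hc, proj_vec hc] at this
    exact (sub_eq_zero.1 this).symm
  · intro j u hu h
    rw [Subgroup.mem_comap, E.st_Y hH hu]
    refine gY_mem_commSub hN hc (E.isIso hH hu) (E.e_pi hH hu) (vecOpt_injective hc.neg_ne ?_)
    rw [← proj_vec hc]; exact hP _ h
  · intro j a ha h
    have hu := E.Theta0_phi hH ha
    rw [Subgroup.mem_comap, E.st_Y hH hu]
    refine gY_mem_commSub hN hc (E.isIso hH hu) (E.e_pi hH hu) (vecOpt_injective hc.neg_ne ?_)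
    rw [← proj_vec hc]
    have := hP _ h
    rw [proj_add] at this
    exact double_eq_zero this

end Induction

/-! ### The homomorphism induced by a crossed module -/

section Delta

variable {R Δ S Θ : Type*} [NonUnitalRing R] [StarRing R] [AddGroup Δ] [OddFormRing R Δ]
  [NonUnitalRing S] [StarRing S] [AddGroup Θ] [OddFormRing S Θ]
variable {B Γ : Type*} [NonUnitalRing B] [StarRing B] [AddGroup Γ] [OddFormRing B Γ]
variable {M : CrossedModule R Δ S Θ} (E : FullAmbient M.action B Γ)
variable {I : Type*} [InvolutiveNeg I] {H : Family R Δ I} (hH : H.IsHyp)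

/-- The structure homomorphism of a crossed module on parameters of root elements. -/
def deltaParam (M : CrossedModule R Δ S Θ) (H : Family R Δ I) :
    ParamHom M.action (selfAction R Δ) H where
  σ := M.dS
  τ := M.dΘ
  σ_add := map_add _
  σ_mul := map_mul _
  σ_star := map_star _
  τ_add := map_add _
  τ_phi := M.map_phi
  σ_pi := M.map_pi
  σ_rho := M.map_rho
  τ_act := M.map_act
  mem_Sij := by
    rintro i j _ ⟨b, rfl⟩
    refine ⟨M.dS b, ?_⟩
    rw [M.map_rmul, M.map_lmul]; rfl
  mem_Theta0 := by
    rintro j u ⟨⟨v, rfl⟩, h⟩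
    refine ⟨⟨M.dΘ v, by rw [M.map_actR]; rfl⟩, fun k => ?_⟩
    have := congrArg M.dS (h k)
    rwa [M.map_lmul, map_zero, M.map_pi] at this

/-- The homomorphism of Steinberg groups induced by a crossed module. -/
def delta : StU M.action H →* StU (selfAction R Δ) H := (deltaParam M H).map E.toAmbient hH

theorem StVal.delta {x : StU M.action H} {t : Θ} (h : StVal M.action H x t) :
    StVal (selfAction R Δ) H (delta E hH x) (M.dΘ t) := by
  induction h with
  | one => rw [map_one, map_zero]; exact .one
  | mulX i j a x t h1 h2 ha _ ih =>
    have e : M.dΘ (umul (S := S) (TX M.action H i j a) t) =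
        umul (S := R) (TX (selfAction R Δ) H i j (M.dS a)) (M.dΘ t) := by
      simp only [umul, TX, map_add, map_neg, M.map_act, M.map_actS, M.map_phi, M.map_pi, map_star]
      rfl
    rw [e, map_mul, OddUnitary.delta, (deltaParam M H).map_X E.toAmbient hH h1 h2 ha]
    exact .mulX i j _ _ _ h1 h2 ((deltaParam M H).mem_Sij ha) ih
  | mulY j u x t hu _ ih =>
    have e : M.dΘ (umul (S := S) (TY M.action H j u) t) =
        umul (S := R) (TY (selfAction R Δ) H j (M.dΘ u)) (M.dΘ t) := by
      simp only [umul, TY, map_add, map_sub, map_neg, M.map_act, M.map_actS, M.map_phi, M.map_pi,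
        map_star, M.map_rho]
      rfl
    rw [e, map_mul, OddUnitary.delta, (deltaParam M H).map_Y E.toAmbient hH hu]
    exact .mulY j _ _ _ ((deltaParam M H).mem_Theta0 hu) ih

theorem delta_mem [Finite I] {P : Set (I → ℤ)} {x : StU M.action H} (hx : x ∈ stSub M.action H P) :
    delta E hH x ∈ stSub (selfAction R Δ) H P := (deltaParam M H).map_mem E.toAmbient hH hx

/-- The canonical homomorphisms commute with the homomorphisms induced by the crossed module. -/
theorem delta_elimHom [Finite I] {J : Type*} [InvolutiveNeg J] [Finite J] {c : I → Option J}
    (hc : IsLabel c) (x : StU M.action (H.push c)) :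
    delta E hH (elimHom E.toAmbient hH hc x) =
      elimHom E.self.toAmbient hH hc (delta E (push_isHyp hH hc) x) := by
  have hH' := push_isHyp hH hc
  have key : ∀ β ∈ roots J, ∀ x ∈ rootSet M.action (H.push c) β,
      delta E hH (elimHom E.toAmbient hH hc x) =
      elimHom E.self.toAmbient hH hc (delta E hH' x) := by
    intro β hβ x hx
    have hω := isOdd_of_mem_roots hβ
    have hpos : ∀ γ ∈ ({β, β + β} : Set (J → ℤ)), 0 < ht β γ := by
      have := ht_self_pos hc.neg_ne hβ
      rintro _ (rfl | rfl)
      · exact this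
      · rw [ht_add]; omega
    refine st_injOn E.self.toAmbient hH (hc.isOdd_pull hω)
      (stSub_mono (pre_subset_posRoots hω hc hpos)
        (delta_mem E hH (elimHom_rootSet E.toAmbient hH hc hx)))
      (stSub_mono (pre_subset_posRoots hω hc hpos) (elimHom_rootSet _ hH hc ?_)) ?_
    · rcases hx with (⟨i, j, a, h1, h2, ha, rfl, rfl⟩ | ⟨j, u, hu, rfl, rfl⟩) | ⟨j, a, ha, rfl, rfl⟩
      · refine Or.inl (Or.inl ⟨i, j, _, h1, h2, (deltaParam M _).mem_Sij ha, rfl, ?_⟩)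
        exact (deltaParam M _).map_X E.toAmbient _ h1 h2 ha
      · refine Or.inl (Or.inr ⟨j, _, (deltaParam M _).mem_Theta0 hu, rfl, ?_⟩)
        exact (deltaParam M _).map_Y E.toAmbient _ hu
      · refine Or.inr ⟨j, _, (deltaParam M _).mem_Sij ha, rfl, ?_⟩
        refine ((deltaParam M _).map_Y E.toAmbient _ (E.Theta0_phi hH' ha)).trans ?_
        rw [(deltaParam M _).τ_phi]
    · rw [st_elimHom]
      obtain ⟨t, ht⟩ := E.exists_stVal hH' x
      obtain ⟨t', ht'⟩ := E.exists_stVal hH (elimHom E.toAmbient hH hc x)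
      have e : t = t' := E.t_inj (by
        rw [← (E.stVal_iff hH').1 ht, ← (E.stVal_iff hH).1 ht', st_elimHom])
      subst e
      refine UGrp.ext ?_
      rw [(E.self.stVal_iff hH).1 (ht'.delta E hH), (E.self.stVal_iff hH').1 (ht.delta E hH')]
  refine StU.induction E.toAmbient hH' (P := fun x => delta E hH (elimHom E.toAmbient hH hc x) =
      elimHom E.self.toAmbient hH hc (delta E hH' x)) x ?_ ?_ ?_
  · simp only [map_one]
  · intro F G a x h1 h2 ha hx
    simp only [map_mul, hx]
    rw [key _ (sub_mem_roots h1) (X M.action _ F G a) (Or.inl (Or.inl ⟨F, G, a, h1, h2, ha, rfl, rfl⟩))]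
  · intro F u x hu hx
    simp only [map_mul, hx]
    rw [key _ (vec_mem_roots F) (Y M.action _ F u) (Or.inl (Or.inr ⟨F, u, hu, rfl, rfl⟩))]

end Delta

/-! ### Cones of roots -/

section Cones

variable {I : Type*} {α β : I → ℤ}

/-- Antiparallel vectors. -/
def Anti (α β : I → ℤ) : Prop := ∃ m n : ℕ, 0 < m ∧ 0 < n ∧ m • α + n • β = 0

theorem add_ne_zero_of_not_anti (h : ¬Anti α β) : α + β ≠ 0 := fun e =>
  h ⟨1, 1, one_pos, one_pos, by rw [one_nsmul, one_nsmul, e]⟩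

variable [InvolutiveNeg I] [Finite I] {ω : I → ℤ}

theorem ht_nsmul (ω v : I → ℤ) (n : ℕ) : ht ω (n • v) = n * ht ω v := by
  induction n with
  | zero => simp [ht_zero]
  | succ n ih => rw [succ_nsmul, ht_add, ih]; push_cast; ring

theorem not_anti_of_ht (hα : 0 ≤ ht ω α) (hβ : 0 < ht ω β) : ¬Anti α β := by
  rintro ⟨m, n, hm, hn, e⟩
  have h := congrArg (ht ω) e
  rw [ht_add, ht_nsmul, ht_nsmul, ht_zero] at h
  have : 0 < (n : ℤ) := by exact_mod_cast hn
  have : 0 < (n : ℤ) * ht ω β := by positivity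
  have : 0 ≤ (m : ℤ) * ht ω α := by positivity
  omega

theorem cone_subset_posRoots (hα : 0 ≤ ht ω α) (hβ : 0 < ht ω β) : cone α β ⊆ posRoots ω := by
  rintro _ ⟨hr, m, n, hn, rfl⟩
  refine ⟨hr, ?_⟩
  rw [ht_add, ht_nsmul, ht_nsmul]
  have : 0 < (n : ℤ) := by exact_mod_cast hn
  positivity

theorem right_mem_cone (hβ : β ∈ roots I) : β ∈ cone α β := ⟨hβ, 0, 1, one_pos, by simp⟩

theorem cone_cone {γ : I → ℤ} (hγ : γ ∈ cone α β) : cone α γ ⊆ cone α β := by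
  obtain ⟨_, m, n, hn, rfl⟩ := hγ
  rintro _ ⟨hr, m', n', hn', rfl⟩
  refine ⟨hr, m' + n' * m, n' * n, by positivity, ?_⟩
  simp only [add_smul, mul_smul, smul_add]
  abel

theorem not_anti_of_mem_cone {γ : I → ℤ} (h : ¬Anti α β) (hγ : γ ∈ cone α β) : ¬Anti α γ := by
  obtain ⟨_, m, n, hn, rfl⟩ := hγ
  rintro ⟨m', n', hm', hn', e⟩
  refine h ⟨m' + n' * m, n' * n, by positivity, by positivity, ?_⟩
  rw [← e]
  simp only [add_smul, mul_smul, smul_add]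
  abel

end Cones

/-! ### Extension of relations from root elements -/

section TrueCones

variable {R Δ S Θ : Type*} [NonUnitalRing R] [StarRing R] [AddGroup Δ] [OddFormRing R Δ]
  [NonUnitalRing S] [StarRing S] [AddGroup Θ] [OddFormRing S Θ]
variable {I : Type*} [InvolutiveNeg I] [Finite I]
variable {A : ActionData R Δ S Θ} {H : Family R Δ I} {α β : I → ℤ}
variable {i j k l : I} {p q : R} {a b : S} {s : Δ} {u : Θ}
variable {B Γ : Type*} [NonUnitalRing B] [StarRing B] [AddGroup Γ] [OddFormRing B Γ]

theorem mem_roots_of_mem_rootSet (hH : H.IsHyp) {x : StU A H} (hx : x ∈ rootSet A H α) :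
    α ∈ roots I := by
  rcases hx with (⟨i, j, a, h1, _, _, rfl, _⟩ | ⟨j, u, _, rfl, _⟩) | ⟨j, a, _, rfl, _⟩
  · exact sub_mem_roots h1
  · exact vec_mem_roots j
  · exact add_mem_roots (hH.neg_ne j).symm

variable (E : FullAmbient A B Γ) (hH : H.IsHyp)
include E hH

theorem Chev.exists_XYphi_core (h1 : i ≠ j) (h2 : i ≠ -j)
    (hp : p ∈ Sij (selfAction R Δ) H i j) (hb : b ∈ Sij A H (-i) i) :
    ∃ w ∈ stSub A H (cone (vec j - vec i) (vec i + vec i)),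
      Chev A H (vec j - vec i) (vec i) (X (selfAction R Δ) H i j p) (Y A H i (phi b)) w := by
  have hu := E.Theta0_phi hH hb
  have hne := hH.neg_ne
  refine ⟨_, mul_mem (mul_mem ?_ ?_) ?_, Chev.mixedXY i j p (phi b) h1 h2 hp hu⟩
  · have e : A.actR (phi b) (-p) = phi (A.rmul (A.lmul (star (-p)) b) (-p)) := E.t_inj (by
      rw [E.t_actR, E.t_phi, E.t_phi, ← phi_conj, E.s_rmul, E.s_lmul, map_star])
    rw [e]
    refine Yphi_mem_stSub ?_ ⟨add_mem_roots (hne j).symm, 2, 1, one_pos, by abel⟩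
    have h3 := (E.self.isMat hH hp).neg
    have h4 := E.isMat hH hb
    have h5 := h3.star (E.fam_isHyp hH)
    rw [E.mem_Sij hH, E.s_rmul, E.s_lmul, map_star, map_neg]
    have h6 := ((h5.mul h4).mul h3).neg
    rw [neg_mul, neg_mul, neg_neg] at h6
    exact h6
  · refine X_mem_stSub (ne_neg h2) (neg_ne_neg' h1) (rmul_rho_mem E hH hu hp)
      ⟨sub_mem_roots (ne_neg h2), 1, 1, one_pos, ?_⟩
    rw [vec_neg, one_nsmul, one_nsmul]; abel
  · exact Yphi_mem_stSub hb (right_mem_cone (add_mem_roots (hne i).symm))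

/-- If the second argument is considered as an element of the long root subgroup, then the roots on
the right hand side of the formula lie in the smaller cone spanned by the long root. -/
theorem Chev.exists_XYphi (h1 : i ≠ j) (h2 : i ≠ -j)
    (hp : p ∈ Sij (selfAction R Δ) H i j) (hb : b ∈ Sij A H (-l) l) :
    ∃ w ∈ stSub A H (cone (vec j - vec i) (vec l + vec l)),
      Chev A H (vec j - vec i) (vec l) (X (selfAction R Δ) H i j p) (Y A H l (phi b)) w := by
  by_cases c1 : i = l
  · subst c1
    exact Chev.exists_XYphi_core E hH h1 h2 hp hb
  by_cases c2 : l = -j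
  · subst c2
    rw [X_sym h1 h2 hp, ← vec_sub_neg_neg i j]
    exact Chev.exists_XYphi_core E hH (neg_ne_neg' h1.symm)
      (by rw [neg_neg]; exact ne_neg (ne_neg' h2)) (E.self.Sij_star hH hp) hb
  · exact ⟨_, Yphi_mem_stSub hb (right_mem_cone (add_mem_roots (hH.neg_ne l).symm)),
      Chev.commXY i j l p _ h1 h2 hp (E.Theta0_phi hH hb) c1 c2⟩

theorem Chev.exists_YphiX_core (h1 : i ≠ j) (h2 : i ≠ -j)
    (hq : q ∈ Sij (selfAction R Δ) H (-i) i) (ha : a ∈ Sij A H i j) :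
    ∃ w ∈ stSub A H (cone (vec i + vec i) (vec j - vec i)),
      Chev A H (vec i) (vec j - vec i) (Y (selfAction R Δ) H i (phi q)) (X A H i j a) w := by
  have hs := E.self.Theta0_phi hH hq
  have hne := hH.neg_ne
  refine ⟨_, mul_mem (mul_mem ?_ ?_) ?_, Chev.mixedYX i j (phi q) a h1 h2 hs ha⟩
  · refine X_mem_stSub (ne_neg h2) (neg_ne_neg' h1) (lmul_rho_mem E hH hs ha)
      ⟨sub_mem_roots (ne_neg h2), 1, 1, one_pos, ?_⟩
    rw [vec_neg, one_nsmul, one_nsmul]; abel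
  · have e : -(A.actS (phi q) (-a)) = phi (-(A.rmul (star (-a)) q * (-a))) := E.t_inj (by
      rw [map_neg, E.t_actS, E.t_phi, E.d_phi, ← phi_conj, ← phi_neg, map_neg E.s, map_neg E.s, map_mul E.s, E.s_rmul, map_star,
        map_neg E.s])
    rw [e]
    refine Yphi_mem_stSub ?_ ⟨add_mem_roots (hne j).symm, 1, 2, two_pos, by abel⟩
    have h3 := (E.isMat hH ha).neg
    have h4 := E.self.isMat hH hq
    have h5 := h3.star (E.fam_isHyp hH)
    rw [E.mem_Sij hH, map_neg, map_mul, E.s_rmul, map_star, map_neg]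
    have h6 := (h5.mul h4).mul h3
    rw [neg_mul, neg_mul] at h6
    exact h6
  · exact X_mem_stSub h1 h2 ha (right_mem_cone (sub_mem_roots h1))

/-- The analogue of `Chev.exists_XYphi` for the first argument. -/
theorem Chev.exists_YphiX (h1 : i ≠ j) (h2 : i ≠ -j)
    (hq : q ∈ Sij (selfAction R Δ) H (-l) l) (ha : a ∈ Sij A H i j) :
    ∃ w ∈ stSub A H (cone (vec l + vec l) (vec j - vec i)),
      Chev A H (vec l) (vec j - vec i) (Y (selfAction R Δ) H l (phi q)) (X A H i j a) w := by
  by_cases c1 : i = l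
  · subst c1
    exact Chev.exists_YphiX_core E hH h1 h2 hq ha
  by_cases c2 : l = -j
  · subst c2
    rw [X_sym h1 h2 ha, ← vec_sub_neg_neg i j]
    exact Chev.exists_YphiX_core E hH (neg_ne_neg' h1.symm)
      (by rw [neg_neg]; exact ne_neg (ne_neg' h2)) hq (E.Sij_star hH ha)
  · exact ⟨_, X_mem_stSub h1 h2 ha (right_mem_cone (sub_mem_roots h1)),
      Chev.commYX i j l _ a h1 h2 (E.self.Theta0_phi hH hq) ha c1 c2⟩

theorem Chev.exists_YY_of_pi (hs : s ∈ Theta0 (selfAction R Δ) H i) (hu : u ∈ Theta0 A H j)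
    (h : vec i + vec j ≠ 0) (h0 : pi s = (0 : R) ∨ pi u = (0 : S)) :
    Chev A H (vec i) (vec j) (Y (selfAction R Δ) H i s) (Y A H j u) (Y A H j u) := by
  have e : A.lmul (star (pi s)) (pi u) = 0 := E.s_inj (by
    rw [E.s_lmul, map_zero]
    rcases h0 with h0 | h0 <;> simp [h0])
  by_cases c1 : i = j
  · subst c1
    have := Chev.same (A := A) i s u hs hu
    rwa [e, neg_zero, phi_zero, Y_zero E.toAmbient hH, one_mul] at this
  by_cases c2 : i = -j
  · subst c2
    refine absurd ?_ h
    simp only [vec, neg_neg]; abel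
  · have := Chev.ultrashort (A := A) i j s u c1 c2 hs hu
    rwa [e, neg_zero, X_zero E.toAmbient hH (ne_neg c2) (neg_ne_neg' c1), one_mul] at this

/-- The commutator of root elements, whose roots are not antiparallel, has factors only at positive
combinations of these roots, and this takes into account that long root elements are special
ultrashort root elements. -/
theorem Chev.exists_cone {x : StU (selfAction R Δ) H} {y : StU A H}
    (hx : x ∈ rootSet (selfAction R Δ) H α) (hy : y ∈ rootSet A H β) (h : ¬Anti α β) :
    ∃ w ∈ stSub A H (cone α β), ∃ α₀ β₀, (α = α₀ ∨ α₀ ∈ roots I ∧ α = α₀ + α₀) ∧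
      Chev A H α₀ β₀ x y w := by
  have hne := hH.neg_ne
  have hyβ : y ∈ stSub A H (cone α β) :=
    mem_stSub hy (right_mem_cone (mem_roots_of_mem_rootSet hH hy))
  rcases hx with hx | ⟨l, q, hq, rfl, rfl⟩ <;> rcases hy with hy | ⟨k, b, hb, rfl, rfl⟩
  · obtain ⟨w, hw⟩ := Chev.exists E hH hx hy (add_ne_zero_of_not_anti h)
    exact ⟨w, hw.mem_cone E hH, α, β, Or.inl rfl, hw⟩
  · rcases hx with ⟨i, j, p, h1, h2, hp, rfl, rfl⟩ | ⟨i, s, hs, rfl, rfl⟩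
    · obtain ⟨w, hw, hw'⟩ := Chev.exists_XYphi E hH h1 h2 hp hb
      exact ⟨w, hw, _, _, Or.inl rfl, hw'⟩
    · refine ⟨_, hyβ, _, _, Or.inl rfl, Chev.exists_YY_of_pi E hH hs (E.Theta0_phi hH hb)
        (fun e => h ⟨2, 1, two_pos, one_pos, ?_⟩) (Or.inr (pi_phi b))⟩
      rw [two_nsmul, one_nsmul, add_add_add_comm, e, add_zero]
  · rcases hy with ⟨i, j, a, h1, h2, ha, rfl, rfl⟩ | ⟨j, u, hu, rfl, rfl⟩
    · obtain ⟨w, hw, hw'⟩ := Chev.exists_YphiX E hH h1 h2 hq ha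
      exact ⟨w, hw, _, _, Or.inr ⟨vec_mem_roots l, rfl⟩, hw'⟩
    · refine ⟨_, hyβ, _, _, Or.inr ⟨vec_mem_roots l, rfl⟩, Chev.exists_YY_of_pi E hH
        (E.self.Theta0_phi hH hq) hu (fun e => h ⟨1, 2, one_pos, two_pos, ?_⟩) (Or.inl (pi_phi q))⟩
      rw [two_nsmul, one_nsmul, add_add_add_comm, e, add_zero]
  · refine ⟨_, hyβ, _, _, Or.inr ⟨vec_mem_roots l, rfl⟩, Chev.exists_YY_of_pi E hH
      (E.self.Theta0_phi hH hq) (E.Theta0_phi hH hb)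
      (fun e => h ⟨1, 1, one_pos, one_pos, ?_⟩) (Or.inl (pi_phi q))⟩
    rw [one_nsmul, one_nsmul, add_add_add_comm, e, add_zero]

/-- A multiplicative relation `p x y w`, to be read as `w = ˣy`, that contains the Chevalley
commutator formulas, extends to the subgroups generated by root subgroups, as long as no
antiparallel roots meet. -/
theorem exists_extend {P Z : Set (I → ℤ)} (hZ : ∀ α ∈ P, ∀ β ∈ Z, ¬Anti α β ∧ cone α β ⊆ Z)
    {p : StU (selfAction R Δ) H → StU A H → StU A H → Prop}
    (one_left : ∀ y, p 1 y y)
    (mul_left : ∀ x ∈ stSub (selfAction R Δ) H P, ∀ x' ∈ stSub (selfAction R Δ) H P, ∀ y w w',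
      p x' y w' → p x w' w → p (x * x') y w)
    (one_right : ∀ x ∈ stSub (selfAction R Δ) H P, p x 1 1)
    (mul_right : ∀ x ∈ stSub (selfAction R Δ) H P, ∀ y y' w w', p x y w → p x y' w' →
      p x (y * y') (w * w'))
    (chev : ∀ α ∈ P, ∀ x y w α₀ β₀, (α = α₀ ∨ α₀ ∈ roots I ∧ α = α₀ + α₀) →
      Chev A H α₀ β₀ x y w → p x y w)
    {x : StU (selfAction R Δ) H} {y : StU A H} (hx : x ∈ stSub (selfAction R Δ) H P)
    (hy : y ∈ stSub A H Z) : ∃ w ∈ stSub A H Z, p x y w := by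
  revert y
  suffices x ∈ stSub (selfAction R Δ) H P ∧
    ∀ {y : StU A H}, y ∈ stSub A H Z → ∃ w ∈ stSub A H Z, p x y w from
      fun {y} hy => this.2 hy
  refine stSub_induction E.self.toAmbient hH (p := fun x => x ∈ stSub (selfAction R Δ) H P ∧
    ∀ {y : StU A H}, y ∈ stSub A H Z → ∃ w ∈ stSub A H Z, p x y w) ?_ ?_ hx
  · exact ⟨one_mem _, fun {y} hy => ⟨y, hy, one_left y⟩⟩
  · intro α hα x hx x' _ ⟨hx', ih⟩
    have hxP := mem_stSub hx hα
    refine ⟨mul_mem hxP hx', fun {y} hy => ?_⟩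
    obtain ⟨w', hw', h1⟩ := ih hy
    obtain ⟨w, hw, h2⟩ : ∃ w ∈ stSub A H Z, p x w' w := by
      refine stSub_induction E.toAmbient hH (p := fun w' => ∃ w ∈ stSub A H Z, p x w' w) ?_ ?_ hw'
      · exact ⟨1, one_mem _, one_right x hxP⟩
      · rintro β hβ y hy y' hy' ⟨w2, h3, h4⟩
        obtain ⟨h5, h6⟩ := hZ α hα β hβ
        obtain ⟨w1, h7, α₀, β₀, h8, h9⟩ := Chev.exists_cone E hH hx hy h5
        exact ⟨w1 * w2, mul_mem (stSub_mono h6 h7) h3,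
          mul_right x hxP _ _ _ _ (chev α hα _ _ _ _ _ h8 h9) h4⟩
    exact ⟨w, hw, mul_left x hxP x' hx' _ _ _ h1 h2⟩

end TrueCones

/-! ### Relations of the conjugacy calculus for arbitrary elements -/

section Brackets

variable {R Δ S Θ : Type*} [NonUnitalRing R] [StarRing R] [AddGroup Δ] [OddFormRing R Δ]
  [NonUnitalRing S] [StarRing S] [AddGroup Θ] [OddFormRing S Θ]
variable {B Γ : Type*} [NonUnitalRing B] [StarRing B] [AddGroup Γ] [OddFormRing B Γ]
variable {I : Type} [InvolutiveNeg I] [Finite I] {M : CrossedModule R Δ S Θ} {H : Family R Δ I}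
variable {P P' : Set (I → ℤ)} {α : I → ℤ}

theorem CalcRel.mk_eq {x y : FreeGroup (CalcSymbol M H)} (h : CalcRel M H x y) :
    (PresentedGroup.mk _ x : StUbar M H) = PresentedGroup.mk _ y := by
  rw [← mul_inv_eq_one, ← map_inv, ← map_mul]
  exact PresentedGroup.one_of_mem ⟨x, y, h, rfl⟩

/-- The homomorphism `h ↦ ᵍ{h}_P`. -/
def brk (hP : IsSatSpecial P) (g : stSub (selfAction R Δ) H P) :
    StU M.action H →* StUbar M H :=
  MonoidHom.mk' (bracket M H P hP g.1 g.2) fun x y => by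
    have := (CalcRel.hom (M := M) P hP g.1 g.2 x y).mk_eq
    rwa [map_mul] at this

theorem brk_sub (hP : IsSatSpecial P) (hP' : IsSatSpecial P') (h : P' ⊆ P)
    {g : stSub (selfAction R Δ) H P} {g' : stSub (selfAction R Δ) H P'} (e : g'.1 = g.1)
    (x : StU M.action H) : brk hP' g' x = brk hP g x := by
  obtain ⟨g, hg⟩ := g
  obtain ⟨g', hg'⟩ := g'
  obtain rfl : g' = g := e
  exact (CalcRel.sub P P' hP hP' h g' hg hg' x).mk_eq

theorem brk_chev (hP : IsSatSpecial P) {g g' : stSub (selfAction R Δ) H P}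
    {x : StU (selfAction R Δ) H} (e : g'.1 = g.1 * x) (hα : α ∈ P) {y w : StU M.action H}
    (h : ChevRel M H α x y w) : brk hP g' y = brk hP g w := by
  obtain ⟨g, hg⟩ := g
  obtain ⟨g', hg'⟩ := g'
  obtain rfl : g' = g * x := e
  exact (CalcRel.chev P hP g x hg hg' α hα y w h).mk_eq

variable (E : FullAmbient M.action B Γ) (hH : H.IsHyp) {ω : I → ℤ}

/-- The Chevalley relation for arbitrary elements of subgroups generated by root subgroups. -/
theorem exists_brk_conj (hP : IsSatSpecial P) {Q Z : Set (I → ℤ)} (hQ : Q ⊆ P)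
    (hZ : ∀ α ∈ Q, ∀ β ∈ Z, ¬Anti α β ∧ cone α β ⊆ Z) {x : StU (selfAction R Δ) H}
    (hx : x ∈ stSub (selfAction R Δ) H Q) {y : StU M.action H} (hy : y ∈ stSub M.action H Z) :
    ∃ w ∈ stSub M.action H Z,
      E.st hH w = E.self.st hH x * E.st hH y * (E.self.st hH x)⁻¹ ∧
      ∀ g g' : stSub (selfAction R Δ) H P, g'.1 = g.1 * x → brk hP g' y = brk hP g w := by
  refine exists_extend E hH hZ (p := fun x y w =>
    E.st hH w = E.self.st hH x * E.st hH y * (E.self.st hH x)⁻¹ ∧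
      ∀ g g' : stSub (selfAction R Δ) H P, g'.1 = g.1 * x → brk hP g' y = brk hP g w)
    ?_ ?_ ?_ ?_ ?_ hx hy
  · refine fun y => ⟨by simp, fun g g' e => ?_⟩
    rw [mul_one] at e
    rw [Subtype.ext e]
  · rintro x hx x' hx' y w w' ⟨h1, h2⟩ ⟨h3, h4⟩
    refine ⟨by rw [h3, h1, map_mul]; group, fun g g' e => ?_⟩
    rw [h2 (g * ⟨x, stSub_mono hQ hx⟩) g' (by rw [e, Subgroup.coe_mul, mul_assoc]), h4 g _ rfl]
  · exact fun x hx => ⟨by simp, fun g g' _ => by simp⟩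
  · rintro x hx y y' w w' ⟨h1, h2⟩ ⟨h3, h4⟩
    refine ⟨?_, fun g g' e => ?_⟩
    · rw [map_mul, map_mul, h1, h3]; group
    · rw [map_mul, map_mul, h2 g g' e, h4 g g' e]
  · intro α hα x y w α₀ β₀ h hc
    refine ⟨hc.st_eq E hH, fun g g' e => brk_chev hP e ?_ hc.chevRel⟩
    rcases h with rfl | ⟨h, rfl⟩
    · exact hQ hα
    · exact hP.half _ (hQ hα) _ h rfl

/-- In the Chevalley relation for arbitrary elements with roots from one half-space, the conjugate
`w = ˣy` is determined by its image in the unitary group. -/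
theorem brk_conj (hω : IsOdd ω) (hP : IsSatSpecial P) {x : StU (selfAction R Δ) H}
    (hx : x ∈ stSub (selfAction R Δ) H (P ∩ posRoots ω)) {y w : StU M.action H}
    (hy : y ∈ stSub M.action H (posRoots ω)) (hw : w ∈ stSub M.action H (posRoots ω))
    (e : E.st hH w = E.self.st hH x * E.st hH y * (E.self.st hH x)⁻¹)
    {g g' : stSub (selfAction R Δ) H P} (e' : g'.1 = g.1 * x) : brk hP g' y = brk hP g w := by
  obtain ⟨w', h1, h2, h3⟩ := exists_brk_conj E hH hP Set.inter_subset_left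
    (fun α hα β hβ => ⟨not_anti_of_ht hα.2.2.le hβ.2, cone_subset_posRoots hα.2.2.le hβ.2⟩) hx hy
  obtain rfl : w = w' := st_injOn E.toAmbient hH hω hw h1 (e.trans h2.symm)
  exact h3 _ _ e'

/-- The crossed module relation for arbitrary elements of `StU(S, Θ; P)`. -/
theorem brk_delta (hP : IsSatSpecial P) {y : StU M.action H} (hy : y ∈ stSub M.action H P)
    {g g' : stSub (selfAction R Δ) H P} (e : g'.1 = delta E hH y * g.1) (h : StU M.action H) :
    brk hP g' h = brk hP 1 y * brk hP g h * (brk hP 1 y)⁻¹ := by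
  revert g g'
  refine stSub_induction E.toAmbient hH (p := fun y => ∀ {g g' : stSub (selfAction R Δ) H P},
    g'.1 = delta E hH y * g.1 → brk hP g' h = brk hP 1 y * brk hP g h * (brk hP 1 y)⁻¹) ?_ ?_ hy
  · intro g g' e
    rw [map_one, one_mul] at e
    rw [Subtype.ext e]; simp
  · intro α hα x hx y hy ih g g' e
    have hx' := delta_mem E hH (mem_stSub hx hα)
    have hy' := delta_mem E hH hy
    have key : ∀ {g g' : stSub (selfAction R Δ) H P}, g'.1 = delta E hH x * g.1 →
        brk hP g' h = brk hP 1 x * brk hP g h * (brk hP 1 x)⁻¹ := by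
      rintro ⟨g, hg⟩ ⟨g', hg'⟩ e
      obtain rfl : g' = delta E hH x * g := e
      have hYY : ∀ j, ∀ u ∈ Theta0 M.action H j, vec j ∈ P → x = Y M.action H j u →
          brk hP ⟨delta E hH x * g, hg'⟩ h =
            brk hP 1 x * brk hP ⟨g, hg⟩ h * (brk hP 1 x)⁻¹ := by
        rintro j u hu hj rfl
        have e1 : delta E hH (Y M.action H j u) = Y (selfAction R Δ) H j (M.dΘ u) :=
          (deltaParam M H).map_Y E.toAmbient hH hu
        have := (CalcRel.xmodY P hP g hg (one_mem _) j u hu hj (e1 ▸ hg') h).mk_eq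
        simp only [map_mul, map_inv] at this
        simp only [e1]
        exact this
      rcases hx with (⟨i, j, a, h1, h2, ha, rfl, rfl⟩ | ⟨j, u, hu, rfl, rfl⟩) | ⟨j, a, ha, rfl, rfl⟩
      · have e1 : delta E hH (X M.action H i j a) = X (selfAction R Δ) H i j (M.dS a) :=
          (deltaParam M H).map_X E.toAmbient hH h1 h2 ha
        have := (CalcRel.xmodX P hP g hg (one_mem _) i j a h1 h2 ha hα (e1 ▸ hg') h).mk_eq
        simp only [map_mul, map_inv] at this
        simp only [e1]
        exact this
      · exact hYY j u hu hα rfl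
      · exact hYY j _ (E.Theta0_phi hH ha) (hP.half _ hα _ (vec_mem_roots j) rfl) rfl
    rw [key (g := ⟨delta E hH y, hy'⟩ * g) (by rw [e, map_mul, mul_assoc]; rfl), ih rfl, map_mul]
    group

variable {J : Type} [InvolutiveNeg J] [Finite J] {c : I → Option J} {Ψ : Set (I → ℤ)} {N : Family R Δ J}

/-- The elements of `StU(R, Δ; Ψ)` act on the Steinberg groups for the quotient by `Ψ` as elements
of the diagonal group. -/
theorem exists_isDiag (hc : IsLabel c) (hΨ : IsSubsystem Ψ) (hq : IsQuotient Ψ c)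
    (hN : N = H.push c) {z : StU (selfAction R Δ) H} (hz : z ∈ stSub (selfAction R Δ) H Ψ) :
    ∃ f, IsDiag E.toAmbient N f ∧ E.d f = (E.self.st hH z).val := by
  subst hN
  obtain ⟨t, ht⟩ := E.self.exists_stVal hH z
  have ht' : (E.self.st hH z).val = E.d t := (E.self.stVal_iff hH).1 ht
  refine ⟨t, ⟨ht' ▸ (E.self.st hH z).2, fun i => ?_⟩, ht'.symm⟩
  have := (st_mem_commSub E.self.toAmbient hH hc
    (fun α hα => IsQuotient.proj_eq_zero hΨ hc hq hα) hz i).1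
  rw [ht', ← fam_push] at this
  exact this

/-- The element acting in the conjugation relation, as an element of the ambient unitary group. -/
theorem d_dΘ_conjΘ {g : StU (selfAction R Δ) H} {x : StU M.action H} {t : Δ} {s : Θ}
    (ht : StVal (selfAction R Δ) H g t) (hs : StVal M.action H x s) :
    E.d (M.dΘ (conjΘ M.action t s)) = (E.self.st hH (g * delta E hH x * g⁻¹)).val := by
  have e1 : M.dΘ (conjΘ M.action t s) = conjΘ (selfAction R Δ) t (M.dΘ s) := by
    simp only [conjΘ, map_add, M.map_actR, M.map_actS, M.map_phi, M.map_rmul, M.map_rho,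
      M.map_pi]
    rfl
  rw [e1, map_mul, map_mul, map_inv, UGrp.val_conj]
  have h1 := E.self.t_conjΘ t (M.dΘ s)
  have h2 : (E.self.st hH g).val = E.self.d t := (E.self.stVal_iff hH).1 ht
  have h3 : (E.self.st hH (delta E hH x)).val = E.self.t (M.dΘ s) :=
    (E.self.stVal_iff hH).1 (hs.delta E hH)
  rw [h2, h3]
  exact h1

/-- The conjugation relation for arbitrary elements of `StU(S, Θ; Ψ)`. The homomorphisms `FR` and
`FS` are only required to satisfy the characterization of the canonical ones, so that composites of
canonical homomorphisms can be used. -/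
theorem brk_conj_diag (hc : IsLabel c) (hΨ : IsSubsystem Ψ) (hq : IsQuotient Ψ c)
    (hP' : IsSatSpecial P') (hPΨ : P' ⊆ Ψ) (g₁ : stSub (selfAction R Δ) H P') {Q : Set (J → ℤ)}
    (hQ : IsSatSpecial Q) (hQ' : IsSatSpecial (pre c Q)) (hN : N = H.push c) (hN' : N.IsHyp)
    {FR : StU (selfAction R Δ) N → StU (selfAction R Δ) H}
    {FS : StU M.action N → StU M.action H}
    (hFR : ∀ x, (x, FR x) ∈ elimGraph (selfAction R Δ) H N c)
    (hFS : ∀ x, (x, FS x) ∈ elimGraph M.action H N c)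
    (hFR' : ∀ x ∈ stSub (selfAction R Δ) N Q, FR x ∈ stSub (selfAction R Δ) H (pre c Q))
    {y : StU M.action H} (hy : y ∈ stSub M.action H Ψ) {f : Δ} (hf : IsDiag E.toAmbient N f)
    (hf' : IsDiag E.self.toAmbient N f)
    (e : E.d f = (E.self.st hH (g₁.1 * delta E hH y * g₁.1⁻¹)).val)
    {g₂ : StU (selfAction R Δ) N} (hg₂ : g₂ ∈ stSub (selfAction R Δ) N Q) (h : StU M.action N) :
    brk hP' g₁ y * brk hQ' ⟨FR g₂, hFR' _ hg₂⟩ (FS h) * (brk hP' g₁ y)⁻¹ =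
      brk hQ' ⟨FR (diagHom hN' hf' g₂), hFR' _ (ParamHom.map_mem _ _ _ hg₂)⟩
        (FS (diagHom hN' hf h)) := by
  have hself : ∀ {f}, IsDiag E.toAmbient N f → IsDiag E.self.toAmbient N f :=
    fun h => ⟨h.unitary, h.comm⟩
  -- multiplicativity in `y`: both sides are compatible with the composition of diagonal
  -- automorphisms
  revert f g₂ h
  refine stSub_induction E.toAmbient hH (p := fun y => ∀ {f : Δ} (hf : IsDiag E.toAmbient N f)
    (hf' : IsDiag E.self.toAmbient N f)
    (_ : E.d f = (E.self.st hH (g₁.1 * delta E hH y * g₁.1⁻¹)).val)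
    {g₂ : StU (selfAction R Δ) N} (hg₂ : g₂ ∈ stSub (selfAction R Δ) N Q) (h : StU M.action N),
    brk hP' g₁ y * brk hQ' ⟨FR g₂, hFR' _ hg₂⟩ (FS h) * (brk hP' g₁ y)⁻¹ =
      brk hQ' ⟨FR (diagHom hN' hf' g₂), hFR' _ (ParamHom.map_mem _ _ _ hg₂)⟩
        (FS (diagHom hN' hf h))) ?_ ?_ hy
  · intro f hf hf' e g₂ hg₂ h
    have e0 : E.d f = 0 := by rw [e, map_one, mul_one, mul_inv_cancel, map_one, UGrp.val_one]
    have e1 := diagHom_of_eq_zero hN' hf' e0 g₂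
    have e2 := diagHom_of_eq_zero hN' hf e0 h
    simp only [e1, e2, map_one, one_mul, inv_one, mul_one]
  · intro α hα x hx y hy ih f hf hf' e g₂ hg₂ h
    have hg₁ := stSub_mono hPΨ g₁.2
    have hx' := mul_mem (mul_mem hg₁ (delta_mem E hH (mem_stSub hx hα))) (inv_mem hg₁)
    have hy' := mul_mem (mul_mem hg₁ (delta_mem E hH hy)) (inv_mem hg₁)
    obtain ⟨fx, hfx, ex⟩ := exists_isDiag E hH hc hΨ hq hN hx'
    obtain ⟨fy, hfy, ey⟩ := exists_isDiag E hH hc hΨ hq hN hy'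
    have key : ∀ {g₂ : StU (selfAction R Δ) N} (hg₂ : g₂ ∈ stSub (selfAction R Δ) N Q)
        (h : StU M.action N),
        brk hP' g₁ x * brk hQ' ⟨FR g₂, hFR' _ hg₂⟩ (FS h) * (brk hP' g₁ x)⁻¹ =
          brk hQ' ⟨FR (diagHom hN' (hself hfx) g₂), hFR' _ (ParamHom.map_mem _ _ _ hg₂)⟩
            (FS (diagHom hN' hfx h)) := by
      intro g₂ hg₂ h
      obtain ⟨t, ht⟩ := E.self.exists_stVal hH g₁.1
      obtain ⟨s, hs⟩ := E.exists_stVal hH x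
      have ef : fx = M.dΘ (conjΘ M.action t s) :=
        E.d_inj (ex.trans (d_dΘ_conjΘ E hH ht hs).symm)
      have m1 := mem_diagGraph hN' (hself hfx) g₂
      have m2 := mem_diagGraph hN' hfx h
      have n1 := hFR' _ (ParamHom.map_mem (diagParam hN' (hself hfx)) E.self.toAmbient hN' hg₂)
      subst ef
      subst hN
      have := (CalcRel.conj Ψ hΨ c hq P' hP' hPΨ g₁.1 g₁.2 α hα x hx t ht s hs Q hQ hQ' g₂ _ hg₂ m1
        h _ m2 _ _ (hFR g₂) (hFR _) (hFR' _ hg₂) n1 _ _ (hFS h) (hFS _)).mk_eq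
      simp only [map_mul, map_inv] at this
      exact this
    have e' : E.d f = umul (S := B) (E.d fx) (E.d fy) := by
      rw [e, ex, ey, ← UGrp.val_mul, ← map_mul, map_mul (delta E hH)]
      congr 2; group
    have e1 := diagHom_diagHom hN' (hself hfx) (hself hfy) hf' e' g₂
    have e2 := diagHom_diagHom hN' hfx hfy hf e' h
    have h1 := ih hfy (hself hfy) ey hg₂ h
    have h2 := key (ParamHom.map_mem (diagParam hN' (hself hfy)) E.self.toAmbient hN' hg₂)
      (diagHom hN' hfy h)
    simp only [← e1, ← e2]
    refine Eq.trans ?_ h2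
    change _ = _ * brk hQ' ⟨FR (diagHom hN' (hself hfy) g₂), _⟩ (FS (diagHom hN' hfy h)) * _
    rw [← h1, map_mul]
    group

end Brackets

/-! ### Canonical homomorphisms of universal groups -/

section Universal

variable {R Δ S Θ : Type*} [NonUnitalRing R] [StarRing R] [AddGroup Δ] [OddFormRing R Δ]
  [NonUnitalRing S] [StarRing S] [AddGroup Θ] [OddFormRing S Θ]
variable {B Γ : Type*} [NonUnitalRing B] [StarRing B] [AddGroup Γ] [OddFormRing B Γ]
variable {I J : Type} [InvolutiveNeg I] [Finite I] [InvolutiveNeg J] [Finite J]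
  {M : CrossedModule R Δ S Θ} {H : Family R Δ I} {c : I → Option J}
variable (E : FullAmbient M.action B Γ) (hH : H.IsHyp)

theorem elimHom_mem_pre {A : ActionData R Δ S Θ} (E : Ambient A B Γ) (hc : IsLabel c)
    {P : Set (J → ℤ)} (hP : IsSaturated P) {x : StU A (H.push c)}
    (hx : x ∈ stSub A (H.push c) P) : elimHom E hH hc x ∈ stSub A H (pre c P) :=
  elimHom_mem E hH hc (hP.double_mem hc.neg_ne) hx

/-- The image of an element of `StU(R, Δ; P)` under the canonical homomorphism. -/
def elimSub (hc : IsLabel c) {P : Set (J → ℤ)} (hP : IsSatSpecial P)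
    (g : stSub (selfAction R Δ) (H.push c) P) : stSub (selfAction R Δ) H (pre c P) :=
  ⟨elimHom E.self.toAmbient hH hc g.1, elimHom_mem_pre hH E.self.toAmbient hc hP.toIsSaturated g.2⟩

theorem coe_elimSub (hc : IsLabel c) {P : Set (J → ℤ)} (hP : IsSatSpecial P)
    (g : stSub (selfAction R Δ) (H.push c) P) :
    (elimSub E hH hc hP g).1 = elimHom E.self.toAmbient hH hc g.1 := rfl

/-- Images of the generators under the canonical homomorphism of universal groups. -/
def elimBarGen (hc : IsLabel c) (x : CalcSymbol M (H.push c)) : StUbar M H :=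
  brk (isSatSpecial_pre hc x.special) (elimSub E hH hc x.special ⟨x.g, x.g_mem⟩)
    (elimHom E.toAmbient hH hc x.h)

theorem lift_br (hc : IsLabel c) (P : Set (J → ℤ)) (hP : IsSatSpecial P)
    (g : StU (selfAction R Δ) (H.push c)) (hg : g ∈ stSub (selfAction R Δ) (H.push c) P)
    (h : StU M.action (H.push c)) :
    FreeGroup.lift (elimBarGen E hH hc) (br M (H.push c) P hP g hg h) =
      brk (isSatSpecial_pre hc hP) (elimSub E hH hc hP ⟨g, hg⟩)
        (elimHom E.toAmbient hH hc h) := by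
  rw [br, FreeGroup.lift_apply_of]; rfl

/-- The image of the Chevalley relation: the images of root elements satisfy the relation for
arbitrary elements with roots from one half-space. -/
theorem elimBar_chev (hc : IsLabel c) {P : Set (J → ℤ)} (hP : IsSatSpecial P)
    {g g' : stSub (selfAction R Δ) (H.push c) P} {x : StU (selfAction R Δ) (H.push c)}
    (e : g'.1 = g.1 * x) {α : J → ℤ} (hα : α ∈ P) {y w : StU M.action (H.push c)}
    (h : ChevRel M (H.push c) α x y w) :
    brk (isSatSpecial_pre hc hP) (elimSub E hH hc hP g') (elimHom E.toAmbient hH hc y) =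
      brk (isSatSpecial_pre hc hP) (elimSub E hH hc hP g) (elimHom E.toAmbient hH hc w) := by
  have hH' := push_isHyp hH hc
  obtain ⟨β, hch⟩ := h.chev
  obtain ⟨ω, hω, h1, h2⟩ := hch.exists_weight hc.neg_ne
  have hpre : pre c (posRoots ω) ⊆ posRoots (pull c ω) :=
    pre_subset_posRoots hω hc fun _ hγ => hγ.2
  have hdbl : ∀ F : J, vec F ∈ posRoots ω → vec F + vec F ∈ posRoots ω := fun F hF =>
    ⟨add_mem_roots (hc.neg_ne F).symm, by have := hF.2; rw [ht_add]; omega⟩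
  have hx : elimHom E.self.toAmbient hH hc x ∈
      stSub (selfAction R Δ) H (pre c P ∩ posRoots (pull c ω)) := by
    have := elimHom_mem E.self.toAmbient hH hc (Q := P ∩ posRoots ω)
      (fun F hF => ⟨hP.double_mem hc.neg_ne F hF.1, hdbl F hF.2⟩)
      (mem_stSub hch.left_mem ⟨hα, hP.subset hα, h1⟩)
    refine stSub_mono ?_ this
    exact fun γ hγ => ⟨⟨hγ.1, hγ.2.1⟩, hpre ⟨hγ.1, hγ.2.2⟩⟩
  have hβ : β ∈ posRoots ω := by
    refine ⟨?_, h2⟩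
    rcases hch.right_mem with (⟨i, j, a, h1, _, _, rfl, _⟩ | ⟨j, u, _, rfl, _⟩) | ⟨j, a, _, rfl, _⟩
    · exact sub_mem_roots h1
    · exact vec_mem_roots j
    · exact add_mem_roots (hc.neg_ne j).symm
  refine brk_conj E hH (hc.isOdd_pull hω) _ hx
    (stSub_mono hpre (elimHom_mem _ hH hc hdbl (mem_stSub hch.right_mem hβ)))
    (stSub_mono hpre (elimHom_mem _ hH hc hdbl
      (stSub_mono (cone_subset_posRoots h1.le h2) (hch.mem_cone E hH')))) ?_ ?_
  · rw [st_elimHom, st_elimHom, st_elimHom]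
    exact hch.st_eq E hH'
  · simp only [elimSub, e, map_mul]

theorem elimBar_xmod (hc : IsLabel c) {P : Set (J → ℤ)} (hP : IsSatSpecial P)
    {g g' e : stSub (selfAction R Δ) (H.push c) P} (he : e.1 = 1) {x : StU M.action (H.push c)}
    (hx : x ∈ stSub M.action (H.push c) P)
    (hg : g'.1 = delta E (push_isHyp hH hc) x * g.1) (h : StU M.action (H.push c)) :
    brk (isSatSpecial_pre hc hP) (elimSub E hH hc hP g') (elimHom E.toAmbient hH hc h) =
      brk (isSatSpecial_pre hc hP) (elimSub E hH hc hP e) (elimHom E.toAmbient hH hc x) *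
      brk (isSatSpecial_pre hc hP) (elimSub E hH hc hP g) (elimHom E.toAmbient hH hc h) *
      (brk (isSatSpecial_pre hc hP) (elimSub E hH hc hP e) (elimHom E.toAmbient hH hc x))⁻¹ := by
  have e1 : elimSub E hH hc hP e = 1 := Subtype.ext (by simp only [elimSub, he, map_one]; rfl)
  rw [e1]
  refine brk_delta E hH _ (elimHom_mem_pre hH _ hc hP.toIsSaturated hx) ?_ _
  simp only [elimSub, hg, map_mul, delta_elimHom]

/-- The relations of the universal group for the quotient hold for the images of the generators. The
conjugation relation for a subsystem `Ψ` becomes the one for the preimage of `Ψ`. -/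
theorem elimBarGen_rel (hc : IsLabel c) (x y : FreeGroup (CalcSymbol M (H.push c)))
    (h : CalcRel M (H.push c) x y) :
    FreeGroup.lift (elimBarGen E hH hc) x = FreeGroup.lift (elimBarGen E hH hc) y := by
  have hH' := push_isHyp hH hc
  cases h with
  | hom P hP g hg h₁ h₂ => simp only [map_mul, lift_br]
  | sub P P' hP hP' hsub g hg hg' h =>
    rw [lift_br, lift_br]
    refine brk_sub (isSatSpecial_pre hc hP) (isSatSpecial_pre hc hP') ?_
      ((coe_elimSub E hH hc hP' ⟨g, hg'⟩).trans (coe_elimSub E hH hc hP ⟨g, hg⟩).symm) _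
    exact fun γ hγ => ⟨hγ.1, hsub hγ.2⟩
  | chev P hP g x hg hgx α hα y w h =>
    rw [lift_br, lift_br]
    exact elimBar_chev E hH hc hP rfl hα h
  | xmodX P hP g hg h1 i j a hij hij' ha hα hxg h =>
    simp only [map_mul, map_inv, lift_br]
    refine elimBar_xmod E hH hc hP rfl (X_mem_stSub hij hij' ha hα) ?_ h
    rw [delta, (deltaParam M _).map_X E.toAmbient hH' hij hij' ha]; rfl
  | xmodY P hP g hg h1 j u hu hα hxg h =>
    simp only [map_mul, map_inv, lift_br]
    refine elimBar_xmod E hH hc hP rfl (Y_mem_stSub hu hα) ?_ h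
    rw [delta, (deltaParam M _).map_Y E.toAmbient hH' hu]; rfl
  | @conj K _ Ψ hΨ d hq P' hP' hPΨ g₁ hg₁ α hα x hx t ht s hs P hP hpP g₂ g₂' hg₂ hgg h h' hhh
      k k' hk hk' hkm hkm' m m' hm hm' =>
    have hd := hq.isLabel hΨ hc.neg_ne
    have : Finite K := by
      choose f hf using hd.surj
      exact Finite.of_injective f fun a b h => Option.some.inj (by rw [← hf a, ← hf b, h])
    simp only [map_mul, map_inv, lift_br]
    obtain ⟨f, hf, ef⟩ := exists_isDiag E hH' hd hΨ hq rfl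
      (mul_mem (mul_mem (stSub_mono hPΨ hg₁) (delta_mem E hH' (mem_stSub hx hα)))
        (inv_mem (stSub_mono hPΨ hg₁)))
    obtain rfl : f = M.dΘ (conjΘ M.action t s) :=
      E.d_inj (ef.trans (d_dΘ_conjΘ E hH' ht hs).symm)
    have hf' : IsDiag E.self.toAmbient ((H.push c).push d) (M.dΘ (conjΘ M.action t s)) :=
      ⟨hf.unitary, hf.comm⟩
    have hN' := push_isHyp hH' hd
    obtain rfl : k = elimHom E.self.toAmbient hH' hd g₂ := eq_elimHom_of_mem_elimGraph _ _ _ hk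
    obtain rfl : k' = elimHom E.self.toAmbient hH' hd g₂' := eq_elimHom_of_mem_elimGraph _ _ _ hk'
    obtain rfl : m = elimHom E.toAmbient hH' hd h := eq_elimHom_of_mem_elimGraph _ _ _ hm
    obtain rfl : m' = elimHom E.toAmbient hH' hd h' := eq_elimHom_of_mem_elimGraph _ _ _ hm'
    obtain rfl : g₂' = diagHom hN' hf' g₂ := eq_diagHom_of_mem_diagGraph _ _ hgg
    obtain rfl : h' = diagHom hN' hf h := eq_diagHom_of_mem_diagGraph _ _ hhh
    have hcd := hc.bind hd
    have hFR' : ∀ x ∈ stSub (selfAction R Δ) ((H.push c).push d) P,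
        elimHom E.self.toAmbient hH hc (elimHom E.self.toAmbient hH' hd x) ∈
          stSub (selfAction R Δ) H (pre (fun i => (c i).bind d) P) := fun x hx =>
      stSub_mono pre_pre_subset (elimHom_mem_pre hH _ hc hpP.toIsSaturated
        (elimHom_mem_pre hH' _ hd hP.toIsSaturated hx))
    have key := brk_conj_diag E hH hcd (isSubsystem_preSub hc hΨ) (isQuotient_preSub hc hΨ hq)
      (isSatSpecial_pre hc hP') (pre_subset_preSub hPΨ) (elimSub E hH hc hP' ⟨g₁, hg₁⟩) hP
      (isSatSpecial_pre hcd hP) (push_push hH hc hd) hN'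
      (FR := fun x => elimHom E.self.toAmbient hH hc (elimHom E.self.toAmbient hH' hd x))
      (FS := fun x => elimHom E.toAmbient hH hc (elimHom E.toAmbient hH' hd x))
      (mem_elimGraph_comp _ hH hc hd) (mem_elimGraph_comp _ hH hc hd) hFR'
      (y := elimHom E.toAmbient hH hc x)
      (stSub_mono (pre_subset_preSub le_rfl)
        (elimHom_mem_pre hH _ hc hΨ.toIsSaturated (mem_stSub hx hα)))
      hf hf' (by
        rw [ef]
        simp only [elimSub, delta_elimHom, map_mul, map_inv, st_elimHom]) hg₂ h
    have e1 : ∀ x (hx : x ∈ stSub (selfAction R Δ) ((H.push c).push d) P)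
        (hx' : elimHom E.self.toAmbient hH' hd x ∈ stSub (selfAction R Δ) (H.push c) (pre d P))
        (z : StU M.action H),
        brk (isSatSpecial_pre hc hpP) (elimSub E hH hc hpP ⟨_, hx'⟩) z =
          brk (isSatSpecial_pre hcd hP) ⟨_, hFR' x hx⟩ z := fun x hx hx' z =>
      brk_sub (isSatSpecial_pre hcd hP) (isSatSpecial_pre hc hpP) pre_pre_subset
        (g := ⟨_, hFR' x hx⟩) (g' := elimSub E hH hc hpP ⟨_, hx'⟩)
        (coe_elimSub E hH hc hpP ⟨_, hx'⟩) z
    have hdg : diagHom hN' hf' g₂ ∈ stSub (selfAction R Δ) ((H.push c).push d) P :=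
      ParamHom.map_mem (diagParam hN' hf') E.self.toAmbient hN' hg₂
    rw [e1 _ hg₂, e1 _ hdg]
    exact key

/-- The canonical homomorphism of universal groups. -/
def elimBar (hc : IsLabel c) : StUbar M (H.push c) →* StUbar M H :=
  PresentedGroup.toGroup (f := elimBarGen E hH hc) (by
    rintro _ ⟨x, y, h, rfl⟩
    rw [map_mul, map_inv, elimBarGen_rel E hH hc x y h, mul_inv_cancel])

theorem elimBar_brk (hc : IsLabel c) {P : Set (J → ℤ)} (hP : IsSatSpecial P)
    (g : stSub (selfAction R Δ) (H.push c) P) (h : StU M.action (H.push c)) :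
    elimBar E hH hc (brk hP g h) =
      brk (isSatSpecial_pre hc hP) (elimSub E hH hc hP g) (elimHom E.toAmbient hH hc h) :=
  lift_br E hH hc P hP g.1 g.2 h

theorem isElim_elimBar (hc : IsLabel c) : IsElim M H (H.push c) c (elimBar E hH hc) :=
  ⟨elimHom E.self.toAmbient hH hc, elimHom E.toAmbient hH hc, mem_elimGraph_elimHom _ _ _,
    mem_elimGraph_elimHom _ _ _, fun _ hP g hg h =>
    ⟨isSatSpecial_pre hc hP, elimHom_mem_pre hH _ hc hP.toIsSaturated hg,
      elimBar_brk E hH hc hP ⟨g, hg⟩ h⟩⟩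

end Universal

/-! ### Positive systems and heights -/

section Weights

variable {I : Type*} [InvolutiveNeg I] [Finite I] {P P' : Set (I → ℤ)} {ω : I → ℤ}

theorem isSatSpecial_posRoots (ω : I → ℤ) : IsSatSpecial (posRoots ω) where
  subset _ h := h.1
  closed α hα β hβ h := ⟨h, by have := hα.2; have := hβ.2; rw [ht_add]; omega⟩
  half α hα β hβ h := ⟨hβ, by have := hα.2; rw [h, ht_add] at this; omega⟩
  special α hα h := by
    have h1 := hα.2
    have h2 := h.2
    rw [ht_neg] at h2
    omega

theorem IsSatSpecial.inter (hP : IsSatSpecial P) (hP' : IsSatSpecial P') :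
    IsSatSpecial (P ∩ P') where
  subset _ h := hP.subset h.1
  closed α hα β hβ h := ⟨hP.closed α hα.1 β hβ.1 h, hP'.closed α hα.2 β hβ.2 h⟩
  half α hα β hβ h := ⟨hP.half α hα.1 β hβ h, hP'.half α hα.2 β hβ h⟩
  special α hα h := hP.special α hα.1 h.1

/-- A saturated special set of roots is contained in a system of positive roots. The weight of `i`
compares the numbers of predecessors and of successors of `i` with respect to the strict order
`k < i ↔ vec i - vec k ∈ P`. -/
theorem IsSatSpecial.exists_weight (hne : ∀ i : I, -i ≠ i) (hP : IsSatSpecial P) :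
    ∃ ω : I → ℤ, IsOdd ω ∧ P ⊆ posRoots ω := by
  set D : I → Set I := fun i => {k | vec i - vec k ∈ P} with hD
  set U : I → Set I := fun i => {k | vec k - vec i ∈ P} with hU
  have hUD : ∀ i, (U (-i)).ncard = (D i).ncard := by
    intro i
    have : U (-i) = (fun k => -k) '' D i := by
      ext k
      simp only [hD, hU, Set.mem_image, Set.mem_ofPred_eq]
      constructor
      · intro h
        refine ⟨-k, ?_, neg_neg k⟩
        rw [vec_neg] at h ⊢
        rw [sub_neg_eq_add] at h ⊢
        rwa [add_comm]
      · rintro ⟨k, h, rfl⟩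
        rwa [vec_sub_neg_neg]
    rw [this, Set.ncard_image_of_injective _ neg_injective]
  have hDU : ∀ i, (D (-i)).ncard = (U i).ncard := fun i => by rw [← hUD, neg_neg]
  have trans : ∀ {i j k : I}, vec j - vec i ∈ P → vec k - vec j ∈ P → vec k - vec i ∈ P := by
    intro i j k h1 h2
    have e : vec k - vec i = (vec j - vec i) + (vec k - vec j) := by abel
    rw [e]
    refine hP.closed _ h1 _ h2 (e ▸ sub_mem_roots ?_)
    rintro rfl
    refine hP.special _ h1 ?_
    rwa [neg_sub]
  have h0 : (0 : I → ℤ) ∉ P := zero_notMem hne hP.toIsSaturated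
  set ω : I → ℤ := fun i => (D i).ncard - (U i).ncard with hω'
  have hω : IsOdd ω := fun i => by
    simp only [hω', hUD, hDU]; ring
  have hlt : ∀ {i j}, vec j - vec i ∈ P → ω i < ω j := by
    intro i j h
    have h1 : (D i).ncard < (D j).ncard := by
      refine Set.ncard_lt_ncard ⟨fun k hk => trans hk h, fun hs => ?_⟩ (Set.toFinite _)
      have : i ∈ D i := hs h
      simp only [hD, Set.mem_ofPred_eq, sub_self] at this
      exact h0 this
    have h2 : (U j).ncard ≤ (U i).ncard :=
      Set.ncard_le_ncard (fun k hk => trans h hk) (Set.toFinite _)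
    simp only [hω']
    omega
  have key : ∀ i j, vec i + vec j ∈ P → 0 < ht ω (vec i + vec j) := by
    intro i j h
    have e : vec i + vec j = vec j - vec (-i) := by rw [vec_neg]; abel
    rw [e] at h ⊢
    rw [ht_sub, ht_vec hω, ht_vec hω]
    have := hlt h
    omega
  refine ⟨ω, hω, fun α hα => ⟨hP.subset hα, ?_⟩⟩
  rcases hP.subset hα with ⟨i, rfl⟩ | ⟨i, j, _, rfl⟩
  · have := key i i (hP.toIsSaturated.double_mem hne i hα)
    rw [ht_add] at this
    omega
  · exact key i j hα

theorem finite_roots : (roots I).Finite := by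
  have h1 : (Set.range (vec : I → I → ℤ)).Finite := Set.finite_range _
  have h2 : (Set.range fun p : I × I => vec p.1 + vec p.2).Finite := Set.finite_range _
  refine (h1.union h2).subset ?_
  rintro _ (⟨i, rfl⟩ | ⟨i, j, _, rfl⟩)
  · exact Or.inl ⟨i, rfl⟩
  · exact Or.inr ⟨(i, j), rfl⟩

theorem Anti.nsmul {I : Type*} {α β : I → ℤ} (h : Anti α β) {n : ℕ} (hn : 0 < n) :
    Anti (n • α) β := by
  obtain ⟨m, k, hm, hk, e⟩ := h
  refine ⟨m, n * k, hm, by positivity, ?_⟩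
  have := congrArg (n • ·) e
  simpa only [smul_add, smul_zero, ← mul_smul, mul_comm n m] using this

theorem Anti.add {I : Type*} {α α' β : I → ℤ} (h : Anti α β) (h' : Anti α' β) :
    Anti (α + α') β := by
  obtain ⟨m, k, hm, hk, e⟩ := h
  obtain ⟨m', k', hm', hk', e'⟩ := h'
  refine ⟨m * m', m' * k + m * k', by positivity, by positivity, ?_⟩
  have h1 := congrArg (m' • ·) e
  have h2 := congrArg (m • ·) e'
  simp only [smul_add, smul_zero, ← mul_smul] at h1 h2
  rw [smul_add, add_smul, mul_comm m m']
  calc _ = ((m' * m) • α + (m' * k) • β) + ((m * m') • α' + (m * k') • β) := by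
        rw [mul_comm m m']; abel
    _ = 0 := by rw [h1, h2, add_zero]

/-- Removing from a closed set of positive roots a root `α` that is not antiparallel to `β`, and has
the minimal height among such roots, leaves a set that is stable under the addition of roots from
the initial set. -/
theorem cone_subset_of_minimal {T : Set (I → ℤ)} (hT : T ⊆ posRoots ω)
    (hcl : ∀ σ ∈ T, ∀ τ ∈ T, cone σ τ ⊆ T) {α β : I → ℤ}
    (hmin : ∀ σ ∈ T, ¬Anti σ β → ht ω α ≤ ht ω σ) (hα : ¬Anti α β) {σ τ : I → ℤ} (hσ : σ ∈ T)
    (hτ : τ ∈ T) (hτα : τ ≠ α) : cone σ τ ⊆ T \ {α} := by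
  refine fun γ hγ => ⟨hcl σ hσ τ hτ hγ, ?_⟩
  rintro rfl
  obtain ⟨_, m, n, hn, e⟩ := hγ
  have h1 := (hT hσ).2
  have h2 := (hT hτ).2
  have h3 : ht ω γ = m * ht ω σ + n * ht ω τ := by rw [e, ht_add, ht_nsmul, ht_nsmul]
  have hn' : (1 : ℤ) ≤ n := by exact_mod_cast hn
  -- if `α = m σ + n τ`, then `σ` or `τ` is not antiparallel to `β`, and its height is smaller
  rcases Nat.eq_zero_or_pos m with rfl | hm
  · rw [zero_smul, zero_add] at e
    have h4 : ¬Anti τ β := fun h => hα (e ▸ h.nsmul hn)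
    have h5 := hmin τ hτ h4
    have h6 : n ≠ 1 := by
      rintro rfl
      rw [one_smul] at e
      exact hτα e.symm
    have hn2 : (2 : ℤ) ≤ n := by exact_mod_cast (by omega : 2 ≤ n)
    push_cast at h3
    nlinarith
  · have hm' : (1 : ℤ) ≤ m := by exact_mod_cast hm
    by_cases h4 : Anti σ β
    · by_cases h5 : Anti τ β
      · exact hα (e ▸ (h4.nsmul hm).add (h5.nsmul hn))
      · have := hmin τ hτ h5
        nlinarith
    · have := hmin σ hσ h4
      nlinarith

end Weights

/-! ### Generation by pairs of antiparallel roots -/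

section Descent

variable {R Δ S Θ : Type*} [NonUnitalRing R] [StarRing R] [AddGroup Δ] [OddFormRing R Δ]
  [NonUnitalRing S] [StarRing S] [AddGroup Θ] [OddFormRing S Θ]
variable {B Γ : Type*} [NonUnitalRing B] [StarRing B] [AddGroup Γ] [OddFormRing B Γ]
variable {I : Type} [InvolutiveNeg I] [Finite I]
  {A : ActionData R Δ S Θ} {M : CrossedModule R Δ S Θ} {H : Family R Δ I} {ω : I → ℤ}
variable (hH : H.IsHyp)

include hH in
/-- The conjugate of an element with roots in `Z` by an element with roots in `P`, if `Z` is stable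
under adding roots from `P`. -/
theorem conj_mem (E : FullAmbient A B Γ) (hω : IsOdd ω) {P Z : Set (I → ℤ)} (hP : P ⊆ posRoots ω)
    (hZ : Z ⊆ posRoots ω) (h : ∀ α ∈ P, ∀ β ∈ Z, cone α β ⊆ Z) {x y : StU (selfAction R Δ) H}
    (hx : x ∈ stSub (selfAction R Δ) H P) (hy : y ∈ stSub (selfAction R Δ) H Z) :
    x * y * x⁻¹ ∈ stSub (selfAction R Δ) H Z := by
  obtain ⟨w, hw, e⟩ := exists_extend E.self hH
    (fun α hα β hβ => ⟨not_anti_of_ht (hP hα).2.le (hZ hβ).2, h α hα β hβ⟩)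
    (p := fun x y w => E.self.st hH w = E.self.st hH x * E.self.st hH y * (E.self.st hH x)⁻¹)
    (fun y => by simp)
    (fun x _ x' _ y w w' h1 h2 => by rw [h2, h1, map_mul]; group)
    (fun x _ => by simp)
    (fun x _ y y' w w' h1 h2 => by rw [map_mul, map_mul, h1, h2]; group)
    (fun α _ x y w α₀ β₀ _ hc => hc.st_eq E.self hH) hx hy
  have hx' := stSub_mono hP hx
  have hy' := stSub_mono hZ hy
  obtain rfl : x * y * x⁻¹ = w := st_injOn E.self.toAmbient hH hω
    (mul_mem (mul_mem hx' hy') (inv_mem hx')) (stSub_mono hZ hw)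
    (by rw [e, map_mul, map_mul, map_inv])
  exact hw

variable (E : FullAmbient M.action B Γ)

include E hH in
/-- If `T \ {α}` is stable under adding roots from `T`, then it generates a normal subgroup, whose
product with the root subgroup of `α` is the whole group. -/
theorem stSub_decomp (hω : IsOdd ω) {T : Set (I → ℤ)} (hT : T ⊆ posRoots ω) {α : I → ℤ}
    (hα : α ∈ T) (h : ∀ σ ∈ T, ∀ τ ∈ T \ {α}, cone σ τ ⊆ T \ {α}) {g : StU (selfAction R Δ) H}
    (hg : g ∈ stSub (selfAction R Δ) H T) :
    ∃ g' ∈ stSub (selfAction R Δ) H (T \ {α}), ∃ x ∈ stSub (selfAction R Δ) H {α}, g = g' * x := by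
  refine stSub_induction E.self.toAmbient hH (p := fun g =>
    ∃ g' ∈ stSub (selfAction R Δ) H (T \ {α}), ∃ x ∈ stSub (selfAction R Δ) H {α}, g = g' * x)
    ?_ ?_ hg
  · exact ⟨1, one_mem _, 1, one_mem _, (one_mul 1).symm⟩
  · rintro σ hσ z hz _ _ ⟨g', hg', x, hx, rfl⟩
    by_cases hσα : σ = α
    · subst hσα
      have hz' : z ∈ stSub (selfAction R Δ) H {σ} := mem_stSub hz rfl
      refine ⟨z * g' * z⁻¹, conj_mem hH E hω (Set.singleton_subset_iff.2 (hT hα))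
        (Set.sdiff_subset.trans hT) ?_ hz' hg', z * x, mul_mem hz' hx, by group⟩
      rintro _ rfl τ hτ
      exact h _ hσ τ hτ
    · exact ⟨z * g', mul_mem (mem_stSub hz ⟨hσ, hσα⟩) hg', x, hx, (mul_assoc _ _ _).symm⟩

include E hH in
/-- The universal group is generated by the elements `ᵍ{y}` for root elements `y`, where `g` is a
product of root elements with roots antiparallel to the root of `y`: all other factors of `g` can be
eliminated by means of the Chevalley relations, starting from those of the smallest height. -/
theorem brk_mem_of_anti (hω : IsOdd ω) {K : Subgroup (StUbar M H)}
    (h : ∀ β, ∀ y ∈ redRootSet M.action H β, ∀ g : stSub (selfAction R Δ) H (posRoots ω),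
      g.1 ∈ stSub (selfAction R Δ) H {α ∈ posRoots ω | Anti α β} →
      brk (isSatSpecial_posRoots ω) g y ∈ K)
    (g : stSub (selfAction R Δ) H (posRoots ω)) (y : StU M.action H) :
    brk (isSatSpecial_posRoots ω) g y ∈ K := by
  suffices key : ∀ n : ℕ, ∀ T : Set (I → ℤ), T ⊆ posRoots ω → (∀ σ ∈ T, ∀ τ ∈ T, cone σ τ ⊆ T) →
      T.ncard ≤ n → ∀ g : stSub (selfAction R Δ) H (posRoots ω), g.1 ∈ stSub (selfAction R Δ) H T →
      ∀ y : StU M.action H, brk (isSatSpecial_posRoots ω) g y ∈ K from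
    key _ _ le_rfl (fun σ hσ τ hτ => cone_subset_posRoots hσ.2.le hτ.2) le_rfl g g.2 y
  intro n
  induction n with
  | zero =>
    intro T hT hcl hcard g hg y
    have hT0 : T = ∅ := by
      rw [Nat.le_zero, Set.ncard_eq_zero (finite_roots.subset fun _ hα => (hT hα).1)] at hcard
      exact hcard
    subst hT0
    have hg' : ∀ β : I → ℤ, g.1 ∈ stSub (selfAction R Δ) H {α ∈ posRoots ω | Anti α β} :=
      fun β => stSub_mono (Set.empty_subset _) hg
    refine StU.induction E.toAmbient hH (P := fun y => brk (isSatSpecial_posRoots ω) g y ∈ K)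
      y ?_ ?_ ?_
    · rw [map_one]; exact one_mem _
    · intro i j a y h1 h2 ha hy
      rw [map_mul]
      exact mul_mem (h _ _ (Or.inl ⟨i, j, a, h1, h2, ha, rfl, rfl⟩) _ (hg' _)) hy
    · intro j u y hu hy
      rw [map_mul]
      exact mul_mem (h _ _ (Or.inr ⟨j, u, hu, rfl, rfl⟩) _ (hg' _)) hy
  | succ n ih =>
    intro T hT hcl hcard g hg y
    have hfin : T.Finite := finite_roots.subset fun _ hα => (hT hα).1
    have hroot : ∀ β, ∀ y ∈ redRootSet M.action H β, brk (isSatSpecial_posRoots ω) g y ∈ K := by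
      intro β y hy
      by_cases hex : ∃ α ∈ T, ¬Anti α β
      · obtain ⟨α, ⟨hα, hαβ⟩, hmin⟩ := Set.exists_min_image {α ∈ T | ¬Anti α β} (ht ω)
          (hfin.subset fun _ h => h.1) hex
        have hcone : ∀ σ ∈ T, ∀ τ ∈ T \ {α}, cone σ τ ⊆ T \ {α} := fun σ hσ τ hτ =>
          cone_subset_of_minimal hT hcl (fun σ hσ h => hmin σ ⟨hσ, h⟩) hαβ hσ hτ.1 hτ.2
        obtain ⟨g', hg', x, hx, e⟩ := stSub_decomp hH E hω hT hα hcone hg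
        have hβ := mem_roots_of_mem_rootSet hH (redRootSet_subset hy)
        obtain ⟨w, _, _, hw⟩ := exists_brk_conj E hH (isSatSpecial_posRoots ω)
          (Q := {α}) (Z := cone α β) (Set.singleton_subset_iff.2 (hT hα))
          (by
            rintro _ rfl γ hγ
            exact ⟨not_anti_of_mem_cone hαβ hγ, cone_cone hγ⟩) hx
          (mem_stSub (redRootSet_subset hy) (right_mem_cone hβ))
        rw [hw ⟨g', stSub_mono (Set.sdiff_subset.trans hT) hg'⟩ g e]
        refine ih (T \ {α}) (Set.sdiff_subset.trans hT) (fun σ hσ τ hτ => hcone σ hσ.1 τ hτ) ?_ _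
          hg' w
        have := Set.ncard_sdiff_singleton_lt_of_mem hα hfin
        omega
      · push Not at hex
        refine h β y hy g (stSub_mono ?_ hg)
        exact fun α hα => ⟨hT hα, hex α hα⟩
    refine StU.induction E.toAmbient hH (P := fun y => brk (isSatSpecial_posRoots ω) g y ∈ K)
      y ?_ ?_ ?_
    · rw [map_one]; exact one_mem _
    · intro i j a y h1 h2 ha hy
      rw [map_mul]
      exact mul_mem (hroot _ _ (Or.inl ⟨i, j, a, h1, h2, ha, rfl, rfl⟩)) hy
    · intro j u y hu hy
      rw [map_mul]
      exact mul_mem (hroot _ _ (Or.inr ⟨j, u, hu, rfl, rfl⟩)) hy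

end Descent

/-! ### Root elements coming from the quotient -/

section Range

variable {R Δ S Θ : Type*} [NonUnitalRing R] [StarRing R] [AddGroup Δ] [OddFormRing R Δ]
  [NonUnitalRing S] [StarRing S] [AddGroup Θ] [OddFormRing S Θ]
variable {B Γ : Type*} [NonUnitalRing B] [StarRing B] [AddGroup Γ] [OddFormRing B Γ]
variable {A : ActionData R Δ S Θ} (E : FullAmbient A B Γ)
variable {I J : Type*} [InvolutiveNeg I] [InvolutiveNeg J] [Finite I] [Finite J] {H : Family R Δ I}
variable {c : I → Option J} {α : I → ℤ} {i j : I} {F G : J} {a : S}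
variable (hH : H.IsHyp)

/-- A root element for the quotient family and one for the original family correspond to each other
under the canonical homomorphism if their images in the unitary group coincide. -/
theorem eq_elimHom_of_st (E : Ambient A B Γ) (hc : IsLabel c) (hα : α ∈ roots I)
    (h : proj c α ≠ 0) {x : StU A H} (hx : x ∈ rootSet A H α) {x' : StU A (H.push c)}
    (hx' : x' ∈ rootSet A (H.push c) (proj c α))
    (e : E.st (push_isHyp hH hc) x' = E.st hH x) : elimHom E hH hc x' = x := by
  have hβ : proj c α ∈ roots J := (proj_mem_roots hc hα).resolve_right h
  have hω := isOdd_of_mem_roots hβ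
  have hpos := ht_self_pos hc.neg_ne hβ
  refine st_injOn E hH (hc.isOdd_pull hω)
    (stSub_mono (pre_subset_posRoots hω hc ?_) (elimHom_rootSet E hH hc hx'))
    (mem_stSub hx ⟨hα, by rwa [ht_proj hω hc hα]⟩) (by rw [st_elimHom, e])
  rintro _ (rfl | rfl)
  · exact hpos
  · rw [ht_add]; omega

/-- A short root element with only one index in the classes. -/
theorem exists_elimHom_eq_none (hc : IsLabel c) (h1 : i ≠ j) (h2 : i ≠ -j) (ha : a ∈ Sij A H i j)
    (hi : c i = none) (hj : c j = some G) :
    ∃ x' ∈ rootSet A (H.push c) (proj c (vec j - vec i)),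
      elimHom E.toAmbient hH hc x' = X A H i j a := by
  have hN := E.fam_isHyp hH
  have hH' := push_isHyp hH hc
  have hm := E.isMat hH ha
  have hp : proj c (vec j - vec i) = vec G := by
    rw [proj_sub, proj_vec hc, proj_vec hc, hi, hj]
    exact sub_zero _
  have et : E.t (A.actS (H.q i) a) = act ((E.fam H).q i) (E.s a) := E.t_actS _ _
  have hu : A.actS (H.q i) a ∈ Theta0 A (H.push c) G := by
    rw [E.mem_Theta0 hH', et, fam_push]
    refine ⟨act_e_push hN hj ?_, fun F => ?_⟩
    · rw [← act_mul, hm.2]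
    · rw [pi_act, hN.pi_q, hm.1, ← hm.1, ← mul_assoc, e_push_mul_zero hN (by simp [hi]), zero_mul]
  have hx' : Y A (H.push c) G (A.actS (H.q i) a) ∈ rootSet A (H.push c) (proj c (vec j - vec i)) :=
    Or.inl (Or.inr ⟨G, _, hu, hp, rfl⟩)
  refine ⟨_, hx', eq_elimHom_of_st hH E.toAmbient hc (sub_mem_roots h1) ?_
    (Or.inl (Or.inl ⟨i, j, a, h1, h2, ha, rfl, rfl⟩)) hx' ?_⟩
  · rw [hp]; exact vec_ne_zero hc.neg_ne G
  · rw [E.st_Y hH' hu, E.st_X hH h1 h2 ha, et, fam_push, gX]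
    exact gY_push hN hc hj (by rw [← act_mul, hm.2])

/-- Root elements, whose roots do not vanish in the quotient, come from the quotient. -/
theorem exists_elimHom_eq (hc : IsLabel c) {x : StU A H} (hx : x ∈ rootSet A H α)
    (h : proj c α ≠ 0) :
    ∃ x' ∈ rootSet A (H.push c) (proj c α), elimHom E.toAmbient hH hc x' = x := by
  have hN := E.fam_isHyp hH
  have hH' := push_isHyp hH hc
  have hx0 := hx
  rcases hx with (⟨i, j, a, h1, h2, ha, rfl, rfl⟩ | ⟨j, u, hu, rfl, rfl⟩) | ⟨j, a, ha, rfl, rfl⟩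
  · have hm := E.isMat hH ha
    rcases hi : c i with _ | F <;> rcases hj : c j with _ | G
    · rw [proj_sub, proj_vec hc, proj_vec hc, hi, hj, sub_self] at h
      exact absurd rfl h
    · exact exists_elimHom_eq_none E hH hc h1 h2 ha hi hj
    · rw [X_sym h1 h2 ha, ← vec_sub_neg_neg i j]
      exact exists_elimHom_eq_none E hH hc (neg_ne_neg' h1.symm)
        (by rw [neg_neg]; exact ne_neg (ne_neg' h2)) (E.Sij_star hH ha) (hc.neg_none hj)
        (hc.neg_some hi)
    · have hp : proj c (vec j - vec i) = vec G - vec F := by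
        rw [proj_sub, proj_vec hc, proj_vec hc, hi, hj]; rfl
      have hFG : F ≠ G := by
        rintro rfl
        rw [hp, sub_self] at h
        exact h rfl
      by_cases hFG' : F = -G
      · have ha' : a ∈ Sij A (H.push c) (-G) G := by
          rw [E.mem_Sij hH', fam_push]
          refine ⟨?_, ?_⟩
          · rw [← hm.1, ← mul_assoc, e_push_mul hN (by rw [hi, hFG'])]
          · rw [← hm.2, mul_assoc, mul_e_push hN hj]
        have hx' : Y A (H.push c) G (phi a) ∈ rootSet A (H.push c) (proj c (vec j - vec i)) :=
          Or.inr ⟨G, a, ha', by rw [hp, hFG', vec_neg]; abel, rfl⟩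
        refine ⟨_, hx', eq_elimHom_of_st hH E.toAmbient hc (sub_mem_roots h1) h hx0 hx' ?_⟩
        rw [E.st_Y hH' (E.Theta0_phi hH' ha'), E.st_X hH h1 h2 ha, E.t_phi, fam_push]
        have h3 : c (-i) = some G := by rw [hc.neg_some hi, hFG', neg_neg]
        rw [gY_push_phi hN hc h3 hj (by rwa [neg_neg]), neg_neg]
      · have ha' : a ∈ Sij A (H.push c) F G := by
          rw [E.mem_Sij hH', fam_push]
          refine ⟨?_, ?_⟩
          · rw [← hm.1, ← mul_assoc, e_push_mul hN hi]
          · rw [← hm.2, mul_assoc, mul_e_push hN hj]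
        have hx' : X A (H.push c) F G a ∈ rootSet A (H.push c) (proj c (vec j - vec i)) :=
          Or.inl (Or.inl ⟨F, G, a, hFG, hFG', ha', hp, rfl⟩)
        refine ⟨_, hx', eq_elimHom_of_st hH E.toAmbient hc (sub_mem_roots h1) h hx0 hx' ?_⟩
        rw [E.st_X hH' hFG hFG' ha', E.st_X hH h1 h2 ha, fam_push, gX, gX, q_push_act_of hN hi hm.1]
        exact gY_push hN hc hj (by rw [← act_mul, hm.2])
  · rcases hj : c j with _ | G
    · rw [proj_vec hc, hj] at h
      exact absurd rfl h
    have hp : proj c (vec j) = vec G := by rw [proj_vec hc, hj]; rfl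
    have hu' : u ∈ Theta0 A (H.push c) G := by
      rw [E.mem_Theta0 hH', fam_push]
      exact ⟨act_e_push hN hj (E.isIso hH hu).1,
        fun F => e_push_mul_eq_zero fun i _ => E.e_pi hH hu i⟩
    have hx' : Y A (H.push c) G u ∈ rootSet A (H.push c) (proj c (vec j)) :=
      Or.inl (Or.inr ⟨G, u, hu', hp, rfl⟩)
    refine ⟨_, hx', eq_elimHom_of_st hH E.toAmbient hc (vec_mem_roots j) h hx0 hx' ?_⟩
    rw [E.st_Y hH' hu', E.st_Y hH hu, fam_push]
    exact gY_push hN hc hj (E.isIso hH hu).1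
  · rcases hj : c j with _ | G
    · rw [proj_add, proj_vec hc, hj] at h
      exact absurd (add_zero _) h
    have hp : proj c (vec j + vec j) = vec G + vec G := by rw [proj_add, proj_vec hc, hj]; rfl
    have hm := E.isMat hH ha
    have hu := E.Theta0_phi hH ha
    have ha' : a ∈ Sij A (H.push c) (-G) G := by
      rw [E.mem_Sij hH', fam_push]
      refine ⟨?_, ?_⟩
      · rw [← hm.1, ← mul_assoc, e_push_mul hN (hc.neg_some hj)]
      · rw [← hm.2, mul_assoc, mul_e_push hN hj]
    have hx' : Y A (H.push c) G (phi a) ∈ rootSet A (H.push c) (proj c (vec j + vec j)) :=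
      Or.inr ⟨G, a, ha', hp, rfl⟩
    refine ⟨_, hx', eq_elimHom_of_st hH E.toAmbient hc (add_mem_roots (hH.neg_ne j).symm) h hx0
      hx' ?_⟩
    rw [E.st_Y hH' (E.Theta0_phi hH' ha'), E.st_Y hH hu, fam_push]
    exact gY_push hN hc hj (E.isIso hH hu).1

/-- Products of root elements, whose roots are mapped to `Q`, come from the quotient. -/
theorem exists_elimHom_eq_of_stSub (hc : IsLabel c) {Q : Set (J → ℤ)} (hQ : 0 ∉ Q) {x : StU A H}
    (hx : x ∈ stSub A H (pre c Q)) :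
    ∃ x' ∈ stSub A (H.push c) Q, elimHom E.toAmbient hH hc x' = x := by
  refine stSub_induction E.toAmbient hH
    (p := fun x => ∃ x' ∈ stSub A (H.push c) Q, elimHom E.toAmbient hH hc x' = x) ?_ ?_ hx
  · exact ⟨1, one_mem _, map_one _⟩
  · rintro α hα x hx _ _ ⟨y', hy', rfl⟩
    obtain ⟨x', hx', rfl⟩ := exists_elimHom_eq E hH hc hx (fun h => hQ (h ▸ hα.2))
    exact ⟨x' * y', mul_mem (mem_stSub hx' hα.2) hy', map_mul _ _ _⟩

end Range

/-! ### A criterion of surjectivity -/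

section Surjectivity

variable {R Δ S Θ : Type*} [NonUnitalRing R] [StarRing R] [AddGroup Δ] [OddFormRing R Δ]
  [NonUnitalRing S] [StarRing S] [AddGroup Θ] [OddFormRing S Θ]
variable {B Γ : Type*} [NonUnitalRing B] [StarRing B] [AddGroup Γ] [OddFormRing B Γ]
variable {I J : Type} [InvolutiveNeg I] [Finite I] [InvolutiveNeg J] [Finite J]
  {M : CrossedModule R Δ S Θ} {H : Family R Δ I} {c : I → Option J} {P : Set (I → ℤ)} {β : I → ℤ}
variable (E : FullAmbient M.action B Γ) (hH : H.IsHyp)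

/-- Roots that do not vanish in the quotient. -/
def offRoots (c : I → Option J) : Set (I → ℤ) := {γ | γ ∈ roots I ∧ proj c γ ≠ 0}

theorem proj_nsmul (n : ℕ) (v : I → ℤ) : proj c (n • v) = n • proj c v := by
  induction n with
  | zero => ext; simp [proj]
  | succ n ih => rw [succ_nsmul, succ_nsmul, proj_add, ih]

/-- The elements `ᵍ{y}` come from the quotient if no root of `g` or of `y` vanishes there, and the
roots of `g` have their images in a special set. -/
theorem brk_mem_range (hc : IsLabel c) (hP : IsSatSpecial P) {Q : Set (J → ℤ)}
    (hQ : IsSatSpecial Q) {g : stSub (selfAction R Δ) H P}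
    (hg : g.1 ∈ stSub (selfAction R Δ) H (P ∩ pre c Q)) {y : StU M.action H}
    (hy : y ∈ stSub M.action H (offRoots c)) : brk hP g y ∈ (elimBar E hH hc).range := by
  obtain ⟨y', _, rfl⟩ := exists_elimHom_eq_of_stSub (Q := {δ : J → ℤ | δ ≠ 0}) E hH hc
    (fun h => h rfl) hy
  obtain ⟨x', hx', e⟩ := exists_elimHom_eq_of_stSub E.self hH hc
    (zero_notMem hc.neg_ne hQ.toIsSaturated) (stSub_mono Set.inter_subset_right hg)
  refine ⟨brk hQ ⟨x', hx'⟩ y', ?_⟩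
  have hQ' := isSatSpecial_pre hc hQ
  rw [elimBar_brk, ← brk_sub hP (hP.inter hQ') Set.inter_subset_left (g' := ⟨g.1, hg⟩) rfl,
    ← brk_sub hQ' (hP.inter hQ') Set.inter_subset_right (g' := ⟨g.1, hg⟩)
      (e.symm.trans (coe_elimSub E hH hc hQ ⟨x', hx'⟩).symm)]

theorem proj_eq_zero_of_anti {α : I → ℤ} (h : Anti α β) (hβ : proj c β = 0) : proj c α = 0 := by
  obtain ⟨m, n, hm, _, e⟩ := h
  have h0 : proj c (0 : I → ℤ) = 0 := by ext; simp [proj]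
  have := congrArg (proj c) e
  rw [proj_add, proj_nsmul, proj_nsmul, hβ, smul_zero, add_zero, h0] at this
  exact (smul_eq_zero.1 this).resolve_left hm.ne'

theorem ht_comm (v w : I → ℤ) : ht v w = ht w v := finsum_congr fun _ => mul_comm _ _

variable {x : stSub (selfAction R Δ) H P} {y : StU (selfAction R Δ) H} {z w : StU M.action H}

/-- Adding roots that vanish in the quotient preserves the set of roots that do not. -/
theorem off_stable {α γ : I → ℤ} (hα : proj c α = 0) (hγ : γ ∈ offRoots c) :
    ¬Anti α γ ∧ cone α γ ⊆ offRoots c := by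
  refine ⟨?_, ?_⟩
  · rintro ⟨m, n, hm, hn, e⟩
    exact hγ.2 (proj_eq_zero_of_anti ⟨n, m, hn, hm, by rw [← e, add_comm]⟩ hα)
  · rintro _ ⟨hr, m, n, hn, rfl⟩
    refine ⟨hr, ?_⟩
    rw [proj_add, proj_nsmul, proj_nsmul, hα, smul_zero, zero_add]
    exact smul_ne_zero hn.ne' hγ.2

/-- If the roots of `x` vanish in the quotient, then `ˣ{z}` for `z` with roots that do not vanish
in the quotient is `¹{w}` for `w = ˣz` with such roots again. -/
theorem brk_mem_range_of_off (hc : IsLabel c) (hP : IsSatSpecial P) (hβ : proj c β = 0)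
    (hx : x.1 ∈ stSub (selfAction R Δ) H (P ∩ {α | Anti α β}))
    (hz : z ∈ stSub M.action H (offRoots c)) : brk hP x z ∈ (elimBar E hH hc).range := by
  obtain ⟨w, hw, _, e⟩ := exists_brk_conj E hH hP (Z := offRoots c) Set.inter_subset_left
    (fun α hα γ hγ => off_stable (proj_eq_zero_of_anti hα.2 hβ) hγ) hx hz
  rw [e 1 x (one_mul _).symm]
  exact brk_mem_range E hH hc hP (isSatSpecial_posRoots 0) (one_mem _) hw

/-- Let `w = ʸz` be given by a commutator formula for roots that do not vanish in the quotient. If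
the roots of `x` vanish in the quotient, then `ˣ{w} = ˣʸ{z} = ᵘˣ{z}` with `u = ˣy`, so
`ˣ{w} = ᵘ{ˣz}` comes from the quotient. -/
theorem brk_mem_range_of_chev (hc : IsLabel c) (hP : IsSatSpecial P) (hβr : β ∈ roots I)
    (hβ : proj c β = 0) (hx : x.1 ∈ stSub (selfAction R Δ) H (P ∩ {α | Anti α β}))
    {γ δ : I → ℤ} (h : Chev M.action H γ δ y z w) (hγ : proj c γ ≠ 0) (hδ : proj c δ ≠ 0) :
    brk hP x w ∈ (elimBar E hH hc).range := by
  have hγr := mem_roots_of_mem_rootSet hH h.left_mem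
  have hδr := mem_roots_of_mem_rootSet hH h.right_mem
  have hγ' : proj c γ ∈ roots J := (proj_mem_roots hc hγr).resolve_right hγ
  have hω' := isOdd_of_mem_roots hγ'
  have hpos := ht_self_pos hc.neg_ne hγ'
  -- a weight that is positive on `γ` and on the roots antiparallel to `β`
  set N : ℕ := (ht β γ).natAbs + 1 with hN
  set ω : I → ℤ := N • pull c (proj c γ) - β with hω_def
  have hht : ∀ α ∈ roots I, ht ω α = N * ht (proj c γ) (proj c α) - ht β α := fun α hα => by
    rw [ht_comm, hω_def, ht_sub, ht_nsmul, ht_comm α, ht_comm α, ht_proj hω' hc hα]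
  have hω : IsOdd ω := by
    intro i
    have h1 := isOdd_of_mem_roots hβr i
    have h2 := hc.isOdd_pull hω' i
    simp only [hω_def, Pi.sub_apply, Pi.smul_apply, h1, h2]
    rw [smul_neg]; ring
  have hγω : γ ∈ posRoots ω := by
    refine ⟨hγr, ?_⟩
    rw [hht γ hγr]
    have h1 : ht β γ ≤ (ht β γ).natAbs := Int.le_natAbs
    have h2 : (N : ℤ) = (ht β γ).natAbs + 1 := by rw [hN]; push_cast; rfl
    nlinarith
  have hanti : P ∩ {α | Anti α β} ⊆ posRoots ω ∩ {α | Anti α β} := by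
    rintro α ⟨hα, hα'⟩
    refine ⟨⟨hP.subset hα, ?_⟩, hα'⟩
    rw [hht α (hP.subset hα), proj_eq_zero_of_anti hα' hβ, ht_zero]
    obtain ⟨m, n, hm, hn, e⟩ := hα'
    have h1 := congrArg (ht β) e
    rw [ht_add, ht_nsmul, ht_nsmul, ht_zero] at h1
    have h2 := ht_self_pos hH.neg_ne hβr
    have h3 : (0 : ℤ) < m := by exact_mod_cast hm
    have h4 : (0 : ℤ) < n := by exact_mod_cast hn
    by_contra h5
    have h6 : 0 ≤ ht β α := by linarith
    nlinarith [mul_nonneg h3.le h6, mul_pos h4 h2]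
  have hP₁ := isSatSpecial_posRoots ω
  have hx₁ := stSub_mono hanti hx
  have hxP : x.1 ∈ stSub (selfAction R Δ) H (posRoots ω) := stSub_mono Set.inter_subset_left hx₁
  have hyP : y ∈ stSub (selfAction R Δ) H (posRoots ω) := mem_stSub h.left_mem hγω
  have hxx : x.1 ∈ stSub (selfAction R Δ) H (P ∩ posRoots ω) := by
    refine stSub_mono ?_ hx
    exact fun α hα => ⟨hα.1, (hanti hα).1⟩
  rw [← brk_sub hP (hP.inter hP₁) Set.inter_subset_left (g' := ⟨x.1, hxx⟩) rfl,
    brk_sub hP₁ (hP.inter hP₁) Set.inter_subset_right (g := ⟨x.1, hxP⟩) rfl,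
    ← brk_chev hP₁ (g' := ⟨x.1 * y, mul_mem hxP hyP⟩) rfl hγω h.chevRel]
  -- the element `u = ˣy` has only roots whose images are positive multiples of that of `γ`
  set Z : Set (I → ℤ) := {τ | τ ∈ posRoots ω ∧ ∃ k : ℕ, 0 < k ∧ proj c τ = k • proj c γ} with hZ
  have hu : x.1 * y * x.1⁻¹ ∈ stSub (selfAction R Δ) H Z := by
    refine conj_mem hH E hω Set.inter_subset_left (fun τ hτ => hτ.1) ?_ hx₁
      (mem_stSub h.left_mem ⟨hγω, 1, one_pos, (one_smul _ _).symm⟩)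
    intro α hα τ hτ σ hσ
    refine ⟨cone_subset_posRoots hα.1.2.le hτ.1.2 hσ, ?_⟩
    obtain ⟨_, m, n, hn, rfl⟩ := hσ
    obtain ⟨_, k, hk, e⟩ := hτ
    refine ⟨n * k, by positivity, ?_⟩
    rw [proj_add, proj_nsmul, proj_nsmul, proj_eq_zero_of_anti hα.2 hβ, e, smul_zero, zero_add,
      mul_smul]
  have huP := stSub_mono (fun τ (hτ : τ ∈ Z) => hτ.1) hu
  obtain ⟨w', hw', _, e⟩ := exists_brk_conj E hH hP₁ (Z := offRoots c) Set.inter_subset_left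
    (fun α hα γ hγ => off_stable (proj_eq_zero_of_anti hα.2 hβ) hγ) hx₁
    (mem_stSub h.right_mem ⟨hδr, hδ⟩)
  rw [e ⟨_, huP⟩ ⟨x.1 * y, mul_mem hxP hyP⟩ (by simp)]
  refine brk_mem_range E hH hc hP₁ (isSatSpecial_posRoots (proj c γ)) (stSub_mono ?_ hu) hw'
  rintro τ ⟨hτ, k, hk, e⟩
  have h1 : 0 < ht (proj c γ) (proj c τ) := by
    rw [e, ht_nsmul]
    positivity
  refine ⟨hτ, hτ.1, (proj_mem_roots hc hτ.1).resolve_right fun h => ?_, h1⟩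
  rw [h, ht_zero] at h1
  exact h1.false

/-- The subgroup generated by the root elements whose roots do not vanish in the quotient and by the
right hand sides of the commutator formulas for such roots. -/
def offSub (M : CrossedModule R Δ S Θ) (H : Family R Δ I) (c : I → Option J) :
    Subgroup (StU M.action H) :=
  stSub M.action H (offRoots c) ⊔ Subgroup.closure {w | ∃ γ δ y z, Chev M.action H γ δ y z w ∧
    proj c γ ≠ 0 ∧ proj c δ ≠ 0}

theorem brk_mem_range_of_offSub (hc : IsLabel c) (hP : IsSatSpecial P) (hβr : β ∈ roots I)
    (hβ : proj c β = 0) (hx : x.1 ∈ stSub (selfAction R Δ) H (P ∩ {α | Anti α β}))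
    (hz : z ∈ offSub M H c) : brk hP x z ∈ (elimBar E hH hc).range := by
  suffices offSub M H c ≤ (elimBar E hH hc).range.comap (brk hP x) from this hz
  refine sup_le (fun z hz => brk_mem_range_of_off E hH hc hP hβ hx hz)
    ((Subgroup.closure_le _).2 ?_)
  rintro w ⟨γ, δ, y, z, h, hγ, hδ⟩
  exact brk_mem_range_of_chev E hH hc hP hβr hβ hx h hγ hδ

theorem eq_top_of_brk_mem {K : Subgroup (StUbar M H)}
    (h : ∀ (P : Set (I → ℤ)) (hP : IsSatSpecial P) (g : stSub (selfAction R Δ) H P)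
      (y : StU M.action H), brk hP g y ∈ K) : K = ⊤ := by
  refine top_le_iff.1 ?_
  rw [← PresentedGroup.closure_range_of]
  refine (Subgroup.closure_le _).2 ?_
  rintro _ ⟨⟨P, hP, g, hg, y⟩, rfl⟩
  exact h P hP ⟨g, hg⟩ y

/-- The canonical homomorphism of universal groups is surjective if the root elements, whose roots
vanish in the quotient, are obtained from commutators of root elements whose roots do not. -/
theorem elimBar_surjective (hc : IsLabel c)
    (h : ∀ β, ∀ y ∈ redRootSet M.action H β, proj c β = 0 → y ∈ offSub M H c) :
    Function.Surjective (elimBar E hH hc) := by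
  rw [← MonoidHom.range_eq_top]
  refine eq_top_of_brk_mem fun P hP g y => ?_
  obtain ⟨ω, hω, hPω⟩ := hP.exists_weight hH.neg_ne
  rw [brk_sub (isSatSpecial_posRoots ω) hP hPω (g := ⟨g.1, stSub_mono hPω g.2⟩) rfl]
  refine brk_mem_of_anti hH E hω (fun β y hy g hg => ?_) _ y
  have hβr := mem_roots_of_mem_rootSet hH (redRootSet_subset hy)
  by_cases hβ : proj c β = 0
  · exact brk_mem_range_of_offSub E hH hc _ hβr hβ hg (h β y hy hβ)
  · have hδ : proj c β ∈ roots J := (proj_mem_roots hc hβr).resolve_right hβ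
    have hpos := ht_self_pos hc.neg_ne hδ
    -- the images of roots antiparallel to `β` are antiparallel to `proj c β`
    refine brk_mem_range E hH hc _ (isSatSpecial_posRoots (-proj c β)) (stSub_mono ?_ hg)
      (mem_stSub (redRootSet_subset hy) ⟨hβr, hβ⟩)
    rintro α ⟨hα, m, n, hm, hn, e⟩
    have h1 := congrArg (ht (proj c β) ∘ proj c) e
    have h0 : proj c (0 : I → ℤ) = 0 := by ext; simp [proj]
    simp only [Function.comp, proj_add, proj_nsmul, ht_add, ht_nsmul, h0, ht_zero] at h1
    have h3 : (0 : ℤ) < m := by exact_mod_cast hm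
    have h4 : (0 : ℤ) < n := by exact_mod_cast hn
    have h5 : 0 < ht (-proj c β) (proj c α) := by
      rw [ht_comm, ht_neg, ht_comm]
      by_contra h5
      have h6 : 0 ≤ ht (proj c β) (proj c α) := by linarith
      nlinarith [mul_nonneg h3.le h6, mul_pos h4 hpos]
    refine ⟨hα, hα.1, (proj_mem_roots hc hα.1).resolve_right fun h => ?_, h5⟩
    rw [h, ht_zero] at h5
    exact h5.false

end Surjectivity

/-! ### Consequences of fullness -/

section Strong

variable {R Δ : Type*} [NonUnitalRing R] [StarRing R] [AddGroup Δ] [OddFormRing R Δ]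
variable {I J : Type*} [InvolutiveNeg I] [InvolutiveNeg J] {H : Family R Δ I}

theorem Family.IsStrong.isHyp (hS : H.IsStrong) (hI : ∀ i : I, -i ≠ i) : H.IsHyp where
  star_e := hS.star_e
  idem := hS.idem
  orth := hS.orth
  pi_q := hS.pi_q
  rho_q := hS.rho_q
  act_q := hS.act_q
  neg_ne := hI

variable [Finite I] {c : I → Option J}

/-- If the class with label `F` has several elements, then `e_F` is a sum of products
`(p - star p) q` with `p ∈ e_F R e_{-F}`. Here `p - star p = ρ(φ(p))`. -/
theorem push_e_mem_closure (hS : H.IsStrong) (hI : ∀ i : I, -i ≠ i) (hc : IsLabel c) {F : J}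
    (h : ∀ i, c i = some F → ∃ j, j ≠ i ∧ c j = some F) :
    (H.push c).e F ∈ AddSubgroup.closure {z : R | ∃ p ∈ Sij (selfAction R Δ) (H.push c) F (-F),
      ∃ q, (H.push c).e (-F) * q = q ∧ z = (p - star p) * q} := by
  have hH := hS.isHyp hI
  refine AddSubgroup.sum_mem _ fun i hi => ?_
  obtain ⟨j, hji, hj⟩ := h i (mem_fiber.1 hi)
  have h1 : H.e i ∈ (AddSubgroup.closure {z : R | ∃ p ∈ Sij (selfAction R Δ) (H.push c) F (-F),
      ∃ q, (H.push c).e (-F) * q = q ∧ z = (p - star p) * q}).comap (AddMonoidHom.mulLeft (H.e i)) := by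
    refine (AddSubgroup.closure_le _).2 ?_ (hS.full i (-j))
    rintro _ ⟨x, y, rfl⟩
    refine AddSubgroup.subset_closure ⟨H.e i * x * H.e (-j), ⟨H.e i * x * H.e (-j), ?_⟩,
      H.e (-j) * y, ?_, ?_⟩
    · change _ = (H.push c).e F * (H.e i * x * H.e (-j)) * (H.push c).e (-F)
      rw [mul_assoc ((H.push c).e F), mul_assoc (H.e i * x), mul_e_push hH (hc.neg_some hj),
        mul_assoc (H.e i), ← mul_assoc ((H.push c).e F), e_push_mul hH (mem_fiber.1 hi)]
    · rw [← mul_assoc, e_push_mul hH (hc.neg_some hj)]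
    · have h2 : H.e (-i) * H.e (-j) = 0 := hS.orth _ _ fun h => hji (neg_injective h).symm
      rw [sub_mul, star_mul, star_mul, hS.star_e, hS.star_e,
        mul_assoc _ (star x * H.e (-i)) (H.e (-j) * y), mul_assoc (star x),
        ← mul_assoc (H.e (-i)), h2, zero_mul, mul_zero, mul_zero, sub_zero,
        mul_assoc (H.e i * x), ← mul_assoc (H.e (-j)), hS.idem]
      simp only [AddMonoidHom.coe_mulLeft, mul_assoc]
  rw [AddSubgroup.mem_comap, AddMonoidHom.coe_mulLeft, hS.idem] at h1
  exact h1

end Strong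

section Fullness

variable {R Δ S Θ : Type*} [NonUnitalRing R] [StarRing R] [AddGroup Δ] [OddFormRing R Δ]
  [NonUnitalRing S] [StarRing S] [AddGroup Θ] [OddFormRing S Θ]
variable {B Γ : Type*} [NonUnitalRing B] [StarRing B] [AddGroup Γ] [OddFormRing B Γ]
variable {A : ActionData R Δ S Θ} (E : FullAmbient A B Γ)
variable {I J : Type*} [InvolutiveNeg I] [InvolutiveNeg J] {H : Family R Δ I}
variable {i j k m : I} {a : S} {u : Θ} {Z : Set R} {K : Subgroup (StU A H)}
variable (hH : H.IsHyp)
include E hH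

theorem cut_lmul_mem (ha : a ∈ Sij A H i j) (z : R) : A.lmul (H.e i * z) a ∈ Sij A H i j := by
  have h1 := E.isMat hH ha
  have h2 := (E.fam_isHyp hH).idem i
  rw [E.mem_Sij hH, E.s_lmul, map_mul]
  exact ⟨by rw [← mul_assoc, ← mul_assoc]; exact congrArg₂ _ (congrArg₂ _ h2 rfl) rfl,
    by rw [mul_assoc, h1.2]⟩

theorem cut_lmul_self (ha : a ∈ Sij A H i j) : A.lmul (H.e i * H.e i) a = a := by
  have h1 := E.isMat hH ha
  apply E.s_inj
  rw [hH.idem, E.s_lmul]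
  exact h1.1

theorem cut_lmul_zero : A.lmul (H.e i * 0) a = 0 := by
  apply E.s_inj
  rw [E.s_lmul]
  simp

theorem cut_lmul_add (z z' : R) :
    A.lmul (H.e i * (z + z')) a = A.lmul (H.e i * z) a + A.lmul (H.e i * z') a := by
  apply E.s_inj
  rw [map_add, E.s_lmul, E.s_lmul, E.s_lmul, mul_add, map_add, add_mul]

theorem cut_lmul_neg (z : R) : A.lmul (H.e i * -z) a = -A.lmul (H.e i * z) a := by
  apply E.s_inj
  rw [map_neg, E.s_lmul, E.s_lmul, mul_neg, map_neg, neg_mul]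

theorem X_mem_of_mem_closure (h1 : i ≠ j) (h2 : i ≠ -j) (ha : a ∈ Sij A H i j)
    (hZ : H.e i ∈ AddSubgroup.closure Z)
    (h : ∀ z ∈ Z, X A H i j (A.lmul (H.e i * z) a) ∈ K) : X A H i j a ∈ K := by
  have key : X A H i j (A.lmul (H.e i * H.e i) a) ∈ K := by
    refine AddSubgroup.closure_induction (p := fun z _ => X A H i j (A.lmul (H.e i * z) a) ∈ K)
      h ?_ ?_ ?_ hZ
    · rw [cut_lmul_zero E hH, X_zero E.toAmbient hH h1 h2]
      exact one_mem _
    · intro z z' _ _ hz hz'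
      rw [cut_lmul_add E hH,
        X_add h1 h2 (cut_lmul_mem E hH ha z) (cut_lmul_mem E hH ha z')]
      exact mul_mem hz hz'
    · intro z _ hz
      rw [cut_lmul_neg E hH, X_neg E.toAmbient hH h1 h2 (cut_lmul_mem E hH ha z)]
      exact inv_mem hz
  rwa [cut_lmul_self E hH ha] at key

theorem Yphi_mem_of_mem_closure (ha : a ∈ Sij A H (-m) m)
    (hZ : H.e (-m) ∈ AddSubgroup.closure Z)
    (h : ∀ z ∈ Z, Y A H m (phi (A.lmul (H.e (-m) * z) a)) ∈ K) : Y A H m (phi a) ∈ K := by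
  have key : Y A H m (phi (A.lmul (H.e (-m) * H.e (-m)) a)) ∈ K := by
    refine AddSubgroup.closure_induction
      (p := fun z _ => Y A H m (phi (A.lmul (H.e (-m) * z) a)) ∈ K) h ?_ ?_ ?_ hZ
    · rw [cut_lmul_zero E hH, phi_zero, Y_zero E.toAmbient hH]
      exact one_mem _
    · intro z z' _ _ hz hz'
      rw [cut_lmul_add E hH, phi_add,
        Y_add (E.Theta0_phi hH (cut_lmul_mem E hH ha z))
          (E.Theta0_phi hH (cut_lmul_mem E hH ha z'))]
      exact mul_mem hz hz'
    · intro z _ hz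
      rw [cut_lmul_neg E hH, phi_neg,
        Y_neg E.toAmbient hH (E.Theta0_phi hH (cut_lmul_mem E hH ha z))]
      exact inv_mem hz
  rwa [cut_lmul_self E hH ha] at key

theorem actR_e_mem (hu : ∀ k, A.lmul (H.e k) (pi u) = 0) (z : R) :
    A.actR u (z * H.e m) ∈ Theta0 A H m := by
  have h2 := (E.fam_isHyp hH).idem m
  rw [E.mem_Theta0 hH, E.t_actR, map_mul]
  refine ⟨by rw [← act_mul, mul_assoc]; exact congrArg _ (congrArg _ h2), fun k => ?_⟩
  have h3 := congrArg E.s (hu k)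
  rw [E.s_lmul, E.t_pi, map_zero] at h3
  rw [pi_act, ← mul_assoc]
  exact (congrArg (· * _) h3).trans (zero_mul _)

/-- Membership of `X_m(u)` in a subgroup can be checked on generators `z` of a group of ring
elements containing `e_m`. Since `u · (a + b)` differs from `u · a + u · b` by some `φ(s)`, the elements
`X_m(φ(s))` have to be considered as well. -/
theorem Y_mem_of_mem_closure (hu : u ∈ Theta0 A H m) (hZ : H.e m ∈ AddSubgroup.closure Z)
    (hφ : ∀ s ∈ Sij A H (-m) m, Y A H m (phi s) ∈ K)
    (h : ∀ z ∈ Z, Y A H m (A.actR u (z * H.e m)) ∈ K) : Y A H m u ∈ K := by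
  have h0 := E.fam_isHyp hH
  have hmem := fun z => actR_e_mem E hH (m := m) hu.2 z
  have hs : ∀ z z' : R, A.lmul (star (z' * H.e m)) (A.rmul (rho u) (z * H.e m)) ∈
      Sij A H (-m) m := by
    intro z z'
    rw [E.mem_Sij hH, E.s_lmul, E.s_rmul, map_star, map_mul, map_mul, star_mul,
      ← map_star E.r (H.e m), hH.star_e]
    constructor
    · rw [← mul_assoc, ← mul_assoc ((E.fam H).e (-m))]
      exact congrArg (fun x => x * star (E.r z') * (E.s (rho u) * (E.r z * E.r (H.e m))))
        (h0.idem (-m))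
    · rw [mul_assoc, mul_assoc (E.s (rho u)), mul_assoc (E.r z)]
      exact congrArg (_ * ·) (congrArg (_ * ·) (congrArg (_ * ·) (h0.idem m)))
  have key : Y A H m (A.actR u (H.e m * H.e m)) ∈ K := by
    refine AddSubgroup.closure_induction
      (p := fun z _ => Y A H m (A.actR u (z * H.e m)) ∈ K) h ?_ ?_ ?_ hZ
    · have e : A.actR u (0 * H.e m) = 0 := by
        apply E.t_inj
        rw [E.t_actR, zero_mul, map_zero, map_zero, act_zero]
      rw [e, Y_zero E.toAmbient hH]
      exact one_mem _
    · intro z z' _ _ hz hz'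
      have e : A.actR u ((z + z') * H.e m) = A.actR u (z * H.e m) +
          phi (A.lmul (star (z' * H.e m)) (A.rmul (rho u) (z * H.e m))) +
          A.actR u (z' * H.e m) := by
        apply E.t_inj
        rw [map_add, map_add, E.t_phi, E.t_actR, E.t_actR, E.t_actR, E.s_lmul, E.s_rmul, map_star,
          E.t_rho, add_mul, map_add, act_add, mul_assoc]
      rw [e, Y_add (E.Theta0_add hH (hmem z) (E.Theta0_phi hH (hs z z'))) (hmem z'),
        Y_add (hmem z) (E.Theta0_phi hH (hs z z'))]
      exact mul_mem (mul_mem hz (hφ _ (hs z z'))) hz'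
    · intro z _ hz
      have e : A.actR u (-z * H.e m) =
          phi (A.lmul (star (z * H.e m)) (A.rmul (rho u) (z * H.e m))) +
          -A.actR u (z * H.e m) := by
        apply E.t_inj
        rw [map_add, map_neg, E.t_phi, E.t_actR, E.t_actR, E.s_lmul, E.s_rmul, map_star,
          E.t_rho, neg_mul, map_neg, act_neg, mul_assoc]
      rw [e, Y_add (E.Theta0_phi hH (hs z z)) (E.Theta0_neg hH (hmem z)),
        Y_neg E.toAmbient hH (hmem z)]
      exact mul_mem (hφ _ (hs z z)) (inv_mem hz)
  have e : A.actR u (H.e m * H.e m) = u := by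
    apply E.t_inj
    rw [E.t_actR, hH.idem]
    exact ((E.mem_Theta0 hH).1 hu).1
  rwa [e] at key

end Fullness

/-! ### Root elements as commutators -/

section OffSub

variable {R Δ S Θ : Type*} [NonUnitalRing R] [StarRing R] [AddGroup Δ] [OddFormRing R Δ]
  [NonUnitalRing S] [StarRing S] [AddGroup Θ] [OddFormRing S Θ]
variable {B Γ : Type*} [NonUnitalRing B] [StarRing B] [AddGroup Γ] [OddFormRing B Γ]
variable {M : CrossedModule R Δ S Θ} (E : FullAmbient M.action B Γ)
variable {I J : Type} [InvolutiveNeg I] [InvolutiveNeg J] [Finite I] [Finite J] {H : Family R Δ I}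
variable {c : I → Option J} {i j k m : I} {a : S} {u : Θ}
variable (hH : H.IsHyp)

theorem proj_vec_ne_zero (hc : IsLabel c) (h : c i ≠ none) : proj c (vec i) ≠ 0 := by
  rw [proj_vec hc]
  rcases h' : c i with _ | F
  · exact absurd h' h
  · exact vec_ne_zero hc.neg_ne F

theorem proj_sub_ne_zero (hc : IsLabel c) (h : c i ≠ c j) : proj c (vec j - vec i) ≠ 0 := by
  rw [proj_sub, proj_vec hc, proj_vec hc, sub_ne_zero]
  exact fun e => h (vecOpt_injective hc.neg_ne e).symm

theorem mem_offSub_of_chev {γ δ : I → ℤ} {y : StU (selfAction R Δ) H} {z w : StU M.action H}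
    (h : Chev M.action H γ δ y z w) (hγ : proj c γ ≠ 0) (hδ : proj c δ ≠ 0) : w ∈ offSub M H c :=
  Subgroup.mem_sup_right (Subgroup.subset_closure ⟨γ, δ, y, z, h, hγ, hδ⟩)

theorem X_mem_offSub (hc : IsLabel c) (h1 : i ≠ j) (h2 : i ≠ -j) (ha : a ∈ Sij M.action H i j)
    (h : c i ≠ c j) : X M.action H i j a ∈ offSub M H c :=
  Subgroup.mem_sup_left (X_mem_stSub h1 h2 ha ⟨sub_mem_roots h1, proj_sub_ne_zero hc h⟩)

theorem Y_mem_offSub (hc : IsLabel c) (hu : u ∈ Theta0 M.action H i) (h : c i ≠ none) :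
    Y M.action H i u ∈ offSub M H c :=
  Subgroup.mem_sup_left (Y_mem_stSub hu ⟨vec_mem_roots i, proj_vec_ne_zero hc h⟩)

include E

/-- A short root element `X_{ij}(a)` with `i` and `j` in one class is a product of commutators
`[X_{ik}(p), X_{kj}(b)]` for any `k` outside this class. -/
theorem X_mem_offSub_of_third (hS : H.IsStrong) (hI : ∀ i : I, -i ≠ i) (hc : IsLabel c)
    (h1 : i ≠ j) (h2 : i ≠ -j) (ha : a ∈ Sij M.action H i j) (h3 : i ≠ k) (h4 : i ≠ -k)
    (h5 : k ≠ j) (h6 : k ≠ -j) (hi : c i ≠ c k) (hj : c k ≠ c j) :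
    X M.action H i j a ∈ offSub M H c := by
  have hH := hS.isHyp hI
  have hm := E.isMat hH ha
  refine X_mem_of_mem_closure E hH h1 h2 ha (hS.full i k) ?_
  rintro _ ⟨x, y, rfl⟩
  have hp : H.e i * x * H.e k ∈ Sij (selfAction R Δ) H i k := ⟨x, rfl⟩
  have hb : M.action.lmul (H.e k * y) a ∈ Sij M.action H k j := by
    have h2 := (E.fam_isHyp hH).idem k
    rw [E.mem_Sij hH, E.s_lmul, map_mul]
    exact ⟨by rw [← mul_assoc, ← mul_assoc]; exact congrArg₂ _ (congrArg₂ _ h2 rfl) rfl,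
      by rw [mul_assoc, hm.2]⟩
  have hw := mem_offSub_of_chev (c := c) (Chev.short i k j _ _ h3 h4 h5 h6 h1 h2 hp hb)
    (proj_sub_ne_zero hc hi) (proj_sub_ne_zero hc hj)
  have e : M.action.lmul (H.e i * x * H.e k) (M.action.lmul (H.e k * y) a) =
      M.action.lmul (H.e i * (x * H.e k * y)) a := by
    apply E.s_inj
    rw [E.s_lmul, E.s_lmul, E.s_lmul, ← mul_assoc, ← map_mul]
    congr 2
    rw [mul_assoc (H.e i * x), ← mul_assoc (H.e k), hH.idem]
    simp only [mul_assoc]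
  rw [e] at hw
  exact (Subgroup.mul_mem_cancel_right _ (X_mem_offSub hc h5 h6 hb hj)).1 hw

/-- A short root element `X_{ij}(a)` with `i` and `j` in one class is obtained from the commutators
`[X_{-i}(φ(p)), X_{-i,j}(b)] = X_{ij}(ρ(φ(p)) b) X_j(…)` if `e_i` is a sum of products
`ρ(φ(p)) q`. -/
theorem X_mem_offSub_of_rho_phi (hH : H.IsHyp) (hc : IsLabel c) (h1 : i ≠ j) (h2 : i ≠ -j)
    (ha : a ∈ Sij M.action H i j)
    (hZ : H.e i ∈ AddSubgroup.closure {z : R | ∃ p ∈ Sij (selfAction R Δ) H i (-i),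
      ∃ q, H.e (-i) * q = q ∧ z = (p - star p) * q}) (hi : c i ≠ none) (hij : c i = c j) :
    X M.action H i j a ∈ offSub M H c := by
  have hm := E.isMat hH ha
  have hni : c (-i) ≠ none := by
    rw [hc.neg]
    simpa using hi
  have hj : c j ≠ none := by rwa [← hij]
  have hnij : c (-i) ≠ c j := by
    rw [← hij, hc.neg]
    rcases h : c i with _ | F
    · exact absurd h hi
    · simpa using hc.neg_ne F
  have h1' : -i ≠ -j := fun h => h1 (neg_injective h)
  have h2' : -i ≠ j := fun h => h2 (by rw [← h, neg_neg])
  refine X_mem_of_mem_closure E hH h1 h2 ha hZ ?_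
  rintro _ ⟨p, hp, q, hq, rfl⟩
  have hp' : p ∈ Sij (selfAction R Δ) H (-(-i)) (-i) := by rwa [neg_neg]
  have hφ : (phi p : Δ) ∈ Theta0 (selfAction R Δ) H (-i) := E.self.Theta0_phi hH hp'
  have hb : M.action.lmul q a ∈ Sij M.action H (-i) j := by
    rw [E.mem_Sij hH, E.s_lmul]
    refine ⟨?_, by rw [mul_assoc, hm.2]⟩
    rw [← mul_assoc]
    exact congrArg (· * _) ((map_mul E.r _ _).symm.trans (congrArg E.r hq))
  have hw := mem_offSub_of_chev (c := c) (Chev.mixedYX (-i) j _ _ h2' h1' hφ hb)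
    (proj_vec_ne_zero hc hni) (proj_sub_ne_zero hc hnij)
  have hps : H.e i * (p - star p) = p - star p := by
    have e1 : H.e i * p = p := by
      obtain ⟨b, rfl⟩ := hp
      change H.e i * (H.e i * b * H.e (-i)) = _
      rw [← mul_assoc, ← mul_assoc, hH.idem]
      rfl
    have e2 : p * H.e (-i) = p := by
      obtain ⟨b, rfl⟩ := hp
      change (H.e i * b * H.e (-i)) * H.e (-i) = _
      rw [mul_assoc, hH.idem]
      rfl
    have e3 : H.e i * star p = star p := by
      have := congrArg star e2
      rwa [star_mul, hH.star_e, neg_neg] at this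
    rw [mul_sub, e1, e3]
  have e : M.action.lmul (rho (phi p : Δ)) (M.action.lmul q a) =
      M.action.lmul (H.e i * ((p - star p) * q)) a := by
    apply E.s_inj
    rw [E.s_lmul, E.s_lmul, E.s_lmul, ← mul_assoc, ← map_mul, rho_phi, ← mul_assoc, hps]
  rw [e, neg_neg] at hw
  rw [Subgroup.mul_mem_cancel_right _ (X_mem_offSub hc h2' h1' hb hnij),
    Subgroup.mul_mem_cancel_right _ (Y_mem_offSub hc (actS_mem E hH hφ hb) hj)] at hw
  exact hw

/-- An ultrashort root element `X_m(u)` with `m` outside all classes is obtained from commutators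
involving some `k` from a class: the elements `X_m(φ(a))` from `[X_{-m,k}(p), X_{km}(b)]`, the other
ones from `[X_{km}(p), X_k(v)]`. -/
theorem Y_mem_offSub_of_other (hS : H.IsStrong) (hI : ∀ i : I, -i ≠ i) (hc : IsLabel c)
    (hu : u ∈ Theta0 M.action H m) (hm : c m = none) (h1 : m ≠ k) (h2 : m ≠ -k)
    (hk : c k ≠ none) : Y M.action H m u ∈ offSub M H c := by
  have hH := hS.isHyp hI
  have h0 := E.fam_isHyp hH
  have hnm := hc.neg_none hm
  have hnk : c (-k) ≠ none := by
    rw [hc.neg]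
    simpa using hk
  have hmk : c (-m) ≠ c k := by rw [hnm]; exact hk.symm
  have hkm : c k ≠ c m := by rw [hm]; exact hk
  have hnkm : c (-k) ≠ c m := by rw [hm]; exact hnk
  have h1' : k ≠ m := h1.symm
  have h2' : k ≠ -m := fun h => h2 (by rw [h, neg_neg])
  have h3 : -k ≠ m := h2.symm
  have h4 : -k ≠ -m := fun h => h1' (neg_injective h)
  refine Y_mem_of_mem_closure E hH hu (hS.full m k) ?_ ?_
  · intro s hs
    have hms := E.isMat hH hs
    refine Yphi_mem_of_mem_closure E hH hs (hS.full (-m) k) ?_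
    rintro _ ⟨x, y, rfl⟩
    have hp : H.e (-m) * x * H.e k ∈ Sij (selfAction R Δ) H (-m) k := ⟨x, rfl⟩
    have hb : M.action.lmul (H.e k * y) s ∈ Sij M.action H k m := by
      rw [E.mem_Sij hH, E.s_lmul, map_mul]
      exact ⟨by rw [← mul_assoc, ← mul_assoc]; exact congrArg₂ _ (congrArg₂ _ (h0.idem k) rfl) rfl,
        by rw [mul_assoc, hms.2]⟩
    have hw := mem_offSub_of_chev (c := c) (Chev.long m k _ _ h1 h2 hp hb)
      (proj_sub_ne_zero hc hmk) (proj_sub_ne_zero hc hkm)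
    have e : M.action.lmul (H.e (-m) * x * H.e k) (M.action.lmul (H.e k * y) s) =
        M.action.lmul (H.e (-m) * (x * H.e k * y)) s := by
      apply E.s_inj
      rw [E.s_lmul, E.s_lmul, E.s_lmul, ← mul_assoc, ← map_mul]
      congr 2
      rw [mul_assoc (H.e (-m) * x), ← mul_assoc (H.e k), hH.idem]
      simp only [mul_assoc]
    rw [e] at hw
    exact (Subgroup.mul_mem_cancel_right _ (X_mem_offSub hc h1' h2' hb hkm)).1 hw
  · rintro _ ⟨x, y, rfl⟩
    have hv : M.action.actR u (x * H.e k) ∈ Theta0 M.action H k := actR_e_mem E hH hu.2 x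
    have hp : -(H.e k * y * H.e m) ∈ Sij (selfAction R Δ) H k m :=
      E.self.Sij_neg hH ⟨y, rfl⟩
    have hw := mem_offSub_of_chev (c := c) (Chev.mixedXY k m _ _ h1' h2' hp hv)
      (proj_sub_ne_zero hc hkm) (proj_vec_ne_zero hc hk)
    have e : M.action.actR (M.action.actR u (x * H.e k)) (H.e k * y * H.e m) =
        M.action.actR u (x * H.e k * y * H.e m) := by
      apply E.t_inj
      rw [E.t_actR, E.t_actR, E.t_actR, ← act_mul, ← map_mul]
      congr 2
      rw [mul_assoc x, ← mul_assoc (H.e k), ← mul_assoc (H.e k), hH.idem]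
      simp only [mul_assoc]
    rw [neg_neg, e] at hw
    rw [Subgroup.mul_mem_cancel_right _ (Y_mem_offSub hc hv hk),
      Subgroup.mul_mem_cancel_right _ (X_mem_offSub hc h3 h4 (rmul_rho_mem E hH hv hp) hnkm)] at hw
    exact hw

end OffSub

/-! ### Short and ultrashort roots, subsystems of type `A₂` -/

section Roots

variable {I J : Type} [InvolutiveNeg I] [InvolutiveNeg J] {α γ : I → ℤ} {i j : I}

/-- The smallest saturated set containing `±α` lies on the line spanned by `α`. -/
theorem mul_eq_mul_of_mem_satHull (hα : α ∈ roots I) (h : γ ∈ satHull {α, -α}) (x y : I) :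
    γ x * α y = γ y * α x := by
  have hsat : IsSaturated {γ : I → ℤ | γ ∈ roots I ∧ ∀ x y, γ x * α y = γ y * α x} := by
    refine ⟨fun γ hγ => hγ.1, ?_, ?_⟩
    · rintro γ ⟨_, h1⟩ δ ⟨_, h2⟩ hr
      refine ⟨hr, fun x y => ?_⟩
      simp only [Pi.add_apply, add_mul, h1 x y, h2 x y]
    · rintro γ ⟨_, h1⟩ β hβ rfl
      refine ⟨hβ, fun x y => ?_⟩
      have := h1 x y
      simp only [Pi.add_apply, add_mul] at this
      omega
  refine (h _ hsat ?_).2 x y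
  rintro δ (rfl | rfl)
  · exact ⟨hα, fun x y => mul_comm _ _⟩
  · refine ⟨neg_mem_roots hα, fun x y => ?_⟩
    simp only [Pi.neg_apply]
    ring

theorem vec_mem_satHull_of_double {P : Set (I → ℤ)} (h : vec i + vec i ∈ satHull P) :
    vec i ∈ satHull P :=
  fun Q hQ hP => hQ.half _ (h Q hQ hP) _ (vec_mem_roots i) rfl

theorem subset_satHull (P : Set (I → ℤ)) : P ⊆ satHull P := fun _ hγ _ _ hP => hP hγ

theorem eq_or_eq_neg_of_vec_ne_zero (h : vec i j ≠ 0) : j = i ∨ j = -i := by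
  by_contra h'
  push Not at h'
  exact h (vec_eq_zero h'.1 h'.2)

theorem IsShort.mem_roots (hα : IsShort α) : α ∈ roots I := by
  obtain ⟨i, j, _, h, rfl⟩ := hα
  exact add_mem_roots h

theorem vec_notMem_satHull_of_isShort (hne : ∀ i : I, -i ≠ i) (hα : IsShort α) (i : I) :
    vec i ∉ satHull {α, -α} := by
  intro h
  have h1 := mul_eq_mul_of_mem_satHull hα.mem_roots h
  obtain ⟨p, q, h2, h3, rfl⟩ := hα
  have h4 := vec_eq_zero h2 h3
  have h5 := vec_self hne p
  have h6 := vec_self hne q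
  have h7 := h1 p q
  have h8 := h1 i p
  have h9 := h1 i q
  have h10 := vec_self hne i
  simp only [Pi.add_apply, h4, h5, h6, h10, vec_comm q p, vec_comm p i, vec_comm q i] at h7 h8 h9
  have h11 : vec i p ≠ 0 := by
    intro h
    rw [h] at h7 h8
    omega
  have h12 : vec i q ≠ 0 := by
    intro h
    rw [h] at h7 h9
    omega
  rcases eq_or_eq_neg_of_vec_ne_zero h11 with rfl | rfl <;>
  rcases eq_or_eq_neg_of_vec_ne_zero h12 with rfl | rfl
  · exact h2 rfl
  · exact h3 rfl
  · exact h3 (neg_neg _).symm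
  · exact h2 rfl

section Quotient

variable {P : Set (I → ℤ)} {c : I → Option J}

theorem IsQuotient.exists_eq_some (h : IsQuotient P c) (hi : vec i ∉ P) : ∃ F, c i = some F := by
  obtain ⟨F, hF, _⟩ := (h.rel i i).1 ⟨Or.inr (sub_self _), hi⟩
  exact ⟨F, hF⟩

theorem IsQuotient.vec_notMem {F : J} (h : IsQuotient P c) (hi : c i = some F) : vec i ∉ P :=
  ((h.rel i i).2 ⟨F, hi, hi⟩).2

theorem IsQuotient.sub_mem {F : J} (h : IsQuotient P c) (hne : ∀ i : I, -i ≠ i) (hij : i ≠ j)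
    (hi : c i = some F) (hj : c j = some F) : vec i - vec j ∈ P :=
  ((h.rel i j).2 ⟨F, hi, hj⟩).1.resolve_right fun e => hij (vec_injective hne (sub_eq_zero.1 e))

end Quotient

variable [Finite I]

theorem exists_notMem_of_card_lt (s : Finset I) (h : s.card < Nat.card I) : ∃ k, k ∉ s := by
  by_contra h'
  push Not at h'
  have : Nat.card I ≤ s.card := by
    have := Fintype.ofFinite I
    rw [Nat.card_eq_fintype_card]
    exact Finset.card_le_card fun k _ => h' k
  omega

theorem ht_vec_vec (i j : I) : ht (vec i) (vec j) = 2 * vec i j := ht_vec (isOdd_vec i) j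

theorem add_ht (u v w : I → ℤ) : ht (u + v) w = ht u w + ht v w := by
  rw [ht_comm, ht_add, ht_comm w, ht_comm w]

theorem neg_ht (u w : I → ℤ) : ht (-u) w = -ht u w := by
  rw [ht_comm, ht_neg, ht_comm w]

theorem ht_vec_self (hne : ∀ i : I, -i ≠ i) (i : I) : ht (vec i) (vec i) = 2 := by
  rw [ht_vec_vec, vec_self hne]
  rfl

theorem ht_double_self (hne : ∀ i : I, -i ≠ i) (i : I) :
    ht (vec i + vec i) (vec i + vec i) = 8 := by
  simp only [ht_add, add_ht, ht_vec_self hne]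
  rfl

theorem IsShort.ht_self (hne : ∀ i : I, -i ≠ i) (hα : IsShort α) : ht α α = 4 := by
  obtain ⟨i, j, h1, h2, rfl⟩ := hα
  simp only [ht_add, add_ht, ht_vec_vec, vec_self hne, vec_comm j i, vec_eq_zero h1 h2]
  rfl

theorem ht_self_cases (hne : ∀ i : I, -i ≠ i) (hγ : γ ∈ roots I) :
    (∃ i, γ = vec i ∧ ht γ γ = 2) ∨ (IsShort γ ∧ ht γ γ = 4) ∨
      ∃ i, γ = vec i + vec i ∧ ht γ γ = 8 := by
  rcases hγ with ⟨i, rfl⟩ | ⟨i, j, hij, rfl⟩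
  · exact Or.inl ⟨i, rfl, ht_vec_self hne i⟩
  · by_cases h : j = i
    · subst h
      exact Or.inr (Or.inr ⟨j, rfl, ht_double_self hne j⟩)
    · have : IsShort (vec i + vec j) := ⟨i, j, h, hij, rfl⟩
      exact Or.inr (Or.inl ⟨this, this.ht_self hne⟩)

/-- The inner products of roots of one length that is not `√2` are divisible by their common square
length, unlike those in a root system of type `A₂`. -/
theorem IsTypeA2.isShort {P : Set (I → ℤ)} (hne : ∀ i : I, -i ≠ i) (hP : IsTypeA2 P) :
    (∀ γ ∈ P, IsShort γ) ∧ ∀ γ ∈ P, ∀ δ ∈ P, ht γ δ ≠ 0 := by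
  obtain ⟨hr, β, γ, h1, h2, h3, rfl⟩ := hP
  change 0 < ht β β at h1
  change ht γ γ = ht β β at h2
  change 2 * ht β γ = -ht β β at h3
  have hβ : β ∈ roots I := hr (by simp)
  have hγ : γ ∈ roots I := hr (by simp)
  have hN : ht β β = 4 := by
    rcases ht_self_cases hne hβ with ⟨i, rfl, h⟩ | ⟨_, h⟩ | ⟨i, rfl, h⟩
    · rcases ht_self_cases hne hγ with ⟨j, rfl, h'⟩ | ⟨_, h'⟩ | ⟨j, rfl, h'⟩
      · rw [ht_vec_vec i j] at h3
        omega
      all_goals omega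
    · exact h
    · rcases ht_self_cases hne hγ with ⟨j, rfl, h'⟩ | ⟨_, h'⟩ | ⟨j, rfl, h'⟩
      on_goal 3 =>
        simp only [h, ht_add, add_ht, ht_vec_vec i j] at h3
        omega
      all_goals omega
  have hval : ∀ δ ∈ ({β, γ, β + γ, -β, -γ, -(β + γ)} : Set (I → ℤ)),
      ht δ δ = 4 ∧ ∀ ε ∈ ({β, γ, β + γ, -β, -γ, -(β + γ)} : Set (I → ℤ)), ht δ ε ≠ 0 := by
    have e3 : ht γ β = ht β γ := ht_comm _ _
    rintro δ (rfl | rfl | rfl | rfl | rfl | rfl)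
    all_goals
      refine ⟨by (try simp only [add_ht, neg_ht, e3, ht_add, ht_neg]); omega, ?_⟩
      rintro ε (rfl | rfl | rfl | rfl | rfl | rfl)
      all_goals
        try simp only [add_ht, neg_ht, e3, ht_add, ht_neg]
        omega
  refine ⟨fun δ hδ => ?_, fun δ hδ => (hval δ hδ).2⟩
  rcases ht_self_cases hne (hr hδ) with ⟨_, _, h⟩ | ⟨h, _⟩ | ⟨_, _, h⟩
  · exact absurd (h.symm.trans (hval δ hδ).1) (by norm_num)
  · exact h
  · exact absurd (h.symm.trans (hval δ hδ).1) (by norm_num)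

theorem not_isShort_vec (hne : ∀ i : I, -i ≠ i) (i : I) : ¬IsShort (vec i) := fun h =>
  absurd ((ht_vec_self hne i).symm.trans (h.ht_self hne)) (by norm_num)

theorem not_isShort_double (hne : ∀ i : I, -i ≠ i) (i : I) : ¬IsShort (vec i + vec i) := fun h =>
  absurd ((ht_double_self hne i).symm.trans (h.ht_self hne)) (by norm_num)

end Roots

/-! ### Elimination of roots -/

section Elimination

variable {R Δ S Θ : Type*} [NonUnitalRing R] [StarRing R] [AddGroup Δ] [OddFormRing R Δ]
  [NonUnitalRing S] [StarRing S] [AddGroup Θ] [OddFormRing S Θ]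
variable {B Γ : Type*} [NonUnitalRing B] [StarRing B] [AddGroup Γ] [OddFormRing B Γ]
variable {M : CrossedModule R Δ S Θ} (E : FullAmbient M.action B Γ)
variable {I J K : Type} [InvolutiveNeg I] [InvolutiveNeg J] [InvolutiveNeg K]
  [Finite I] [Finite J] [Finite K] {H : Family R Δ I}
variable {c : I → Option J} {α : I → ℤ}
variable (hS : H.IsStrong) (hI : ∀ i : I, -i ≠ i)
include E

/-- A root vanishes in the quotient if it is `e_j - e_i` with `i`, `j` in one class or outside all
classes, or if it is `e_j` with `j` outside all classes. -/
theorem elimBar_surjective_of_indices (hH : H.IsHyp) (hc : IsLabel c)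
    (hX : ∀ i j a, i ≠ j → i ≠ -j → a ∈ Sij M.action H i j → c i = c j →
      X M.action H i j a ∈ offSub M H c)
    (hY : ∀ j, ∀ u ∈ Theta0 M.action H j, c j = none → Y M.action H j u ∈ offSub M H c) :
    Function.Surjective (elimBar E hH hc) := by
  refine elimBar_surjective E hH hc ?_
  rintro _ _ (⟨i, j, a, h1, h2, ha, rfl, rfl⟩ | ⟨j, u, hu, rfl, rfl⟩) h
  · refine hX i j a h1 h2 ha ?_
    by_contra h'
    exact proj_sub_ne_zero hc h' h
  · refine hY j u hu ?_
    by_contra h'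
    exact proj_vec_ne_zero hc h' h

include hS hI

/-- If `α` is a short root, then a class contains at most two indices `i`, `j`, so in rank at least
three there is an index different from `±i`, `±j`, and it lies outside this class. -/
theorem exists_elim_of_isShort (hα : IsShort α) (hcard : 6 ≤ Nat.card I)
    (h : IsQuotient (satHull {α, -α}) c) :
    ∃ F : StUbar M (H.push c) →* StUbar M H,
      IsElim M H (H.push c) c F ∧ Function.Surjective F := by
  classical
  have hc := h.isLabel_of_double hI fun i => vec_mem_satHull_of_double
  have hH := hS.isHyp hI
  have hv := vec_notMem_satHull_of_isShort hI hα
  refine ⟨elimBar E hH hc, isElim_elimBar E hH hc, elimBar_surjective_of_indices E hH hc ?_ ?_⟩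
  · intro i j a h1 h2 ha hij
    obtain ⟨k, hk⟩ := exists_notMem_of_card_lt ({i, -i, j, -j} : Finset I)
      (lt_of_le_of_lt Finset.card_le_four (by omega))
    simp only [Finset.mem_insert, Finset.mem_singleton, not_or] at hk
    obtain ⟨k1, k2, k3, k4⟩ := hk
    have hik : c i ≠ c k := by
      obtain ⟨F, hF⟩ := h.exists_eq_some (hv i)
      intro hik
      have h3 := mul_eq_mul_of_mem_satHull hα.mem_roots
        (h.sub_mem hI h1 hF (hij.symm.trans hF))
      have h4 := mul_eq_mul_of_mem_satHull hα.mem_roots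
        (h.sub_mem hI (Ne.symm k1) hF (hik.symm.trans hF))
      have h5 := h3 i k
      have h7 := h4 i k
      simp only [Pi.sub_apply, vec_self hI, vec_eq_zero k1 k2, vec_eq_zero k3 k4,
        vec_eq_zero h1 h2, vec_comm k i] at h5 h7
      -- `e_i - e_j` and `e_i - e_k` are both proportional to `α`
      have h8 : α i = 0 := by omega
      refine root_ne_zero hI hα.mem_roots (funext fun p => ?_)
      have h9 := h3 i p
      rw [h8, mul_zero, Pi.sub_apply, vec_self hI, vec_eq_zero (i := j) h1 h2, sub_zero,
        one_mul] at h9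
      exact h9
    exact X_mem_offSub_of_third E hS hI hc h1 h2 ha (Ne.symm k1)
      (fun e => k2 (by rw [e, neg_neg])) k3 k4 hik (fun e => hik (hij.trans e.symm))
  · intro j u _ hj
    obtain ⟨F, hF⟩ := h.exists_eq_some (hv j)
    rw [hj] at hF
    exact absurd hF (by simp)

/-- If `α = e_m`, then the classes are the single indices different from `±m`. -/
theorem exists_elim_of_isUltrashort (hα : IsUltrashort α) (hcard : 4 ≤ Nat.card I)
    (h : IsQuotient (satHull {α, -α}) c) :
    ∃ F : StUbar M (H.push c) →* StUbar M H,
      IsElim M H (H.push c) c F ∧ Function.Surjective F := by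
  classical
  have hc := h.isLabel_of_double hI fun i => vec_mem_satHull_of_double
  have hH := hS.isHyp hI
  obtain ⟨m, rfl⟩ := hα
  have hzero : ∀ γ ∈ satHull {vec m, -vec m}, ∀ k, k ≠ m → k ≠ -m → γ k = 0 := by
    intro γ hγ k h1 h2
    have h3 := mul_eq_mul_of_mem_satHull (vec_mem_roots m) hγ m k
    rw [vec_self hI, vec_eq_zero h1 h2] at h3
    omega
  have hnone : ∀ i, c i = none → i = m ∨ i = -m := by
    intro i hi
    by_contra h'
    push Not at h'
    have hv : vec i ∉ satHull {vec m, -vec m} := fun hv => by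
      have := hzero _ hv i h'.1 h'.2
      rw [vec_self hI] at this
      exact one_ne_zero this
    obtain ⟨F, hF⟩ := h.exists_eq_some hv
    rw [hi] at hF
    exact absurd hF (by simp)
  have hm : vec m ∈ satHull {vec m, -vec m} := subset_satHull _ (by simp)
  have hsome : ∀ i F, c i = some F → i ≠ m ∧ i ≠ -m := by
    intro i F hi
    constructor
    · rintro rfl
      exact h.vec_notMem hi hm
    · rintro rfl
      exact h.vec_notMem hi (subset_satHull _ (by simp [vec_neg]))
  refine ⟨elimBar E hH hc, isElim_elimBar E hH hc, elimBar_surjective_of_indices E hH hc ?_ ?_⟩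
  · intro i j a h1 h2 ha hij
    exfalso
    rcases hi : c i with _ | F
    · have hj := hnone j (hij.symm.trans hi)
      rcases hnone i hi with rfl | rfl <;> rcases hj with rfl | rfl <;> simp at h1 h2
    · obtain ⟨h3, h4⟩ := hsome i F hi
      have := hzero _ (h.sub_mem hI h1 hi (hij.symm.trans hi)) i h3 h4
      rw [Pi.sub_apply, vec_self hI, vec_comm, vec_eq_zero (Ne.symm h1)
        (fun e => h2 (by rw [e, neg_neg]))] at this
      omega
  · intro j u hu hj
    obtain ⟨k, hk⟩ := exists_notMem_of_card_lt ({m, -m} : Finset I)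
      (lt_of_le_of_lt Finset.card_le_two (by omega))
    simp only [Finset.mem_insert, Finset.mem_singleton, not_or] at hk
    have hkn : c k ≠ none := fun e => (hnone k e).elim hk.1 hk.2
    refine Y_mem_offSub_of_other E hS hI hc hu hj (k := k) ?_ ?_ hkn
    · rintro rfl
      exact hkn hj
    · rintro rfl
      exact hkn (by simpa using hc.neg_none hj)

/-- If `α` lies in a subsystem of type `A₂`, then two opposite classes for `α` consist of two
indices each, and only these classes are merged with other ones for the subsystem. -/
theorem exists_elim_of_isTypeA2 {P : Set (I → ℤ)} (hP : IsTypeA2 P) (hα : α ∈ P)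
    {b : I → Option K} {d : J → Option K} (h : IsQuotient (satHull {α, -α}) c)
    (hb : IsQuotient P b) (hd : ∀ i, (c i).bind d = b i) :
    ∃ F : StUbar M (H.push b) →* StUbar M (H.push c),
      IsElim M (H.push c) (H.push b) d F ∧ Function.Surjective F := by
  obtain ⟨hshort, hform⟩ := hP.isShort hI
  have hc := h.isLabel_of_double hI fun i => vec_mem_satHull_of_double
  have hbl := hb.isLabel_of_double hI fun i hi => absurd (hshort _ hi) (not_isShort_double hI i)
  have hH := hS.isHyp hI
  have hvc := vec_notMem_satHull_of_isShort hI (hshort α hα)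
  have hvb : ∀ i, vec i ∉ P := fun i hi => not_isShort_vec hI i (hshort _ hi)
  have hdl : IsLabel d := by
    refine ⟨fun F => ?_, fun L => ?_, hbl.neg_ne⟩
    · obtain ⟨i, hi⟩ := hc.surj F
      have h1 := hd (-i)
      rw [hc.neg_some hi, hbl.neg, ← hd i, hi] at h1
      exact h1
    · obtain ⟨i, hi⟩ := hbl.surj L
      rw [← hd] at hi
      obtain ⟨F, _, hF⟩ := Option.bind_eq_some_iff.1 hi
      exact ⟨F, hF⟩
  obtain rfl : (fun i => (c i).bind d) = b := funext hd
  rw [← push_push hH hc hdl]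
  have hH' := push_isHyp hH hc
  have hdn : ∀ F, d F ≠ none := by
    intro F hF
    obtain ⟨i, hi⟩ := hc.surj F
    obtain ⟨L, hL⟩ := hb.exists_eq_some (hvb i)
    simp [hi, hF] at hL
  obtain ⟨y, x', hxy, hxy', hαv⟩ := hshort α hα
  obtain ⟨x, rfl⟩ : ∃ x, x' = -x := ⟨-x', (neg_neg _).symm⟩
  rw [vec_neg, ← sub_eq_add_neg] at hαv
  have hyx : y ≠ x := fun e => hxy' (by rw [e])
  have hnn : y ≠ -x := fun e => hxy e.symm
  obtain ⟨D, hy, hx⟩ : ∃ D, c y = some D ∧ c x = some D :=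
    (h.rel y x).1 ⟨Or.inl (hαv ▸ subset_satHull _ (by simp)), hvc x⟩
  -- the labels of the classes for `α` with two elements are `D` and `-D`
  have hZ : ∀ F, F = D ∨ F = -D → (H.push c).e F ∈ AddSubgroup.closure
      {z : R | ∃ p ∈ Sij (selfAction R Δ) (H.push c) F (-F),
        ∃ q, (H.push c).e (-F) * q = q ∧ z = (p - star p) * q} := by
    intro F hF
    refine push_e_mem_closure hS hI hc fun i hi => ?_
    rcases hF with rfl | rfl
    · by_cases hix : i = x
      · exact ⟨y, hix ▸ hyx, hy⟩
      · exact ⟨x, Ne.symm hix, hx⟩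
    · by_cases hix : i = -x
      · exact ⟨-y, hix ▸ fun e => hyx (neg_injective e), hc.neg_some hy⟩
      · exact ⟨-x, Ne.symm hix, hc.neg_some hx⟩
  -- classes merged by the subsystem are connected by its roots, which are not orthogonal to `α`
  have hmerge : ∀ F G, F ≠ G → d F = d G → (F = D ∨ F = -D) ∨ (G = D ∨ G = -D) := by
    intro F G hFG hdFG
    obtain ⟨i, hi⟩ := hc.surj F
    obtain ⟨j, hj⟩ := hc.surj G
    obtain ⟨L, hL⟩ := hb.exists_eq_some (hvb i)
    have hL' : (c j).bind d = some L := by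
      rw [← hL, hi, hj]
      exact hdFG.symm
    have hij : i ≠ j := by
      rintro rfl
      exact hFG (Option.some.inj (hi.symm.trans hj))
    have h1 := hform α hα _ (hb.sub_mem hI hij hL hL')
    rw [hαv, ht_sub, ht_comm, ht_comm _ (vec j), ht_sub, ht_sub, ht_vec_vec, ht_vec_vec,
      ht_vec_vec, ht_vec_vec] at h1
    have h2 : vec i y ≠ 0 ∨ vec i x ≠ 0 ∨ vec j y ≠ 0 ∨ vec j x ≠ 0 := by
      by_contra h2
      push Not at h2
      obtain ⟨h3, h4, h5, h6⟩ := h2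
      rw [h3, h4, h5, h6] at h1
      exact h1 rfl
    have key : ∀ w F i, c w = some D → c i = some F → vec i w ≠ 0 → F = D ∨ F = -D := by
      intro w F i hw hi hiw
      rcases eq_or_eq_neg_of_vec_ne_zero hiw with rfl | rfl
      · exact Or.inl (Option.some.inj (hi.symm.trans hw))
      · right
        rw [hc.neg_some hi] at hw
        rw [← Option.some.inj hw, neg_neg]
    rcases h2 with h2 | h2 | h2 | h2
    · exact Or.inl (key y F i hy hi h2)
    · exact Or.inl (key x F i hx hi h2)
    · exact Or.inr (key y G j hy hj h2)
    · exact Or.inr (key x G j hx hj h2)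
  refine ⟨elimBar E hH' hdl, isElim_elimBar E hH' hdl, elimBar_surjective_of_indices E hH' hdl ?_ ?_⟩
  · intro F G a h1 h2 ha hFG
    rcases hmerge F G h1 hFG with hF | hG
    · exact X_mem_offSub_of_rho_phi E hH' hdl h1 h2 ha (hZ F hF) (hdn F) hFG
    · rw [X_sym h1 h2 ha]
      refine X_mem_offSub_of_rho_phi E hH' hdl (neg_injective.ne (Ne.symm h1))
        (fun e => h2 (by rw [neg_neg] at e; exact e.symm)) (E.Sij_star hH' ha) (hZ (-G) ?_)
        (hdn _) (by rw [hdl.neg, hdl.neg, hFG])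
      rcases hG with rfl | rfl
      · exact Or.inr rfl
      · exact Or.inl (neg_neg D)
  · intro F u _ hF
    exact absurd hF (hdn F)

end Elimination

end

end OddUnitary

theorem mainTheorem5 {R Δ S Θ : Type*}
    [NonUnitalRing R] [StarRing R] [AddGroup Δ] [OddFormRing R Δ]
    [NonUnitalRing S] [StarRing S] [AddGroup Θ] [OddFormRing S Θ]
    (M : CrossedModule R Δ S Θ)
    {I : Type} [Finite I] [InvolutiveNeg I] (hI : ∀ i : I, -i ≠ i)
    (ℓ : ℕ) (hℓ : Nat.card I = 2 * ℓ)
    (H : Family R Δ I) (hH : H.IsStrong) :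
    (∀ α : I → ℤ, (IsShort α ∧ 3 ≤ ℓ) ∨ (IsUltrashort α ∧ 2 ≤ ℓ) →
      ∀ {J : Type} [Finite J] [InvolutiveNeg J] (c : I → Option J),
        IsQuotient (satHull {α, -α}) c →
        ∃ F : StUbar M (H.push c) →* StUbar M H,
          IsElim M H (H.push c) c F ∧ Function.Surjective F) ∧
    (∀ Ψ : Set (I → ℤ), IsTypeA2 Ψ → ∀ α ∈ Ψ, 3 ≤ ℓ →
      ∀ {J K : Type} [Finite J] [InvolutiveNeg J] [Finite K] [InvolutiveNeg K]
        (c : I → Option J) (b : I → Option K) (d : J → Option K),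
        IsQuotient (satHull {α, -α}) c → IsQuotient Ψ b → (∀ i, (c i).bind d = b i) →
        ∃ F : StUbar M (H.push b) →* StUbar M (H.push c),
          IsElim M (H.push c) (H.push b) d F ∧ Function.Surjective F) := by
  obtain ⟨_, _, _, _, ⟨E⟩⟩ := M.exists_fullAmbient
  refine ⟨fun α hα J _ _ c h => ?_, fun Ψ hΨ α hα _ J K _ _ _ _ c b d hc hb hd =>
    exists_elim_of_isTypeA2 E hH hI hΨ hα hc hb hd⟩
  rcases hα with ⟨hα, h3⟩ | ⟨hα, h2⟩
  · exact exists_elim_of_isShort E hH hI hα (by omega) h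
  · exact exists_elim_of_isUltrashort E hH hI hα (by omega) h
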